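/- Let $d\ge 1$ and let $\Omega\subset\mathbb{R}^d$ be a bounded open set whose boundary $\partial\Omega$ is locally the graph (in suitable Euclidean coordinates) of a $C^{1,1}$ function. Let $\sigma$ be surface measure on $\partial\Omega$, let $G_0(x,y)$ be Green's kernel of $\Delta^{-1}$, i.e. $G_0(x,y)=-\frac{|x-y|^{2-d}}{(d-2)\,\omega_d}$ for $d\ne2$, with $\omega_d$ the area of the unit sphere, and $G_0(x,y)=\frac1{2\pi}\log|x-y|$ for $d=2$; and let $S\ell f(x)=\int_{\partial\Omega}G_0(x,y)f(y)\,d\sigma(y)$ be the single layer potential. Then: (1) For $f\in H^{1/2}(\partial\Omega)$ the integral defining $S\ell f(x)$ converges absolutely for every $x\notin\partial\Omega$, and $S\ell$ induces a continuous map from $H^{1/2}(\partial\Omega)$ to $H^2(\Omega)\oplus H^2_{\mathrm{loc}}(\mathbb{R}^d\setminus\overline\Omega)$, where $H^2_{\mathrm{loc}}(\mathbb{R}^d\setminus\overline\Omega)$ includes regularity up to $\partial\Omega$; that is, there is $C$, and for every $R$ there is $C_R$, with $\|S\ell f\|_{H^2(\Omega)}\le C\|f\|_{H^{1/2}(\partial\Omega)}$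 and $\|S\ell f\|_{H^2(\{|x|<R\}\setminus\overline\Omega)}\le C_R\|f\|_{H^{1/2}(\partial\Omega)}$ for all $f\in H^{1/2}(\partial\Omega)$. (2) Let $V$ be a bounded self-adjoint operator on $L^2(\partial\Omega)$ that maps $H^{1/2}(\partial\Omega)$ into itself. Let $\mathcal D$ be the domain of the operator $-\Delta_V=-\Delta+V\otimes\delta_{\partial\Omega}$ determined by the form $Q(u,w)=\langle\nabla u,\nabla w\rangle_{L^2(\mathbb{R}^d)}+\langle V u|_{\partial\Omega},w|_{\partial\Omega}\rangle_{L^2(\partial\Omega)}$ on $H^1(\mathbb{R}^d)$; that is, $\mathcal D$ is the set of $u\in H^1(\mathbb{R}^d)$ for which there is $C$ with $|Q(u,w)|\le C\|w\|_{L^2}$ for all $w\in H^1(\mathbb{R}^d)$, and $-\Delta_Vu=h\in L^2(\mathbb{R}^d)$ means $Q(u,w)=\langle h,w\rangle$ for all $w\in H^1(\mathbb{R}^d)$. Then $$\mathcal D\subset\mathcal E_2:=H^1(\mathbb{R}^d)\cap\bigl(H^2(\Omega)\oplus H^2(\mathbb{R}^d\setminus\overline\Omega)\bigr)$$ with continuous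 inclusion: there is $C$ with $\|u\|_{H^1(\mathbb{R}^d)}+\|u\|_{H^2(\Omega)}+\|u\|_{H^2(\mathbb{R}^d\setminus\overline\Omega)}\le C\bigl(\|u\|_{H^1(\mathbb{R}^d)}+\|\Delta_Vu\|_{L^2}\bigr)$ for all $u\in\mathcal D$. -/

import Mathlib

open MeasureTheory Filter Topology Set
open scoped ENNReal NNReal ContDiff ComplexConjugate

noncomputable section

namespace Transmission

/-- Euclidean space `ℝ^d`. -/
abbrev E (d : ℕ) : Type := EuclideanSpace ℝ (Fin d)

/-! ### Sobolev spaces of integer order on an open set -/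

/-- `g` is the weak partial derivative `∂ᵢ u` on the open set `U`. -/
def HasWeakPartial {d : ℕ} (U : Set (E d)) (i : Fin d) (u g : E d → ℂ) : Prop :=
  LocallyIntegrableOn u U ∧ LocallyIntegrableOn g U ∧
    ∀ φ : E d → ℝ, ContDiff ℝ ∞ φ → HasCompactSupport φ → tsupport φ ⊆ U →
      ∫ x in U, (fderiv ℝ φ x (EuclideanSpace.single i 1)) • u x = -∫ x in U, φ x • g x

open Classical in
/-- The weak partial derivative `∂ᵢ u` on `U` (unique almost everywhere on `U`), and `0` if it does
not exist. -/
def weakPartial {d : ℕ} (U : Set (E d)) (i : Fin d) (u : E d → ℂ) : E d → ℂ :=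
  if h : ∃ g, HasWeakPartial U i u g then h.choose else 0

/-- `u ∈ H^k(U)`. -/
def MemSobolev {d : ℕ} : ℕ → Set (E d) → (E d → ℂ) → Prop
  | 0, U, u => MemLp u 2 (volume.restrict U)
  | k + 1, U, u => MemLp u 2 (volume.restrict U) ∧
      ∀ i, (∃ g, HasWeakPartial U i u g) ∧ MemSobolev k U (weakPartial U i u)

/-- The `L²` norm (a real number, meaningful for functions in `L²`). -/
def l2Norm {d : ℕ} (μ : Measure (E d)) (u : E d → ℂ) : ℝ := (eLpNorm u 2 μ).toReal

/-- The square of the `H^k(U)` norm of `u ∈ H^k(U)`: the sum of the squared `L²(U)` norms of all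
iterated weak partial derivatives `∂_{i₁} ⋯ ∂_{iⱼ} u` with `j ≤ k`. -/
def sobolevNormSq {d : ℕ} : ℕ → Set (E d) → (E d → ℂ) → ℝ
  | 0, U, u => l2Norm (volume.restrict U) u ^ 2
  | k + 1, U, u => l2Norm (volume.restrict U) u ^ 2 +
      ∑ i, sobolevNormSq k U (weakPartial U i u)

/-- The `H^k(U)` norm of `u ∈ H^k(U)`. -/
def sobolevNorm {d : ℕ} (k : ℕ) (U : Set (E d)) (u : E d → ℂ) : ℝ :=
  Real.sqrt (sobolevNormSq k U u)

/-! ### `C^{1,1}` boundaries, surface measure and `H^{1/2}` of the boundary -/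

/-- `F` is of class `C^{1,1}`: continuously differentiable with Lipschitz derivative. -/
def IsC11 {X : Type*} [NormedAddCommGroup X] [NormedSpace ℝ X] (F : X → ℝ) : Prop :=
  ContDiff ℝ 1 F ∧ ∃ K : ℝ≥0, LipschitzWith K (fderiv ℝ F)

/-- The set `Γ` is locally the graph of a `C^{1,1}` function: near each of its points it is the
graph, over the hyperplane orthogonal to some unit vector `ν`, of a `C^{1,1}` function `F`. -/
def IsLocallyC11Graph {d : ℕ} (Γ : Set (E d)) : Prop :=
  ∀ p ∈ Γ, ∃ ν : E d, ‖ν‖ = 1 ∧ ∃ F : (ℝ ∙ ν)ᗮ → ℝ, IsC11 F ∧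
    ∀ᶠ x in 𝓝 p, x ∈ Γ ↔ inner ℝ ν x = F ((ℝ ∙ ν)ᗮ.orthogonalProjectionOnto x)

/-- Surface measure on the boundary of `Ω`: the `(d-1)`-dimensional Hausdorff measure, normalized
to agree with Lebesgue measure on hyperplanes, restricted to `∂Ω`. -/
def surfaceMeasure {d : ℕ} (Ω : Set (E d)) : Measure (E d) :=
  (Measure.euclideanHausdorffMeasure (d - 1)).restrict (frontier Ω)

/-- The square of the Gagliardo–Slobodeckij seminorm of order `1/2` on the `(d-1)`-dimensional
hypersurface `∂Ω`, `∬ |f(x) - f(y)|² / |x - y|^{(d-1) + 2·(1/2)} dσ(y) dσ(x)`. -/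
def gagliardoSq {d : ℕ} (Ω : Set (E d)) (f : E d → ℂ) : ℝ≥0∞ :=
  ∫⁻ x, ∫⁻ y, ENNReal.ofReal (‖f x - f y‖ ^ 2 / ‖x - y‖ ^ d)
    ∂(surfaceMeasure Ω) ∂(surfaceMeasure Ω)

/-- `f ∈ H^{1/2}(∂Ω)`. -/
def MemHHalf {d : ℕ} (Ω : Set (E d)) (f : E d → ℂ) : Prop :=
  MemLp f 2 (surfaceMeasure Ω) ∧ gagliardoSq Ω f < ⊤

/-- The norm of `f ∈ H^{1/2}(∂Ω)`. -/
def hHalfNorm {d : ℕ} (Ω : Set (E d)) (f : E d → ℂ) : ℝ :=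
  Real.sqrt (l2Norm (surfaceMeasure Ω) f ^ 2 + (gagliardoSq Ω f).toReal)

/-! ### The single layer potential of the Laplacian -/

/-- The fundamental solution `G` of the Laplacian, `ΔG = δ₀`: `(2π)⁻¹ log |x|` if `d = 2`, and
`-|x|^{2-d} / ((d-2) ω_d)` otherwise, where `ω_d = d |B(0,1)|` is the area of the unit sphere
(so it is `|x| / 2` if `d = 1`). -/
def fundamentalSolution {d : ℕ} (x : E d) : ℝ :=
  if d = 2 then (2 * Real.pi)⁻¹ * Real.log ‖x‖
  else -(((d : ℝ) - 2) * (d * volume.real (Metric.ball (0 : E d) 1)))⁻¹ * ‖x‖ ^ (2 - (d : ℤ))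

/-- Green's kernel `G₀(x, y)` of `Δ⁻¹`. -/
def greenKernel {d : ℕ} (x y : E d) : ℝ := fundamentalSolution (x - y)

/-- The single layer potential `Sℓ f (x) = ∫_{∂Ω} G₀(x, y) f(y) dσ(y)`. -/
def singleLayer {d : ℕ} (Ω : Set (E d)) (f : E d → ℂ) (x : E d) : ℂ :=
  ∫ y, (greenKernel x y : ℂ) * f y ∂(surfaceMeasure Ω)

/-! ### The operator `-Δ + V ⊗ δ_{∂Ω}` -/

/-- `L²(∂Ω)`. -/
abbrev BdryL2 {d : ℕ} (Ω : Set (E d)) : Type := Lp ℂ 2 (surfaceMeasure Ω)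

/-- `g` is the trace on `∂Ω` of `u ∈ H¹(ℝ^d)`: some sequence of test functions converges to `u` in
`H¹(ℝ^d)` and, restricted to the boundary, to `g` in `L²(∂Ω)`. -/
def IsTrace {d : ℕ} (Ω : Set (E d)) (u : E d → ℂ) (g : BdryL2 Ω) : Prop :=
  ∃ φ : ℕ → E d → ℂ, (∀ n, ContDiff ℝ ∞ (φ n) ∧ HasCompactSupport (φ n)) ∧
    Tendsto (fun n => sobolevNorm 1 univ (fun x => φ n x - u x)) atTop (𝓝 0) ∧
    Tendsto (fun n => l2Norm (surfaceMeasure Ω) (fun x => φ n x - g x)) atTop (𝓝 0)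

open Classical in
/-- The trace `u|_{∂Ω} ∈ L²(∂Ω)` of `u ∈ H¹(ℝ^d)`. -/
def trace {d : ℕ} (Ω : Set (E d)) (u : E d → ℂ) : BdryL2 Ω :=
  if h : ∃ g, IsTrace Ω u g then h.choose else 0

/-- The sesquilinear form `Q(u, w) = ⟨∇u, ∇w⟩_{L²(ℝ^d)} + ⟨V u|_{∂Ω}, w|_{∂Ω}⟩_{L²(∂Ω)}`, linear in
`u` and conjugate linear in `w`, on the form domain `H¹(ℝ^d)`. -/
def formQ {d : ℕ} (Ω : Set (E d)) (V : BdryL2 Ω →L[ℂ] BdryL2 Ω) (u w : E d → ℂ) : ℂ :=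
  (∑ i, ∫ x, weakPartial univ i u x * conj (weakPartial univ i w x)) +
    inner ℂ (trace Ω w) (V (trace Ω u))

/-- The domain `𝒟` of the operator `-Δ_V = -Δ + V ⊗ δ_{∂Ω}` determined by `Q`: the functions
`u ∈ H¹(ℝ^d)` for which `|Q(u, w)| ≤ C ‖w‖_{L²}` for all `w ∈ H¹(ℝ^d)`. -/
def formDomain {d : ℕ} (Ω : Set (E d)) (V : BdryL2 Ω →L[ℂ] BdryL2 Ω) : Set (E d → ℂ) :=
  {u | MemSobolev 1 univ u ∧
    ∃ C : ℝ, ∀ w, MemSobolev 1 univ w → ‖formQ Ω V u w‖ ≤ C * l2Norm volume w}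

/-- `-Δ_V u = h`: `h ∈ L²(ℝ^d)` represents `Q(u, ·)`, that is `Q(u, w) = ⟨h, w⟩` for all
`w ∈ H¹(ℝ^d)`. -/
def IsDeltaLaplacian {d : ℕ} (Ω : Set (E d)) (V : BdryL2 Ω →L[ℂ] BdryL2 Ω)
    (u h : E d → ℂ) : Prop :=
  MemLp h 2 volume ∧ ∀ w, MemSobolev 1 univ w → formQ Ω V u w = ∫ x, h x * conj (w x)

/-- The space `ℰ_N = H¹(ℝ^d) ∩ (H^N(Ω) ⊕ H^N(ℝ^d ∖ closure Ω))`. -/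
def spaceE {d : ℕ} (N : ℕ) (Ω : Set (E d)) : Set (E d → ℂ) :=
  {u | MemSobolev 1 univ u ∧ MemSobolev N Ω u ∧ MemSobolev N (closure Ω)ᶜ u}

/-- The norm of `ℰ_N`. -/
def normE {d : ℕ} (N : ℕ) (Ω : Set (E d)) (u : E d → ℂ) : ℝ :=
  sobolevNorm 1 univ u + sobolevNorm N Ω u + sobolevNorm N (closure Ω)ᶜ u

end Transmission

end

open MeasureTheory Filter Topology Set
open scoped ENNReal NNReal ContDiff ComplexConjugate

noncomputable section

namespace Transmission

/-! ### Weak partial derivatives and the Sobolev norms computed from them -/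

section

variable {d : ℕ}

/-! Write `n = d - 1` for the dimension of `Γ = ∂Ω`, `σ` for surface measure, `G` for the
fundamental solution and `S f` for the single layer potential. On bounded sets `G` and its gradient
are `O(|x|^{-n})`, and a weighted Cauchy-Schwarz inequality bounds `S f` and its gradient in `L²` by
`f` in `L²` (`exists_lintegral_pot_le`). The difficulty lies in the second derivatives, whose kernel
`H` has size `|x|^{-d}`.

Near `Γ`, write `x = p + t ν` with `p` on the graph, and split `∫ H(x - z) f(z) dσ(z)` into `∫ H(x -
z) (f(z) - f(p)) dσ(z)` and `f(p) ∫ H(x - z) dσ(z)`. Cauchy-Schwarz with powers of `|t| + |p - z|`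
bounds the square of the first term by `|t|^{-1/2}` times a weighted mean oscillation of `f`;
integration in `t` and then in `p` produces the Gagliardo seminorm. The second term needs a
cancellation: `∫ H(x - z) dσ(z) = O(|t|^{-1/4})`, with integrable square
(`GraphChart.exists_abs_integral_hessG_le`).

The cancellation is where `C^{1,1}` regularity enters. If one of the two directions of `H` is
tangential, `H` is a derivative along the surface of the gradient kernel and can be integrated by
parts against a Lipschitz density, leaving a kernel of size `|x|^{-n}`
(`GraphChart.good_tangential`). The remaining entry `H(ν, ν)` is a combination of such kernels with
Lipschitz coefficients, because `G` is harmonic off the origin (`GraphChart.good_hessG`). The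
integration by parts works directly with Hausdorff measure: a shift of the parameter by `h` distorts
the graph by a factor `1 + K|h|` at most, hence its measure by at most `(1 + K|h|)^n`
(`Frame.graph_shift_le`), and difference quotients pass to the limit.

For the operator, boundedness of `Q(u, ·)` in the `L²` norm and the Riesz theorem give `k` in `L²`
with `-Δu + f σ = k` weakly, where `f = V(u|_Γ)`. The trace maps `H¹` to `H^{1/2}(Γ)`: two surface
points are joined through an apex above their midpoint, at a height equal to their parameter
distance, and the gradient is integrated along the two slanted segments (`exists_trace_estimate`).
By the closed graph theorem `V` is bounded on `H^{1/2}(Γ)` (`exists_hHalfNorm_map_le`), so `f` lies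
in `H^{1/2}` with norm controlled by `u`. Since `Δ S f = f σ`, the function `v = u - χ S f`, with
`χ` a cutoff equal to `1` on `Γ`, satisfies `Δ v ∈ L²` on the whole space, hence `v ∈ H²` by a
bounded Fourier multiplier (`exists_isH2On_univ`). Off `Γ` one reads the regularity of `u` from `u =
v + χ S f` and the potential estimate. -/

/-- The `i`-th coordinate vector. -/
abbrev coordVec (i : Fin d) : E d := EuclideanSpace.single i 1

theorem tsupport_fderiv_apply_subset' {F : Type*} [NormedAddCommGroup F] [NormedSpace ℝ F]
    {φ : E d → F} (v : E d) :
    tsupport (fun x => fderiv ℝ φ x v) ⊆ tsupport φ :=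
  (closure_mono fun x hx => by
    contrapose! hx
    simp only [Function.mem_support, not_not] at hx ⊢
    simp [hx]).trans (tsupport_fderiv_subset ℝ (f := φ))

theorem integrable_smul_of_locallyIntegrableOn {U : Set (E d)} {F : Type*} [NormedAddCommGroup F]
    [NormedSpace ℝ F] {u : E d → F} {φ : E d → ℝ}
    (hu : LocallyIntegrableOn u U) (hφ : Continuous φ) (hc : HasCompactSupport φ)
    (hs : tsupport φ ⊆ U) : Integrable (fun x => φ x • u x) := by
  have h1 : IntegrableOn u (tsupport φ) := hu.integrableOn_compact_subset hs hc
  have h2 : IntegrableOn (fun x => φ x • u x) (tsupport φ) :=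
    h1.continuousOn_smul hφ.continuousOn hc
  refine (integrableOn_iff_integrable_of_support_subset ?_).1 h2
  intro x hx
  by_contra h
  exact hx (by simp [image_eq_zero_of_notMem_tsupport h])

theorem setIntegral_smul_eq_of_tsupport {U : Set (E d)} {F : Type*} [NormedAddCommGroup F]
    [NormedSpace ℝ F] {u : E d → F} {φ : E d → ℝ} (hs : tsupport φ ⊆ U) :
    ∫ x in U, φ x • u x = ∫ x, φ x • u x :=
  setIntegral_eq_integral_of_forall_compl_eq_zero fun x hx => by
    rw [image_eq_zero_of_notMem_tsupport fun h => hx (hs h), zero_smul]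

theorem HasWeakPartial.eq_integral {U : Set (E d)} {i : Fin d} {u g : E d → ℂ}
    (h : HasWeakPartial U i u g) {φ : E d → ℝ} (h1 : ContDiff ℝ ∞ φ) (h2 : HasCompactSupport φ)
    (h3 : tsupport φ ⊆ U) :
    ∫ x, (fderiv ℝ φ x (coordVec i)) • u x = -∫ x, φ x • g x := by
  have := h.2.2 φ h1 h2 h3
  rwa [setIntegral_smul_eq_of_tsupport h3,
    setIntegral_smul_eq_of_tsupport ((tsupport_fderiv_apply_subset' _).trans h3)] at this

theorem hasWeakPartial_of_integral {U : Set (E d)} {i : Fin d} {u g : E d → ℂ}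
    (hu : LocallyIntegrableOn u U) (hg : LocallyIntegrableOn g U)
    (h : ∀ φ : E d → ℝ, ContDiff ℝ ∞ φ → HasCompactSupport φ → tsupport φ ⊆ U →
      ∫ x, (fderiv ℝ φ x (coordVec i)) • u x = -∫ x, φ x • g x) :
    HasWeakPartial U i u g :=
  ⟨hu, hg, fun φ h1 h2 h3 => by
    rw [setIntegral_smul_eq_of_tsupport h3,
      setIntegral_smul_eq_of_tsupport ((tsupport_fderiv_apply_subset' _).trans h3)]
    exact h φ h1 h2 h3⟩

theorem HasWeakPartial.mono {U U' : Set (E d)} {i : Fin d} {u g : E d → ℂ}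
    (h : HasWeakPartial U i u g) (hU : U' ⊆ U) : HasWeakPartial U' i u g :=
  hasWeakPartial_of_integral (h.1.mono_set hU) (h.2.1.mono_set hU)
    fun _ h1 h2 h3 => h.eq_integral h1 h2 (h3.trans hU)

theorem HasWeakPartial.congr {U : Set (E d)} {i : Fin d} {u u' g g' : E d → ℂ}
    (h : HasWeakPartial U i u g) (hu : u =ᵐ[volume.restrict U] u')
    (hg : g =ᵐ[volume.restrict U] g') : HasWeakPartial U i u' g' := by
  refine ⟨h.1.congr hu, h.2.1.congr hg, fun φ h1 h2 h3 => ?_⟩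
  have e1 : ∫ x in U, (fderiv ℝ φ x (coordVec i)) • u' x =
      ∫ x in U, (fderiv ℝ φ x (coordVec i)) • u x :=
    integral_congr_ae (hu.mono fun x hx => by simp only [hx])
  have e2 : ∫ x in U, φ x • g' x = ∫ x in U, φ x • g x :=
    integral_congr_ae (hg.mono fun x hx => by simp only [hx])
  rw [e1, e2]
  exact h.2.2 φ h1 h2 h3

theorem continuous_fderiv_apply {F : Type*} [NormedAddCommGroup F] [NormedSpace ℝ F]
    {φ : E d → F} (h1 : ContDiff ℝ ∞ φ) (v : E d) :
    Continuous fun x => fderiv ℝ φ x v :=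
  (h1.continuous_fderiv (by simp)).clm_apply continuous_const

/-- The fundamental lemma of the calculus of variations. It makes the choice hidden in `weakPartial`
harmless. -/
theorem HasWeakPartial.ae_unique {U : Set (E d)} (hU : IsOpen U) {i : Fin d} {u g g' : E d → ℂ}
    (h : HasWeakPartial U i u g) (h' : HasWeakPartial U i u g') :
    g =ᵐ[volume.restrict U] g' := by
  have key : ∀ᵐ x, x ∈ U → (g - g') x = 0 := by
    refine hU.ae_eq_zero_of_integral_contDiff_smul_eq_zero (h.2.1.sub h'.2.1) ?_
    intro φ h1 h2 h3
    have e1 := h.eq_integral h1 h2 h3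
    have e2 := h'.eq_integral h1 h2 h3
    have : ∫ x, φ x • g x = ∫ x, φ x • g' x := neg_injective (e1.symm.trans e2)
    simp only [Pi.sub_apply, smul_sub]
    rw [integral_sub (integrable_smul_of_locallyIntegrableOn h.2.1 h1.continuous h2 h3)
      (integrable_smul_of_locallyIntegrableOn h'.2.1 h1.continuous h2 h3), this, sub_self]
  filter_upwards [(ae_restrict_iff' hU.measurableSet).2 key] with x hx
  exact sub_eq_zero.1 hx

theorem weakPartial_spec {U : Set (E d)} {i : Fin d} {u : E d → ℂ}
    (h : ∃ g, HasWeakPartial U i u g) : HasWeakPartial U i u (weakPartial U i u) := by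
  unfold weakPartial
  rw [dif_pos h]
  exact h.choose_spec

theorem HasWeakPartial.weakPartial_ae_eq {U : Set (E d)} (hU : IsOpen U) {i : Fin d}
    {u g : E d → ℂ} (h : HasWeakPartial U i u g) :
    weakPartial U i u =ᵐ[volume.restrict U] g :=
  (weakPartial_spec ⟨g, h⟩).ae_unique hU h

theorem hasCompactSupport_fderiv_apply {F : Type*} [NormedAddCommGroup F] [NormedSpace ℝ F]
    {φ : E d → F} (h : HasCompactSupport φ) (v : E d) :
    HasCompactSupport fun x => fderiv ℝ φ x v :=
  IsCompact.of_isClosed_subset h (isClosed_tsupport _) (tsupport_fderiv_apply_subset' v)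

theorem HasWeakPartial.add {U : Set (E d)} {i : Fin d} {u v g k : E d → ℂ}
    (h : HasWeakPartial U i u g) (h' : HasWeakPartial U i v k) :
    HasWeakPartial U i (u + v) (g + k) := by
  refine hasWeakPartial_of_integral (h.1.add h'.1) (h.2.1.add h'.2.1) fun φ h1 h2 h3 => ?_
  have hd := continuous_fderiv_apply h1 (coordVec i)
  have hc := hasCompactSupport_fderiv_apply h2 (coordVec i)
  have hs := (tsupport_fderiv_apply_subset' (φ := φ) (coordVec i)).trans h3
  simp only [Pi.add_apply, smul_add]
  rw [integral_add (integrable_smul_of_locallyIntegrableOn h.1 hd hc hs)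
      (integrable_smul_of_locallyIntegrableOn h'.1 hd hc hs),
    integral_add (integrable_smul_of_locallyIntegrableOn h.2.1 h1.continuous h2 h3)
      (integrable_smul_of_locallyIntegrableOn h'.2.1 h1.continuous h2 h3),
    h.eq_integral h1 h2 h3, h'.eq_integral h1 h2 h3, neg_add]

theorem HasWeakPartial.const_mul {U : Set (E d)} {i : Fin d} {u g : E d → ℂ}
    (h : HasWeakPartial U i u g) (c : ℂ) :
    HasWeakPartial U i (fun x => c * u x) (fun x => c * g x) := by
  refine hasWeakPartial_of_integral (h.1.smul c) (h.2.1.smul c) fun φ h1 h2 h3 => ?_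
  have := h.eq_integral h1 h2 h3
  simp only [Complex.real_smul] at this ⊢
  simp only [mul_left_comm _ c, integral_const_mul, this, mul_neg]

theorem HasWeakPartial.sub {U : Set (E d)} {i : Fin d} {u v g k : E d → ℂ}
    (h : HasWeakPartial U i u g) (h' : HasWeakPartial U i v k) :
    HasWeakPartial U i (fun x => u x - v x) (fun x => g x - k x) := by
  have := h.add (h'.const_mul (-1))
  simp only [neg_one_mul] at this
  convert this using 1 <;> ext x <;> simp [sub_eq_add_neg]

/-- A classical continuous partial derivative is a weak partial derivative. -/
theorem hasWeakPartial_of_hasFDerivAt {U : Set (E d)} (hU : IsOpen U) {i : Fin d} {u : E d → ℂ}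
    {Du : E d → E d →L[ℝ] ℂ} (h : ∀ x ∈ U, HasFDerivAt u (Du x) x)
    (hc : ContinuousOn (fun x => Du x (coordVec i)) U) :
    HasWeakPartial U i u (fun x => Du x (coordVec i)) := by
  have hu : LocallyIntegrableOn u U :=
    ContinuousOn.locallyIntegrableOn (fun x hx => (h x hx).continuousAt.continuousWithinAt)
      hU.measurableSet
  have hg : LocallyIntegrableOn (fun x => Du x (coordVec i)) U :=
    hc.locallyIntegrableOn hU.measurableSet
  refine hasWeakPartial_of_integral hu hg fun φ h1 h2 h3 => ?_
  have key := integral_bilinear_hasFDerivAt_right_eq_neg_left_of_integrable (μ := volume)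
    (f := φ) (f' := fderiv ℝ φ) (g := u) (g' := Du) (v := coordVec i)
    (B := ContinuousLinearMap.lsmul ℝ ℝ)
    (integrable_smul_of_locallyIntegrableOn hu (continuous_fderiv_apply h1 _)
      (hasCompactSupport_fderiv_apply h2 _) ((tsupport_fderiv_apply_subset' _).trans h3))
    (integrable_smul_of_locallyIntegrableOn hg h1.continuous h2 h3)
    (integrable_smul_of_locallyIntegrableOn hu h1.continuous h2 h3)
    (fun x _ => (h1.differentiable (by simp) x).hasFDerivAt) (fun x hx => h x (h3 hx))
  simp only [ContinuousLinearMap.lsmul_apply] at key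
  rw [key, neg_neg]

/-- Fubini, with joint integrability asked only over the support of `ψ`: potential kernels are
integrable only locally in `x`. -/
theorem integral_smul_integral_mul {σ : Measure (E d)} [SFinite σ] {k : E d → E d → ℂ}
    {f : E d → ℂ} {ψ : E d → ℝ}
    (hk : Integrable (fun p : E d × E d => k p.1 p.2 * f p.2)
      ((volume.restrict (tsupport ψ)).prod σ))
    (hψ : Continuous ψ) (hc : HasCompactSupport ψ) :
    ∫ x, ψ x • ∫ y, k x y * f y ∂σ = ∫ y, (∫ x, ψ x • k x y) * f y ∂σ := by
  rw [← setIntegral_smul_eq_of_tsupport (U := tsupport ψ) subset_rfl]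
  obtain ⟨C, hC⟩ := hψ.bounded_above_of_compact_support hc
  have hint : Integrable (fun p : E d × E d => ψ p.1 • (k p.1 p.2 * f p.2))
      ((volume.restrict (tsupport ψ)).prod σ) :=
    hk.bdd_smul C (hψ.comp continuous_fst).aestronglyMeasurable (.of_forall fun p => hC p.1)
  simp_rw [← integral_smul]
  rw [integral_integral_swap hint]
  congr 1 with y
  rw [← setIntegral_smul_eq_of_tsupport (U := tsupport ψ) subset_rfl, ← integral_mul_const]
  simp only [smul_mul_assoc]

/-- Differentiation under the integral sign, in the weak sense. -/
theorem hasWeakPartial_integral {U : Set (E d)} (hU : IsOpen U) {i : Fin d}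
    {σ : Measure (E d)} [SFinite σ] {k k' : E d → E d → ℂ} {f : E d → ℂ}
    (h : ∀ᵐ y ∂σ, HasWeakPartial U i (fun x => k x y) (fun x => k' x y))
    (hk : ∀ K ⊆ U, IsCompact K →
      Integrable (fun p : E d × E d => k p.1 p.2 * f p.2) ((volume.restrict K).prod σ))
    (hk' : ∀ K ⊆ U, IsCompact K →
      Integrable (fun p : E d × E d => k' p.1 p.2 * f p.2) ((volume.restrict K).prod σ)) :
    HasWeakPartial U i (fun x => ∫ y, k x y * f y ∂σ) (fun x => ∫ y, k' x y * f y ∂σ) := by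
  have loc : ∀ k : E d → E d → ℂ, (∀ K ⊆ U, IsCompact K →
      Integrable (fun p : E d × E d => k p.1 p.2 * f p.2) ((volume.restrict K).prod σ)) →
      LocallyIntegrableOn (fun x => ∫ y, k x y * f y ∂σ) U := fun k hk =>
    (locallyIntegrableOn_iff hU.isLocallyClosed).2 fun K hK hKc =>
      (hk K hK hKc).integral_prod_left
  refine hasWeakPartial_of_integral (loc k hk) (loc k' hk') fun φ h1 h2 h3 => ?_
  have hc2 := hasCompactSupport_fderiv_apply h2 (coordVec i)
  rw [integral_smul_integral_mul (hk _ ((tsupport_fderiv_apply_subset' _).trans h3) hc2)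
    (continuous_fderiv_apply h1 _) hc2, integral_smul_integral_mul (hk' _ h3 h2) h1.continuous h2,
    ← integral_neg]
  refine integral_congr_ae (h.mono fun y hy => ?_)
  simp only [hy.eq_integral h1 h2 h3, neg_mul]

/-- `g` and `G` are the weak gradient and Hessian of `u` on `U`, all in `L²(U)` with norm at
most `M`. -/
structure IsH2On (U : Set (E d)) (u : E d → ℂ) (g : Fin d → E d → ℂ)
    (G : Fin d → Fin d → E d → ℂ) (M : ℝ) : Prop where
  grad : ∀ i, HasWeakPartial U i u (g i)
  hess : ∀ i j, HasWeakPartial U j (g i) (G i j)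
  memLp : MemLp u 2 (volume.restrict U)
  memLp_grad : ∀ i, MemLp (g i) 2 (volume.restrict U)
  memLp_hess : ∀ i j, MemLp (G i j) 2 (volume.restrict U)
  le : l2Norm (volume.restrict U) u ≤ M
  le_grad : ∀ i, l2Norm (volume.restrict U) (g i) ≤ M
  le_hess : ∀ i j, l2Norm (volume.restrict U) (G i j) ≤ M

theorem l2Norm_nonneg {μ : Measure (E d)} {u : E d → ℂ} : 0 ≤ l2Norm μ u := ENNReal.toReal_nonneg

theorem l2Norm_congr {μ : Measure (E d)} {u v : E d → ℂ} (h : u =ᵐ[μ] v) :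
    l2Norm μ u = l2Norm μ v := by
  unfold l2Norm; rw [eLpNorm_congr_ae h]

theorem memSobolev_one {U : Set (E d)} (hU : IsOpen U) {u : E d → ℂ} {g : Fin d → E d → ℂ}
    (hu : MemLp u 2 (volume.restrict U)) (h : ∀ i, HasWeakPartial U i u (g i))
    (hg : ∀ i, MemLp (g i) 2 (volume.restrict U)) : MemSobolev 1 U u :=
  ⟨hu, fun i => ⟨⟨_, h i⟩, (memLp_congr_ae ((h i).weakPartial_ae_eq hU)).2 (hg i)⟩⟩

theorem sobolevNormSq_one {U : Set (E d)} (hU : IsOpen U) {u : E d → ℂ} {g : Fin d → E d → ℂ}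
    (h : ∀ i, HasWeakPartial U i u (g i)) :
    sobolevNormSq 1 U u = l2Norm (volume.restrict U) u ^ 2 +
      ∑ i, l2Norm (volume.restrict U) (g i) ^ 2 := by
  simp only [sobolevNormSq]
  simp_rw [fun i => l2Norm_congr ((h i).weakPartial_ae_eq hU)]

/-- `MemSobolev` differentiates the representative chosen by `weakPartial`. It agrees almost
everywhere with `g i`, so `G i` is a gradient of it as well. -/
theorem IsH2On.memSobolev {U : Set (E d)} (hU : IsOpen U) {u : E d → ℂ} {g : Fin d → E d → ℂ}
    {G : Fin d → Fin d → E d → ℂ} {M : ℝ} (h : IsH2On U u g G M) : MemSobolev 2 U u :=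
  ⟨h.memLp, fun i => ⟨⟨_, h.grad i⟩, memSobolev_one (g := G i) hU
    ((memLp_congr_ae ((h.grad i).weakPartial_ae_eq hU)).2 (h.memLp_grad i))
    (fun j => (h.hess i j).congr ((h.grad i).weakPartial_ae_eq hU).symm .rfl)
    (h.memLp_hess i)⟩⟩

/-- The constant counts the iterated derivatives of order at most two; being at least `1`, it also
bounds its own square root. -/
theorem IsH2On.sobolevNorm_le {U : Set (E d)} (hU : IsOpen U) {u : E d → ℂ}
    {g : Fin d → E d → ℂ} {G : Fin d → Fin d → E d → ℂ} {M : ℝ} (h : IsH2On U u g G M) :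
    sobolevNorm 2 U u ≤ (1 + d + d ^ 2) * M := by
  have hM : 0 ≤ M := l2Norm_nonneg.trans h.le
  have e : sobolevNormSq 2 U u = l2Norm (volume.restrict U) u ^ 2 +
      ∑ i, (l2Norm (volume.restrict U) (g i) ^ 2 +
        ∑ j, l2Norm (volume.restrict U) (G i j) ^ 2) := by
    change _ + ∑ i, sobolevNormSq 1 U (weakPartial U i u) = _
    congr 1
    refine Finset.sum_congr rfl fun i _ => ?_
    rw [sobolevNormSq_one hU (g := G i) fun j =>
      (h.hess i j).congr ((h.grad i).weakPartial_ae_eq hU).symm .rfl,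
      l2Norm_congr ((h.grad i).weakPartial_ae_eq hU)]
  have hle : sobolevNormSq 2 U u ≤ (1 + d + d ^ 2) * M ^ 2 := by
    rw [e]
    calc _ ≤ M ^ 2 + ∑ i : Fin d, (M ^ 2 + ∑ j : Fin d, M ^ 2) := by
          gcongr with i _ j _
          · exact l2Norm_nonneg
          · exact h.le
          · exact l2Norm_nonneg
          · exact h.le_grad i
          · exact l2Norm_nonneg
          · exact h.le_hess i j
      _ = _ := by
          simp only [Finset.sum_const, Finset.card_univ, Fintype.card_fin, nsmul_eq_mul]; ring
  refine Real.sqrt_le_iff.2 ⟨by positivity, hle.trans ?_⟩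
  rw [mul_pow]
  gcongr
  nlinarith [show (0 : ℝ) ≤ d + d ^ 2 by positivity]

theorem IsH2On.mono {U U' : Set (E d)} {u : E d → ℂ} {g : Fin d → E d → ℂ}
    {G : Fin d → Fin d → E d → ℂ} {M : ℝ} (h : IsH2On U u g G M) (hU : U' ⊆ U) :
    IsH2On U' u g G M := by
  have hle : ∀ {v : E d → ℂ}, MemLp v 2 (volume.restrict U) →
      l2Norm (volume.restrict U') v ≤ l2Norm (volume.restrict U) v := fun hv =>
    ENNReal.toReal_mono hv.eLpNorm_ne_top (eLpNorm_mono_measure _ (Measure.restrict_mono hU le_rfl))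
  have hm : volume.restrict U' ≤ volume.restrict U := Measure.restrict_mono hU le_rfl
  exact ⟨fun i => (h.grad i).mono hU, fun i j => (h.hess i j).mono hU, h.memLp.mono_measure hm,
    fun i => (h.memLp_grad i).mono_measure hm, fun i j => (h.memLp_hess i j).mono_measure hm,
    (hle h.memLp).trans h.le, fun i => (hle (h.memLp_grad i)).trans (h.le_grad i),
    fun i j => (hle (h.memLp_hess i j)).trans (h.le_hess i j)⟩

end

/-! ### Integrals of powers against measures of polynomial growth -/

section

/-- Used from right to left: a negative power is the integral of its derivative over a tail, which
feeds the layer-cake formula below. -/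
theorem lintegral_Ioi_shift_rpow {c τ r : ℝ} (hc : 0 < c) (h : 0 < τ + r) :
    ∫⁻ s in Ioi r, ENNReal.ofReal (c * (τ + s) ^ (-c - 1)) = ENNReal.ofReal ((τ + r) ^ (-c)) := by
  have hd : ∀ x ∈ Ici r, HasDerivAt (fun s => -(τ + s) ^ (-c)) (c * (τ + x) ^ (-c - 1)) x := by
    intro x hx
    have hx' : 0 < τ + x := by have : r ≤ x := hx; linarith
    have := (((hasDerivAt_id x).const_add τ).rpow_const (p := -c) (Or.inl hx'.ne')).neg
    refine this.congr_deriv ?_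
    rw [id]
    ring
  have hn : ∀ x ∈ Ioi r, 0 ≤ c * (τ + x) ^ (-c - 1) := fun x hx => by
    have : r < x := hx
    have : 0 < τ + x := by linarith
    positivity
  have ht : Tendsto (fun s => -(τ + s) ^ (-c)) atTop (𝓝 0) := by
    have := ((tendsto_rpow_neg_atTop hc).comp (tendsto_atTop_add_const_left atTop τ tendsto_id)).neg
    simpa using this
  have hcont := (hd r self_mem_Ici).continuousAt.continuousWithinAt (s := Ici r)
  have e := integral_Ioi_of_hasDerivAt_of_nonneg hcont (fun x hx => hd x (Ioi_subset_Ici_self hx)) hn ht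
  rw [← ofReal_integral_eq_lintegral_ofReal
    (integrableOn_Ioi_deriv_of_nonneg hcont (fun x hx => hd x (Ioi_subset_Ici_self hx)) hn ht)
    ((ae_restrict_iff' measurableSet_Ioi).2 (.of_forall hn)), e]
  simp

theorem lintegral_Ioc_rpow {m D : ℝ} (hm : 0 < m) (hD : 0 < D) :
    ∫⁻ s in Ioc 0 D, ENNReal.ofReal (s ^ (m - 1)) = ENNReal.ofReal (D ^ m / m) := by
  have e : ∫ s in (0 : ℝ)..D, s ^ (m - 1) = D ^ m / m := by
    rw [integral_rpow (Or.inl (by linarith))]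
    simp [Real.zero_rpow hm.ne']
  have hi : IntervalIntegrable (fun s : ℝ => s ^ (m - 1)) volume 0 D :=
    intervalIntegral.intervalIntegrable_rpow' (by linarith)
  rw [← e, intervalIntegral.integral_of_le hD.le, ofReal_integral_eq_lintegral_ofReal
    ((intervalIntegrable_iff_integrableOn_Ioc_of_le hD.le).1 hi)]
  exact (ae_restrict_iff' measurableSet_Ioc).2 (.of_forall fun x hx => by
    have : 0 < x := hx.1
    positivity)

section Growth

variable {X : Type*} [MeasurableSpace X] {μ : Measure X} [SFinite μ] {ρ : X → ℝ}

/-- Tonelli on the region `ρ y < s`: a layer-cake formula that turns bounds on sublevel sets into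
bounds on integrals. -/
theorem lintegral_lintegral_Ioi (hρ : Measurable ρ) {k : ℝ → ℝ≥0∞} (hk : Measurable k) :
    ∫⁻ y, (∫⁻ s in Ioi (ρ y), k s) ∂μ = ∫⁻ s, k s * μ {y | ρ y < s} := by
  have hm : Measurable (Function.uncurry fun y s => (Ioi (ρ y)).indicator k s) := by
    have : (Function.uncurry fun y s => (Ioi (ρ y)).indicator k s) =
        {p : X × ℝ | ρ p.1 < p.2}.indicator (fun p => k p.2) := by
      ext ⟨y, s⟩; simp [indicator]
    rw [this]
    exact (hk.comp measurable_snd).indicator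
      (measurableSet_lt (hρ.comp measurable_fst) measurable_snd)
  simp_rw [← lintegral_indicator measurableSet_Ioi]
  rw [lintegral_lintegral_swap hm.aemeasurable]
  congr 1 with s
  have : (fun y => (Ioi (ρ y)).indicator k s) = {y | ρ y < s}.indicator (fun _ => k s) := by
    ext y; simp [indicator]
  rw [this, lintegral_indicator (measurableSet_lt hρ measurable_const), lintegral_const]
  simp

/-- Integral of a shifted negative power of a distance-like function `ρ` with respect to a measure
of growth `n`. -/
theorem lintegral_shift_rpow_le (hρ : Measurable ρ) (hρ0 : ∀ y, 0 ≤ ρ y) {A : ℝ≥0∞} {n : ℕ}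
    (hμ : ∀ s > 0, μ {y | ρ y < s} ≤ A * ENNReal.ofReal (s ^ n)) {b τ : ℝ} (hb : n < b)
    (hτ : 0 < τ) :
    ∫⁻ y, ENNReal.ofReal ((τ + ρ y) ^ (-b)) ∂μ ≤
      A * ENNReal.ofReal (b / (b - n) * τ ^ (n - b)) := by
  have hb0 : 0 < b := lt_of_le_of_lt (Nat.cast_nonneg n) hb
  have e : ∀ y, ENNReal.ofReal ((τ + ρ y) ^ (-b)) =
      ∫⁻ s in Ioi (ρ y), ENNReal.ofReal (b * (τ + s) ^ (-b - 1)) := fun y =>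
    (lintegral_Ioi_shift_rpow hb0 (by have := hρ0 y; linarith)).symm
  simp_rw [e]
  rw [lintegral_lintegral_Ioi hρ (by fun_prop)]
  calc _ ≤ ∫⁻ s, (Ioi (0 : ℝ)).indicator (fun s => A * (ENNReal.ofReal (b / (b - n)) *
          ENNReal.ofReal ((b - n) * (τ + s) ^ (-(b - n) - 1)))) s := by
        refine lintegral_mono fun s => ?_
        by_cases hs : 0 < s
        · rw [indicator_of_mem (show s ∈ Ioi (0 : ℝ) from hs)]
          grw [hμ s hs]
          rw [mul_left_comm, ← ENNReal.ofReal_mul (by positivity),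
            ← ENNReal.ofReal_mul (div_nonneg hb0.le (by linarith))]
          gcongr A * ENNReal.ofReal ?_
          -- The growth `s ^ n` is absorbed into the shifted power, which becomes `-(b - n) - 1` and
          -- stays integrable at infinity because `b > n`.
          have h1 : s ^ n ≤ (τ + s) ^ (n : ℝ) := by
            rw [Real.rpow_natCast]; gcongr; linarith
          have h2 : (τ + s) ^ (-(b - n) - 1) = (τ + s) ^ (-b - 1) * (τ + s) ^ (n : ℝ) := by
            rw [← Real.rpow_add (by linarith)]; ring_nf
          have h3 : b - n ≠ 0 := by linarith
          rw [h2]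
          calc b * (τ + s) ^ (-b - 1) * s ^ n ≤ b * (τ + s) ^ (-b - 1) * (τ + s) ^ (n : ℝ) := by
                gcongr
            _ = _ := by field_simp
        · have : {y | ρ y < s} = ∅ := by
            ext y; simp only [mem_ofPred_eq, mem_empty_iff_false, iff_false, not_lt]
            linarith [hρ0 y]
          simp [this]
    _ = _ := by
        rw [lintegral_indicator measurableSet_Ioi, lintegral_const_mul _ (by fun_prop),
          lintegral_const_mul _ (by fun_prop),
          lintegral_Ioi_shift_rpow (by linarith) (by linarith),
          ← ENNReal.ofReal_mul (div_nonneg hb0.le (by linarith))]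
        simp [neg_sub]

/-- Integral of a weakly singular power of a distance-like function `ρ` with respect to a measure
of growth `n`. -/
theorem setLIntegral_rpow_le (hρ : Measurable ρ) (hρ0 : ∀ y, 0 ≤ ρ y) {A : ℝ≥0∞} {n : ℕ}
    (hμ : ∀ s > 0, μ {y | ρ y < s} ≤ A * ENNReal.ofReal (s ^ n)) {b D : ℝ} (hb : b < n)
    (hD : 0 < D) :
    ∫⁻ y in {y | ρ y < D}, ENNReal.ofReal (ρ y ^ (-b)) ∂μ ≤
      A * ENNReal.ofReal ((|b| / (n - b) + 1) * D ^ (n - b)) := by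
  have hS : MeasurableSet {y | ρ y < D} := measurableSet_lt hρ measurable_const
  have hnb : 0 < n - b := by linarith
  rcases le_or_gt b 0 with hb0 | hb0
  -- For `b ≤ 0` the integrand is at most `D ^ (-b)`; the summand `1` in the constant serves this
  -- case.
  · calc _ ≤ ∫⁻ y in {y | ρ y < D}, ENNReal.ofReal (D ^ (-b)) ∂μ := by
          refine setLIntegral_mono measurable_const fun y hy => ?_
          exact ENNReal.ofReal_le_ofReal
            (Real.rpow_le_rpow (hρ0 y) (le_of_lt hy) (by linarith))
      _ ≤ A * ENNReal.ofReal (D ^ (n - b)) := by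
          rw [setLIntegral_const]
          grw [hμ D hD]
          rw [mul_left_comm, ← ENNReal.ofReal_mul (by positivity)]
          gcongr
          rw [sub_eq_neg_add, Real.rpow_add hD, Real.rpow_natCast]
      _ ≤ _ := by
          gcongr
          have : 0 ≤ |b| / (n - b) := by positivity
          nlinarith [Real.rpow_nonneg hD.le (n - b)]
  -- Only an inequality: where `ρ y = 0` the real power is `0` by convention, while the right-hand
  -- side need not vanish.
  · have e : ∀ y, ENNReal.ofReal (ρ y ^ (-b)) ≤
        ∫⁻ s in Ioi (ρ y), ENNReal.ofReal (b * (0 + s) ^ (-b - 1)) := fun y => by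
      rcases (hρ0 y).eq_or_lt with h | h
      · simp [← h, Real.zero_rpow (neg_ne_zero.2 hb0.ne')]
      · rw [lintegral_Ioi_shift_rpow hb0 (by linarith), zero_add]
    -- Sublevel sets of the truncated measure grow like `s ^ n` up to `D` and are bounded by a
    -- constant afterwards; the two ranges of `s` give the two terms of the constant.
    have hν : ∀ s, (μ.restrict {y | ρ y < D}) {y | ρ y < s} ≤
        (Ioc 0 D).indicator (fun s => A * ENNReal.ofReal (s ^ n)) s +
        (Ioi D).indicator (fun s => A * ENNReal.ofReal (D ^ n)) s := by
      intro s
      rcases le_or_gt s 0 with h | h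
      · have : {y | ρ y < s} = ∅ := by
          ext y; simp only [mem_ofPred_eq, mem_empty_iff_false, iff_false, not_lt]
          linarith [hρ0 y]
        simp [this]
      rcases le_or_gt s D with h' | h'
      · rw [indicator_of_mem (show s ∈ Ioc 0 D from ⟨h, h'⟩)]
        exact ((Measure.restrict_apply_le _ _).trans (hμ s h)).trans le_self_add
      · rw [indicator_of_mem (show s ∈ Ioi D from h')]
        refine le_trans ?_ le_add_self
        refine (measure_mono (subset_univ _)).trans ?_
        rw [Measure.restrict_apply_univ]
        exact hμ D hD
    calc _ ≤ ∫⁻ y in {y | ρ y < D}, (∫⁻ s in Ioi (ρ y), ENNReal.ofReal (b * (0 + s) ^ (-b - 1))) ∂μ :=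
          lintegral_mono e
      _ ≤ ∫⁻ s, ((Ioc 0 D).indicator (fun s => A * ENNReal.ofReal b *
            ENNReal.ofReal (s ^ (n - b - 1))) s + (Ioi D).indicator (fun s =>
            A * ENNReal.ofReal (D ^ n) * ENNReal.ofReal (b * (0 + s) ^ (-b - 1))) s) := by
          rw [lintegral_lintegral_Ioi hρ (by fun_prop)]
          refine lintegral_mono fun s => ?_
          grw [hν s]
          rw [mul_add]
          refine add_le_add ?_ ?_
          · by_cases h : s ∈ Ioc 0 D
            · rw [indicator_of_mem h, indicator_of_mem h]
              have hs : 0 < s := h.1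
              rw [mul_left_comm, mul_assoc, ← ENNReal.ofReal_mul (by positivity),
                ← ENNReal.ofReal_mul (by positivity), zero_add]
              refine le_of_eq ?_
              rw [mul_assoc, ← Real.rpow_natCast, ← Real.rpow_add hs]
              ring_nf
            · simp [indicator_of_notMem h]
          · by_cases h : s ∈ Ioi D
            · rw [indicator_of_mem h, indicator_of_mem h, mul_comm]
            · simp [indicator_of_notMem h]
      _ = A * ENNReal.ofReal b * ENNReal.ofReal (D ^ (n - b) / (n - b)) +
            A * ENNReal.ofReal (D ^ n) * ENNReal.ofReal (D ^ (-b)) := by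
          rw [lintegral_add_left (Measurable.indicator (by fun_prop) measurableSet_Ioc),
            lintegral_indicator measurableSet_Ioc, lintegral_indicator measurableSet_Ioi,
            lintegral_const_mul _ (by fun_prop), lintegral_const_mul _ (by fun_prop),
            lintegral_Ioc_rpow hnb hD, lintegral_Ioi_shift_rpow hb0 (by linarith), zero_add]
      _ = _ := by
          rw [abs_of_pos hb0, mul_assoc, mul_assoc, ← mul_add, ← ENNReal.ofReal_mul hb0.le,
            ← ENNReal.ofReal_mul (by positivity), ← ENNReal.ofReal_add (by positivity)
            (by positivity), ← Real.rpow_natCast, ← Real.rpow_add hD]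
          congr 2
          rw [← sub_eq_add_neg]
          ring

end Growth

end

section

variable {d : ℕ}

/-! ### The fundamental solution -/

/-- The area of the unit sphere. -/
def sphereArea (d : ℕ) : ℝ := d * volume.real (Metric.ball (0 : E d) 1)

theorem sphereArea_pos (hd : 1 ≤ d) : 0 < sphereArea d := by
  have : 0 < volume.real (Metric.ball (0 : E d) 1) :=
    ENNReal.toReal_pos (Metric.measure_ball_pos _ _ one_pos).ne' measure_ball_lt_top.ne
  have : (0 : ℝ) < d := by exact_mod_cast hd
  unfold sphereArea
  positivity

theorem sphereArea_two : sphereArea 2 = 2 * Real.pi := by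
  have : volume.real (Metric.ball (0 : E 2) 1) = Real.pi := by
    rw [Measure.real, EuclideanSpace.volume_ball_fin_two]
    simp [ENNReal.toReal_ofReal, Real.pi_nonneg]
  simp [sphereArea, this]

/-- The radial profile of the fundamental solution. -/
def radialProfile (d : ℕ) (r : ℝ) : ℝ :=
  if d = 2 then (2 * Real.pi)⁻¹ * Real.log r
  else -(((d : ℝ) - 2) * sphereArea d)⁻¹ * r ^ (2 - (d : ℤ))

theorem fundamentalSolution_eq (x : E d) : fundamentalSolution x = radialProfile d ‖x‖ := rfl

/-- One formula covers the logarithm and all the powers, so gradient and Hessian need no distinction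
of dimensions. The factor `r` is kept apart because the chain rule with `‖x‖` cancels it. -/
theorem hasDerivAt_radialProfile (hd : 1 ≤ d) {r : ℝ} (hr : 0 < r) :
    HasDerivAt (radialProfile d) ((sphereArea d)⁻¹ * r * (r ^ d)⁻¹) r := by
  by_cases h2 : d = 2
  · subst h2
    have := (Real.hasDerivAt_log hr.ne').const_mul (2 * Real.pi)⁻¹
    rw [sphereArea_two]
    refine (this.congr_of_eventuallyEq (.of_forall fun r => by simp [radialProfile])).congr_deriv ?_
    field_simp
  · have := (hasDerivAt_zpow (2 - (d : ℤ)) r (Or.inl hr.ne')).const_mul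
      (-(((d : ℝ) - 2) * sphereArea d)⁻¹)
    refine (this.congr_of_eventuallyEq
      (.of_forall fun r => by simp [radialProfile, h2])).congr_deriv ?_
    have h0 := (sphereArea_pos hd).ne'
    have h1 : (d : ℝ) - 2 ≠ 0 := by
      rw [sub_ne_zero]; exact_mod_cast h2
    have e : r ^ (2 - (d : ℤ) - 1) = r * (r ^ d)⁻¹ := by
      rw [show 2 - (d : ℤ) - 1 = 1 - d by ring, zpow_sub₀ hr.ne', zpow_one, zpow_natCast]; rfl
    rw [e]
    push_cast
    field_simp
    ring

/-- Makes the regularizations monotone in `ε`, so that `regFundamental ε` lies between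
`fundamentalSolution` and `regFundamental 1`; this yields a dominating function whatever the sign of
the kernel. -/
theorem monotoneOn_radialProfile (hd : 1 ≤ d) : MonotoneOn (radialProfile d) (Ioi 0) := by
  refine monotoneOn_of_deriv_nonneg (convex_Ioi 0)
    (fun r hr => (hasDerivAt_radialProfile hd hr).continuousAt.continuousWithinAt)
    (fun r hr => (hasDerivAt_radialProfile hd
      (interior_subset hr)).differentiableAt.differentiableWithinAt) fun r hr => ?_
  have hr' : 0 < r := interior_subset hr
  rw [(hasDerivAt_radialProfile hd hr').deriv]
  have := sphereArea_pos hd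
  positivity

/-- The fundamental solution regularized at the origin. -/
def regFundamental (ε : ℝ) (x : E d) : ℝ := radialProfile d (Real.sqrt (‖x‖ ^ 2 + ε ^ 2))

theorem regFundamental_zero (x : E d) : regFundamental 0 x = fundamentalSolution x := by
  simp [regFundamental, fundamentalSolution_eq]

/-- The directional derivative along `a` of the regularized fundamental solution. -/
def regGrad (ε : ℝ) (a x : E d) : ℝ :=
  (sphereArea d)⁻¹ * (Real.sqrt (‖x‖ ^ 2 + ε ^ 2) ^ d)⁻¹ * inner ℝ x a

/-- The derivative along `a` of the fundamental solution. -/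
def gradG (a x : E d) : ℝ := (sphereArea d)⁻¹ * (‖x‖ ^ d)⁻¹ * inner ℝ x a

/-- The second derivative along `a` and `b` of the fundamental solution. -/
def hessG (a b x : E d) : ℝ :=
  (sphereArea d)⁻¹ * ((‖x‖ ^ d)⁻¹ * inner ℝ a b -
    d * (‖x‖ ^ (d + 2))⁻¹ * inner ℝ x a * inner ℝ x b)

theorem hasFDerivAt_regFundamental (hd : 1 ≤ d) {ε : ℝ} {x : E d} (h : 0 < ‖x‖ ^ 2 + ε ^ 2) :
    HasFDerivAt (regFundamental ε)
      (((sphereArea d)⁻¹ * (Real.sqrt (‖x‖ ^ 2 + ε ^ 2) ^ d)⁻¹) • innerSL ℝ x) x := by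
  have h1 := ((hasStrictFDerivAt_norm_sq x).hasFDerivAt.add_const (ε ^ 2)).sqrt h.ne'
  have h2 := (hasDerivAt_radialProfile hd (Real.sqrt_pos.2 h)).comp_hasFDerivAt x h1
  refine h2.congr_fderiv ?_
  have : Real.sqrt (‖x‖ ^ 2 + ε ^ 2) ≠ 0 := (Real.sqrt_pos.2 h).ne'
  ext v
  simp
  field_simp

theorem hasFDerivAt_fundamentalSolution (hd : 1 ≤ d) {x : E d} (h : x ≠ 0) :
    HasFDerivAt fundamentalSolution (((sphereArea d)⁻¹ * (‖x‖ ^ d)⁻¹) • innerSL ℝ x) x := by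
  have := hasFDerivAt_regFundamental hd (ε := 0) (x := x)
    (by have := norm_pos_iff.2 h; positivity)
  simpa [funext regFundamental_zero] using this

theorem hasFDerivAt_gradG (a : E d) {x : E d} (h : x ≠ 0) :
    HasFDerivAt (gradG a) ((sphereArea d)⁻¹ • ((‖x‖ ^ d)⁻¹ • innerSL ℝ a -
      (d * (‖x‖ ^ (d + 2))⁻¹ * inner ℝ x a) • innerSL ℝ x)) x := by
  have hx : 0 < ‖x‖ := norm_pos_iff.2 h
  have h0 : HasFDerivAt (fun x : E d => ‖x‖) (‖x‖⁻¹ • innerSL ℝ x) x := by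
    have h1 := (hasStrictFDerivAt_norm_sq x).hasFDerivAt.sqrt (by positivity)
    simp only [Real.sqrt_sq (norm_nonneg _)] at h1
    refine h1.congr_fderiv ?_
    ext v
    simp
    field_simp
  have h1 := (hasDerivAt_zpow (-(d : ℤ)) ‖x‖ (Or.inl hx.ne')).comp_hasFDerivAt x h0
  have h2 : HasFDerivAt (fun x : E d => inner ℝ x a) (innerSL ℝ a) x := by
    refine ((innerSL ℝ a).hasFDerivAt (x := x)).congr_of_eventuallyEq (.of_forall fun y => ?_)
    simp [real_inner_comm]
  have h3 := (h1.mul h2).const_mul (sphereArea d)⁻¹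
  refine (h3.congr_of_eventuallyEq (.of_forall fun y => ?_)).congr_fderiv ?_
  · simp [gradG, mul_assoc, zpow_neg]
  · ext v
    have e1 : ‖x‖ ^ (-(d : ℤ) - 1) * ‖x‖⁻¹ = (‖x‖ ^ (d + 2))⁻¹ := by
      rw [zpow_sub₀ hx.ne', zpow_neg, zpow_natCast, zpow_one, pow_add]
      field_simp
    simp only [zpow_neg, zpow_natCast, add_apply, smul_apply, innerSL_apply_apply, smul_eq_mul,
      Int.cast_neg, Int.cast_natCast, sub_apply, Function.comp_apply]
    rw [← e1]
    ring

theorem abs_gradG_le (hd : 1 ≤ d) (a x : E d) :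
    |gradG a x| ≤ (sphereArea d)⁻¹ * ‖a‖ * ‖x‖ ^ (-(d - 1 : ℝ)) := by
  have hω := sphereArea_pos hd
  rcases eq_or_ne x 0 with rfl | hx
  · simp only [gradG, inner_zero_left, mul_zero, abs_zero]
    positivity
  have hx' := norm_pos_iff.2 hx
  have e : ‖x‖ ^ (-(d - 1 : ℝ)) = (‖x‖ ^ d)⁻¹ * ‖x‖ := by
    rw [neg_sub, sub_eq_neg_add, Real.rpow_add hx', Real.rpow_neg hx'.le, Real.rpow_natCast,
      Real.rpow_one]
  rw [gradG, e, abs_mul, abs_of_nonneg (by positivity : 0 ≤ (sphereArea d)⁻¹ * (‖x‖ ^ d)⁻¹)]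
  grw [abs_real_inner_le_norm]
  exact le_of_eq (by ring)

theorem abs_hessG_le (hd : 1 ≤ d) (a b x : E d) :
    |hessG a b x| ≤ (sphereArea d)⁻¹ * (1 + d) * ‖a‖ * ‖b‖ * ‖x‖ ^ (-d : ℝ) := by
  have hω := sphereArea_pos hd
  rcases eq_or_ne x 0 with rfl | hx
  · have : (0 : ℝ) ^ d = 0 := zero_pow (by omega)
    simp only [hessG, norm_zero, this, inner_zero_left, mul_zero, inv_zero, zero_mul, sub_zero,
      abs_zero]
    positivity
  have hx' := norm_pos_iff.2 hx
  rw [hessG, Real.rpow_neg hx'.le, Real.rpow_natCast, abs_mul, abs_of_nonneg (inv_nonneg.2 hω.le)]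
  have h1 : |(‖x‖ ^ d)⁻¹ * inner ℝ a b| ≤ (‖x‖ ^ d)⁻¹ * (‖a‖ * ‖b‖) := by
    rw [abs_mul, abs_of_nonneg (by positivity)]
    grw [abs_real_inner_le_norm]
  have h2 : |d * (‖x‖ ^ (d + 2))⁻¹ * inner ℝ x a * inner ℝ x b| ≤
      d * (‖x‖ ^ (d + 2))⁻¹ * (‖x‖ * ‖a‖) * (‖x‖ * ‖b‖) := by
    rw [abs_mul, abs_mul, abs_of_nonneg (by positivity : 0 ≤ d * (‖x‖ ^ (d + 2))⁻¹)]
    grw [abs_real_inner_le_norm, abs_real_inner_le_norm]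
  grw [abs_sub, h1, h2]
  refine le_of_eq ?_
  rw [pow_add]
  field_simp

/-- The half power of slack beyond the true order `d - 2` absorbs the logarithm in dimension two; on
bounded sets it costs only a constant. -/
theorem abs_fundamentalSolution_le (hd : 1 ≤ d) (D : ℝ) : ∃ C, 0 ≤ C ∧ ∀ x : E d, ‖x‖ ≤ D →
    |fundamentalSolution x| ≤ C * ‖x‖ ^ (-(d - 3 / 2 : ℝ)) := by
  by_cases h2 : d = 2
  · subst h2
    refine ⟨(2 * Real.pi)⁻¹ * (2 + |D| ^ (1 / 2 : ℝ) * |D|), by positivity, fun x hx => ?_⟩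
    rcases eq_or_ne x 0 with rfl | h0
    · simp [fundamentalSolution]
      norm_num
    have hx' := norm_pos_iff.2 h0
    rw [fundamentalSolution, if_pos rfl, abs_mul, abs_of_pos (by positivity), mul_assoc]
    gcongr
    have e : (-((2 : ℕ) - 3 / 2 : ℝ)) = -(1 / 2) := by norm_num
    rw [e, Real.rpow_neg hx'.le, ← div_eq_mul_inv, le_div_iff₀ (by positivity)]
    rcases le_or_gt ‖x‖ 1 with h1 | h1
    · have := (Real.abs_log_mul_self_rpow_lt ‖x‖ (1 / 2) hx' h1 (by norm_num)).le
      rw [abs_mul, abs_of_pos (by positivity : 0 < ‖x‖ ^ (1 / 2 : ℝ))] at this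
      have : 0 ≤ |D| ^ (1 / 2 : ℝ) * |D| := by positivity
      linarith
    · have hD : ‖x‖ ≤ |D| := hx.trans (le_abs_self D)
      have h3 : |Real.log ‖x‖| ≤ |D| := by
        rw [abs_of_nonneg (Real.log_nonneg h1.le)]
        exact (Real.log_le_self hx'.le).trans hD
      have h4 : ‖x‖ ^ (1 / 2 : ℝ) ≤ |D| ^ (1 / 2 : ℝ) := by gcongr
      nlinarith [mul_le_mul h3 h4 (by positivity) (by positivity)]
  · refine ⟨|-(((d : ℝ) - 2) * sphereArea d)⁻¹| * |D| ^ (1 / 2 : ℝ), by positivity, fun x hx => ?_⟩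
    rw [fundamentalSolution_eq, radialProfile, if_neg h2, abs_mul, mul_assoc]
    gcongr
    rcases eq_or_ne x 0 with rfl | h0
    · rw [norm_zero, zero_zpow _ (by omega), abs_zero]
      positivity
    have hx' := norm_pos_iff.2 h0
    have hD : ‖x‖ ≤ |D| := hx.trans (le_abs_self D)
    have e : ‖x‖ ^ (2 - (d : ℤ)) = ‖x‖ ^ (1 / 2 : ℝ) * ‖x‖ ^ (-(d - 3 / 2 : ℝ)) := by
      rw [← Real.rpow_add hx', ← Real.rpow_intCast]
      congr 1
      push_cast
      ring
    rw [abs_of_pos (by positivity), e]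
    gcongr

theorem integrableOn_rpow_norm_sub (hd : 1 ≤ d) {b : ℝ} (hb : b < d) (y : E d) (D : ℝ) :
    IntegrableOn (fun x => ‖x - y‖ ^ (-b)) (Metric.ball y D) := by
  have hm : Measurable fun x : E d => ‖x - y‖ := by fun_prop
  have : Nonempty (Fin d) := ⟨⟨0, hd⟩⟩
  have h := setLIntegral_rpow_le (μ := (volume : Measure (E d))) (ρ := fun x => ‖x - y‖)
    hm (fun _ => norm_nonneg _) (A := volume (Metric.ball (0 : E d) 1)) (n := d)
    (fun s hs => by
      have : {x | ‖x - y‖ < s} = Metric.ball y s := by ext x; simp [dist_eq_norm]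
      rw [this, Measure.addHaar_ball _ _ hs.le, mul_comm]
      simp) hb (D := max D 1) (by positivity)
  refine ⟨(by fun_prop : Measurable fun x => ‖x - y‖ ^ (-b)).aestronglyMeasurable, ?_⟩
  rw [hasFiniteIntegral_iff_ofReal (.of_forall fun x => by positivity)]
  refine lt_of_le_of_lt ((lintegral_mono_set fun x hx => ?_).trans h)
    (ENNReal.mul_lt_top measure_ball_lt_top ENNReal.ofReal_lt_top)
  have : ‖x - y‖ < D := by simpa [dist_eq_norm] using hx
  exact lt_max_of_lt_left this

theorem measurable_fundamentalSolution : Measurable (fundamentalSolution (d := d)) := by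
  unfold fundamentalSolution
  split_ifs <;> fun_prop

theorem measurable_gradG (a : E d) : Measurable (gradG a) := by
  unfold gradG; fun_prop

theorem measurable_hessG (a b : E d) : Measurable (hessG a b) := by
  unfold hessG; fun_prop

theorem locallyIntegrable_of_rpow_bound (hd : 1 ≤ d) {k : E d → ℝ} (hk : Measurable k) {b : ℝ}
    (hb : b < d) (h : ∀ D, ∃ C, ∀ x, ‖x‖ ≤ D → |k x| ≤ C * ‖x‖ ^ (-b)) : LocallyIntegrable k := by
  intro x
  obtain ⟨C, hC⟩ := h (‖x‖ + 1)
  refine ⟨Metric.ball 0 (‖x‖ + 1), Metric.isOpen_ball.mem_nhds (by simp), ?_⟩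
  have := (integrableOn_rpow_norm_sub hd hb 0 (‖x‖ + 1)).const_mul C
  simp only [sub_zero] at this
  refine this.mono' hk.aestronglyMeasurable ?_
  refine (ae_restrict_iff' measurableSet_ball).2 (.of_forall fun y hy => hC y ?_)
  exact le_of_lt (by simpa using hy)

theorem locallyIntegrable_fundamentalSolution (hd : 1 ≤ d) :
    LocallyIntegrable (fundamentalSolution (d := d)) :=
  locallyIntegrable_of_rpow_bound hd measurable_fundamentalSolution (b := d - 3 / 2) (by linarith)
    fun D => (abs_fundamentalSolution_le hd D).imp fun _ h => h.2

theorem locallyIntegrable_gradG (hd : 1 ≤ d) (a : E d) : LocallyIntegrable (gradG a) :=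
  locallyIntegrable_of_rpow_bound hd (measurable_gradG a) (b := d - 1) (by linarith)
    fun _ => ⟨_, fun x _ => abs_gradG_le hd a x⟩

/-- Replacing `‖x‖` by `√(‖x‖² + ε²)` removes the singularity and permits classical integration by
parts. As `ε → 0` both sides converge by domination: the kernels are squeezed by monotonicity, and
the regularized gradients are smaller than the singular one. -/
theorem integral_smul_deriv_fundamentalSolution (hd : 1 ≤ d) {ψ : E d → ℝ} (hψ : ContDiff ℝ ∞ ψ)
    (hc : HasCompactSupport ψ) (a : E d) :
    ∫ x, fderiv ℝ ψ x a * fundamentalSolution x = -∫ x, ψ x * gradG a x := by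
  have : Nonempty (Fin d) := ⟨⟨0, hd⟩⟩
  have hω := sphereArea_pos hd
  have hψ' := continuous_fderiv_apply hψ a
  have hc' := hasCompactSupport_fderiv_apply hc a
  set ε : ℕ → ℝ := fun n => 1 / ((n : ℝ) + 1) with hε
  have hε0 : ∀ n, 0 < ε n := fun n => by positivity
  have hε1 : ∀ n, ε n ≤ 1 := fun n => by
    rw [hε]; simp only; rw [div_le_one (by positivity)]; linarith [Nat.cast_nonneg (α := ℝ) n]
  have hεt : Tendsto ε atTop (𝓝 0) := tendsto_one_div_add_atTop_nhds_zero_nat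
  have hpos : ∀ n (x : E d), 0 < ‖x‖ ^ 2 + ε n ^ 2 := fun n x => by have := hε0 n; positivity
  have hregc : ∀ ε > 0, Continuous (regFundamental (d := d) ε) := fun ε h =>
    continuous_iff_continuousAt.2 fun x =>
      (hasFDerivAt_regFundamental hd (by positivity)).continuousAt
  have hgradc : ∀ n, Continuous fun x => regGrad (ε n) a x := fun n => by
    unfold regGrad
    have : ∀ x : E d, Real.sqrt (‖x‖ ^ 2 + ε n ^ 2) ^ d ≠ 0 := fun x =>
      pow_ne_zero _ (Real.sqrt_pos.2 (hpos n x)).ne'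
    fun_prop (disch := assumption)
  have key : ∀ n, ∫ x, fderiv ℝ ψ x a * regFundamental (ε n) x =
      -∫ x, ψ x * regGrad (ε n) a x := by
    intro n
    have := integral_bilinear_hasFDerivAt_right_eq_neg_left_of_integrable (μ := volume)
      (f := ψ) (f' := fderiv ℝ ψ) (g := regFundamental (ε n))
      (g' := fun x => ((sphereArea d)⁻¹ * (Real.sqrt (‖x‖ ^ 2 + ε n ^ 2) ^ d)⁻¹) • innerSL ℝ x)
      (v := a) (B := ContinuousLinearMap.mul ℝ ℝ) ?_ ?_ ?_
      (fun x _ => (hψ.differentiable (by simp) x).hasFDerivAt)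
      (fun x _ => hasFDerivAt_regFundamental hd (hpos n x))
    · have e : ∀ x : E d, (((sphereArea d)⁻¹ * (Real.sqrt (‖x‖ ^ 2 + ε n ^ 2) ^ d)⁻¹) • innerSL ℝ x) a
        = regGrad (ε n) a x := fun x => by simp [regGrad]
      simp only [e, ContinuousLinearMap.mul_apply'] at this
      rw [this, neg_neg]
    · exact (hψ'.mul (hregc _ (hε0 n))).integrable_of_hasCompactSupport hc'.mul_right
    · have e : ∀ x : E d, (((sphereArea d)⁻¹ * (Real.sqrt (‖x‖ ^ 2 + ε n ^ 2) ^ d)⁻¹) • innerSL ℝ x) a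
        = regGrad (ε n) a x := fun x => by simp [regGrad]
      simp only [e]
      exact (hψ.continuous.mul (hgradc n)).integrable_of_hasCompactSupport hc.mul_right
    · exact (hψ.continuous.mul (hregc _ (hε0 n))).integrable_of_hasCompactSupport hc.mul_right
  have hne : ∀ᵐ x : E d, x ≠ 0 := by simp [ae_iff]
  have hsq : ∀ x : E d, Tendsto (fun n => Real.sqrt (‖x‖ ^ 2 + ε n ^ 2)) atTop (𝓝 ‖x‖) := fun x => by
    have : Tendsto (fun n => Real.sqrt (‖x‖ ^ 2 + ε n ^ 2)) atTop (𝓝 (Real.sqrt (‖x‖ ^ 2 + 0 ^ 2))) :=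
      (Real.continuous_sqrt.tendsto _).comp ((hεt.pow 2).const_add _)
    simpa using this
  have l1 : Tendsto (fun n => ∫ x, fderiv ℝ ψ x a * regFundamental (ε n) x) atTop
      (𝓝 (∫ x, fderiv ℝ ψ x a * fundamentalSolution x)) := by
    refine tendsto_integral_of_dominated_convergence
      (fun x => |fderiv ℝ ψ x a * fundamentalSolution x| + |fderiv ℝ ψ x a * regFundamental 1 x|)
      (fun n => (hψ'.mul (hregc _ (hε0 n))).aestronglyMeasurable) ?_ ?_ ?_
    · refine Integrable.add ?_ ?_
      · exact (((locallyIntegrable_fundamentalSolution hd).integrable_smul_left_of_hasCompactSupport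
          hψ' hc').congr (.of_forall fun x => by simp)).abs
      · exact ((hψ'.mul (hregc _ one_pos)).integrable_of_hasCompactSupport hc'.mul_right).abs
    · intro n
      filter_upwards [hne] with x hx
      have hx' := norm_pos_iff.2 hx
      rw [Real.norm_eq_abs, abs_mul, abs_mul, abs_mul, ← mul_add]
      gcongr
      have m1 : fundamentalSolution x ≤ regFundamental (ε n) x :=
        monotoneOn_radialProfile hd hx' (Real.sqrt_pos.2 (hpos n x))
          (Real.le_sqrt_of_sq_le (by have := sq_nonneg (ε n); linarith))
      have m2 : regFundamental (ε n) x ≤ regFundamental 1 x :=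
        monotoneOn_radialProfile hd (Real.sqrt_pos.2 (hpos n x))
          (Real.sqrt_pos.2 (by positivity)) (Real.sqrt_le_sqrt (by
            have := hε1 n; have := hε0 n; gcongr))
      have := abs_le_max_abs_abs m1 m2
      exact this.trans (max_le_add_of_nonneg (abs_nonneg _) (abs_nonneg _))
    · filter_upwards [hne] with x hx
      exact (((hasDerivAt_radialProfile hd (norm_pos_iff.2 hx)).continuousAt.tendsto.comp
        (hsq x))).const_mul _
  have l2 : Tendsto (fun n => ∫ x, ψ x * regGrad (ε n) a x) atTop (𝓝 (∫ x, ψ x * gradG a x)) := by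
    refine tendsto_integral_of_dominated_convergence (fun x => |ψ x * gradG a x|)
      (fun n => (hψ.continuous.mul (hgradc n)).aestronglyMeasurable) ?_ ?_ ?_
    · exact (((locallyIntegrable_gradG hd a).integrable_smul_left_of_hasCompactSupport
          hψ.continuous hc).congr (.of_forall fun x => by simp)).abs
    · intro n
      filter_upwards [hne] with x hx
      have hx' := norm_pos_iff.2 hx
      rw [Real.norm_eq_abs, regGrad, gradG]
      simp only [abs_mul, abs_inv, abs_pow, abs_norm, abs_of_nonneg (Real.sqrt_nonneg _)]
      gcongr
      exact Real.le_sqrt_of_sq_le (by have := sq_nonneg (ε n); linarith)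
    · filter_upwards [hne] with x hx
      unfold regGrad gradG
      exact ((((hsq x).pow d).inv₀ (pow_ne_zero _ (norm_pos_iff.2 hx).ne')).const_mul _
        |>.mul_const _).const_mul _
  have := tendsto_nhds_unique (l1.congr key) l2.neg
  exact this

theorem sum_coord_smul (x : E d) : ∑ i, x i • coordVec i = x := by
  ext j
  simp [Pi.single_apply]

/-- Polar coordinates: along the ray in direction `θ` the integrand times `r ^ (d - 1)` is the
derivative of `r ↦ φ (r θ)` divided by the sphere area, so each ray contributes `-φ 0` over that
area. -/
theorem integral_fderiv_self_eq (hd : 1 ≤ d) {φ : E d → ℝ} (hφ : ContDiff ℝ ∞ φ)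
    (hc : HasCompactSupport φ) :
    ∫ x, (sphereArea d)⁻¹ * (‖x‖ ^ d)⁻¹ * fderiv ℝ φ x x = -φ 0 := by
  have : Nonempty (Fin d) := ⟨⟨0, hd⟩⟩
  have hω := sphereArea_pos hd
  have hfr : Module.finrank ℝ (E d) = d := by simp
  set h : E d → ℝ := fun x => (sphereArea d)⁻¹ * (‖x‖ ^ d)⁻¹ * fderiv ℝ φ x x with hh
  have hint : Integrable h := by
    have : h = fun x => ∑ i, fderiv ℝ φ x (coordVec i) * gradG (coordVec i) x := by
      ext x
      rw [hh]
      simp only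
      conv_lhs => rw [← sum_coord_smul x, map_sum, sum_coord_smul x]
      rw [Finset.mul_sum]
      refine Finset.sum_congr rfl fun i _ => ?_
      simp [gradG, EuclideanSpace.inner_single_right]
      ring
    rw [this]
    exact integrable_finsetSum _ fun i _ =>
      (locallyIntegrable_gradG hd _).integrable_smul_left_of_hasCompactSupport
        (continuous_fderiv_apply hφ _) (hasCompactSupport_fderiv_apply hc _)
  set μ : Measure (E d) := volume
  have hmp := μ.measurePreserving_homeomorphUnitSphereProd
  have hme := (homeomorphUnitSphereProd (E d)).measurableEmbedding
  set H : Metric.sphere (0 : E d) 1 × Ioi (0 : ℝ) → ℝ := fun p => h (p.2.1 • p.1.1) with hH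
  have hcomp : ∀ x : ({0}ᶜ : Set (E d)), H (homeomorphUnitSphereProd (E d) x) = h x := fun x => by
    rw [hH]
    simp only
    rw [← homeomorphUnitSphereProd_symm_apply_coe, Homeomorph.symm_apply_apply]
  have e1 : ∫ x, h x = ∫ p, H p ∂(μ.toSphere.prod (.volumeIoiPow (Module.finrank ℝ (E d) - 1))) := by
    rw [← hmp.integral_comp hme]
    simp_rw [hcomp]
    rw [integral_subtype_comap (measurableSet_singleton _).compl h, restrict_compl_singleton]
  have hHint : Integrable H (μ.toSphere.prod (.volumeIoiPow (Module.finrank ℝ (E d) - 1))) := by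
    rw [← hmp.integrable_comp_emb hme]
    have : H ∘ (homeomorphUnitSphereProd (E d)) = h ∘ Subtype.val := funext hcomp
    rw [this, ← integrableOn_iff_comap_subtypeVal (measurableSet_singleton _).compl]
    exact hint.integrableOn
  have inner : ∀ θ : Metric.sphere (0 : E d) 1,
      ∫ r, H (θ, r) ∂(.volumeIoiPow (Module.finrank ℝ (E d) - 1)) = (sphereArea d)⁻¹ * -φ 0 := by
    intro θ
    have hθ : ‖(θ : E d)‖ = 1 := by simp
    have e2 : ∫ r, H (θ, r) ∂(.volumeIoiPow (Module.finrank ℝ (E d) - 1)) =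
        ∫ r in Ioi (0 : ℝ), r ^ (d - 1) * h (r • (θ : E d)) := by
      simp only [Measure.volumeIoiPow, ENNReal.ofReal]
      rw [integral_withDensity_eq_integral_smul
        ((measurable_subtype_coe.pow_const _).real_toNNReal), hfr,
        integral_subtype_comap measurableSet_Ioi
          fun a : ℝ => Real.toNNReal (a ^ (d - 1)) • h (a • (θ : E d))]
      refine setIntegral_congr_fun measurableSet_Ioi fun x hx => ?_
      simp only [NNReal.smul_def, Real.coe_toNNReal _ (pow_nonneg (le_of_lt hx) _), smul_eq_mul]
    set f : ℝ → ℝ := fun r => φ (r • (θ : E d)) with hf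
    have hfd : ∀ r, HasDerivAt f (fderiv ℝ φ (r • (θ : E d)) θ) r := fun r => by
      have h1 : HasDerivAt (fun r : ℝ => r • (θ : E d)) (θ : E d) r := by
        simpa using (hasDerivAt_id r).smul_const (θ : E d)
      exact ((hφ.differentiable (by simp) _).hasFDerivAt).comp_hasDerivAt r h1
    have hfc : HasCompactSupport f := by
      have : Topology.IsClosedEmbedding fun r : ℝ => r • (θ : E d) := by
        have hiso : Isometry fun r : ℝ => r • (θ : E d) := Isometry.of_dist_eq fun a b => by
          rw [dist_eq_norm, ← sub_smul, norm_smul, hθ, mul_one, dist_eq_norm]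
        exact hiso.isClosedEmbedding
      exact hc.comp_isClosedEmbedding this
    have hfC : ContDiff ℝ 1 f :=
      (hφ.comp (contDiff_id.smul contDiff_const)).of_le (by simp)
    have h0 : φ 0 = f 0 := by simp [hf]
    rw [e2, h0, ← hfc.integral_Ioi_deriv_eq hfC 0, ← integral_const_mul]
    refine setIntegral_congr_fun measurableSet_Ioi fun r hr => ?_
    have hr' : 0 < r := hr
    simp only [hh, norm_smul, hθ, mul_one, map_smul, (hfd r).deriv, smul_eq_mul,
      Real.norm_eq_abs, abs_of_pos hr']
    have : r ^ d = r ^ (d - 1) * r := by rw [← pow_succ]; congr 1; omega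
    rw [this]
    field_simp
  rw [e1, integral_prod _ hHint]
  simp_rw [inner]
  rw [integral_const, μ.toSphere_real_apply_univ, hfr]
  change sphereArea d • _ = _
  rw [smul_eq_mul, mul_inv_cancel_left₀ hω.ne']

/-- The Laplacian of a smooth function, in coordinates. -/
def lap (φ : E d → ℝ) (x : E d) : ℝ :=
  ∑ i, fderiv ℝ (fun z => fderiv ℝ φ z (coordVec i)) x (coordVec i)

theorem contDiff_fderiv_apply {F : Type*} [NormedAddCommGroup F] [NormedSpace ℝ F] {φ : E d → F}
    (h : ContDiff ℝ ∞ φ) (v : E d) : ContDiff ℝ ∞ fun x => fderiv ℝ φ x v :=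
  (h.fderiv_right (m := ∞) (by simp)).clm_apply contDiff_const

/-- `ΔG = δ₀`. Moving one derivative onto `G` leaves the pairing of the gradients of `φ` and `G`,
which is the radial derivative computed in `integral_fderiv_self_eq`. -/
theorem integral_lap_fundamentalSolution (hd : 1 ≤ d) {φ : E d → ℝ} (hφ : ContDiff ℝ ∞ φ)
    (hc : HasCompactSupport φ) : ∫ x, lap φ x * fundamentalSolution x = φ 0 := by
  have hi : ∀ i, Integrable fun x => fderiv ℝ (fun z => fderiv ℝ φ z (coordVec i)) x (coordVec i) *
      fundamentalSolution x := fun i =>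
    (locallyIntegrable_fundamentalSolution hd).integrable_smul_left_of_hasCompactSupport
      (continuous_fderiv_apply (contDiff_fderiv_apply hφ _) _)
      (hasCompactSupport_fderiv_apply (hasCompactSupport_fderiv_apply hc _) _)
  have hi' : ∀ i, Integrable fun x => fderiv ℝ φ x (coordVec i) * gradG (coordVec i) x := fun i =>
    (locallyIntegrable_gradG hd _).integrable_smul_left_of_hasCompactSupport
      (continuous_fderiv_apply hφ _) (hasCompactSupport_fderiv_apply hc _)
  simp only [lap, Finset.sum_mul]
  rw [integral_finsetSum _ fun i _ => hi i]
  simp_rw [integral_smul_deriv_fundamentalSolution hd (contDiff_fderiv_apply hφ _)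
    (hasCompactSupport_fderiv_apply hc _)]
  rw [Finset.sum_neg_distrib, ← integral_finsetSum _ fun i _ => hi' i, ← neg_inj, neg_neg,
    ← integral_fderiv_self_eq hd hφ hc]
  congr 1 with x
  conv_rhs => rw [← sum_coord_smul x, map_sum, sum_coord_smul x]
  rw [Finset.mul_sum]
  refine Finset.sum_congr rfl fun i _ => ?_
  simp [gradG, EuclideanSpace.inner_single_right]
  ring

theorem integral_lap_mul_fundamentalSolution_sub (hd : 1 ≤ d) {φ : E d → ℝ} (hφ : ContDiff ℝ ∞ φ)
    (hc : HasCompactSupport φ) (y : E d) : ∫ x, lap φ x * fundamentalSolution (x - y) = φ y := by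
  have h := integral_lap_fundamentalSolution hd (φ := fun x => φ (x + y))
    (hφ.comp (contDiff_id.add contDiff_const)) (hc.comp_homeomorph (Homeomorph.addRight y))
  rw [zero_add] at h
  rw [← h, ← integral_add_right_eq_self _ y]
  congr 1 with x
  rw [add_sub_cancel_right]
  simp only [lap, fderiv_comp_add_right y]
  congr 1
  refine Finset.sum_congr rfl fun i _ => ?_
  rw [← fderiv_comp_add_right (f := fun z => fderiv ℝ φ z (coordVec i)) y]

end

section

variable {n : ℕ}

/-! ### Graph coordinates -/

/-- An orthogonal splitting of `ℝ^(n+1)` into a hyperplane, parametrized by `ℝ^n`, and the line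
spanned by the unit vector `ν`. -/
structure Frame (n : ℕ) where
  ι : E n →ₗᵢ[ℝ] E (n + 1)
  ν : E (n + 1)
  π : E (n + 1) →L[ℝ] E n
  norm_ν : ‖ν‖ = 1
  orth : ∀ y, inner ℝ ν (ι y) = 0
  decomp : ∀ x, ι (π x) + inner ℝ ν x • ν = x

namespace Frame

variable (B : Frame n)

theorem inner_ν_ν : inner ℝ B.ν B.ν = (1 : ℝ) := by
  rw [real_inner_self_eq_norm_sq, B.norm_ν, one_pow]

theorem inner_ν_mk (y : E n) (s : ℝ) : inner ℝ B.ν (B.ι y + s • B.ν) = s := by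
  rw [inner_add_right, B.orth, inner_smul_right, B.inner_ν_ν]; simp

theorem π_mk (y : E n) (s : ℝ) : B.π (B.ι y + s • B.ν) = y := by
  have := B.decomp (B.ι y + s • B.ν)
  rw [B.inner_ν_mk] at this
  exact B.ι.injective (add_right_cancel this)

theorem norm_mk_sq (y : E n) (s : ℝ) : ‖B.ι y + s • B.ν‖ ^ 2 = ‖y‖ ^ 2 + s ^ 2 := by
  rw [norm_add_sq_real, inner_smul_right, real_inner_comm, B.orth, norm_smul, B.norm_ν,
    B.ι.norm_map]
  simp

theorem norm_π_le (x : E (n + 1)) : ‖B.π x‖ ≤ ‖x‖ := by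
  have := B.norm_mk_sq (B.π x) (inner ℝ B.ν x)
  rw [B.decomp] at this
  nlinarith [sq_nonneg (inner ℝ B.ν x : ℝ), norm_nonneg x, norm_nonneg (B.π x)]

theorem abs_inner_ν_le (x : E (n + 1)) : |inner ℝ B.ν x| ≤ ‖x‖ := by
  simpa [B.norm_ν] using abs_real_inner_le_norm B.ν x

theorem measurePreserving_mk :
    MeasurePreserving (fun p : E n × ℝ => B.ι p.1 + p.2 • B.ν) := by
  let e : WithLp 2 (E n × ℝ) ≃ₗᵢ[ℝ] E (n + 1) :=
    { toFun := fun p => B.ι p.fst + p.snd • B.ν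
      invFun := fun x => WithLp.toLp 2 (B.π x, inner ℝ B.ν x)
      map_add' := fun p q => by simp only [WithLp.add_fst, WithLp.add_snd, map_add, add_smul]; abel
      map_smul' := fun c p => by simp [smul_smul]
      left_inv := fun p => by
        change WithLp.toLp 2 (B.π (B.ι p.fst + p.snd • B.ν), _) = p
        rw [B.π_mk, B.inner_ν_mk]; rfl
      right_inv := fun x => B.decomp x
      norm_map' := fun p => by
        change ‖B.ι p.fst + p.snd • B.ν‖ = ‖p‖
        rw [← sq_eq_sq₀ (norm_nonneg _) (norm_nonneg _), B.norm_mk_sq,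
          WithLp.prod_norm_sq_eq_of_L2]
        simp }
  exact e.measurePreserving.comp (WithLp.volume_preserving_toLp (E n) ℝ)

/-- Fubini in base point and height above the graph. On each vertical line the change of variable is
a translation, so nothing is asked of `F`. -/
theorem lintegral_eq {g : E (n + 1) → ℝ≥0∞} (hg : Measurable g) (F : E n → ℝ) :
    ∫⁻ x, g x = ∫⁻ y, ∫⁻ t : ℝ, g (B.ι y + F y • B.ν + t • B.ν) := by
  have hι : Measurable B.ι := B.ι.continuous.measurable
  rw [← B.measurePreserving_mk.lintegral_comp hg, Measure.volume_eq_prod,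
    lintegral_prod (fun p : E n × ℝ => g (B.ι p.1 + p.2 • B.ν))
      (hg.comp B.measurePreserving_mk.measurable).aemeasurable]
  congr 1 with y
  rw [← lintegral_add_left_eq_self _ (F y)]
  simp_rw [add_smul, add_assoc]

/-- The parametrization of the graph of `F`. -/
def graph (F : E n → ℝ) (y : E n) : E (n + 1) := B.ι y + F y • B.ν

theorem π_graph (F : E n → ℝ) (y : E n) : B.π (B.graph F y) = y := B.π_mk _ _

theorem inner_ν_graph (F : E n → ℝ) (y : E n) : inner ℝ B.ν (B.graph F y) = F y := B.inner_ν_mk _ _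

theorem graph_sub (F : E n → ℝ) (y z : E n) :
    B.graph F y - B.graph F z = B.ι (y - z) + (F y - F z) • B.ν := by
  simp only [graph, map_sub, sub_smul]; abel

theorem norm_sub_le_graph (F : E n → ℝ) (y z : E n) : ‖y - z‖ ≤ ‖B.graph F y - B.graph F z‖ := by
  have := B.norm_π_le (B.graph F y - B.graph F z)
  rwa [map_sub, B.π_graph, B.π_graph] at this

theorem continuous_graph {F : E n → ℝ} (hF : Continuous F) : Continuous (B.graph F) :=
  B.ι.continuous.add (hF.smul continuous_const)

theorem measurableEmbedding_graph {F : E n → ℝ} (hF : Continuous F) :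
    MeasurableEmbedding (B.graph F) :=
  (B.continuous_graph hF).measurableEmbedding fun y z h => by
    rw [← B.π_graph F y, h, B.π_graph]

end Frame

/-- The isometry `e` transports a function on the hyperplane orthogonal to `ν`, as in
`IsLocallyC11Graph`, to a function on `E n`. -/
theorem exists_frame {ν : E (n + 1)} (hν : ‖ν‖ = 1) : ∃ B : Frame n, B.ν = ν ∧
    ∃ e : E n →ₗᵢ[ℝ] (ℝ ∙ ν)ᗮ, ∀ x, e (B.π x) = (ℝ ∙ ν)ᗮ.orthogonalProjectionOnto x := by
  have hν0 : ν ≠ 0 := fun h => by simp [h] at hν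
  have : Fact (Module.finrank ℝ (E (n + 1)) = n + 1) := ⟨by simp⟩
  let b := OrthonormalBasis.fromOrthogonalSpanSingleton (𝕜 := ℝ) n hν0
  let e : E n ≃ₗᵢ[ℝ] (ℝ ∙ ν)ᗮ := b.repr.symm
  refine ⟨⟨(ℝ ∙ ν)ᗮ.subtypeₗᵢ.comp e.toLinearIsometry, ν,
    (e.symm.toContinuousLinearEquiv : _ →L[ℝ] E n).comp (ℝ ∙ ν)ᗮ.orthogonalProjectionOnto, hν,
    fun y => ?_, fun x => ?_⟩, rfl, e.toLinearIsometry, fun x => ?_⟩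
  · exact Submodule.mem_orthogonal_singleton_iff_inner_right.1 (e y).2
  · have := Submodule.starProjection_add_starProjection_orthogonal (K := ℝ ∙ ν) x
    rw [Submodule.starProjection_singleton, hν] at this
    simp only [one_pow, RCLike.ofReal_one, div_one] at this
    refine (add_comm _ _).trans ?_
    simpa using this
  · simp

/-! ### Hausdorff measure of graphs -/

theorem euclideanHausdorffMeasure_image_le {X Y : Type*} [EMetricSpace X] [EMetricSpace Y]
    [MeasurableSpace X] [BorelSpace X] [MeasurableSpace Y] [BorelSpace Y] {K : ℝ≥0} {f : X → Y}
    {s : Set X} (h : LipschitzOnWith K f s) (m : ℕ) :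
    Measure.euclideanHausdorffMeasure m (f '' s) ≤
      (K : ℝ≥0∞) ^ m * Measure.euclideanHausdorffMeasure m s := by
  simp only [Measure.euclideanHausdorffMeasure_def, Measure.smul_apply]
  have := h.hausdorffMeasure_image_le (Nat.cast_nonneg (α := ℝ) m)
  rw [ENNReal.smul_def, ENNReal.smul_def, smul_eq_mul, smul_eq_mul, mul_left_comm]
  gcongr
  simpa using this

namespace Frame

variable (B : Frame n) {F : E n → ℝ}

/-- The projection `π` is 1-Lipschitz. Together with the Lipschitz bound for the graph map, this
compares surface and Lebesgue measure, which replaces the exact area density in all size estimates.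
-/
theorem volume_le_graph (A : Set (E n)) :
    volume A ≤ Measure.euclideanHausdorffMeasure n (B.graph F '' A) := by
  have h : LipschitzOnWith 1 B.π (B.graph F '' A) := LipschitzWith.lipschitzOnWith
    (LipschitzWith.of_dist_le_mul fun x y => by
      simpa [dist_eq_norm, ← map_sub] using B.norm_π_le (x - y))
  have := euclideanHausdorffMeasure_image_le h n
  rw [← image_comp, EuclideanSpace.euclideanHausdorffMeasure_eq_volume] at this
  simpa [π_graph] using this

theorem graph_le_volume {L : ℝ≥0} {A : Set (E n)} (h : LipschitzOnWith L (B.graph F) A) :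
    Measure.euclideanHausdorffMeasure n (B.graph F '' A) ≤ (L : ℝ≥0∞) ^ n * volume A := by
  have := euclideanHausdorffMeasure_image_le h n
  rwa [EuclideanSpace.euclideanHausdorffMeasure_eq_volume] at this

/-- Seen on the graph, the shift by `h` is Lipschitz with constant `1 + K‖h‖`, because the gradient
of `F (· + h) - F` is at most `K‖h‖`. This plays the role of differentiating the area density and is
the point where a Lipschitz derivative of `F` is needed. -/
theorem graph_shift_le (hF : Differentiable ℝ F) {K : ℝ≥0} (hK : LipschitzWith K (fderiv ℝ F))
    (A : Set (E n)) (h : E n) :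
    Measure.euclideanHausdorffMeasure n (B.graph F '' ((fun y => y + h) '' A)) ≤
      ((1 + K * ‖h‖₊ : ℝ≥0) : ℝ≥0∞) ^ n *
        Measure.euclideanHausdorffMeasure n (B.graph F '' A) := by
  have e : B.graph F '' ((fun y => y + h) '' A) =
      (fun x => B.graph F (B.π x + h)) '' (B.graph F '' A) := by
    rw [image_image, image_image]
    simp only [B.π_graph]
  rw [e]
  refine euclideanHausdorffMeasure_image_le (LipschitzOnWith.of_dist_le_mul ?_) n
  rintro _ ⟨y, -, rfl⟩ _ ⟨z, -, rfl⟩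
  rw [B.π_graph, B.π_graph, dist_eq_norm, dist_eq_norm]
  have hG : LipschitzWith (K * ‖h‖₊) fun y => F (y + h) - F y := by
    refine lipschitzWith_of_nnnorm_fderiv_le (𝕜 := ℝ)
      ((hF.comp (differentiable_id.add_const h)).sub hF) fun y => ?_
    have hd : DifferentiableAt ℝ (fun y => F (y + h)) y :=
      (hF.comp (differentiable_id.add_const h)) y
    rw [fderiv_fun_sub hd (hF y), fderiv_comp_add_right]
    have := hK.dist_le_mul (y + h) y
    rw [dist_eq_norm, dist_eq_norm, add_sub_cancel_left] at this
    exact_mod_cast this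
  have h1 : B.graph F (y + h) - B.graph F (z + h) = (B.graph F y - B.graph F z) +
      ((F (y + h) - F y) - (F (z + h) - F z)) • B.ν := by
    rw [graph_sub, graph_sub, add_sub_add_right_eq_sub, add_assoc, ← add_smul]
    congr 3; ring
  have h2 := hG.dist_le_mul y z
  rw [Real.dist_eq, dist_eq_norm] at h2
  push_cast at h2 ⊢
  calc _ ≤ ‖B.graph F y - B.graph F z‖ + K * ‖h‖ * ‖y - z‖ := by
        rw [h1]
        refine (norm_add_le _ _).trans (add_le_add le_rfl ?_)
        rwa [norm_smul, B.norm_ν, mul_one, Real.norm_eq_abs]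
    _ ≤ _ := by
        have := mul_le_mul_of_nonneg_left (B.norm_sub_le_graph F y z)
          (by positivity : (0 : ℝ) ≤ K * ‖h‖)
        linarith

end Frame

end

/-! ### Cylindrical charts of a `C^{1,1}` hypersurface -/

section

variable {n : ℕ}

/-- A cylindrical neighbourhood in which `Γ` is the graph of the `C^{1,1}` function `F`. -/
structure GraphChart (Γ : Set (E (n + 1))) extends Frame n where
  F : E n → ℝ
  isC11 : IsC11 F
  c : E n
  ρ : ℝ
  τ : ℝ
  r₀ : ℝ
  L : ℝ≥0
  ρ_pos : 0 < ρ
  τ_pos : 0 < τ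
  r₀_pos : 0 < r₀
  lip : LipschitzOnWith L (toFrame.graph F) (Metric.ball c (3 * ρ))
  mem : ∀ y ∈ Metric.ball c (3 * ρ), toFrame.graph F y ∈ Γ
  -- Seen from the cylinder, a point of `Γ` either lies on the graph over the ball of radius `2ρ` or
  -- is at distance at least `r₀`, where kernels are bounded. The graph is controlled up to radius
  -- `3ρ`, which leaves room for cutoffs.
  sep : ∀ x, π x ∈ Metric.ball c ρ → |inner ℝ ν x - F (π x)| < τ → ∀ z ∈ Γ,
    (z = toFrame.graph F (π z) ∧ π z ∈ Metric.ball c (2 * ρ)) ∨ r₀ ≤ ‖x - z‖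

namespace GraphChart

variable {Γ : Set (E (n + 1))} (χ : GraphChart Γ)

/-- The parametrization of the surface. -/
abbrev Φ : E n → E (n + 1) := χ.toFrame.graph χ.F

/-- The height above the surface. -/
def height (x : E (n + 1)) : ℝ := inner ℝ χ.ν x - χ.F (χ.π x)

/-- The cylinder. -/
def cyl : Set (E (n + 1)) := {x | χ.π x ∈ Metric.ball χ.c χ.ρ ∧ |χ.height x| < χ.τ}

theorem continuous_F : Continuous χ.F := χ.isC11.1.continuous

theorem differentiable_F : Differentiable ℝ χ.F := χ.isC11.1.differentiable (by simp)

theorem continuous_Φ : Continuous χ.Φ := χ.continuous_graph χ.continuous_F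

theorem continuous_height : Continuous χ.height := by
  have := χ.continuous_F
  unfold height
  fun_prop

theorem isOpen_cyl : IsOpen χ.cyl := by
  have h1 : Continuous χ.π := χ.π.continuous
  exact (Metric.isOpen_ball.preimage h1).inter
    (isOpen_lt (χ.continuous_height.abs) continuous_const)

theorem Φ_add_height (x : E (n + 1)) : χ.Φ (χ.π x) + χ.height x • χ.ν = x := by
  conv_rhs => rw [← χ.decomp x]
  simp only [Frame.graph, height, sub_smul]
  abel

theorem Φ_add_smul (y : E n) (t : ℝ) : χ.Φ y + t • χ.ν = χ.ι y + (χ.F y + t) • χ.ν := by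
  simp only [Frame.graph, add_smul, add_assoc]

theorem height_mk (y : E n) (t : ℝ) : χ.height (χ.Φ y + t • χ.ν) = t := by
  rw [height, Φ_add_smul, χ.inner_ν_mk, χ.π_mk]
  ring

theorem π_mk' (y : E n) (t : ℝ) : χ.π (χ.Φ y + t • χ.ν) = y := by
  rw [Φ_add_smul, χ.π_mk]

theorem ball_subset {a b : ℝ} (h : a ≤ b) : Metric.ball χ.c (a * χ.ρ) ⊆ Metric.ball χ.c (b * χ.ρ) :=
  Metric.ball_subset_ball (mul_le_mul_of_nonneg_right h χ.ρ_pos.le)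

/-- On the graph this is the Lipschitz bound; for the other points `sep` gives distance at least
`r₀` while the height is below `τ`. -/
theorem exists_height_le : ∃ C : ℝ, 0 < C ∧ ∀ x ∈ χ.cyl, ∀ z ∈ Γ, |χ.height x| ≤ C * ‖x - z‖ := by
  refine ⟨max (1 + χ.L) (χ.τ / χ.r₀), by positivity, fun x hx z hz => ?_⟩
  rcases χ.sep x hx.1 hx.2 z hz with ⟨h1, h2⟩ | h
  · have hx3 : χ.π x ∈ Metric.ball χ.c (3 * χ.ρ) := by
      have := χ.ball_subset (show (1 : ℝ) ≤ 3 by norm_num)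
      rw [one_mul] at this
      exact this hx.1
    have h3 := χ.lip.dist_le_mul _ hx3 _ (χ.ball_subset (show (2 : ℝ) ≤ 3 by norm_num) h2)
    rw [dist_eq_norm, dist_eq_norm] at h3
    have h4 := χ.abs_inner_ν_le (χ.Φ (χ.π x) - χ.Φ (χ.π z))
    rw [inner_sub_right, χ.inner_ν_graph, χ.inner_ν_graph] at h4
    have h5 := χ.norm_π_le (x - z)
    rw [map_sub] at h5
    have h6 := χ.abs_inner_ν_le (x - z)
    have h7 : inner ℝ χ.ν z = χ.F (χ.π z) := by
      conv_lhs => rw [h1]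
      exact χ.inner_ν_graph _ _
    rw [inner_sub_right, h7] at h6
    have h8 : |χ.height x| ≤ ‖x - z‖ + χ.L * ‖x - z‖ := by
      have : χ.height x = (inner ℝ χ.ν x - χ.F (χ.π z)) - (χ.F (χ.π x) - χ.F (χ.π z)) := by
        rw [height]; ring
      rw [this]
      refine (abs_sub _ _).trans (add_le_add h6 (h4.trans (h3.trans ?_)))
      gcongr
    calc _ ≤ (1 + χ.L) * ‖x - z‖ := by linarith
      _ ≤ _ := by gcongr; exact le_max_left _ _
  · calc _ ≤ χ.τ := hx.2.le
      _ = χ.τ / χ.r₀ * χ.r₀ := by field_simp [χ.r₀_pos.ne']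
      _ ≤ χ.τ / χ.r₀ * ‖x - z‖ := by have := χ.τ_pos; have := χ.r₀_pos; gcongr
      _ ≤ _ := by gcongr; exact le_max_right _ _

theorem eq_Φ_of_mem {z : E (n + 1)} (hz : z ∈ Γ) (hc : z ∈ χ.cyl) : z = χ.Φ (χ.π z) := by
  rcases χ.sep z hc.1 hc.2 z hz with h | h
  · exact h.1
  · simp only [sub_self, norm_zero] at h
    exact absurd χ.r₀_pos h.not_gt

end GraphChart

theorem IsC11.comp_linearIsometry {X Y : Type*} [NormedAddCommGroup X] [NormedSpace ℝ X]
    [NormedAddCommGroup Y] [NormedSpace ℝ Y] {F : X → ℝ} (hF : IsC11 F) (e : Y →ₗᵢ[ℝ] X) :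
    IsC11 fun y => F (e y) := by
  obtain ⟨h1, K, hK⟩ := hF
  refine ⟨h1.comp e.toContinuousLinearMap.contDiff, K, LipschitzWith.of_dist_le_mul fun y z => ?_⟩
  have hd : ∀ y, fderiv ℝ (fun y => F (e y)) y = (fderiv ℝ F (e y)).comp e.toContinuousLinearMap :=
    fun y => (((h1.differentiable (by simp)) (e y)).hasFDerivAt.comp y
      e.toContinuousLinearMap.hasFDerivAt).fderiv
  rw [hd, hd, dist_eq_norm, ← ContinuousLinearMap.sub_comp]
  refine (ContinuousLinearMap.opNorm_comp_le _ _).trans ?_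
  grw [e.norm_toContinuousLinearMap_le, mul_one]
  have := hK.dist_le_mul (e y) (e z)
  rwa [e.dist_map, dist_eq_norm] at this

theorem exists_graphChart {Γ : Set (E (n + 1))} (h : IsLocallyC11Graph Γ) {p : E (n + 1)}
    (hp : p ∈ Γ) : ∃ χ : GraphChart Γ, p ∈ χ.cyl := by
  obtain ⟨ν, hν, F₀, hF₀, hev⟩ := h p hp
  obtain ⟨B, rfl, e, he⟩ := exists_frame hν
  set F : E n → ℝ := fun y => F₀ (e y) with hFdef
  have hF : IsC11 F := hF₀.comp_linearIsometry e
  have hc := hF.1.continuous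
  simp only [← he] at hev
  obtain ⟨ε, hε, hball⟩ := Metric.eventually_nhds_iff_ball.1 hev
  have hpΦ : B.graph F (B.π p) = p := by
    conv_rhs => rw [← B.decomp p]
    rw [Frame.graph, (hball p (Metric.mem_ball_self hε)).1 hp]
  have hgr : ContDiffAt ℝ 1 (B.graph F) (B.π p) :=
    (B.ι.toContinuousLinearMap.contDiff.add (hF.1.smul contDiff_const)).contDiffAt
  obtain ⟨L, t, ht, hL⟩ := hgr.exists_lipschitzOnWith
  have hnear : B.graph F ⁻¹' Metric.ball p (ε / 2) ∈ 𝓝 (B.π p) :=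
    (B.continuous_graph hc).continuousAt.preimage_mem_nhds
      (by rw [hpΦ]; exact Metric.ball_mem_nhds _ (by positivity))
  obtain ⟨r, hr, hrsub⟩ := Metric.mem_nhds_iff.1 (inter_mem ht hnear)
  have hr3 : 3 * (r / 3) = r := by ring
  -- Over the ball of radius `r` the graph stays within `ε / 2` of `p`, so with height below `ε / 4`
  -- the cylinder stays within `3ε / 4`. A point of `Γ` closer than `ε / 4` to it is then in the
  -- ball of radius `ε` where the graph description holds, and closeness `r / 3` moves its
  -- projection by at most one radius of the chart.
  refine ⟨⟨B, F, hF, B.π p, r / 3, ε / 4, min (ε / 4) (r / 3), L, by positivity, by positivity,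
    by positivity, ?_, ?_, ?_⟩, ?_, ?_⟩
  · rw [hr3]
    exact hL.mono fun y hy => (hrsub hy).1
  · rw [hr3]
    intro y hy
    refine (hball _ (Metric.ball_subset_ball (by linarith) (hrsub hy).2)).2 ?_
    rw [B.inner_ν_graph, B.π_graph]
  · intro x hx1 hx2 z hz
    by_contra! hcon
    obtain ⟨h1, h2⟩ := hcon
    rw [lt_min_iff] at h2
    have hxp : ‖x - p‖ < 3 * ε / 4 := by
      have e1 : x - p = (B.graph F (B.π x) - p) + (inner ℝ B.ν x - F (B.π x)) • B.ν := by
        conv_lhs => rw [← B.decomp x]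
        simp only [Frame.graph, sub_smul]
        abel
      have e2 : ‖B.graph F (B.π x) - p‖ < ε / 2 := by
        have := (hrsub (Metric.ball_subset_ball (by linarith) hx1)).2
        simpa [dist_eq_norm] using this
      rw [e1]
      refine (norm_add_le _ _).trans_lt ?_
      rw [norm_smul, B.norm_ν, mul_one, Real.norm_eq_abs]
      linarith
    have hzp : z ∈ Metric.ball p ε := by
      rw [Metric.mem_ball, dist_eq_norm]
      calc ‖z - p‖ = ‖(x - p) - (x - z)‖ := by congr 1; abel
        _ ≤ ‖x - p‖ + ‖x - z‖ := norm_sub_le _ _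
        _ < ε := by linarith
    have hz1 : z = B.graph F (B.π z) := by
      conv_lhs => rw [← B.decomp z]
      rw [Frame.graph, (hball z hzp).1 hz]
    refine h1 hz1 ?_
    rw [Metric.mem_ball] at hx1 ⊢
    have h3 := B.norm_π_le (x - z)
    rw [map_sub, ← dist_eq_norm, dist_comm] at h3
    have := dist_triangle (B.π z) (B.π x) (B.π p)
    linarith
  · simp only [Metric.mem_ball, dist_self]
    positivity
  · change |inner ℝ B.ν p - F (B.π p)| < ε / 4
    rw [(hball p (Metric.mem_ball_self hε)).1 hp]
    simp [hFdef, hε]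

end

section

variable {n : ℕ}

/-! ### Surface measure in graph coordinates -/

/-- The `n`-dimensional Hausdorff measure on `Γ`. -/
def surf (Γ : Set (E (n + 1))) : Measure (E (n + 1)) :=
  (Measure.euclideanHausdorffMeasure n).restrict Γ

namespace GraphChart

variable {Γ : Set (E (n + 1))} (χ : GraphChart Γ)

theorem measurableEmbedding_Φ : MeasurableEmbedding χ.Φ :=
  χ.measurableEmbedding_graph χ.continuous_F

theorem image_subset {A : Set (E n)} (hA : A ⊆ Metric.ball χ.c (3 * χ.ρ)) : χ.Φ '' A ⊆ Γ := by
  rintro _ ⟨y, hy, rfl⟩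
  exact χ.mem y (hA hy)

theorem setLIntegral_Φ_le {A : Set (E n)} (hA : A ⊆ Metric.ball χ.c (3 * χ.ρ))
    (g : E (n + 1) → ℝ≥0∞) :
    ∫⁻ y in A, g (χ.Φ y) ≤ ∫⁻ x, g x ∂surf Γ := by
  rw [← χ.measurableEmbedding_Φ.lintegral_map]
  refine lintegral_mono' (Measure.le_iff.2 fun S hS => ?_) le_rfl
  rw [χ.measurableEmbedding_Φ.map_apply, Measure.restrict_apply
    (χ.continuous_Φ.measurable hS), surf, Measure.restrict_apply hS]
  refine (χ.volume_le_graph (F := χ.F) _).trans (measure_mono ?_)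
  rintro _ ⟨y, hy, rfl⟩
  exact ⟨hy.1, χ.mem y (hA hy.2)⟩

theorem setLIntegral_surf_le {A : Set (E n)} (hA : A ⊆ Metric.ball χ.c (3 * χ.ρ))
    (g : E (n + 1) → ℝ≥0∞) :
    ∫⁻ x in χ.Φ '' A, g x ∂surf Γ ≤ (χ.L : ℝ≥0∞) ^ n * ∫⁻ y in A, g (χ.Φ y) := by
  rw [← χ.measurableEmbedding_Φ.lintegral_map, ← smul_eq_mul, ← lintegral_smul_measure]
  refine lintegral_mono' (Measure.le_iff.2 fun S hS => ?_) le_rfl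
  rw [Measure.smul_apply, χ.measurableEmbedding_Φ.map_apply, Measure.restrict_apply
    (χ.continuous_Φ.measurable hS), surf, Measure.restrict_apply hS]
  refine (Measure.restrict_apply_le _ _).trans ?_
  have : S ∩ χ.Φ '' A = χ.Φ '' (χ.Φ ⁻¹' S ∩ A) := (image_preimage_inter _ _ _).symm
  rw [this]
  exact χ.graph_le_volume (χ.lip.mono (inter_subset_right.trans hA))

theorem inter_cyl_subset : Γ ∩ χ.cyl ⊆ χ.Φ '' Metric.ball χ.c χ.ρ := fun z hz =>
  ⟨χ.π z, hz.2.1, (χ.eq_Φ_of_mem hz.1 hz.2).symm⟩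

theorem ball_one_subset : Metric.ball χ.c χ.ρ ⊆ Metric.ball χ.c (3 * χ.ρ) := by
  have := χ.ball_subset (show (1 : ℝ) ≤ 3 by norm_num)
  rwa [one_mul] at this

theorem setLIntegral_cyl_le (g : E (n + 1) → ℝ≥0∞) :
    ∫⁻ x in χ.cyl, g x ∂surf Γ ≤
      (χ.L : ℝ≥0∞) ^ n * ∫⁻ y in Metric.ball χ.c χ.ρ, g (χ.Φ y) := by
  refine le_trans ?_ (χ.setLIntegral_surf_le χ.ball_one_subset g)
  rw [surf, Measure.restrict_restrict χ.isOpen_cyl.measurableSet, Measure.restrict_restrict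
    (χ.measurableEmbedding_Φ.measurableSet_image.2 measurableSet_ball)]
  refine lintegral_mono_set fun x hx => ⟨?_, hx.2⟩
  exact χ.inter_cyl_subset ⟨hx.2, hx.1⟩

end GraphChart

theorem exists_finite_cover {Γ : Set (E (n + 1))} (hc : IsCompact Γ) (h : IsLocallyC11Graph Γ) :
    ∃ s : Finset (GraphChart Γ), Γ ⊆ ⋃ χ ∈ s, χ.cyl := by
  classical
  choose f hf using fun p : Γ => exists_graphChart h p.2
  obtain ⟨t, ht⟩ := hc.elim_finite_subcover (fun p : Γ => (f p).cyl) (fun p => (f p).isOpen_cyl)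
    fun p hp => mem_iUnion.2 ⟨⟨p, hp⟩, hf _⟩
  refine ⟨t.image f, fun x hx => ?_⟩
  obtain ⟨p, hp, hx'⟩ := mem_iUnion₂.1 (ht hx)
  exact mem_iUnion₂.2 ⟨f p, Finset.mem_image_of_mem f hp, hx'⟩

section Cover

variable {Γ : Set (E (n + 1))} {s : Finset (GraphChart Γ)}

theorem setLIntegral_biUnion_finset_le {α β : Type*} [MeasurableSpace α] (μ : Measure α)
    (s : Finset β) (t : β → Set α) (g : α → ℝ≥0∞) :
    ∫⁻ x in ⋃ i ∈ s, t i, g x ∂μ ≤ ∑ i ∈ s, ∫⁻ x in t i, g x ∂μ := by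
  classical
  induction s using Finset.induction_on with
  | empty => simp
  | insert a s ha ih =>
    rw [Finset.set_biUnion_insert, Finset.sum_insert ha]
    exact (lintegral_union_le _ _ _).trans (add_le_add le_rfl ih)

theorem lintegral_surf_le_sum (hs : Γ ⊆ ⋃ χ ∈ s, χ.cyl) (g : E (n + 1) → ℝ≥0∞) :
    ∫⁻ x, g x ∂surf Γ ≤ ∑ χ ∈ s, ∫⁻ x in χ.cyl, g x ∂surf Γ := by
  refine le_trans (le_of_eq ?_) (setLIntegral_biUnion_finset_le _ _ _ _)
  have hm : MeasurableSet (⋃ χ ∈ s, χ.cyl) :=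
    (isOpen_biUnion fun χ (_ : χ ∈ s) => χ.isOpen_cyl).measurableSet
  rw [surf, Measure.restrict_restrict hm, inter_eq_right.2 hs]

/-- In a chart, the graph points within `r` of `x` have parameters within `r` of `π x`. The centre
`x` is arbitrary, not only on `Γ`, as potentials are evaluated off the surface. -/
theorem exists_growth (hc : IsCompact Γ) (h : IsLocallyC11Graph Γ) :
    ∃ A : ℝ≥0, ∀ x, ∀ r > 0, surf Γ {y | ‖x - y‖ < r} ≤ A * ENNReal.ofReal (r ^ n) := by
  obtain ⟨s, hs⟩ := exists_finite_cover hc h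
  refine ⟨∑ χ ∈ s, χ.L ^ n * (volume (Metric.ball (0 : E n) 1)).toNNReal, fun x r hr => ?_⟩
  have hm : MeasurableSet {y | ‖x - y‖ < r} := measurableSet_lt (by fun_prop) measurable_const
  rw [← lintegral_indicator_one hm]
  grw [lintegral_surf_le_sum hs]
  push_cast
  rw [Finset.sum_mul]
  refine Finset.sum_le_sum fun χ _ => ?_
  grw [χ.setLIntegral_cyl_le]
  rw [mul_assoc]
  gcongr
  rw [ENNReal.coe_toNNReal measure_ball_lt_top.ne, mul_comm]
  have hb : volume (Metric.ball (χ.π x) r) =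
      ENNReal.ofReal (r ^ n) * volume (Metric.ball (0 : E n) 1) := by
    rw [Measure.addHaar_ball_of_pos _ _ hr]; simp
  rw [← hb]
  refine (setLIntegral_le_lintegral _ _).trans ?_
  rw [← lintegral_indicator_one measurableSet_ball]
  refine lintegral_mono fun y => ?_
  by_cases hy : χ.Φ y ∈ {y | ‖x - y‖ < r}
  · have h1 := χ.norm_π_le (x - χ.Φ y)
    rw [map_sub, χ.π_graph] at h1
    have h2 : y ∈ Metric.ball (χ.π x) r := by
      rw [Metric.mem_ball, dist_comm, dist_eq_norm]
      exact h1.trans_lt hy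
    rw [indicator_of_mem hy, indicator_of_mem h2]
    rfl
  · rw [indicator_of_notMem hy]
    exact zero_le

theorem surf_lt_top (hc : IsCompact Γ) (h : IsLocallyC11Graph Γ) : surf Γ univ < ⊤ := by
  obtain ⟨s, hs⟩ := exists_finite_cover hc h
  rw [← lintegral_one]
  refine (lintegral_surf_le_sum hs _).trans_lt ?_
  refine ENNReal.sum_lt_top.2 fun χ _ => (χ.setLIntegral_cyl_le _).trans_lt ?_
  rw [setLIntegral_one]
  exact ENNReal.mul_lt_top (ENNReal.pow_lt_top ENNReal.coe_lt_top) measure_ball_lt_top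

/-- The cylinders contain a uniform neighbourhood of `Γ`, so outside them the Hessian kernel is
bounded. -/
theorem exists_dist_ge (hc : IsCompact Γ) (hs : Γ ⊆ ⋃ χ ∈ s, χ.cyl) :
    ∃ δ > 0, ∀ x, (∀ χ ∈ s, x ∉ χ.cyl) → ∀ z ∈ Γ, δ ≤ ‖x - z‖ := by
  obtain ⟨δ, hδ, hsub⟩ := hc.exists_thickening_subset_open
    (isOpen_biUnion fun χ (_ : χ ∈ s) => χ.isOpen_cyl) hs
  refine ⟨δ, hδ, fun x hx z hz => ?_⟩
  by_contra! hlt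
  have : x ∈ ⋃ χ ∈ s, χ.cyl := hsub (Metric.mem_thickening_iff.2 ⟨z, hz, by rwa [dist_eq_norm]⟩)
  simp only [mem_iUnion] at this
  obtain ⟨χ, h1, h2⟩ := this
  exact hx χ h1 h2

end Cover

end

section

variable {n : ℕ}

/-! ### Almost invariance of the surface measure under tangential shifts -/

/-- Makes the distortion `(1 + K‖h‖) ^ n` of Hausdorff measure linear in the size of the shift, as
difference quotients require. -/
theorem exists_pow_one_add_le (m : ℕ) {x : ℝ} (hx : 0 ≤ x) :
    ∃ M, 0 ≤ M ∧ ∀ s ∈ Icc (0 : ℝ) 1, (1 + s * x) ^ m ≤ 1 + s * M := by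
  induction m with
  | zero => exact ⟨0, le_rfl, fun s _ => by simp⟩
  | succ m ih =>
    obtain ⟨M, hM, h⟩ := ih
    refine ⟨M + x + M * x, by positivity, fun s hs => ?_⟩
    have h0 := hs.1
    have h1 := hs.2
    calc (1 + s * x) ^ (m + 1) = (1 + s * x) ^ m * (1 + s * x) := pow_succ _ _
      _ ≤ (1 + s * M) * (1 + s * x) := by gcongr; exact h s hs
      _ = 1 + s * (M + x + s * (M * x)) := by ring
      _ ≤ 1 + s * (M + x + 1 * (M * x)) := by gcongr
      _ = _ := by ring

theorem integral_shift_le {μ : Measure (E n)} {h : E n} {c : ℝ} (hc : 0 ≤ c)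
    (h1 : ∀ g : E n → ℝ≥0∞, Measurable g → ∫⁻ y, g (y + h) ∂μ ≤ ENNReal.ofReal c * ∫⁻ y, g y ∂μ)
    {g : E n → ℝ} (hg : Measurable g) (hi : Integrable g μ) (h0 : ∀ y, 0 ≤ g y) :
    Integrable (fun y => g (y + h)) μ ∧ ∫ y, g (y + h) ∂μ ≤ c * ∫ y, g y ∂μ := by
  have hm : Measurable fun y => g (y + h) := hg.comp (measurable_add_const h)
  have e1 := ofReal_integral_eq_lintegral_ofReal hi (.of_forall h0)
  have k := h1 (fun y => ENNReal.ofReal (g y)) hg.ennreal_ofReal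
  rw [← e1, ← ENNReal.ofReal_mul hc] at k
  have hi' : Integrable (fun y => g (y + h)) μ := by
    refine ⟨hm.aestronglyMeasurable, ?_⟩
    rw [hasFiniteIntegral_iff_ofReal (.of_forall fun y => h0 _)]
    exact k.trans_lt ENNReal.ofReal_lt_top
  refine ⟨hi', ?_⟩
  rw [← ofReal_integral_eq_lintegral_ofReal hi' (.of_forall fun y => h0 _)] at k
  exact (ENNReal.ofReal_le_ofReal_iff (mul_nonneg hc (integral_nonneg h0))).1 k

/-- With `I` the integral and `J` the shifted one, the two hypotheses give `J ≤ c I` and, shifting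
back, `I ≤ c J`. Hence `I - J ≤ (c - 1) J ≤ c (c - 1) I`. -/
theorem abs_integral_shift_sub_le_of_nonneg {μ : Measure (E n)} {h : E n} {c : ℝ} (hc : 1 ≤ c)
    (h1 : ∀ g : E n → ℝ≥0∞, Measurable g → ∫⁻ y, g (y + h) ∂μ ≤ ENNReal.ofReal c * ∫⁻ y, g y ∂μ)
    (h2 : ∀ g : E n → ℝ≥0∞, Measurable g → ∫⁻ y, g (y - h) ∂μ ≤ ENNReal.ofReal c * ∫⁻ y, g y ∂μ)
    {q : E n → ℝ} (hq : Measurable q) (hi : Integrable q μ) (h0 : ∀ y, 0 ≤ q y) :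
    |∫ y, q (y + h) ∂μ - ∫ y, q y ∂μ| ≤ c * (c - 1) * ∫ y, q y ∂μ := by
  have hc0 : 0 ≤ c := by linarith
  obtain ⟨i1, k1⟩ := integral_shift_le hc0 h1 hq hi h0
  have k2 := (integral_shift_le (h := -h) hc0 (by simpa only [← sub_eq_add_neg] using h2)
    (hq.comp (measurable_add_const h)) i1 fun y => h0 _).2
  simp only [Function.comp_def, neg_add_cancel_right] at k2
  set I := ∫ y, q y ∂μ
  set J := ∫ y, q (y + h) ∂μ
  have n1 : 0 ≤ I := integral_nonneg h0
  have h3 : 0 ≤ c - 1 := by linarith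
  have h4 := mul_nonneg (mul_nonneg h3 h3) n1
  have h5 := mul_le_mul_of_nonneg_left k1 h3
  rw [abs_le]
  constructor <;> nlinarith

theorem abs_integral_shift_sub_le {μ : Measure (E n)}
    [IsFiniteMeasureOnCompacts μ] {h : E n} {c : ℝ} (hc : 1 ≤ c)
    (h1 : ∀ g : E n → ℝ≥0∞, Measurable g → ∫⁻ y, g (y + h) ∂μ ≤ ENNReal.ofReal c * ∫⁻ y, g y ∂μ)
    (h2 : ∀ g : E n → ℝ≥0∞, Measurable g → ∫⁻ y, g (y - h) ∂μ ≤ ENNReal.ofReal c * ∫⁻ y, g y ∂μ)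
    {q : E n → ℝ} (hq : Continuous q) (hs : HasCompactSupport q) :
    |∫ y, q (y + h) ∂μ - ∫ y, q y ∂μ| ≤ c * (c - 1) * ∫ y, |q y| ∂μ := by
  have hc0 : 0 ≤ c := by linarith
  have iq := hq.integrable_of_hasCompactSupport (μ := μ) hs
  set p : E n → ℝ := fun y => max (q y) 0 with hp
  set m : E n → ℝ := fun y => max (-q y) 0 with hm
  have ip : Integrable p μ := iq.pos_part
  have im : Integrable m μ := iq.neg_part
  have p0 : ∀ y, 0 ≤ p y := fun y => le_max_right _ _
  have m0 : ∀ y, 0 ≤ m y := fun y => le_max_right _ _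
  have mp : Measurable p := hq.measurable.max measurable_const
  have mm : Measurable m := hq.measurable.neg.max measurable_const
  have p1 := abs_integral_shift_sub_le_of_nonneg hc h1 h2 mp ip p0
  have p2 := abs_integral_shift_sub_le_of_nonneg hc h1 h2 mm im m0
  have ip' := (integral_shift_le hc0 h1 mp ip p0).1
  have im' := (integral_shift_le hc0 h1 mm im m0).1
  have d1 : ∀ y, q y = p y - m y := fun y => by
    rcases le_total (q y) 0 with h | h <;> simp [hp, hm, h]
  have d2 : ∀ y, |q y| = p y + m y := fun y => by
    rcases le_total (q y) 0 with h | h <;> simp [hp, hm, h, abs_of_nonneg, abs_of_nonpos]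
  simp only [d2]
  simp only [d1]
  rw [integral_sub ip im, integral_sub ip' im', integral_add ip im, mul_add]
  calc _ = |(∫ y, p (y + h) ∂μ - ∫ y, p y ∂μ) - (∫ y, m (y + h) ∂μ - ∫ y, m y ∂μ)| := by
        congr 1; ring
    _ ≤ _ := (abs_sub _ _).trans (add_le_add p1 p2)

namespace GraphChart

variable {Γ : Set (E (n + 1))} (χ : GraphChart Γ)

/-- The Hausdorff measure on the graph, in the parameter domain. -/
def param : Measure (E n) := (Measure.euclideanHausdorffMeasure n).comap χ.Φ

theorem param_apply (A : Set (E n)) :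
    χ.param A = Measure.euclideanHausdorffMeasure n (χ.Φ '' A) :=
  χ.measurableEmbedding_Φ.comap_apply _ _

/-- Relies on local Lipschitz bounds from the `C¹` regularity of `F` everywhere; the bound `lip`
holds only over the chart ball, whereas `param` lives on all of `E n`. -/
instance : IsLocallyFiniteMeasure χ.param := ⟨fun y => by
  have hgr : ContDiffAt ℝ 1 χ.Φ y :=
    (χ.ι.toContinuousLinearMap.contDiff.add (χ.isC11.1.smul contDiff_const)).contDiffAt
  obtain ⟨L, t, ht, hL⟩ := hgr.exists_lipschitzOnWith
  obtain ⟨r, hr, hsub⟩ := Metric.mem_nhds_iff.1 ht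
  refine ⟨Metric.ball y r, Metric.ball_mem_nhds _ hr, ?_⟩
  rw [param_apply]
  exact (χ.graph_le_volume (hL.mono hsub)).trans_lt
    (ENNReal.mul_lt_top (ENNReal.pow_lt_top ENNReal.coe_lt_top) measure_ball_lt_top)⟩

theorem exists_shift_const : ∃ K : ℝ, 0 ≤ K ∧ ∀ (h : E n) (g : E n → ℝ≥0∞), Measurable g →
    ∫⁻ y, g (y + h) ∂χ.param ≤ ENNReal.ofReal ((1 + K * ‖h‖) ^ n) * ∫⁻ y, g y ∂χ.param := by
  obtain ⟨h1, K, hK⟩ := χ.isC11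
  refine ⟨K, K.2, fun h g hg => ?_⟩
  have hm : Measurable fun y : E n => y + h := measurable_add_const h
  rw [← lintegral_map hg hm, ← smul_eq_mul, ← lintegral_smul_measure]
  refine lintegral_mono' (Measure.le_iff.2 fun A hA => ?_) le_rfl
  rw [Measure.map_apply hm hA, Measure.smul_apply, param_apply, param_apply, smul_eq_mul]
  have e : (fun y => y + h) ⁻¹' A = (fun y => y + -h) '' A := by
    ext y
    simp [← sub_eq_add_neg, sub_eq_iff_eq_add]
  rw [e]
  refine (χ.graph_shift_le χ.differentiable_F hK A (-h)).trans (le_of_eq ?_)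
  congr 1
  rw [ENNReal.ofReal_pow (by positivity), nnnorm_neg, ENNReal.ofReal, Real.toNNReal_of_nonneg
    (by positivity)]
  rfl

/-- Integration by parts along the graph, against a Lipschitz density. -/
theorem exists_abs_integral_deriv_le {a : E n → ℝ} {La : ℝ≥0} (ha : LipschitzWith La a) {r R : ℝ}
    (hr : r < R) (hs : ∀ y, a y ≠ 0 → y ∈ Metric.closedBall χ.c r) (v : E n) :
    ∃ C, 0 ≤ C ∧ ∀ ψ : E n → ℝ, ContDiff ℝ 1 ψ →
      |∫ y, a y * fderiv ℝ ψ y v ∂χ.param| ≤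
        C * ∫ y in Metric.closedBall χ.c R, |ψ y| ∂χ.param := by
  obtain ⟨K, hK, hshift⟩ := χ.exists_shift_const
  obtain ⟨M, hM, hpow⟩ := exists_pow_one_add_le n (mul_nonneg hK (norm_nonneg v))
  have hts : tsupport a ⊆ Metric.closedBall χ.c r :=
    closure_minimal (fun y hy => hs y hy) Metric.isClosed_closedBall
  have hac : HasCompactSupport a :=
    IsCompact.of_isClosed_subset (isCompact_closedBall _ _) (isClosed_tsupport _) hts
  obtain ⟨A, hA⟩ := ha.continuous.bounded_above_of_compact_support hac
  have hA0 : 0 ≤ A := (norm_nonneg _).trans (hA 0)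
  refine ⟨(1 + M) * M * A + La * ‖v‖ * (1 + M), by positivity, fun ψ hψ => ?_⟩
  set I := ∫ y in Metric.closedBall χ.c R, |ψ y| ∂χ.param with hI
  have hI0 : 0 ≤ I := integral_nonneg fun y => abs_nonneg _
  have hcB : MeasurableSet (Metric.closedBall χ.c R) := measurableSet_closedBall
  have hψc := hψ.continuous
  have hψi : IntegrableOn (fun y => |ψ y|) (Metric.closedBall χ.c R) χ.param :=
    hψc.abs.continuousOn.integrableOn_compact (isCompact_closedBall _ _)
  -- Discrete integration by parts. Shifting the whole product `a ψ` changes its integral by `O(s)`,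
  -- by almost invariance of `param`; the remaining difference falls on `a`, which is Lipschitz.
  -- These are the two terms of the constant.
  have quot : ∀ s : ℝ, 0 < s → s ≤ 1 → s * ‖v‖ ≤ R - r →
      |∫ y, a y * ψ (y + s • v) ∂χ.param - ∫ y, a y * ψ y ∂χ.param| ≤
        s * (((1 + M) * M * A + La * ‖v‖ * (1 + M)) * I) := by
    intro s hs0 hs1 hsR
    have hc1 : (1 : ℝ) ≤ 1 + s * M := by nlinarith [mul_nonneg hs0.le hM]
    have hle : (1 + K * ‖s • v‖) ^ n ≤ 1 + s * M := by
      rw [norm_smul, Real.norm_eq_abs, abs_of_pos hs0, mul_left_comm]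
      exact hpow s ⟨hs0.le, hs1⟩
    have h1 : ∀ g : E n → ℝ≥0∞, Measurable g → ∫⁻ y, g (y + s • v) ∂χ.param ≤
        ENNReal.ofReal (1 + s * M) * ∫⁻ y, g y ∂χ.param := fun g hg =>
      (hshift _ g hg).trans (by gcongr)
    have h2 : ∀ g : E n → ℝ≥0∞, Measurable g → ∫⁻ y, g (y - s • v) ∂χ.param ≤
        ENNReal.ofReal (1 + s * M) * ∫⁻ y, g y ∂χ.param := fun g hg => by
      have := hshift (-(s • v)) g hg
      rw [norm_neg] at this
      simp only [← sub_eq_add_neg] at this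
      exact this.trans (by gcongr)
    have b1 := abs_integral_shift_sub_le hc1 h1 h2 (ha.continuous.mul hψc) hac.mul_right
    have hq : ∫ y, |a y * ψ y| ∂χ.param ≤ A * I := by
      rw [hI, ← integral_const_mul, ← integral_indicator hcB]
      refine integral_mono_of_nonneg (.of_forall fun y => abs_nonneg _)
        ((integrable_indicator_iff hcB).2 (hψi.const_mul A)) (.of_forall fun y => ?_)
      by_cases hy : a y = 0
      · simp only [hy, zero_mul, abs_zero]
        exact indicator_nonneg (fun _ _ => by positivity) _
      · have : y ∈ Metric.closedBall χ.c R :=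
          Metric.closedBall_subset_closedBall hr.le (hs y hy)
        simp only [indicator_of_mem this, abs_mul]
        gcongr
        exact hA y
    have b1' : |∫ y, a (y + s • v) * ψ (y + s • v) ∂χ.param - ∫ y, a y * ψ y ∂χ.param| ≤
        s * ((1 + M) * M * A * I) := by
      refine b1.trans ?_
      calc (1 + s * M) * (1 + s * M - 1) * ∫ y, |a y * ψ y| ∂χ.param
          ≤ (1 + 1 * M) * (s * M) * (A * I) := by
            gcongr
            · linarith
        _ = _ := by ring
    obtain ⟨i2, b2⟩ := integral_shift_le (c := 1 + s * M) (by linarith) h1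
      (g := (Metric.closedBall χ.c R).indicator fun y => |ψ y|)
      (hψc.abs.measurable.indicator hcB) ((integrable_indicator_iff hcB).2 hψi)
      (fun y => indicator_nonneg (fun _ _ => abs_nonneg _) _)
    rw [integral_indicator hcB] at b2
    have hbd : ∀ y, |(a (y + s • v) - a y) * ψ (y + s • v)| ≤ (La * (s * ‖v‖)) *
        (Metric.closedBall χ.c R).indicator (fun y => |ψ y|) (y + s • v) := by
      intro y
      by_cases hy : y + s • v ∈ Metric.closedBall χ.c R
      · rw [indicator_of_mem hy, abs_mul]
        gcongr
        have := ha.dist_le_mul (y + s • v) y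
        rwa [dist_eq_norm, dist_eq_norm, add_sub_cancel_left, norm_smul, Real.norm_eq_abs,
          Real.norm_eq_abs, abs_of_pos hs0] at this
      · have e1 : a (y + s • v) = 0 := by
          by_contra h
          exact hy (Metric.closedBall_subset_closedBall hr.le (hs _ h))
        have e2 : a y = 0 := by
          by_contra h
          refine hy ?_
          have h3 := hs y h
          rw [Metric.mem_closedBall, dist_eq_norm] at h3 ⊢
          calc _ = ‖(y - χ.c) + s • v‖ := by congr 1; abel
            _ ≤ r + s * ‖v‖ := (norm_add_le _ _).trans (add_le_add h3 (by
                rw [norm_smul, Real.norm_eq_abs, abs_of_pos hs0]))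
            _ ≤ R := by linarith
        simp [e1, e2, indicator_of_notMem hy]
    have b3 : |∫ y, (a (y + s • v) - a y) * ψ (y + s • v) ∂χ.param| ≤
        s * (La * ‖v‖ * (1 + M) * I) := by
      calc _ ≤ ∫ y, |(a (y + s • v) - a y) * ψ (y + s • v)| ∂χ.param := abs_integral_le_integral_abs
        _ ≤ ∫ y, (La * (s * ‖v‖)) *
            (Metric.closedBall χ.c R).indicator (fun y => |ψ y|) (y + s • v) ∂χ.param :=
          integral_mono_of_nonneg (.of_forall fun y => abs_nonneg _) (i2.const_mul _)
            (.of_forall hbd)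
        _ ≤ La * (s * ‖v‖) * ((1 + 1 * M) * I) := by
          rw [integral_const_mul]
          gcongr
          exact b2.trans (by gcongr)
        _ = _ := by ring
    have hacs : HasCompactSupport fun y => a (y + s • v) :=
      hac.comp_homeomorph (Homeomorph.addRight (s • v))
    have hψs : Continuous fun y => ψ (y + s • v) := by fun_prop
    have has : Continuous fun y => a (y + s • v) := ha.continuous.comp (by fun_prop)
    have j1 : Integrable (fun y => a (y + s • v) * ψ (y + s • v)) χ.param :=
      (has.mul hψs).integrable_of_hasCompactSupport hacs.mul_right
    have j2 : Integrable (fun y => a y * ψ (y + s • v)) χ.param :=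
      (ha.continuous.mul hψs).integrable_of_hasCompactSupport hac.mul_right
    have e : ∫ y, a y * ψ (y + s • v) ∂χ.param = ∫ y, a (y + s • v) * ψ (y + s • v) ∂χ.param -
        ∫ y, (a (y + s • v) - a y) * ψ (y + s • v) ∂χ.param := by
      rw [← integral_sub j1 ((j1.sub j2).congr (.of_forall fun y => by simp [sub_mul]))]
      congr 1 with y; ring
    rw [e]
    calc _ = |(∫ y, a (y + s • v) * ψ (y + s • v) ∂χ.param - ∫ y, a y * ψ y ∂χ.param) -
          ∫ y, (a (y + s • v) - a y) * ψ (y + s • v) ∂χ.param| := by congr 1; ring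
      _ ≤ _ := (abs_sub _ _).trans (add_le_add b1' b3)
      _ = _ := by ring
  have hdψ : Continuous (fderiv ℝ ψ) := hψ.continuous_fderiv one_ne_zero
  -- A bound for the derivative of `ψ` on the region swept by shifts of size at most one; it permits
  -- differentiation under the integral at `s = 0`.
  obtain ⟨Cb, hCb⟩ := ((isCompact_closedBall χ.c r).prod
    (isCompact_Icc (a := (-1 : ℝ)) (b := 1))).exists_bound_of_continuousOn
    (f := fun p : E n × ℝ => fderiv ℝ ψ (p.1 + p.2 • v) v)
    ((hdψ.comp (by fun_prop)).clm_apply continuous_const).continuousOn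
  have j0 : Integrable (fun y => a y * ψ y) χ.param :=
    (ha.continuous.mul hψc).integrable_of_hasCompactSupport hac.mul_right
  have hder := hasDerivAt_integral_of_dominated_loc_of_deriv_le (μ := χ.param) (x₀ := (0 : ℝ))
    (s := Icc (-1) 1) (F := fun s y => a y * ψ (y + s • v))
    (F' := fun s y => a y * fderiv ℝ ψ (y + s • v) v) (bound := fun y => |a y| * Cb)
    (Icc_mem_nhds (by norm_num) (by norm_num))
    (.of_forall fun s => (ha.continuous.mul (hψc.comp (by fun_prop))).aestronglyMeasurable)
    (by simpa using j0)
    (ha.continuous.mul ((hdψ.comp (by fun_prop)).clm_apply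
      continuous_const)).aestronglyMeasurable
    (.of_forall fun y s hs' => by
      rw [norm_mul, Real.norm_eq_abs]
      by_cases hy : a y = 0
      · simp [hy]
      · gcongr
        exact hCb (y, s) ⟨hs y hy, hs'⟩)
    ((ha.continuous.integrable_of_hasCompactSupport hac).abs.mul_const _)
    (.of_forall fun y s _ => by
      have h1 : HasDerivAt (fun s : ℝ => y + s • v) v s := by
        simpa using ((hasDerivAt_id s).smul_const v).const_add y
      exact (((hψ.differentiable one_ne_zero) _).hasFDerivAt.comp_hasDerivAt s h1).const_mul _)
  have hlim := hder.2.tendsto_slope_zero_right.abs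
  simp only [zero_add, zero_smul, add_zero] at hlim
  refine le_of_tendsto hlim ?_
  have hpos : 0 < min 1 ((R - r) / (‖v‖ + 1)) := by
    have : 0 < R - r := by linarith
    positivity
  filter_upwards [Ioc_mem_nhdsGT hpos] with s hs'
  have hs1 : s ≤ 1 := hs'.2.trans (min_le_left _ _)
  have hs2 : s * ‖v‖ ≤ R - r := by
    have := hs'.2.trans (min_le_right _ _)
    rw [le_div_iff₀ (by positivity)] at this
    nlinarith [hs'.1]
  rw [smul_eq_mul, abs_mul, abs_inv, abs_of_pos hs'.1, inv_mul_le_iff₀ hs'.1]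
  exact quot s hs'.1 hs1 hs2

end GraphChart

end

section

variable {n d : ℕ}

/-! ### Algebra of the Hessian of the fundamental solution -/

theorem hessG_comm (a b x : E d) : hessG a b x = hessG b a x := by
  simp only [hessG, real_inner_comm a b]
  ring

theorem hessG_add_right (a b c x : E d) : hessG a (b + c) x = hessG a b x + hessG a c x := by
  simp only [hessG, inner_add_right]
  ring

theorem hessG_smul_right (a b x : E d) (s : ℝ) : hessG a (s • b) x = s * hessG a b x := by
  simp only [hessG, inner_smul_right]
  ring

theorem hessG_add_left (a b c x : E d) : hessG (a + b) c x = hessG a c x + hessG b c x := by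
  rw [hessG_comm, hessG_add_right, hessG_comm c, hessG_comm c]

theorem hessG_smul_left (a b x : E d) (s : ℝ) : hessG (s • a) b x = s * hessG a b x := by
  rw [hessG_comm, hessG_smul_right, hessG_comm b]

theorem hasFDerivAt_gradG_apply (a v : E d) {x : E d} (h : x ≠ 0) :
    fderiv ℝ (gradG a) x v = hessG a v x := by
  rw [(hasFDerivAt_gradG a h).fderiv]
  simp [hessG]

theorem contDiffAt_gradG (a : E d) {x : E d} (h : x ≠ 0) : ContDiffAt ℝ ∞ (gradG a) x := by
  have h1 : ContDiffAt ℝ ∞ (fun x : E d => ‖x‖ ^ d) x := (contDiffAt_id.norm ℝ h).pow d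
  exact (contDiffAt_const.mul (h1.inv (by positivity))).mul
    (contDiffAt_id.inner ℝ contDiffAt_const)

theorem continuousAt_hessG (a b : E d) {x : E d} (h : x ≠ 0) : ContinuousAt (hessG a b) x := by
  have h' : ‖x‖ ≠ 0 := norm_ne_zero_iff.2 h
  unfold hessG
  fun_prop (disch := positivity)

/-! ### Kernel integrals over a piece of the surface -/

namespace GraphChart

variable {Γ : Set (E (n + 1))} (χ : GraphChart Γ)

theorem setLIntegral_param_le {A : Set (E n)} (hA : A ⊆ Metric.ball χ.c (3 * χ.ρ))
    (g : E (n + 1) → ℝ≥0∞) :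
    ∫⁻ y in A, g (χ.Φ y) ∂χ.param ≤ ∫⁻ x, g x ∂surf Γ := by
  rw [← χ.measurableEmbedding_Φ.lintegral_map]
  refine lintegral_mono' (Measure.le_iff.2 fun S hS => ?_) le_rfl
  rw [χ.measurableEmbedding_Φ.map_apply, Measure.restrict_apply
    (χ.continuous_Φ.measurable hS), surf, Measure.restrict_apply hS, param_apply]
  refine measure_mono ?_
  rintro _ ⟨y, ⟨hy, hyA⟩, rfl⟩
  exact ⟨hy, χ.mem y (hA hyA)⟩

theorem ne_Φ {x : E (n + 1)} (hx : χ.height x ≠ 0) (y : E n) : x - χ.Φ y ≠ 0 := by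
  intro h
  apply hx
  have := χ.height_mk y 0
  rwa [zero_smul, add_zero, ← sub_eq_zero.1 h] at this

theorem exists_norm_le : ∃ D : ℝ, 0 < D ∧ ∀ x ∈ χ.cyl, ‖x‖ ≤ D := by
  obtain ⟨D, hD⟩ := (isCompact_closedBall χ.c χ.ρ).exists_bound_of_continuousOn
    χ.continuous_Φ.continuousOn
  refine ⟨|D| + χ.τ, by have := χ.τ_pos; positivity, fun x hx => ?_⟩
  rw [← χ.Φ_add_height x]
  refine (norm_add_le _ _).trans (add_le_add ((hD _ (Metric.ball_subset_closedBall hx.1)).trans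
    (le_abs_self D)) ?_)
  rw [norm_smul, χ.norm_ν, mul_one]
  exact hx.2.le

/-- The kernel of the tangential derivative is integrable up to a small power of the height. -/
theorem exists_lintegral_rpow_le (hc : IsCompact Γ) (h : IsLocallyC11Graph Γ) :
    ∃ C : ℝ, 0 ≤ C ∧ ∀ x ∈ χ.cyl, χ.height x ≠ 0 →
      ∫⁻ z, ENNReal.ofReal (‖x - z‖ ^ (-n : ℝ)) ∂surf Γ ≤
        ENNReal.ofReal (C * |χ.height x| ^ (-(1 / 4) : ℝ)) := by
  obtain ⟨A, hA⟩ := exists_growth hc h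
  obtain ⟨C, hC, hCx⟩ := χ.exists_height_le
  obtain ⟨D, hD, hDx⟩ := χ.exists_norm_le
  obtain ⟨D', hD'⟩ := hc.isBounded.exists_norm_le
  set M : ℝ := (1 + C) ^ (n + 1 / 4 : ℝ) * (D + |D'|) ^ (1 / 4 : ℝ) with hM
  have hM0 : 0 ≤ M := by positivity
  have : IsFiniteMeasure (surf Γ) := ⟨surf_lt_top hc h⟩
  refine ⟨M * (A * ((n + 1 / 4 : ℝ) / ((n + 1 / 4 : ℝ) - n))), by simp; positivity,
    fun x hx ht => ?_⟩
  set s := |χ.height x| with hs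
  have hs0 : 0 < s := abs_pos.2 ht
  -- The exponent `n` is critical for a surface of dimension `n`. Giving away a bounded factor `r ^
  -- (1/4)` makes it supercritical, and `|t| ≤ C r` allows `r` to be replaced by `|t| + r`. The loss
  -- `1/4` is harmless, since the square of `|t| ^ (-1/4)` is still integrable in `t`.
  have key : ∀ z ∈ Γ, ENNReal.ofReal (‖x - z‖ ^ (-n : ℝ)) ≤
      ENNReal.ofReal M * ENNReal.ofReal ((s + ‖x - z‖) ^ (-(n + 1 / 4 : ℝ))) := by
    intro z hz
    rw [← ENNReal.ofReal_mul hM0]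
    refine ENNReal.ofReal_le_ofReal ?_
    have h1 := hCx x hx z hz
    set r := ‖x - z‖ with hr
    have hr0 : 0 < r := by
      by_contra! hle
      have : C * r ≤ 0 := mul_nonpos_of_nonneg_of_nonpos hC.le hle
      linarith
    have h2 : r ≤ D + |D'| := (norm_sub_le _ _).trans
      (add_le_add (hDx x hx) ((hD' z hz).trans (le_abs_self _)))
    calc r ^ (-n : ℝ) = r ^ (-(n + 1 / 4 : ℝ)) * r ^ (1 / 4 : ℝ) := by
          rw [← Real.rpow_add hr0]; congr 1; ring
      _ ≤ ((1 + C) ^ (n + 1 / 4 : ℝ) * (s + r) ^ (-(n + 1 / 4 : ℝ))) * (D + |D'|) ^ (1 / 4 : ℝ) := by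
          gcongr
          rw [Real.rpow_neg hr0.le, Real.rpow_neg (by positivity), ← div_eq_mul_inv,
            le_div_iff₀ (by positivity), inv_mul_le_iff₀ (by positivity),
            ← Real.mul_rpow hr0.le (by positivity)]
          gcongr
          linarith
      _ = _ := by rw [hM]; ring
  have hΓ : MeasurableSet Γ := hc.isClosed.measurableSet
  calc _ ≤ ∫⁻ z, ENNReal.ofReal M * ENNReal.ofReal ((s + ‖x - z‖) ^ (-(n + 1 / 4 : ℝ))) ∂surf Γ := by
        refine lintegral_mono_ae ?_
        filter_upwards [ae_restrict_mem hΓ] with z hz using key z hz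
    _ = ENNReal.ofReal M * ∫⁻ z, ENNReal.ofReal ((s + ‖x - z‖) ^ (-(n + 1 / 4 : ℝ))) ∂surf Γ :=
        lintegral_const_mul' _ _ ENNReal.ofReal_ne_top
    _ ≤ ENNReal.ofReal M * (A * ENNReal.ofReal ((n + 1 / 4 : ℝ) / ((n + 1 / 4 : ℝ) - n) *
          s ^ (n - (n + 1 / 4 : ℝ)))) := by
        gcongr
        exact lintegral_shift_rpow_le (by fun_prop) (fun z => norm_nonneg _) (hA x) (by linarith) hs0
    _ = _ := by
        rw [← ENNReal.ofReal_coe_nnreal (p := A), ← ENNReal.ofReal_mul A.coe_nonneg,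
          ← ENNReal.ofReal_mul hM0]
        congr 1
        rw [show (n - (n + 1 / 4 : ℝ)) = -(1 / 4) by ring]
        ring

/-- Kernels whose integral over the surface, against Lipschitz densities, diverges at most like
a small power of the height. -/
structure Good (K : E (n + 1) → E n → ℝ) : Prop where
  cont : ∀ x, χ.height x ≠ 0 → Continuous (K x)
  bound : ∀ a : E n → ℝ, (∃ La, LipschitzWith La a) →
    (∀ y, a y ≠ 0 → y ∈ Metric.closedBall χ.c (5 / 2 * χ.ρ)) →
    ∃ C, 0 ≤ C ∧ ∀ x ∈ χ.cyl, χ.height x ≠ 0 →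
      |∫ y, a y * K x y ∂χ.param| ≤ C * |χ.height x| ^ (-(1 / 4) : ℝ)

variable {χ} {K K' : E (n + 1) → E n → ℝ}

theorem hasCompactSupport_of_closedBall {a : E n → ℝ} {c : E n} {r : ℝ}
    (hs : ∀ y, a y ≠ 0 → y ∈ Metric.closedBall c r) : HasCompactSupport a :=
  IsCompact.of_isClosed_subset (isCompact_closedBall c r) (isClosed_tsupport _)
    (closure_minimal (fun y hy => hs y hy) Metric.isClosed_closedBall)

theorem Good.add (h : χ.Good K) (h' : χ.Good K') : χ.Good fun x y => K x y + K' x y := by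
  refine ⟨fun x hx => (h.cont x hx).add (h'.cont x hx), fun a ha hs => ?_⟩
  obtain ⟨C, hC, hb⟩ := h.bound a ha hs
  obtain ⟨C', hC', hb'⟩ := h'.bound a ha hs
  refine ⟨C + C', by positivity, fun x hx ht => ?_⟩
  have hcs := hasCompactSupport_of_closedBall hs
  obtain ⟨La, hLa⟩ := ha
  have i1 : Integrable (fun y => a y * K x y) χ.param :=
    (hLa.continuous.mul (h.cont x ht)).integrable_of_hasCompactSupport hcs.mul_right
  have i2 : Integrable (fun y => a y * K' x y) χ.param :=
    (hLa.continuous.mul (h'.cont x ht)).integrable_of_hasCompactSupport hcs.mul_right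
  simp only [mul_add]
  rw [integral_add i1 i2, add_mul]
  exact (abs_add_le _ _).trans (add_le_add (hb x hx ht) (hb' x hx ht))

theorem Good.const_mul (h : χ.Good K) (s : ℝ) : χ.Good fun x y => s * K x y := by
  refine ⟨fun x hx => continuous_const.mul (h.cont x hx), fun a ha hs => ?_⟩
  obtain ⟨C, hC, hb⟩ := h.bound a ha hs
  refine ⟨|s| * C, by positivity, fun x hx ht => ?_⟩
  simp only [mul_left_comm _ s]
  rw [integral_const_mul, abs_mul, mul_assoc]
  gcongr
  exact hb x hx ht

theorem Good.congr (h : χ.Good K) (he : ∀ x, χ.height x ≠ 0 → ∀ y, K' x y = K x y) :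
    χ.Good K' := by
  refine ⟨fun x hx => by rw [funext (he x hx)]; exact h.cont x hx, fun a ha hs => ?_⟩
  obtain ⟨C, hC, hb⟩ := h.bound a ha hs
  refine ⟨C, hC, fun x hx ht => ?_⟩
  simp only [he x ht]
  exact hb x hx ht

theorem Good.sub (h : χ.Good K) (h' : χ.Good K') : χ.Good fun x y => K x y - K' x y :=
  (h.add (h'.const_mul (-1))).congr fun x _ y => by ring

theorem Good.zero : χ.Good fun _ _ => 0 :=
  ⟨fun _ _ => continuous_const, fun _ _ _ => ⟨0, le_rfl, fun x _ _ => by simp⟩⟩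

theorem Good.sum {ι : Type*} (s : Finset ι) {K : ι → E (n + 1) → E n → ℝ}
    (h : ∀ i ∈ s, χ.Good (K i)) : χ.Good fun x y => ∑ i ∈ s, K i x y := by
  classical
  induction s using Finset.induction_on with
  | empty => simpa using Good.zero
  | insert i s hi ih =>
    simp only [Finset.sum_insert hi]
    exact (h i (Finset.mem_insert_self _ _)).add
      (ih fun j hj => h j (Finset.mem_insert_of_mem hj))

/-- The compact support of `a` compensates for `b` being possibly unbounded, as the derivatives of
`F` may be. -/
theorem lipschitz_mul {a b : E n → ℝ} {La Lb : ℝ≥0} (ha : LipschitzWith La a)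
    (hb : LipschitzWith Lb b) {c : E n} {r : ℝ} (hs : ∀ y, a y ≠ 0 → y ∈ Metric.closedBall c r) :
    ∃ L, LipschitzWith L fun y => a y * b y := by
  obtain ⟨A, hA⟩ := ha.continuous.bounded_above_of_compact_support
    (hasCompactSupport_of_closedBall hs)
  obtain ⟨M, hM⟩ := (isCompact_closedBall c r).exists_bound_of_continuousOn hb.continuous.continuousOn
  have hA0 : 0 ≤ A := (norm_nonneg _).trans (hA 0)
  have key : ∀ y z, y ∈ Metric.closedBall c r →
      |a y * b y - a z * b z| ≤ (La * |M| + A * Lb) * dist y z := by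
    intro y z hy
    have h1 := ha.dist_le_mul y z
    have h2 := hb.dist_le_mul y z
    rw [Real.dist_eq] at h1 h2
    calc |a y * b y - a z * b z| = |(a y - a z) * b y + a z * (b y - b z)| := by congr 1; ring
      _ ≤ |a y - a z| * |b y| + |a z| * |b y - b z| := by
        rw [← abs_mul, ← abs_mul]; exact abs_add_le _ _
      _ ≤ (La * dist y z) * |M| + A * (Lb * dist y z) := by
        exact add_le_add (mul_le_mul h1 ((hM y hy).trans (le_abs_self M)) (abs_nonneg _)
          (by positivity)) (mul_le_mul (hA z) h2 (abs_nonneg _) hA0)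
      _ = _ := by ring
  refine ⟨⟨La * |M| + A * Lb, by positivity⟩, LipschitzWith.of_dist_le_mul fun y z => ?_⟩
  rw [Real.dist_eq]
  by_cases hy : y ∈ Metric.closedBall c r
  · exact key y z hy
  · by_cases hz : z ∈ Metric.closedBall c r
    · rw [abs_sub_comm, dist_comm]
      exact key z y hz
    · have h1 : a y = 0 := by_contra fun h => hy (hs y h)
      have h2 : a z = 0 := by_contra fun h => hz (hs z h)
      rw [h1, h2, zero_mul, zero_mul, sub_zero, abs_zero]
      exact mul_nonneg (NNReal.coe_nonneg _) dist_nonneg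

/-- The coefficient is absorbed into the density. Good kernels thus form a module over Lipschitz
functions, where the linear algebra of `good_hessG` takes place. -/
theorem Good.mul (h : χ.Good K) {b : E n → ℝ} {Lb : ℝ≥0} (hb : LipschitzWith Lb b) :
    χ.Good fun x y => b y * K x y := by
  refine ⟨fun x hx => hb.continuous.mul (h.cont x hx), fun a ⟨La, hLa⟩ hs => ?_⟩
  obtain ⟨C, hC, hC'⟩ := h.bound (fun y => a y * b y) (lipschitz_mul hLa hb hs)
    fun y hy => hs y (left_ne_zero_of_mul hy)
  exact ⟨C, hC, fun x hx ht => by simpa only [mul_assoc] using hC' x hx ht⟩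

variable (χ)

theorem hasFDerivAt_Φ (y : E n) : HasFDerivAt χ.Φ
    (χ.ι.toContinuousLinearMap + (fderiv ℝ χ.F y).smulRight χ.ν) y :=
  χ.ι.toContinuousLinearMap.hasFDerivAt.add
    ((χ.differentiable_F y).hasFDerivAt.smul_const χ.ν)

theorem contDiff_Φ : ContDiff ℝ 1 χ.Φ :=
  χ.ι.toContinuousLinearMap.contDiff.add (χ.isC11.1.smul contDiff_const)

/-- The vector `ι v + (∂ᵥF) ν` is the derivative of `Φ` along `v`, so the kernel is minus the
derivative of `y ↦ gradG w (x - Φ y)`. Integrating by parts onto the Lipschitz density leaves the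
gradient kernel, of size `‖x - Φ y‖ ^ (-n)`. -/
theorem good_tangential (hc : IsCompact Γ) (h : IsLocallyC11Graph Γ) (w : E (n + 1)) (v : E n) :
    χ.Good fun x y => hessG w (χ.ι v) (x - χ.Φ y) +
      fderiv ℝ χ.F y v * hessG w χ.ν (x - χ.Φ y) := by
  have hFc : Continuous fun y => fderiv ℝ χ.F y v :=
    (χ.isC11.1.continuous_fderiv one_ne_zero).clm_apply continuous_const
  have hcont : ∀ (u : E (n + 1)) (x), χ.height x ≠ 0 →
      Continuous fun y => hessG w u (x - χ.Φ y) := fun u x hx =>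
    continuous_iff_continuousAt.2 fun y =>
      (continuousAt_hessG w u (χ.ne_Φ hx y)).comp (f := fun y => x - χ.Φ y)
        (continuous_const.sub χ.continuous_Φ).continuousAt
  refine ⟨fun x hx => (hcont _ x hx).add (hFc.mul (hcont _ x hx)), fun a ⟨La, hLa⟩ hs => ?_⟩
  -- The radii satisfy `5/2 < 11/4 < 3`: shifts of the support of the density stay over the part of
  -- the graph known to lie in `Γ`.
  obtain ⟨C, hC, hb⟩ := χ.exists_abs_integral_deriv_le hLa
    (show 5 / 2 * χ.ρ < 11 / 4 * χ.ρ by have := χ.ρ_pos; linarith) hs v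
  obtain ⟨C', hC', hb'⟩ := χ.exists_lintegral_rpow_le hc h
  have hω := sphereArea_pos (d := n + 1) (by omega)
  set M := (sphereArea (n + 1))⁻¹ * ‖w‖ with hM
  refine ⟨C * (M * C'), by positivity, fun x hx ht => ?_⟩
  have hψ : ContDiff ℝ 1 fun y => gradG w (x - χ.Φ y) := contDiff_iff_contDiffAt.2 fun y =>
    ((contDiffAt_gradG w (χ.ne_Φ ht y)).of_le (by simp)).comp (f := fun y => x - χ.Φ y) y
      (contDiff_const.sub χ.contDiff_Φ).contDiffAt
  have hder : ∀ y, hessG w (χ.ι v) (x - χ.Φ y) + fderiv ℝ χ.F y v * hessG w χ.ν (x - χ.Φ y) =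
      -fderiv ℝ (fun y => gradG w (x - χ.Φ y)) y v := by
    intro y
    have h1 := (hasFDerivAt_gradG w (χ.ne_Φ ht y)).differentiableAt.hasFDerivAt.comp y
      ((χ.hasFDerivAt_Φ y).const_sub x)
    have h2 : fderiv ℝ (fun y => gradG w (x - χ.Φ y)) y = _ := h1.fderiv
    rw [h2]
    simp [hasFDerivAt_gradG_apply _ _ (χ.ne_Φ ht y), hessG_smul_right]
  have hgoal := hb _ hψ
  simp only [hder, mul_neg, integral_neg, abs_neg]
  refine hgoal.trans ?_
  rw [mul_assoc]
  gcongr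
  have hcont : Continuous fun y => |gradG w (x - χ.Φ y)| := hψ.continuous.abs
  rw [← ENNReal.ofReal_le_ofReal_iff (by positivity),
    ofReal_integral_eq_lintegral_ofReal (hcont.continuousOn.integrableOn_compact
      (isCompact_closedBall _ _)) (.of_forall fun _ => abs_nonneg _), mul_assoc,
    ENNReal.ofReal_mul (by positivity)]
  calc _ ≤ ∫⁻ y in Metric.closedBall χ.c (11 / 4 * χ.ρ),
        ENNReal.ofReal M * ENNReal.ofReal (‖x - χ.Φ y‖ ^ (-n : ℝ)) ∂χ.param := by
        refine lintegral_mono fun y => ?_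
        rw [← ENNReal.ofReal_mul (by positivity)]
        refine ENNReal.ofReal_le_ofReal ((abs_gradG_le (by omega) w _).trans (le_of_eq ?_))
        rw [hM]; push_cast; ring_nf
    _ = ENNReal.ofReal M * ∫⁻ y in Metric.closedBall χ.c (11 / 4 * χ.ρ),
        ENNReal.ofReal (‖x - χ.Φ y‖ ^ (-n : ℝ)) ∂χ.param :=
        lintegral_const_mul' _ _ ENNReal.ofReal_ne_top
    _ ≤ _ := by
        gcongr
        refine (χ.setLIntegral_param_le ?_ fun z => ENNReal.ofReal (‖x - z‖ ^ (-n : ℝ))).trans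
          (hb' x hx ht)
        exact Metric.closedBall_subset_ball (by have := χ.ρ_pos; linarith)

/-- Harmonicity of the fundamental solution off the origin, in the orthonormal frame formed by the
`ι eₖ` and `ν`. -/
theorem sum_hessG_frame_eq_zero {x : E (n + 1)} (hx : x ≠ 0) :
    ∑ k, hessG (χ.ι (coordVec k)) (χ.ι (coordVec k)) x + hessG χ.ν χ.ν x = 0 := by
  have h0 : ‖x‖ ≠ 0 := norm_ne_zero_iff.2 hx
  have h1 : ∀ k, inner ℝ x (χ.ι (coordVec k)) = χ.π x k := fun k => by
    conv_lhs => rw [← χ.decomp x]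
    rw [inner_add_left, inner_smul_left, χ.orth, χ.ι.inner_map_map]
    simp [EuclideanSpace.inner_single_right]
  have h2 := χ.norm_mk_sq (χ.π x) (inner ℝ χ.ν x)
  rw [χ.decomp, EuclideanSpace.real_norm_sq_eq (χ.π x)] at h2
  have h3 : ∀ k : Fin n, inner ℝ (χ.ι (coordVec k)) (χ.ι (coordVec k)) = (1 : ℝ) := fun k => by
    rw [χ.ι.inner_map_map]; simp
  simp only [hessG, h1, h3, χ.inner_ν_ν, real_inner_comm χ.ν x, ← Finset.mul_sum,
    Finset.sum_sub_distrib, mul_assoc, ← pow_two]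
  have h4 : ∑ k, (χ.π x k) ^ 2 = ‖x‖ ^ 2 - (inner ℝ χ.ν x) ^ 2 := by linarith
  rw [h4]
  simp only [Finset.sum_const, Finset.card_univ, Fintype.card_fin, nsmul_eq_mul]
  push_cast
  field_simp
  ring

theorem gradient_apply_eq (y : E n) (k : Fin n) :
    gradient χ.F y k = fderiv ℝ χ.F y (coordVec k) := by
  rw [← InnerProductSpace.toDual_symm_apply (𝕜 := ℝ), EuclideanSpace.inner_single_right]
  simp [gradient]

theorem exists_lipschitz_fderiv_apply (v : E n) :
    ∃ L, LipschitzWith L fun y => fderiv ℝ χ.F y v := by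
  obtain ⟨-, K, hK⟩ := χ.isC11
  refine ⟨K * ‖v‖₊, LipschitzWith.of_dist_le_mul fun y z => ?_⟩
  have := hK.dist_le_mul y z
  rw [dist_eq_norm] at this ⊢
  rw [← sub_apply]
  refine (ContinuousLinearMap.le_opNorm _ _).trans ?_
  push_cast
  calc _ ≤ K * dist y z * ‖v‖ := by gcongr
    _ = _ := by ring

/-- Globally Lipschitz although the gradient of `F` may be unbounded: for the gradient norms `p` and
`q` at two points, the difference of the inverses is `|p - q| (p + q)` over `(1 + p²)(1 + q²)`, and
the denominator dominates `p + q`. -/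
theorem exists_lipschitz_inv :
    ∃ L, LipschitzWith L fun y => (1 + ∑ k, (fderiv ℝ χ.F y (coordVec k)) ^ 2)⁻¹ := by
  obtain ⟨-, K, hK⟩ := χ.isC11
  have e : ∀ y, ∑ k, (fderiv ℝ χ.F y (coordVec k)) ^ 2 = ‖gradient χ.F y‖ ^ 2 := fun y => by
    simp only [EuclideanSpace.real_norm_sq_eq, gradient_apply_eq]
  refine ⟨K, LipschitzWith.of_dist_le_mul fun y z => ?_⟩
  have h1 : ‖gradient χ.F y - gradient χ.F z‖ ≤ K * dist y z := by
    have := hK.dist_le_mul y z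
    rwa [dist_eq_norm, ← (InnerProductSpace.toDual ℝ (E n)).symm.norm_map, map_sub] at this
  rw [Real.dist_eq]
  simp only [e]
  set p := ‖gradient χ.F y‖ with hp
  set q := ‖gradient χ.F z‖ with hq
  have h2 : |p - q| ≤ K * dist y z := (abs_norm_sub_norm_le _ _).trans h1
  have hp0 : 0 ≤ p := norm_nonneg _
  have hq0 : 0 ≤ q := norm_nonneg _
  rw [inv_sub_inv (by positivity) (by positivity), abs_div,
    abs_of_pos (by positivity : 0 < (1 + p ^ 2) * (1 + q ^ 2)), div_le_iff₀ (by positivity)]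
  have h3 : p + q ≤ (1 + p ^ 2) * (1 + q ^ 2) := by
    nlinarith [sq_nonneg (p - 1 / 2), sq_nonneg (q - 1 / 2), sq_nonneg (p * q)]
  calc |1 + q ^ 2 - (1 + p ^ 2)| = |p - q| * (p + q) := by
        rw [show 1 + q ^ 2 - (1 + p ^ 2) = -((p - q) * (p + q)) by ring, abs_neg, abs_mul,
          abs_of_nonneg (by positivity : 0 ≤ p + q)]
    _ ≤ _ := by gcongr

/-- Let `Fₖ` be the partial derivatives of `F` and `Tₖ = ι eₖ + Fₖ ν`. The good kernels `H(ι eₖ, Tₖ)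
- Fₖ H(ν, Tₖ)` sum to `∑ (H(ι eₖ, ι eₖ) - Fₖ² H(ν, ν))`, which by harmonicity equals `-(1 + ∑ Fₖ²)
H(ν, ν)`. Dividing by the Lipschitz factor gives `H(ν, ν)`; the mixed and then the horizontal
entries follow from the tangential kernels by subtraction, and general directions by bilinearity. -/
theorem good_hessG (hc : IsCompact Γ) (h : IsLocallyC11Graph Γ) (v w : E (n + 1)) :
    χ.Good fun x y => hessG v w (x - χ.Φ y) := by
  have T := χ.good_tangential hc h
  have hF : ∀ v : E n, ∃ L, LipschitzWith L fun y => fderiv ℝ χ.F y v :=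
    χ.exists_lipschitz_fderiv_apply
  have gνν : χ.Good fun x y => hessG χ.ν χ.ν (x - χ.Φ y) := by
    obtain ⟨L, hL⟩ := χ.exists_lipschitz_inv
    have h1 := Good.sum (χ := χ) Finset.univ fun k _ =>
      (T (χ.ι (coordVec k)) (coordVec k)).sub
        ((T χ.ν (coordVec k)).mul (hF (coordVec k)).choose_spec)
    refine ((h1.mul hL).const_mul (-1)).congr fun x hx y => ?_
    have h0 := χ.sum_hessG_frame_eq_zero (χ.ne_Φ hx y)
    have h2 : ∀ k, hessG (χ.ι (coordVec k)) (χ.ι (coordVec k)) (x - χ.Φ y) +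
        fderiv ℝ χ.F y (coordVec k) * hessG (χ.ι (coordVec k)) χ.ν (x - χ.Φ y) -
        fderiv ℝ χ.F y (coordVec k) * (hessG χ.ν (χ.ι (coordVec k)) (x - χ.Φ y) +
          fderiv ℝ χ.F y (coordVec k) * hessG χ.ν χ.ν (x - χ.Φ y)) =
        hessG (χ.ι (coordVec k)) (χ.ι (coordVec k)) (x - χ.Φ y) -
          fderiv ℝ χ.F y (coordVec k) ^ 2 * hessG χ.ν χ.ν (x - χ.Φ y) := fun k => by
      rw [hessG_comm χ.ν (χ.ι _)]; ring
    simp only [h2, Finset.sum_sub_distrib, ← Finset.sum_mul]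
    have h3 : 0 < 1 + ∑ k, (fderiv ℝ χ.F y (coordVec k)) ^ 2 := by positivity
    rw [eq_neg_of_add_eq_zero_left h0]
    field_simp
    ring
  have gνι : ∀ u : E n, χ.Good fun x y => hessG χ.ν (χ.ι u) (x - χ.Φ y) := fun u =>
    ((T χ.ν u).sub (gνν.mul (hF u).choose_spec)).congr fun x _ y => by ring
  have gιι : ∀ u u' : E n, χ.Good fun x y => hessG (χ.ι u') (χ.ι u) (x - χ.Φ y) := fun u u' =>
    ((T (χ.ι u') u).sub ((gνι u').mul (hF u).choose_spec)).congr fun x _ y => by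
      rw [hessG_comm (χ.ι u') χ.ν]; ring
  have g := ((gιι (χ.π w) (χ.π v)).add ((gνι (χ.π v)).const_mul (inner ℝ χ.ν w))).add
    (((gνι (χ.π w)).const_mul (inner ℝ χ.ν v)).add
      (gνν.const_mul (inner ℝ χ.ν v * inner ℝ χ.ν w)))
  refine g.congr fun x _ y => ?_
  conv_lhs => rw [← χ.decomp v, ← χ.decomp w]
  simp only [hessG_add_left, hessG_add_right, hessG_smul_left, hessG_smul_right]
  rw [hessG_comm (χ.ι (χ.π v)) χ.ν]
  ring

/-- The key cancellation: the second derivatives of the single layer potential of the constant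
density diverge at most like a small power of the height. -/
theorem exists_abs_integral_hessG_le (hc : IsCompact Γ) (h : IsLocallyC11Graph Γ)
    (v w : E (n + 1)) : ∃ C, 0 ≤ C ∧ ∀ x ∈ χ.cyl, χ.height x ≠ 0 →
      |∫ z, hessG v w (x - z) ∂surf Γ| ≤ C * |χ.height x| ^ (-(1 / 4) : ℝ) := by
  have : IsFiniteMeasure (surf Γ) := ⟨surf_lt_top hc h⟩
  have hρ := χ.ρ_pos
  have hΓ : MeasurableSet Γ := hc.isClosed.measurableSet
  -- a Lipschitz cutoff
  set a : E n → ℝ := fun y => max 0 (min 1 (5 - 2 / χ.ρ * dist y χ.c)) with ha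
  have haL : ∃ La, LipschitzWith La a := by
    refine ⟨(2 / χ.ρ).toNNReal, LipschitzWith.const_max (LipschitzWith.const_min
      (LipschitzWith.of_dist_le_mul fun y z => ?_) 1) 0⟩
    rw [Real.coe_toNNReal _ (by positivity), Real.dist_eq]
    rw [show 5 - 2 / χ.ρ * dist y χ.c - (5 - 2 / χ.ρ * dist z χ.c) =
      2 / χ.ρ * (dist z χ.c - dist y χ.c) by ring, abs_mul, abs_of_pos (by positivity)]
    gcongr
    rw [dist_comm y z]
    exact abs_dist_sub_le _ _ _
  have has : ∀ y, a y ≠ 0 → y ∈ Metric.closedBall χ.c (5 / 2 * χ.ρ) := by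
    intro y hy
    by_contra hn
    rw [Metric.mem_closedBall, not_le] at hn
    refine hy (max_eq_left ((min_le_right _ _).trans ?_))
    have : 2 / χ.ρ * (5 / 2 * χ.ρ) ≤ 2 / χ.ρ * dist y χ.c := by gcongr
    rw [show 2 / χ.ρ * (5 / 2 * χ.ρ) = 5 by field_simp] at this
    linarith
  have ha1 : ∀ y ∈ Metric.ball χ.c (2 * χ.ρ), a y = 1 := by
    intro y hy
    have : 2 / χ.ρ * dist y χ.c ≤ 2 / χ.ρ * (2 * χ.ρ) := by gcongr; exact (Metric.mem_ball.1 hy).le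
    rw [show 2 / χ.ρ * (2 * χ.ρ) = 4 by field_simp; norm_num] at this
    rw [ha]
    simp only
    rw [min_eq_left (by linarith), max_eq_right zero_le_one]
  have ha01 : ∀ y, 0 ≤ a y ∧ a y ≤ 1 := fun y =>
    ⟨le_max_left _ _, max_le zero_le_one (min_le_left _ _)⟩
  obtain ⟨C, hC, hb⟩ := (χ.good_hessG hc h v w).bound a haL has
  obtain ⟨C₀, hC₀, hC₀x⟩ := χ.exists_height_le
  set M := (sphereArea (n + 1))⁻¹ * (1 + (n + 1 : ℕ)) * ‖v‖ * ‖w‖ with hM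
  have hω := sphereArea_pos (d := n + 1) (by omega)
  have hM0 : 0 ≤ M := by positivity
  set r := χ.r₀ with hr
  have hr0 : 0 < r := χ.r₀_pos
  set S := χ.Φ '' Metric.ball χ.c (3 * χ.ρ) with hS
  have hSm : MeasurableSet S := χ.measurableEmbedding_Φ.measurableSet_image.2 measurableSet_ball
  have hSΓ : S ⊆ Γ := χ.image_subset subset_rfl
  set σ := (surf Γ).real univ with hσ
  refine ⟨C + M * r ^ (-(n + 1 : ℕ) : ℝ) * σ * χ.τ ^ (1 / 4 : ℝ), by
    have := χ.τ_pos; positivity, fun x hx ht => ?_⟩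
  have hmain := hb x hx ht
  have hcont := (χ.good_hessG hc h v w).cont x ht
  have ht0 : 0 < |χ.height x| := abs_pos.2 ht
  -- Since the height is below `τ`, bounded contributions are absorbed into the same power.
  have hτ : 1 ≤ χ.τ ^ (1 / 4 : ℝ) * |χ.height x| ^ (-(1 / 4) : ℝ) := by
    rw [Real.rpow_neg ht0.le, ← div_eq_mul_inv, one_le_div (by positivity)]
    exact Real.rpow_le_rpow ht0.le hx.2.le (by norm_num)
  -- the density `a` extended to the surface
  set b : E (n + 1) → ℝ := S.indicator fun z => a (χ.π z) with hbdef
  have hbm : Measurable b := by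
    have : Measurable a := haL.choose_spec.continuous.measurable
    exact (this.comp χ.π.continuous.measurable).indicator hSm
  have e1 : ∫ z, b z * hessG v w (x - z) ∂surf Γ =
      ∫ y, a y * hessG v w (x - χ.Φ y) ∂χ.param := by
    have h1 : ∀ z, b z * hessG v w (x - z) =
        S.indicator (fun z => a (χ.π z) * hessG v w (x - z)) z := fun z => by
      by_cases hz : z ∈ S <;> simp [hbdef, hz]
    simp only [h1]
    rw [integral_indicator hSm, surf, Measure.restrict_restrict hSm, inter_eq_left.2 hSΓ,
      ← integral_indicator hSm]
    have h2 := χ.measurableEmbedding_Φ.integral_map (μ := χ.param)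
      (S.indicator fun z => a (χ.π z) * hessG v w (x - z))
    rw [param, χ.measurableEmbedding_Φ.map_comap, integral_indicator hSm,
      Measure.restrict_restrict hSm, inter_eq_left.2 (image_subset_range _ _),
      ← integral_indicator hSm] at h2
    rw [h2, param]
    congr 1 with y
    by_cases hy : y ∈ Metric.ball χ.c (3 * χ.ρ)
    · have : χ.Φ y ∈ S := ⟨y, hy, rfl⟩
      rw [indicator_of_mem this, χ.π_graph]
    · have : χ.Φ y ∉ S := by
        rintro ⟨y', hy', he⟩
        have he' := congrArg χ.π he
        rw [χ.π_graph, χ.π_graph] at he'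
        exact hy (he' ▸ hy')
      rw [indicator_of_notMem this]
      have : a y = 0 := by
        by_contra h0
        exact hy (Metric.closedBall_subset_ball (by linarith) (has y h0))
      rw [this, zero_mul]
  -- The cutoff is `1` over the ball of radius `2ρ`, so by `sep` the complementary density lives at
  -- distance at least `r₀` from `x`.
  have hrest : ∀ z ∈ Γ, |(1 - b z) * hessG v w (x - z)| ≤ M * r ^ (-(n + 1 : ℕ) : ℝ) := by
    intro z hz
    rcases χ.sep x hx.1 hx.2 z hz with ⟨h1, h2⟩ | h1
    · have hzS : z ∈ S := ⟨χ.π z, χ.ball_subset (by norm_num) h2, h1.symm⟩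
      rw [hbdef, indicator_of_mem hzS, ha1 _ h2, sub_self, zero_mul, abs_zero]
      positivity
    · have hb01 : |1 - b z| ≤ 1 := by
        have : 0 ≤ b z ∧ b z ≤ 1 := by
          by_cases hz : z ∈ S <;> simp [hbdef, hz, ha01]
        rw [abs_le]; constructor <;> linarith
      rw [abs_mul, ← one_mul (M * _)]
      refine mul_le_mul hb01 ((abs_hessG_le (by omega) _ _ _).trans ?_) (abs_nonneg _) zero_le_one
      gcongr ?_ * ?_
      exact Real.rpow_le_rpow_of_nonpos hr0 h1 (neg_nonpos.2 (Nat.cast_nonneg _))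
  -- A bound that degenerates at the surface; it serves only to show integrability for the fixed
  -- `x`.
  have hbig : ∀ z ∈ Γ, |hessG v w (x - z)| ≤ M * (|χ.height x| / C₀) ^ (-(n + 1 : ℕ) : ℝ) := by
    intro z hz
    refine (abs_hessG_le (by omega) _ _ _).trans ?_
    gcongr ?_ * ?_
    refine Real.rpow_le_rpow_of_nonpos (by positivity) ?_ (neg_nonpos.2 (Nat.cast_nonneg _))
    rw [div_le_iff₀ hC₀, mul_comm]
    exact hC₀x x hx z hz
  have hmeas : Measurable fun z => hessG v w (x - z) :=
    (measurable_hessG v w).comp (measurable_const.sub measurable_id)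
  have i0 : Integrable (fun z => hessG v w (x - z)) (surf Γ) :=
    Integrable.of_bound hmeas.aestronglyMeasurable _
      ((ae_restrict_mem hΓ).mono fun z hz => hbig z hz)
  have i2 : Integrable (fun z => (1 - b z) * hessG v w (x - z)) (surf Γ) :=
    Integrable.of_bound ((measurable_const.sub hbm).mul hmeas).aestronglyMeasurable _
      ((ae_restrict_mem hΓ).mono fun z hz => hrest z hz)
  have e2 : ∫ z, hessG v w (x - z) ∂surf Γ =
      ∫ z, b z * hessG v w (x - z) ∂surf Γ + ∫ z, (1 - b z) * hessG v w (x - z) ∂surf Γ := by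
    rw [← sub_eq_iff_eq_add, ← integral_sub i0 i2]
    congr 1 with z; ring
  have e3 : |∫ z, (1 - b z) * hessG v w (x - z) ∂surf Γ| ≤ M * r ^ (-(n + 1 : ℕ) : ℝ) * σ := by
    have : ∀ᵐ z ∂surf Γ, ‖(1 - b z) * hessG v w (x - z)‖ ≤ M * r ^ (-(n + 1 : ℕ) : ℝ) :=
      (ae_restrict_mem hΓ).mono fun z hz => hrest z hz
    rw [← Real.norm_eq_abs]
    exact norm_integral_le_of_norm_le_const this
  rw [e2, e1]
  calc _ ≤ C * |χ.height x| ^ (-(1 / 4) : ℝ) + M * r ^ (-(n + 1 : ℕ) : ℝ) * σ * 1 := by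
        rw [mul_one]
        exact (abs_add_le _ _).trans (add_le_add hmain e3)
    _ ≤ C * |χ.height x| ^ (-(1 / 4) : ℝ) + M * r ^ (-(n + 1 : ℕ) : ℝ) * σ *
        (χ.τ ^ (1 / 4 : ℝ) * |χ.height x| ^ (-(1 / 4) : ℝ)) := by gcongr
    _ = _ := by ring

end GraphChart

end

section

variable {n d : ℕ}

/-! ### Weighted Cauchy-Schwarz inequalities -/

section CauchySchwarz

variable {α : Type*} [MeasurableSpace α] {μ : Measure α}

theorem lintegral_mul_sq_le {u v : α → ℝ≥0∞} (hu : AEMeasurable u μ) (hv : AEMeasurable v μ) :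
    (∫⁻ x, u x * v x ∂μ) ^ 2 ≤ (∫⁻ x, u x ^ 2 ∂μ) * ∫⁻ x, v x ^ 2 ∂μ := by
  have h := ENNReal.lintegral_mul_le_Lp_mul_Lq μ Real.HolderConjugate.two_two hu hv
  simp only [Pi.mul_apply, ENNReal.rpow_two] at h
  have e : ∀ a : ℝ≥0∞, (a ^ (1 / 2 : ℝ)) ^ 2 = a := fun a => by
    rw [← ENNReal.rpow_two, ← ENNReal.rpow_mul]; norm_num
  calc _ ≤ ((∫⁻ x, u x ^ 2 ∂μ) ^ (1 / 2 : ℝ) * (∫⁻ x, v x ^ 2 ∂μ) ^ (1 / 2 : ℝ)) ^ 2 := by gcongr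
    _ = _ := by rw [mul_pow, e, e]

/-- Cauchy-Schwarz with the power split unevenly. The first factor is half an order less singular
than the kernel; the second, half an order more singular, carries `g²` and is integrated over one
further variable. It is applied with `m = n` for the `L²` bounds and `m = d` for the Hessian. -/
theorem lintegral_rpow_mul_sq_le {s : α → ℝ} (hs : Measurable s) (h0 : ∀ᵐ x ∂μ, 0 < s x) (m : ℝ)
    {g : α → ℝ≥0∞} (hg : AEMeasurable g μ) :
    (∫⁻ x, ENNReal.ofReal (s x ^ (-m)) * g x ∂μ) ^ 2 ≤
      (∫⁻ x, ENNReal.ofReal (s x ^ (-(m - 1 / 2))) ∂μ) *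
        ∫⁻ x, ENNReal.ofReal (s x ^ (-(m + 1 / 2))) * g x ^ 2 ∂μ := by
  have h := lintegral_mul_sq_le (μ := μ) (u := fun x => ENNReal.ofReal (s x ^ (-(m - 1 / 2) / 2)))
    (v := fun x => ENNReal.ofReal (s x ^ (-(m + 1 / 2) / 2)) * g x)
    (by fun_prop) ((by fun_prop : Measurable fun x =>
      ENNReal.ofReal (s x ^ (-(m + 1 / 2) / 2))).aemeasurable.mul hg)
  refine le_trans (le_of_eq ?_) (h.trans (le_of_eq ?_))
  · congr 1
    refine lintegral_congr_ae (h0.mono fun x hx => ?_)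
    simp only
    rw [← mul_assoc, ← ENNReal.ofReal_mul (by positivity), ← Real.rpow_add hx]
    congr 3; ring
  · congr 1
    · refine lintegral_congr_ae (h0.mono fun x hx => ?_)
      simp only
      rw [← ENNReal.ofReal_pow (by positivity), ← Real.rpow_mul_natCast hx.le]
      congr 2; push_cast; ring
    · refine lintegral_congr_ae (h0.mono fun x hx => ?_)
      simp only
      rw [mul_pow, ← ENNReal.ofReal_pow (by positivity), ← Real.rpow_mul_natCast hx.le]
      congr 3; push_cast; ring

end CauchySchwarz

theorem add_sq_le_four_mul (a b : ℝ≥0∞) : (a + b) ^ 2 ≤ 4 * (a ^ 2 + b ^ 2) := by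
  have h1 : a + b ≤ 2 * max a b := by
    rw [two_mul]; exact add_le_add (le_max_left _ _) (le_max_right _ _)
  calc (a + b) ^ 2 ≤ (2 * max a b) ^ 2 := by gcongr
    _ = 4 * max a b ^ 2 := by rw [mul_pow]; norm_num
    _ ≤ _ := by
      gcongr
      rcases le_total a b with h | h
      · rw [max_eq_right h]; exact le_add_self
      · rw [max_eq_left h]; exact le_self_add

theorem volume_abs_lt (s : ℝ) (_ : 0 < s) :
    volume {t : ℝ | |t| < s} ≤ 2 * ENNReal.ofReal (s ^ 1) := by
  have : {t : ℝ | |t| < s} = Ioo (-s) s := by ext t; simp [abs_lt]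
  rw [this, Real.volume_Ioo, pow_one, ← ENNReal.ofReal_ofNat 2, ← ENNReal.ofReal_mul (by norm_num)]
  exact ENNReal.ofReal_le_ofReal (by linarith)

/-- Split at `|t| = r`: below, the shifted power is at most its value at `t = 0`; above, the weight
is at most `r ^ (-1/2)`. Both parts scale like `r ^ (-(n + 1))`, the Gagliardo kernel of order `1/2`
on an `n`-dimensional surface. -/
theorem exists_lintegral_weight_le (n : ℕ) : ∃ C : ℝ≥0, ∀ r : ℝ, 0 < r →
    ∫⁻ t : ℝ, ENNReal.ofReal (|t| ^ (-(1 / 2) : ℝ)) *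
        ENNReal.ofReal ((|t| + r) ^ (-(((n + 1 : ℕ) : ℝ) + 1 / 2))) ≤
      C * ENNReal.ofReal (r ^ (-((n + 1 : ℕ) : ℝ))) := by
  set b : ℝ := ((n + 1 : ℕ) : ℝ) + 1 / 2 with hb
  have hb1 : ((1 : ℕ) : ℝ) < b := by rw [hb]; push_cast; linarith [(Nat.cast_nonneg n : (0 : ℝ) ≤ n)]
  have hb1' : (1 : ℝ) < b := by simpa using hb1
  refine ⟨⟨2 * 2 + 2 * (b / (b - 1)), by have : 0 < b - 1 := by linarith
                                         positivity⟩, fun r hr => ?_⟩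
  have hm : Measurable fun t : ℝ => |t| := by fun_prop
  have hS : MeasurableSet {t : ℝ | |t| < r} := measurableSet_lt hm measurable_const
  rw [← lintegral_add_compl _ hS]
  have h1 : ∫⁻ t in {t : ℝ | |t| < r}, ENNReal.ofReal (|t| ^ (-(1 / 2) : ℝ)) *
      ENNReal.ofReal ((|t| + r) ^ (-b)) ≤
      ENNReal.ofReal (2 * 2 * r ^ (-((n + 1 : ℕ) : ℝ))) := by
    calc _ ≤ ∫⁻ t in {t : ℝ | |t| < r}, ENNReal.ofReal (|t| ^ (-(1 / 2) : ℝ)) *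
          ENNReal.ofReal (r ^ (-b)) := by
          refine lintegral_mono fun t => ?_
          gcongr 1
          refine ENNReal.ofReal_le_ofReal (Real.rpow_le_rpow_of_nonpos hr ?_ (by linarith))
          linarith [abs_nonneg t]
      _ = (∫⁻ t in {t : ℝ | |t| < r}, ENNReal.ofReal (|t| ^ (-(1 / 2) : ℝ))) *
          ENNReal.ofReal (r ^ (-b)) := lintegral_mul_const' _ _ ENNReal.ofReal_ne_top
      _ ≤ (2 * ENNReal.ofReal ((|(1 / 2 : ℝ)| / ((1 : ℕ) - 1 / 2) + 1) * r ^ ((1 : ℕ) - 1 / 2 : ℝ))) *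
          ENNReal.ofReal (r ^ (-b)) := by
          gcongr
          exact setLIntegral_rpow_le hm abs_nonneg volume_abs_lt (by norm_num) hr
      _ = _ := by
          rw [← ENNReal.ofReal_ofNat 2, ← ENNReal.ofReal_mul (by norm_num),
            ← ENNReal.ofReal_mul (by norm_num; positivity)]
          congr 1
          rw [show -((n + 1 : ℕ) : ℝ) = ((1 : ℕ) - 1 / 2) + -b by rw [hb]; push_cast; ring,
            Real.rpow_add hr, abs_of_pos (by norm_num)]
          push_cast; ring
  have h2 : ∫⁻ t in {t : ℝ | |t| < r}ᶜ, ENNReal.ofReal (|t| ^ (-(1 / 2) : ℝ)) *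
      ENNReal.ofReal ((|t| + r) ^ (-b)) ≤
      ENNReal.ofReal (2 * (b / (b - 1)) * r ^ (-((n + 1 : ℕ) : ℝ))) := by
    have : 0 < b - 1 := by linarith
    calc _ ≤ ∫⁻ t in {t : ℝ | |t| < r}ᶜ, ENNReal.ofReal (r ^ (-(1 / 2) : ℝ)) *
          ENNReal.ofReal ((r + |t|) ^ (-b)) := by
          refine setLIntegral_mono' hS.compl fun t ht => ?_
          rw [add_comm r]
          gcongr 1
          exact ENNReal.ofReal_le_ofReal (Real.rpow_le_rpow_of_nonpos hr (not_lt.1 ht) (by norm_num))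
      _ ≤ ENNReal.ofReal (r ^ (-(1 / 2) : ℝ)) * ∫⁻ t : ℝ, ENNReal.ofReal ((r + |t|) ^ (-b)) := by
          rw [lintegral_const_mul' _ _ ENNReal.ofReal_ne_top]
          gcongr
          exact Measure.restrict_le_self
      _ ≤ ENNReal.ofReal (r ^ (-(1 / 2) : ℝ)) *
          (2 * ENNReal.ofReal (b / (b - (1 : ℕ)) * r ^ ((1 : ℕ) - b))) := by
          gcongr
          exact lintegral_shift_rpow_le hm abs_nonneg volume_abs_lt hb1 hr
      _ = _ := by
          rw [← ENNReal.ofReal_ofNat 2, ← ENNReal.ofReal_mul (by norm_num),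
            ← ENNReal.ofReal_mul (by positivity)]
          congr 1
          rw [show -((n + 1 : ℕ) : ℝ) = -(1 / 2) + ((1 : ℕ) - b) by rw [hb]; push_cast; ring,
            Real.rpow_add hr]
          push_cast; ring
  refine (add_le_add h1 h2).trans (le_of_eq ?_)
  have : 0 < b - 1 := by linarith
  rw [← ENNReal.ofReal_add (by positivity) (by positivity), ← add_mul,
    ENNReal.ofReal_mul (by positivity)]
  congr 1
  rw [ENNReal.ofReal, Real.toNNReal_of_nonneg (by positivity)]
  rfl

/-! ### Potentials of functions on the surface -/

/-- The potential with kernel `k`. -/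
def pot (Γ : Set (E (n + 1))) (k : E (n + 1) → ℝ) (f : E (n + 1) → ℂ) (x : E (n + 1)) : ℂ :=
  ∫ y, (k (x - y) : ℂ) * f y ∂surf Γ

/-- The squared Gagliardo seminorm on the surface. -/
def gagliardo (Γ : Set (E (n + 1))) (f : E (n + 1) → ℂ) : ℝ≥0∞ :=
  ∫⁻ x, ∫⁻ y, ENNReal.ofReal (‖f x - f y‖ ^ 2 / ‖x - y‖ ^ (n + 1)) ∂surf Γ ∂surf Γ

variable {Γ : Set (E (n + 1))}

/-- Inside a cylinder each vertical line meets `Γ` at height zero at most. -/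
theorem volume_surface_eq_zero (hc : IsCompact Γ) (h : IsLocallyC11Graph Γ) : volume Γ = 0 := by
  obtain ⟨s, hs⟩ := exists_finite_cover hc h
  have hcyl : ∀ χ : GraphChart Γ, volume (Γ ∩ χ.cyl) = 0 := by
    intro χ
    have hm : MeasurableSet (Γ ∩ χ.cyl) := hc.isClosed.measurableSet.inter χ.isOpen_cyl.measurableSet
    rw [← lintegral_indicator_one hm, χ.lintegral_eq (measurable_one.indicator hm) χ.F]
    refine lintegral_eq_zero_of_ae_eq_zero (.of_forall fun y => ?_)
    refine lintegral_eq_zero_of_ae_eq_zero ?_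
    have : ∀ᵐ t : ℝ, t ≠ 0 := by simp [ae_iff]
    filter_upwards [this] with t ht
    refine indicator_of_notMem (fun hz => ht ?_) _
    have h1 := χ.eq_Φ_of_mem hz.1 hz.2
    have h2 := χ.height_mk y t
    simp only [Frame.graph] at h1 h2
    rw [h1] at h2
    have h3 := χ.height_mk (χ.π (χ.ι y + χ.F y • χ.ν + t • χ.ν)) 0
    simp only [Frame.graph, zero_smul, add_zero] at h3
    rw [← h2, h3]
  refine measure_mono_null (fun x hx => ?_) ((measure_biUnion_null_iff s.countable_toSet).2
    fun χ _ => hcyl χ)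
  obtain ⟨χ, hχ, hx'⟩ := mem_iUnion₂.1 (hs hx)
  exact mem_iUnion₂.2 ⟨χ, hχ, hx, hx'⟩

theorem volume_norm_sub_lt (y : E d) (s : ℝ) (hs : 0 < s) :
    volume {x : E d | ‖x - y‖ < s} ≤
      ((volume (Metric.ball (0 : E d) 1)).toNNReal : ℝ≥0∞) * ENNReal.ofReal (s ^ d) := by
  have : {x : E d | ‖x - y‖ < s} = Metric.ball y s := by ext x; simp [dist_eq_norm]
  rw [this, Measure.addHaar_ball_of_pos _ _ hs, finrank_euclideanSpace, Fintype.card_fin, mul_comm,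
    ENNReal.coe_toNNReal measure_ball_lt_top.ne]

/-- `L²` bound for potentials with a kernel of homogeneity `-n`. -/
theorem exists_lintegral_pot_le (hc : IsCompact Γ) (h : IsLocallyC11Graph Γ) (R : ℝ)
    {k : E (n + 1) → ℝ}
    (hkb : ∀ D : ℝ, ∃ C, 0 ≤ C ∧ ∀ x, ‖x‖ ≤ D → |k x| ≤ C * ‖x‖ ^ (-n : ℝ)) :
    ∃ C : ℝ≥0, ∀ f : E (n + 1) → ℂ, AEStronglyMeasurable f (surf Γ) →
      ∫⁻ x in Metric.ball 0 R, (∫⁻ y, ‖k (x - y)‖ₑ * ‖f y‖ₑ ∂surf Γ) ^ 2 ≤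
        C * ∫⁻ y, ‖f y‖ₑ ^ 2 ∂surf Γ := by
  have : IsFiniteMeasure (surf Γ) := ⟨surf_lt_top hc h⟩
  obtain ⟨A, hA⟩ := exists_growth hc h
  obtain ⟨D', hD'⟩ := hc.isBounded.exists_norm_le
  set D := |R| + |D'| + 1 with hD
  have hD0 : 0 < D := by positivity
  obtain ⟨M, hM, hMk⟩ := hkb D
  have hΓ : MeasurableSet Γ := hc.isClosed.measurableSet
  set Ω := (volume (Metric.ball (0 : E (n + 1)) 1)).toNNReal with hΩ
  have hlt : ∀ x ∈ Metric.ball (0 : E (n + 1)) R, ∀ y ∈ Γ, ‖x - y‖ < D := fun x hx y hy => by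
    have h1 : ‖x‖ < R := by simpa using hx
    calc _ ≤ ‖x‖ + ‖y‖ := norm_sub_le _ _
      _ < _ := by linarith [hD' y hy, le_abs_self R, le_abs_self D']
  -- `C₁` comes from the surface integral of the power `-(n - 1/2)` and `C₂` from the volume
  -- integral of the power `-(n + 1/2)`: each is half an order below its critical exponent, `n` and
  -- `n + 1`.
  set C₁ : ℝ := (|(n - 1 / 2 : ℝ)| / (n - (n - 1 / 2)) + 1) * D ^ (n - (n - 1 / 2) : ℝ) with hC₁
  set C₂ : ℝ := (|(n + 1 / 2 : ℝ)| / ((n + 1 : ℕ) - (n + 1 / 2)) + 1) *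
    D ^ ((n + 1 : ℕ) - (n + 1 / 2) : ℝ) with hC₂
  refine ⟨M.toNNReal ^ 2 * (A * C₁.toNNReal) * (Ω * C₂.toNNReal), fun f hf => ?_⟩
  have hfe : AEMeasurable (fun y => ‖f y‖ₑ) (surf Γ) := hf.enorm
  have pt : ∀ x ∈ Metric.ball (0 : E (n + 1)) R, x ∉ Γ →
      (∫⁻ y, ‖k (x - y)‖ₑ * ‖f y‖ₑ ∂surf Γ) ^ 2 ≤
      ENNReal.ofReal M ^ 2 * ((A * ENNReal.ofReal C₁) *
        ∫⁻ y, ENNReal.ofReal (‖x - y‖ ^ (-(n + 1 / 2) : ℝ)) * ‖f y‖ₑ ^ 2 ∂surf Γ) := by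
    intro x hx hxΓ
    have hpos : ∀ᵐ y ∂surf Γ, 0 < ‖x - y‖ := (ae_restrict_mem hΓ).mono fun y hy =>
      norm_pos_iff.2 (sub_ne_zero.2 fun h => hxΓ (h ▸ hy))
    have h1 : ∫⁻ y, ‖k (x - y)‖ₑ * ‖f y‖ₑ ∂surf Γ ≤ ENNReal.ofReal M *
        ∫⁻ y, ENNReal.ofReal (‖x - y‖ ^ (-n : ℝ)) * ‖f y‖ₑ ∂surf Γ := by
      rw [← lintegral_const_mul' _ _ ENNReal.ofReal_ne_top]
      refine lintegral_mono_ae ((ae_restrict_mem hΓ).mono fun y hy => ?_)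
      rw [← mul_assoc, ← ENNReal.ofReal_mul hM]
      gcongr
      rw [← ofReal_norm]
      exact ENNReal.ofReal_le_ofReal (hMk _ (hlt x hx y hy).le)
    have h2 := lintegral_rpow_mul_sq_le (μ := surf Γ) (s := fun y => ‖x - y‖) (by fun_prop) hpos n
      hfe
    have h3 : ∫⁻ y, ENNReal.ofReal (‖x - y‖ ^ (-(n - 1 / 2) : ℝ)) ∂surf Γ ≤
        A * ENNReal.ofReal C₁ := by
      refine le_trans ?_ (setLIntegral_rpow_le (μ := surf Γ) (ρ := fun y => ‖x - y‖) (by fun_prop)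
        (fun _ => norm_nonneg _) (hA x) (b := n - 1 / 2) (by linarith) hD0)
      rw [surf, Measure.restrict_restrict (measurableSet_lt (by fun_prop) measurable_const)]
      exact lintegral_mono_set fun y hy => ⟨hlt x hx y hy, hy⟩
    calc _ ≤ (ENNReal.ofReal M *
        ∫⁻ y, ENNReal.ofReal (‖x - y‖ ^ (-n : ℝ)) * ‖f y‖ₑ ∂surf Γ) ^ 2 := by gcongr
      _ = ENNReal.ofReal M ^ 2 *
        (∫⁻ y, ENNReal.ofReal (‖x - y‖ ^ (-n : ℝ)) * ‖f y‖ₑ ∂surf Γ) ^ 2 := mul_pow _ _ _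
      _ ≤ _ := by
        gcongr
        exact h2.trans (by gcongr)
  have hnull : ∀ᵐ x : E (n + 1), x ∉ Γ := measure_eq_zero_iff_ae_notMem.1
    (volume_surface_eq_zero hc h)
  have hmm : AEMeasurable (fun p : E (n + 1) × E (n + 1) =>
      ENNReal.ofReal (‖p.1 - p.2‖ ^ (-(n + 1 / 2) : ℝ)) * ‖f p.2‖ₑ ^ 2)
      ((volume.restrict (Metric.ball 0 R)).prod (surf Γ)) :=
    (by fun_prop : Measurable fun p : E (n + 1) × E (n + 1) =>
      ENNReal.ofReal (‖p.1 - p.2‖ ^ (-(n + 1 / 2) : ℝ))).aemeasurable.mul (hf.comp_snd.enorm.pow_const 2)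
  calc _ ≤ ∫⁻ x in Metric.ball 0 R, ENNReal.ofReal M ^ 2 * ((A * ENNReal.ofReal C₁) *
        ∫⁻ y, ENNReal.ofReal (‖x - y‖ ^ (-(n + 1 / 2) : ℝ)) * ‖f y‖ₑ ^ 2 ∂surf Γ) := by
        refine lintegral_mono_ae ?_
        filter_upwards [ae_restrict_mem measurableSet_ball, ae_restrict_of_ae hnull] with x h1 h2
        exact pt x h1 h2
    _ = ENNReal.ofReal M ^ 2 * ((A * ENNReal.ofReal C₁) * ∫⁻ y, (∫⁻ x in Metric.ball 0 R,
        ENNReal.ofReal (‖x - y‖ ^ (-(n + 1 / 2) : ℝ)) * ‖f y‖ₑ ^ 2) ∂surf Γ) := by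
        rw [lintegral_const_mul' _ _ (by finiteness), lintegral_const_mul' _ _ (by finiteness),
          lintegral_lintegral_swap hmm]
    _ ≤ ENNReal.ofReal M ^ 2 * ((A * ENNReal.ofReal C₁) * ∫⁻ y,
        Ω * ENNReal.ofReal C₂ * ‖f y‖ₑ ^ 2 ∂surf Γ) := by
        gcongr ENNReal.ofReal M ^ 2 * (_ * ?_)
        refine lintegral_mono_ae ((ae_restrict_mem hΓ).mono fun y hy => ?_)
        rw [lintegral_mul_const _ (by fun_prop)]
        gcongr
        refine le_trans (lintegral_mono_set fun x hx => ?_) (setLIntegral_rpow_le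
          (μ := volume) (ρ := fun x => ‖x - y‖) (by fun_prop) (fun _ => norm_nonneg _)
          (fun s hs => volume_norm_sub_lt y s hs) (b := n + 1 / 2)
          (by push_cast; linarith) hD0)
        exact hlt x hx y hy
    _ = _ := by
        rw [lintegral_const_mul' _ _ (by finiteness)]
        push_cast
        simp only [ENNReal.ofReal]
        ring

/-- The weighted mean square oscillation of `f` at `p`, at scale `|t|`. -/
def meanOsc (Γ : Set (E (n + 1))) (f : E (n + 1) → ℂ) (t : ℝ) (p : E (n + 1)) : ℝ≥0∞ :=
  ∫⁻ z, ENNReal.ofReal ((|t| + ‖p - z‖) ^ (-(((n + 1 : ℕ) : ℝ) + 1 / 2))) * ‖f z - f p‖ₑ ^ 2 ∂surf Γ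

theorem measurable_meanOsc [SFinite (surf Γ)] {f : E (n + 1) → ℂ} (hf : Measurable f) :
    Measurable fun q : ℝ × E (n + 1) => meanOsc Γ f q.1 q.2 :=
  Measurable.lintegral_prod_right' (f := fun r : (ℝ × E (n + 1)) × E (n + 1) =>
    ENNReal.ofReal ((|r.1.1| + ‖r.1.2 - r.2‖) ^ (-(((n + 1 : ℕ) : ℝ) + 1 / 2))) *
      ‖f r.2 - f r.1.2‖ₑ ^ 2) (by fun_prop)

/-- Pointwise bound for the second derivatives of the single layer potential. -/
theorem exists_enorm_hess_sq_le (hc : IsCompact Γ) (h : IsLocallyC11Graph Γ)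
    (χ : GraphChart Γ) (v w : E (n + 1)) :
    ∃ K₁ K₂ : ℝ≥0, ∀ f : E (n + 1) → ℂ, Measurable f → Integrable f (surf Γ) → ∀ x ∈ χ.cyl, x ∉ Γ →
      ‖pot Γ (hessG v w) f x‖ₑ ^ 2 ≤
        4 * (K₁ * (ENNReal.ofReal (|χ.height x| ^ (-(1 / 2) : ℝ)) *
            meanOsc Γ f (χ.height x) (χ.Φ (χ.π x))) +
          K₂ * (ENNReal.ofReal (|χ.height x| ^ (-(1 / 2) : ℝ)) * ‖f (χ.Φ (χ.π x))‖ₑ ^ 2)) := by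
  have : IsFiniteMeasure (surf Γ) := ⟨surf_lt_top hc h⟩
  have hΓ : MeasurableSet Γ := hc.isClosed.measurableSet
  obtain ⟨A, hA⟩ := exists_growth hc h
  obtain ⟨C₀, hC₀, hC₀x⟩ := χ.exists_height_le
  obtain ⟨Cm, hCm, hm⟩ := χ.exists_abs_integral_hessG_le hc h v w
  have hω := sphereArea_pos (d := n + 1) (by omega)
  set d : ℝ := ((n + 1 : ℕ) : ℝ) with hd
  have hd0 : 0 < d := by positivity
  have hdn : d = n + 1 := by rw [hd]; push_cast; ring
  set M₀ : ℝ := (sphereArea (n + 1))⁻¹ * (1 + d) * ‖v‖ * ‖w‖ with hM₀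
  have hM₀0 : 0 ≤ M₀ := by positivity
  set M := M₀ * (1 + 2 * C₀) ^ d with hM
  have hM0 : 0 ≤ M := by positivity
  set B₁ : ℝ := (d - 1 / 2) / ((d - 1 / 2) - n) with hB₁
  have hB₁0 : 0 ≤ B₁ := by
    rw [hB₁, hdn, show (n : ℝ) + 1 - 1 / 2 = n + 1 / 2 by ring]
    simp only [add_sub_cancel_left]; positivity
  set K₁ : ℝ≥0 := M.toNNReal ^ 2 * (A * B₁.toNNReal) with hK₁
  set K₂ : ℝ≥0 := (Cm ^ 2).toNNReal with hK₂
  refine ⟨K₁, K₂, fun f hf hfi x hx hxΓ => ?_⟩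
  set W : ℝ → ℝ≥0∞ := fun t => ENNReal.ofReal (|t| ^ (-(1 / 2) : ℝ)) with hW
  set t := χ.height x with ht
  set p := χ.Φ (χ.π x) with hp
  have hpΓ : p ∈ Γ := χ.mem _ (χ.ball_one_subset hx.1)
  have hxp : p + t • χ.ν = x := χ.Φ_add_height x
  have ht0 : t ≠ 0 := fun h0 => hxΓ (by rw [← hxp, h0, zero_smul, add_zero]; exact hpΓ)
  have hta : 0 < |t| := abs_pos.2 ht0
  -- The distance from `x` to the surface point `z` controls both the height and the distance from
  -- the foot point, so the kernel can be measured by `|t| + ‖p - z‖`.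
  have hs : ∀ z ∈ Γ, |t| + ‖p - z‖ ≤ (1 + 2 * C₀) * ‖x - z‖ := by
    intro z hz
    have h1 := hC₀x x hx z hz
    have h2 : ‖p - z‖ ≤ ‖x - z‖ + |t| := by
      calc ‖p - z‖ = ‖(x - z) - t • χ.ν‖ := by rw [← hxp]; congr 1; abel
        _ ≤ _ := (norm_sub_le _ _).trans (by rw [norm_smul, χ.norm_ν, mul_one, Real.norm_eq_abs])
    linarith
  have hk : ∀ z ∈ Γ, |hessG v w (x - z)| ≤ M * (|t| + ‖p - z‖) ^ (-d) := by
    intro z hz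
    have h1 := hs z hz
    have h2 : 0 < |t| + ‖p - z‖ := by positivity
    have h3 : 0 < ‖x - z‖ := by
      by_contra! hle
      have : (1 + 2 * C₀) * ‖x - z‖ ≤ 0 := mul_nonpos_of_nonneg_of_nonpos (by positivity) hle
      linarith
    refine (abs_hessG_le (by omega) v w _).trans ?_
    rw [hM, mul_assoc M₀]
    gcongr
    rw [Real.rpow_neg h3.le, Real.rpow_neg h2.le, ← div_eq_mul_inv, le_div_iff₀ (by positivity),
      inv_mul_le_iff₀ (by positivity), ← Real.mul_rpow h3.le (by positivity), mul_comm ‖x - z‖]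
    gcongr
  have hkm : Measurable fun z => hessG v w (x - z) :=
    (measurable_hessG v w).comp (measurable_const.sub measurable_id)
  have hkb : ∀ᵐ z ∂surf Γ, ‖(hessG v w (x - z) : ℂ)‖ ≤ M * |t| ^ (-d) :=
    (ae_restrict_mem hΓ).mono fun z hz => by
      rw [Complex.norm_real]
      refine (hk z hz).trans ?_
      gcongr M * ?_
      exact Real.rpow_le_rpow_of_nonpos hta (by linarith [norm_nonneg (p - z)]) (by linarith)
  have hkmc : Measurable fun z => (hessG v w (x - z) : ℂ) := Complex.measurable_ofReal.comp hkm
  have i0 : Integrable (fun z => (hessG v w (x - z) : ℂ)) (surf Γ) :=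
    Integrable.of_bound hkmc.aestronglyMeasurable _ hkb
  have i1 : Integrable (fun z => (hessG v w (x - z) : ℂ) * (f z - f p)) (surf Γ) :=
    (hfi.sub (integrable_const _)).bdd_mul hkmc.aestronglyMeasurable hkb
  have e0 : ((∫ z, hessG v w (x - z) ∂surf Γ : ℝ) : ℂ) = ∫ z, (hessG v w (x - z) : ℂ) ∂surf Γ :=
    integral_ofReal.symm
  -- The value at the foot point `p` is subtracted; what remains is `f p` times the potential of the
  -- constant density, where the cancellation applies.
  have e : pot Γ (hessG v w) f x = ∫ z, (hessG v w (x - z) : ℂ) * (f z - f p) ∂surf Γ +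
      ((∫ z, hessG v w (x - z) ∂surf Γ : ℝ) : ℂ) * f p := by
    rw [e0, ← integral_mul_const, ← integral_add i1 (i0.mul_const _)]
    unfold pot
    congr 1 with z; ring
  have b1 : ‖∫ z, (hessG v w (x - z) : ℂ) * (f z - f p) ∂surf Γ‖ₑ ^ 2 ≤ K₁ * (W t * meanOsc Γ f t p) := by
    have h1 : ‖∫ z, (hessG v w (x - z) : ℂ) * (f z - f p) ∂surf Γ‖ₑ ≤ ENNReal.ofReal M *
        ∫⁻ z, ENNReal.ofReal ((|t| + ‖p - z‖) ^ (-d)) * ‖f z - f p‖ₑ ∂surf Γ := by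
      refine (enorm_integral_le_lintegral_enorm _).trans ?_
      rw [← lintegral_const_mul' _ _ ENNReal.ofReal_ne_top]
      refine lintegral_mono_ae ((ae_restrict_mem hΓ).mono fun z hz => ?_)
      rw [enorm_mul, ← mul_assoc, ← ENNReal.ofReal_mul hM0]
      gcongr
      rw [← ofReal_norm, Complex.norm_real]
      exact ENNReal.ofReal_le_ofReal (hk z hz)
    have h2 := lintegral_rpow_mul_sq_le (μ := surf Γ) (s := fun z => |t| + ‖p - z‖)
      (by fun_prop) (.of_forall fun z => by positivity) d (g := fun z => ‖f z - f p‖ₑ)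
      (by fun_prop)
    -- The growth exponent of the surface is `n = d - 1`, so this factor is of order `|t| ^ (n - (d
    -- - 1/2)) = |t| ^ (-1/2)`.
    have h3 : ∫⁻ z, ENNReal.ofReal ((|t| + ‖p - z‖) ^ (-(d - 1 / 2))) ∂surf Γ ≤
        (A * ENNReal.ofReal B₁) * W t := by
      refine (lintegral_shift_rpow_le (by fun_prop) (fun z => norm_nonneg _) (hA p)
        (by rw [hdn]; linarith) hta).trans (le_of_eq ?_)
      rw [mul_assoc, hW, ← ENNReal.ofReal_mul hB₁0]
      congr 4
      rw [hdn]; ring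
    calc _ ≤ (ENNReal.ofReal M *
        ∫⁻ z, ENNReal.ofReal ((|t| + ‖p - z‖) ^ (-d)) * ‖f z - f p‖ₑ ∂surf Γ) ^ 2 := by gcongr
      _ ≤ ENNReal.ofReal M ^ 2 * (((A * ENNReal.ofReal B₁) * W t) * meanOsc Γ f t p) := by
        rw [mul_pow]
        gcongr
        exact h2.trans (mul_le_mul' h3 le_rfl)
      _ = _ := by rw [hK₁]; push_cast; simp only [ENNReal.ofReal]; ring
  -- Squaring the bound of order `|t| ^ (-1/4)` gives the same weight `|t| ^ (-1/2)` as the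
  -- oscillation term.
  have b2 : ‖((∫ z, hessG v w (x - z) ∂surf Γ : ℝ) : ℂ) * f p‖ₑ ^ 2 ≤
      K₂ * (W t * ‖f p‖ₑ ^ 2) := by
    rw [enorm_mul, mul_pow, ← mul_assoc]
    gcongr
    rw [← ofReal_norm, Complex.norm_real, ← ENNReal.ofReal_pow (norm_nonneg _),
      show (K₂ : ℝ≥0∞) = ENNReal.ofReal (Cm ^ 2) from rfl, hW, ← ENNReal.ofReal_mul (by positivity)]
    refine ENNReal.ofReal_le_ofReal ((pow_le_pow_left₀ (norm_nonneg _) (hm x hx ht0) 2).trans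
      (le_of_eq ?_))
    rw [mul_pow, ← Real.rpow_mul_natCast (abs_nonneg _)]
    norm_num [← ht]
  rw [e]
  calc _ ≤ (‖∫ z, (hessG v w (x - z) : ℂ) * (f z - f p) ∂surf Γ‖ₑ +
        ‖((∫ z, hessG v w (x - z) ∂surf Γ : ℝ) : ℂ) * f p‖ₑ) ^ 2 := by
        gcongr; exact enorm_add_le _ _
    _ ≤ _ := add_sq_le_four_mul _ _
    _ ≤ _ := mul_le_mul_right (add_le_add b1 b2) _

theorem GraphChart.setLIntegral_cyl_eq (χ : GraphChart Γ) {T : ℝ → E (n + 1) → ℝ≥0∞}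
    (hT : Measurable fun q : ℝ × E (n + 1) => T q.1 q.2) :
    ∫⁻ x in χ.cyl, T (χ.height x) (χ.Φ (χ.π x)) =
      ∫⁻ y in Metric.ball χ.c χ.ρ, (∫⁻ t in {t | |t| < χ.τ}, T t (χ.Φ y)) := by
  have hTx : Measurable fun x => T (χ.height x) (χ.Φ (χ.π x)) :=
    hT.comp (χ.continuous_height.measurable.prodMk
      (χ.continuous_Φ.comp χ.π.continuous).measurable)
  have hcm := χ.isOpen_cyl.measurableSet
  rw [← lintegral_indicator hcm, χ.lintegral_eq (hTx.indicator hcm) χ.F,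
    ← lintegral_indicator measurableSet_ball]
  congr 1 with y
  have hh : ∀ t, χ.height (χ.ι y + χ.F y • χ.ν + t • χ.ν) = t := χ.height_mk y
  have hπ : ∀ t, χ.π (χ.ι y + χ.F y • χ.ν + t • χ.ν) = y := χ.π_mk' y
  by_cases hy : y ∈ Metric.ball χ.c χ.ρ
  · rw [indicator_of_mem hy, ← lintegral_indicator
      (measurableSet_lt (by fun_prop) measurable_const)]
    congr 1 with t
    by_cases ht : |t| < χ.τ
    · have h1 : χ.ι y + χ.F y • χ.ν + t • χ.ν ∈ χ.cyl :=
        ⟨by rwa [hπ], by rwa [hh]⟩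
      rw [indicator_of_mem h1, indicator_of_mem (show t ∈ {t | |t| < χ.τ} from ht), hh, hπ]
    · have h1 : χ.ι y + χ.F y • χ.ν + t • χ.ν ∉ χ.cyl := fun hx => ht (by
        have := hx.2; rwa [hh] at this)
      rw [indicator_of_notMem h1, indicator_of_notMem (show t ∉ {t | |t| < χ.τ} from ht)]
  · rw [indicator_of_notMem hy]
    refine lintegral_eq_zero_of_ae_eq_zero (.of_forall fun t => indicator_of_notMem
      (fun hx => hy ?_) _)
    have := hx.1
    rwa [hπ] at this

/-- After Tonelli, integrating over the height turns the weight of the mean oscillation into the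
Gagliardo kernel; the diagonal `p = z` does no harm because the increment of `f` vanishes there. -/
theorem lintegral_weight_mul_meanOsc_le [SFinite (surf Γ)] {Cw : ℝ≥0}
    (hCw : ∀ r : ℝ, 0 < r → ∫⁻ t : ℝ, ENNReal.ofReal (|t| ^ (-(1 / 2) : ℝ)) *
        ENNReal.ofReal ((|t| + r) ^ (-(((n + 1 : ℕ) : ℝ) + 1 / 2))) ≤
      Cw * ENNReal.ofReal (r ^ (-((n + 1 : ℕ) : ℝ)))) {f : E (n + 1) → ℂ} (hf : Measurable f)
    (p : E (n + 1)) :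
    ∫⁻ t, ENNReal.ofReal (|t| ^ (-(1 / 2) : ℝ)) * meanOsc Γ f t p ≤
      Cw * ∫⁻ z, ENNReal.ofReal (‖f p - f z‖ ^ 2 / ‖p - z‖ ^ (n + 1)) ∂surf Γ := by
  calc ∫⁻ t, ENNReal.ofReal (|t| ^ (-(1 / 2) : ℝ)) * meanOsc Γ f t p
      = ∫⁻ t, (∫⁻ z, ENNReal.ofReal (|t| ^ (-(1 / 2) : ℝ)) *
          (ENNReal.ofReal ((|t| + ‖p - z‖) ^ (-(((n + 1 : ℕ) : ℝ) + 1 / 2))) *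
          ‖f z - f p‖ₑ ^ 2) ∂surf Γ) := by
        congr 1 with t
        exact (lintegral_const_mul' _ _ ENNReal.ofReal_ne_top).symm
    _ = ∫⁻ z, (∫⁻ t, ENNReal.ofReal (|t| ^ (-(1 / 2) : ℝ)) *
          (ENNReal.ofReal ((|t| + ‖p - z‖) ^ (-(((n + 1 : ℕ) : ℝ) + 1 / 2))) *
          ‖f z - f p‖ₑ ^ 2)) ∂surf Γ := by
        refine lintegral_lintegral_swap (Measurable.aemeasurable ?_)
        exact (by fun_prop : Measurable fun q : ℝ × E (n + 1) =>
          ENNReal.ofReal (|q.1| ^ (-(1 / 2) : ℝ))).mul (by fun_prop)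
    _ ≤ ∫⁻ z, Cw * ENNReal.ofReal (‖f p - f z‖ ^ 2 / ‖p - z‖ ^ (n + 1)) ∂surf Γ := by
        refine lintegral_mono fun z => ?_
        simp only [← mul_assoc]
        rw [lintegral_mul_const _ (by fun_prop)]
        rcases eq_or_ne p z with rfl | hpz
        · simp
        have hr : 0 < ‖p - z‖ := norm_pos_iff.2 (sub_ne_zero.2 hpz)
        refine (mul_le_mul_left (hCw _ hr) _).trans (le_of_eq ?_)
        rw [mul_assoc, ← ofReal_norm, ← ENNReal.ofReal_pow (norm_nonneg _),
          ← ENNReal.ofReal_mul (by positivity), norm_sub_rev (f z)]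
        congr 2
        rw [Real.rpow_neg hr.le, Real.rpow_natCast, div_eq_inv_mul]
    _ = _ := lintegral_const_mul' _ _ ENNReal.coe_ne_top

theorem lintegral_four_mul_le {α : Type*} [MeasurableSpace α] {μ : Measure α} {W J : α → ℝ≥0∞}
    (hW : Measurable W) (hJ : Measurable J) {a b I F : ℝ≥0∞} (K₁ K₂ : ℝ≥0∞)
    (h1 : ∫⁻ t, W t * J t ∂μ ≤ a * I) (h2 : ∫⁻ t, W t ∂μ ≤ b) :
    ∫⁻ t, 4 * (K₁ * (W t * J t) + K₂ * (W t * F)) ∂μ ≤ 4 * (K₁ * a + K₂ * b) * (I + F) := by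
  rw [lintegral_const_mul _ (by fun_prop), lintegral_add_left (by fun_prop),
    lintegral_const_mul _ (by fun_prop), lintegral_const_mul _ (by fun_prop),
    lintegral_mul_const _ (by fun_prop), mul_assoc 4, add_mul]
  refine mul_le_mul_right (add_le_add ?_ ?_) _
  · rw [mul_assoc]
    exact mul_le_mul_right (h1.trans (mul_le_mul_right le_self_add _)) _
  · rw [mul_assoc]
    exact mul_le_mul_right (mul_le_mul' h2 le_add_self) _

theorem exists_lintegral_height_le (n : ℕ) {τ : ℝ} (hτ : 0 < τ) (K₁ K₂ : ℝ≥0) :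
    ∃ C : ℝ≥0, ∀ (Γ : Set (E (n + 1))) [SFinite (surf Γ)] (f : E (n + 1) → ℂ), Measurable f → ∀ p,
      ∫⁻ t in {t : ℝ | |t| < τ}, 4 * (K₁ * (ENNReal.ofReal (|t| ^ (-(1 / 2) : ℝ)) *
        meanOsc Γ f t p) + K₂ * (ENNReal.ofReal (|t| ^ (-(1 / 2) : ℝ)) * ‖f p‖ₑ ^ 2)) ≤
      C * (∫⁻ z, ENNReal.ofReal (‖f p - f z‖ ^ 2 / ‖p - z‖ ^ (n + 1)) ∂surf Γ + ‖f p‖ₑ ^ 2) := by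
  obtain ⟨Cw, hCw⟩ := exists_lintegral_weight_le n
  have hB := setLIntegral_rpow_le (ρ := fun t : ℝ => |t|) (by fun_prop) abs_nonneg volume_abs_lt
    (b := 1 / 2) (by norm_num) hτ
  obtain ⟨B, hB'⟩ := WithTop.ne_top_iff_exists.1 (hB.trans_lt (by finiteness)).ne
  refine ⟨4 * (K₁ * Cw + K₂ * B), fun Γ _ f hf p => ?_⟩
  push_cast
  exact lintegral_four_mul_le (by fun_prop) ((measurable_meanOsc hf).comp
    (measurable_id.prodMk measurable_const)) _ _ ((setLIntegral_le_lintegral _ _).trans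
      (lintegral_weight_mul_meanOsc_le hCw hf p)) hB'.ge

/-- The second derivatives of the single layer potential are square integrable in a cylinder. -/
theorem exists_lintegral_hess_cyl_le (hc : IsCompact Γ) (h : IsLocallyC11Graph Γ)
    (χ : GraphChart Γ) (v w : E (n + 1)) :
    ∃ C : ℝ≥0, ∀ f : E (n + 1) → ℂ, Measurable f → Integrable f (surf Γ) →
      ∫⁻ x in χ.cyl, ‖pot Γ (hessG v w) f x‖ₑ ^ 2 ≤
        C * (gagliardo Γ f + ∫⁻ y, ‖f y‖ₑ ^ 2 ∂surf Γ) := by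
  have : IsFiniteMeasure (surf Γ) := ⟨surf_lt_top hc h⟩
  obtain ⟨K₁, K₂, hK⟩ := exists_enorm_hess_sq_le hc h χ v w
  obtain ⟨C, hC⟩ := exists_lintegral_height_le n χ.τ_pos K₁ K₂
  refine ⟨C, fun f hf hfi => ?_⟩
  have hnull : ∀ᵐ x : E (n + 1), x ∉ Γ := measure_eq_zero_iff_ae_notMem.1
    (volume_surface_eq_zero hc h)
  set T : ℝ → E (n + 1) → ℝ≥0∞ := fun t p => 4 * (K₁ * (ENNReal.ofReal (|t| ^ (-(1 / 2) : ℝ)) *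
    meanOsc Γ f t p) + K₂ * (ENNReal.ofReal (|t| ^ (-(1 / 2) : ℝ)) * ‖f p‖ₑ ^ 2)) with hT
  have hTm : Measurable fun q : ℝ × E (n + 1) => T q.1 q.2 := by
    have := measurable_meanOsc (Γ := Γ) hf
    fun_prop
  calc _ ≤ ∫⁻ x in χ.cyl, T (χ.height x) (χ.Φ (χ.π x)) := by
        refine lintegral_mono_ae ?_
        filter_upwards [ae_restrict_mem χ.isOpen_cyl.measurableSet, ae_restrict_of_ae hnull]
          with x h1 h2 using hK f hf hfi x h1 h2
    _ = _ := χ.setLIntegral_cyl_eq hTm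
    _ ≤ ∫⁻ y in Metric.ball χ.c χ.ρ, _ := lintegral_mono fun y => hC Γ f hf (χ.Φ y)
    _ ≤ ∫⁻ p, C * (∫⁻ z, ENNReal.ofReal (‖f p - f z‖ ^ 2 / ‖p - z‖ ^ (n + 1)) ∂surf Γ +
          ‖f p‖ₑ ^ 2) ∂surf Γ :=
        χ.setLIntegral_Φ_le χ.ball_one_subset fun p => C * (∫⁻ z,
          ENNReal.ofReal (‖f p - f z‖ ^ 2 / ‖p - z‖ ^ (n + 1)) ∂surf Γ + ‖f p‖ₑ ^ 2)
    _ = _ := by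
        rw [lintegral_const_mul' _ _ ENNReal.coe_ne_top, lintegral_add_right _ (by fun_prop)]
        rfl

end

section

variable {n : ℕ} {Γ : Set (E (n + 1))}

/-! ### Second derivatives of the single layer potential on bounded sets -/

theorem pot_congr {k : E (n + 1) → ℝ} {f f' : E (n + 1) → ℂ} (h : f =ᵐ[surf Γ] f') :
    pot Γ k f = pot Γ k f' :=
  funext fun _ => integral_congr_ae (h.mono fun y hy => by simp only [hy])

theorem gagliardo_congr {f f' : E (n + 1) → ℂ} (h : f =ᵐ[surf Γ] f') :
    gagliardo Γ f = gagliardo Γ f' :=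
  lintegral_congr_ae (h.mono fun x hx => lintegral_congr_ae (h.mono fun y hy => by
    simp only [hx, hy]))

theorem lintegral_sq_le {α : Type*} [MeasurableSpace α] {μ : Measure α} {u : α → ℝ≥0∞}
    (hu : AEMeasurable u μ) : (∫⁻ x, u x ∂μ) ^ 2 ≤ μ univ * ∫⁻ x, u x ^ 2 ∂μ := by
  simpa using lintegral_mul_sq_le (u := fun _ => 1) aemeasurable_const hu

/-- Finitely many cylinders handle a neighbourhood of `Γ`. Elsewhere the kernel is bounded and `σ`
is finite, so Cauchy-Schwarz suffices. -/
theorem exists_lintegral_hess_le (hc : IsCompact Γ) (h : IsLocallyC11Graph Γ) (R : ℝ)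
    (v w : E (n + 1)) :
    ∃ C : ℝ≥0, ∀ f : E (n + 1) → ℂ, Integrable f (surf Γ) →
      ∫⁻ x in Metric.ball 0 R, ‖pot Γ (hessG v w) f x‖ₑ ^ 2 ≤
        C * (gagliardo Γ f + ∫⁻ y, ‖f y‖ₑ ^ 2 ∂surf Γ) := by
  have : IsFiniteMeasure (surf Γ) := ⟨surf_lt_top hc h⟩
  obtain ⟨s, hs⟩ := exists_finite_cover hc h
  obtain ⟨δ, hδ, hδx⟩ := exists_dist_ge hc hs
  choose C hC using fun χ : GraphChart Γ => exists_lintegral_hess_cyl_le hc h χ v w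
  set M := (sphereArea (n + 1))⁻¹ * (1 + (n + 1 : ℕ)) * ‖v‖ * ‖w‖ with hM
  have hω := sphereArea_pos (d := n + 1) (by omega)
  have hM0 : 0 ≤ M := by positivity
  set B := ENNReal.ofReal (M * δ ^ (-(n + 1 : ℕ) : ℝ)) with hB
  set U : Set (E (n + 1)) := ⋃ χ ∈ s, χ.cyl with hU
  have hUm : MeasurableSet U := (isOpen_biUnion fun χ (_ : χ ∈ s) => χ.isOpen_cyl).measurableSet
  set D : ℝ≥0∞ := B ^ 2 * surf Γ univ * volume (Metric.ball (0 : E (n + 1)) R) with hD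
  have hDt : D ≠ ⊤ := by
    have := measure_ball_lt_top (μ := (volume : Measure (E (n + 1)))) (x := 0) (r := R)
    rw [hD]; finiteness
  refine ⟨∑ χ ∈ s, C χ + D.toNNReal, fun f hf => ?_⟩
  -- The cylinder estimate evaluates the density at foot points and needs it measurable; all
  -- quantities in the claim depend only on its class modulo `σ`-null sets.
  set g := hf.1.mk with hg
  have hfg : f =ᵐ[surf Γ] g := hf.1.ae_eq_mk
  rw [pot_congr hfg, gagliardo_congr hfg, lintegral_congr_ae (g := fun y => ‖g y‖ₑ ^ 2)
    (hfg.mono fun y hy => by simp only [hy])]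
  have hgi : Integrable g (surf Γ) := hf.congr hfg
  have hgm : Measurable g := hf.1.stronglyMeasurable_mk.measurable
  set N := gagliardo Γ g + ∫⁻ y, ‖g y‖ₑ ^ 2 ∂surf Γ with hN
  have far : ∀ x ∉ U, ‖pot Γ (hessG v w) g x‖ₑ ^ 2 ≤ B ^ 2 * surf Γ univ * N := by
    intro x hx
    have hx' : ∀ χ ∈ s, x ∉ χ.cyl := fun χ hχ hxχ => hx (mem_iUnion₂.2 ⟨χ, hχ, hxχ⟩)
    have h1 : ‖pot Γ (hessG v w) g x‖ₑ ≤ B * ∫⁻ y, ‖g y‖ₑ ∂surf Γ := by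
      refine (enorm_integral_le_lintegral_enorm _).trans ?_
      rw [← lintegral_const_mul' _ _ ENNReal.ofReal_ne_top]
      refine lintegral_mono_ae ((ae_restrict_mem hc.isClosed.measurableSet).mono fun y hy => ?_)
      rw [enorm_mul]
      gcongr
      rw [← ofReal_norm, Complex.norm_real]
      refine ENNReal.ofReal_le_ofReal ((abs_hessG_le (by omega) v w _).trans ?_)
      gcongr M * ?_
      exact Real.rpow_le_rpow_of_nonpos hδ (hδx x hx' y hy) (neg_nonpos.2 (Nat.cast_nonneg _))
    calc _ ≤ (B * ∫⁻ y, ‖g y‖ₑ ∂surf Γ) ^ 2 := by gcongr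
      _ ≤ B ^ 2 * (surf Γ univ * ∫⁻ y, ‖g y‖ₑ ^ 2 ∂surf Γ) := by
        rw [mul_pow]
        gcongr
        exact lintegral_sq_le hgm.enorm.aemeasurable
      _ ≤ _ := by
        rw [mul_assoc]
        gcongr
        exact le_add_self
  calc _ ≤ ∫⁻ x in U ∪ (Metric.ball 0 R ∩ Uᶜ), ‖pot Γ (hessG v w) g x‖ₑ ^ 2 := by
        refine lintegral_mono_set fun x hx => ?_
        by_cases hxU : x ∈ U
        · exact Or.inl hxU
        · exact Or.inr ⟨hx, hxU⟩
    _ ≤ (∫⁻ x in U, ‖pot Γ (hessG v w) g x‖ₑ ^ 2) +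
        ∫⁻ x in Metric.ball 0 R ∩ Uᶜ, ‖pot Γ (hessG v w) g x‖ₑ ^ 2 := lintegral_union_le _ _ _
    _ ≤ ∑ χ ∈ s, C χ * N + D * N := by
        refine add_le_add ?_ ?_
        · exact (setLIntegral_biUnion_finset_le _ _ _ _).trans
            (Finset.sum_le_sum fun χ _ => hC χ g hgm hgi)
        · calc _ ≤ ∫⁻ x in Metric.ball 0 R ∩ Uᶜ, B ^ 2 * surf Γ univ * N :=
                setLIntegral_mono' (measurableSet_ball.inter hUm.compl) fun x hx => far x hx.2
            _ ≤ B ^ 2 * surf Γ univ * N * volume (Metric.ball (0 : E (n + 1)) R) := by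
                rw [setLIntegral_const]
                gcongr
                exact inter_subset_left
            _ = D * N := by rw [hD]; ring
    _ = _ := by
        rw [ENNReal.coe_add, ENNReal.coe_toNNReal hDt, add_mul, ← Finset.sum_mul]
        push_cast
        rfl

/-! ### Weak derivatives of potentials -/

theorem integrable_prod_kernel [SFinite (surf Γ)] (hΓ : MeasurableSet Γ) {k : E (n + 1) → ℝ}
    (hk : Measurable k) {f : E (n + 1) → ℂ} (hf : Integrable f (surf Γ)) {K : Set (E (n + 1))}
    {C : ℝ≥0∞} (hCt : C ≠ ⊤) (hC : ∀ y ∈ Γ, ∫⁻ x in K, ‖k (x - y)‖ₑ ≤ C) :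
    Integrable (fun p : E (n + 1) × E (n + 1) => (k (p.1 - p.2) : ℂ) * f p.2)
      ((volume.restrict K).prod (surf Γ)) := by
  have hkm : Measurable fun p : E (n + 1) × E (n + 1) => (k (p.1 - p.2) : ℂ) :=
    Complex.measurable_ofReal.comp (hk.comp (measurable_fst.sub measurable_snd))
  have hm : AEStronglyMeasurable (fun p : E (n + 1) × E (n + 1) => (k (p.1 - p.2) : ℂ) * f p.2)
      ((volume.restrict K).prod (surf Γ)) := hkm.aestronglyMeasurable.mul hf.1.comp_snd
  refine ⟨hm, ?_⟩
  rw [HasFiniteIntegral, lintegral_prod_symm _ hm.enorm]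
  calc _ ≤ ∫⁻ y, C * ‖f y‖ₑ ∂surf Γ := by
        refine lintegral_mono_ae ((ae_restrict_mem hΓ).mono fun y hy => ?_)
        simp only [enorm_mul]
        have : Measurable fun x => ‖(k (x - y) : ℂ)‖ₑ :=
          (Complex.measurable_ofReal.comp (hk.comp (measurable_id.sub_const y))).enorm
        rw [lintegral_mul_const _ this]
        gcongr
        refine le_trans (le_of_eq (lintegral_congr fun x => ?_)) (hC y hy)
        rw [← ofReal_norm, ← ofReal_norm, Complex.norm_real]
    _ < ⊤ := by
        rw [lintegral_const_mul' _ _ hCt]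
        exact ENNReal.mul_lt_top hCt.lt_top hf.2

theorem exists_lintegral_translate_le {k : E (n + 1) → ℝ} (hk : LocallyIntegrable k)
    (hΓ : IsCompact Γ) {K : Set (E (n + 1))} (hK : IsCompact K) :
    ∃ C : ℝ≥0∞, C ≠ ⊤ ∧ ∀ y ∈ Γ, ∫⁻ x in K, ‖k (x - y)‖ₑ ≤ C := by
  obtain ⟨D, hD⟩ := hΓ.isBounded.exists_norm_le
  obtain ⟨D', hD'⟩ := hK.isBounded.exists_norm_le
  refine ⟨∫⁻ x in Metric.closedBall 0 (D + D'), ‖k x‖ₑ,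
    (hk.integrableOn_isCompact (isCompact_closedBall _ _)).2.ne, fun y hy => ?_⟩
  rw [← lintegral_indicator measurableSet_closedBall,
    ← lintegral_sub_right_eq_self (μ := volume) _ y, ← lintegral_indicator hK.isClosed.measurableSet]
  refine lintegral_mono fun x => ?_
  by_cases hx : x ∈ K
  · have : x - y ∈ Metric.closedBall (0 : E (n + 1)) (D + D') := by
      rw [mem_closedBall_zero_iff]
      exact (norm_sub_le _ _).trans (by linarith [hD y hy, hD' x hx])
    rw [indicator_of_mem hx, indicator_of_mem this]
  · rw [indicator_of_notMem hx]
    exact zero_le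

theorem locallyIntegrable_ofReal_translate {d : ℕ} {k : E d → ℝ} (hk : LocallyIntegrable k)
    (y : E d) : LocallyIntegrable fun x => (k (x - y) : ℂ) := by
  rw [locallyIntegrable_iff]
  intro K hK
  have h1 : IntegrableOn k ((fun x => x - y) '' K) :=
    hk.integrableOn_isCompact (hK.image (by fun_prop))
  have h2 := ((measurePreserving_sub_right volume y).integrableOn_comp_preimage
    (MeasurableEquiv.subRight y).measurableEmbedding).2 h1
  rw [preimage_image_eq _ sub_left_injective] at h2
  exact h2.ofReal

theorem hasWeakPartial_fundamentalSolution {d : ℕ} (hd : 1 ≤ d) (i : Fin d) (y : E d) :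
    HasWeakPartial univ i (fun x => (fundamentalSolution (x - y) : ℂ))
      (fun x => (gradG (coordVec i) (x - y) : ℂ)) := by
  refine hasWeakPartial_of_integral
    ((locallyIntegrable_ofReal_translate (locallyIntegrable_fundamentalSolution hd) y).locallyIntegrableOn _)
    ((locallyIntegrable_ofReal_translate (locallyIntegrable_gradG hd _) y).locallyIntegrableOn _)
    fun φ h1 h2 _ => ?_
  have h := integral_smul_deriv_fundamentalSolution hd (ψ := fun x => φ (x + y))
    (h1.comp (contDiff_id.add contDiff_const)) (h2.comp_homeomorph (Homeomorph.addRight y))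
    (coordVec i)
  have e1 := integral_sub_right_eq_self (μ := (volume : Measure (E d)))
    (fun x => fderiv ℝ (fun x => φ (x + y)) x (coordVec i) * fundamentalSolution x) y
  have e2 := integral_sub_right_eq_self (μ := (volume : Measure (E d)))
    (fun x => φ (x + y) * gradG (coordVec i) x) y
  simp only [fderiv_comp_add_right, sub_add_cancel] at e1 e2 h
  rw [← e1, ← e2] at h
  simp only [Complex.real_smul, ← Complex.ofReal_mul]
  rw [integral_complex_ofReal, integral_complex_ofReal, h, Complex.ofReal_neg]

theorem hasWeakPartial_gradG {d : ℕ} {U : Set (E d)} (hU : IsOpen U) (i j : Fin d) {y : E d}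
    (hy : y ∉ U) : HasWeakPartial U j (fun x => (gradG (coordVec i) (x - y) : ℂ))
      (fun x => (hessG (coordVec i) (coordVec j) (x - y) : ℂ)) := by
  have hne : ∀ x ∈ U, x - y ≠ 0 := fun x hx h => hy (sub_eq_zero.1 h ▸ hx)
  set Du : E d → E d →L[ℝ] ℂ := fun x =>
    Complex.ofRealCLM.comp (fderiv ℝ (gradG (coordVec i)) (x - y)) with hDu
  have hD : ∀ x ∈ U, Du x (coordVec j) = (hessG (coordVec i) (coordVec j) (x - y) : ℂ) :=
    fun x hx => by
      rw [hDu]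
      simp [hasFDerivAt_gradG_apply _ _ (hne x hx)]
  refine (hasWeakPartial_of_hasFDerivAt hU (Du := Du) (fun x hx => ?_) ?_).congr .rfl
    ((ae_restrict_mem hU.measurableSet).mono hD)
  · have h1 := (hasFDerivAt_gradG (coordVec i) (hne x hx)).differentiableAt.hasFDerivAt.comp
      (f := fun x => x - y) x ((hasFDerivAt_id x).sub_const y)
    rw [ContinuousLinearMap.comp_id] at h1
    exact Complex.ofRealCLM.hasFDerivAt.comp x h1
  · refine ContinuousOn.congr (fun x hx => ContinuousAt.continuousWithinAt ?_) hD
    exact Complex.continuous_ofReal.continuousAt.comp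
      ((continuousAt_hessG _ _ (hne x hx)).comp (f := fun x => x - y) (by fun_prop))

/-- Valid across `Γ`, since the gradient kernel is still locally integrable in `x`, uniformly in the
pole. -/
theorem hasWeakPartial_pot (hc : IsCompact Γ) (h : IsLocallyC11Graph Γ) {f : E (n + 1) → ℂ}
    (hf : Integrable f (surf Γ)) (i : Fin (n + 1)) :
    HasWeakPartial univ i (pot Γ fundamentalSolution f) (pot Γ (gradG (coordVec i)) f) := by
  have : IsFiniteMeasure (surf Γ) := ⟨surf_lt_top hc h⟩
  refine hasWeakPartial_integral (k := fun x y => (fundamentalSolution (x - y) : ℂ))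
    (k' := fun x y => (gradG (coordVec i) (x - y) : ℂ)) isOpen_univ
    (.of_forall fun y => hasWeakPartial_fundamentalSolution (by omega) i y)
    (fun K _ hK => ?_) (fun K _ hK => ?_)
  · obtain ⟨C, hCt, hC⟩ := exists_lintegral_translate_le
      (locallyIntegrable_fundamentalSolution (by omega)) hc hK
    exact integrable_prod_kernel hc.isClosed.measurableSet measurable_fundamentalSolution hf hCt hC
  · obtain ⟨C, hCt, hC⟩ := exists_lintegral_translate_le
      (locallyIntegrable_gradG (by omega) (coordVec i)) hc hK
    exact integrable_prod_kernel hc.isClosed.measurableSet (measurable_gradG _) hf hCt hC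

/-- Only off `Γ`, where the kernel is smooth; on the whole space the weak divergence of the gradient
carries the surface term of `sum_integral_fderiv_pot`. -/
theorem hasWeakPartial_pot_gradG (hc : IsCompact Γ) (h : IsLocallyC11Graph Γ) {f : E (n + 1) → ℂ}
    (hf : Integrable f (surf Γ)) (i j : Fin (n + 1)) :
    HasWeakPartial Γᶜ j (pot Γ (gradG (coordVec i)) f)
      (pot Γ (hessG (coordVec i) (coordVec j)) f) := by
  have : IsFiniteMeasure (surf Γ) := ⟨surf_lt_top hc h⟩
  have hΓ := hc.isClosed.measurableSet
  refine hasWeakPartial_integral (k := fun x y => (gradG (coordVec i) (x - y) : ℂ))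
    (k' := fun x y => (hessG (coordVec i) (coordVec j) (x - y) : ℂ)) hc.isClosed.isOpen_compl
    ((ae_restrict_mem hΓ).mono fun y hy => hasWeakPartial_gradG hc.isClosed.isOpen_compl i j
      (not_not.2 hy)) (fun K _ hK => ?_) (fun K hKΓ hK => ?_)
  · obtain ⟨C, hCt, hC⟩ := exists_lintegral_translate_le
      (locallyIntegrable_gradG (by omega) (coordVec i)) hc hK
    exact integrable_prod_kernel hΓ (measurable_gradG _) hf hCt hC
  · obtain ⟨M, hM⟩ := (hK.prod hc).exists_bound_of_continuousOn
      (f := fun p : E (n + 1) × E (n + 1) => hessG (coordVec i) (coordVec j) (p.1 - p.2))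
      fun p hp => ContinuousAt.continuousWithinAt <|
        (continuousAt_hessG _ _ (sub_ne_zero.2 fun he => hKΓ hp.1 (by rw [he]; exact hp.2))).comp
          (f := fun p : E (n + 1) × E (n + 1) => p.1 - p.2) (by fun_prop)
    refine integrable_prod_kernel hΓ (measurable_hessG _ _) hf
      (C := ENNReal.ofReal M * volume K)
      (ENNReal.mul_ne_top ENNReal.ofReal_ne_top hK.measure_lt_top.ne) fun y hy => ?_
    rw [← setLIntegral_const]
    refine setLIntegral_mono' hK.isClosed.measurableSet fun x hx => ?_
    rw [← ofReal_norm]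
    exact ENNReal.ofReal_le_ofReal (hM (x, y) ⟨hx, hy⟩)

/-! ### `H²` bounds -/

theorem stronglyMeasurable_pot [SFinite (surf Γ)] {k : E (n + 1) → ℝ} (hk : Measurable k)
    {f : E (n + 1) → ℂ} (hf : AEStronglyMeasurable f (surf Γ)) : StronglyMeasurable (pot Γ k f) := by
  rw [pot_congr hf.ae_eq_mk]
  refine StronglyMeasurable.integral_prod_right (f := fun x y => (k (x - y) : ℂ) * hf.mk f y) ?_
  exact ((Complex.measurable_ofReal.comp (hk.comp (measurable_fst.sub measurable_snd))).mul
    (hf.stronglyMeasurable_mk.measurable.comp measurable_snd)).stronglyMeasurable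

theorem eLpNorm_two_sq {α : Type*} [MeasurableSpace α] {μ : Measure α} (u : α → ℂ) :
    eLpNorm u 2 μ ^ 2 = ∫⁻ x, ‖u x‖ₑ ^ 2 ∂μ := by
  have := eLpNorm_nnreal_pow_eq_lintegral (μ := μ) (f := u) (p := 2) (by norm_num)
  simpa using this

theorem memLp_two_of_lintegral_le {d : ℕ} {μ : Measure (E d)} {u : E d → ℂ}
    (hu : AEStronglyMeasurable u μ) {M : ℝ} (hM : 0 ≤ M)
    (h : ∫⁻ x, ‖u x‖ₑ ^ 2 ∂μ ≤ ENNReal.ofReal (M ^ 2)) : MemLp u 2 μ ∧ l2Norm μ u ≤ M := by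
  rw [← eLpNorm_two_sq, ENNReal.ofReal_pow hM] at h
  have h' : eLpNorm u 2 μ ≤ ENNReal.ofReal M := (ENNReal.pow_le_pow_left_iff two_ne_zero).1 h
  exact ⟨⟨hu, h'.trans_lt ENNReal.ofReal_lt_top⟩, ENNReal.toReal_le_of_le_ofReal hM h'⟩

theorem lintegral_eq_l2Norm_sq {d : ℕ} {μ : Measure (E d)} {u : E d → ℂ} (hu : MemLp u 2 μ) :
    ∫⁻ x, ‖u x‖ₑ ^ 2 ∂μ = ENNReal.ofReal (l2Norm μ u ^ 2) := by
  rw [← eLpNorm_two_sq, l2Norm, ENNReal.ofReal_pow ENNReal.toReal_nonneg,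
    ENNReal.ofReal_toReal hu.eLpNorm_ne_top]

/-- `f` is in `L²` with finite Gagliardo seminorm; the norm of `H^{1/2}`. -/
def halfNorm (Γ : Set (E (n + 1))) (f : E (n + 1) → ℂ) : ℝ :=
  Real.sqrt (l2Norm (surf Γ) f ^ 2 + (gagliardo Γ f).toReal)

theorem halfNorm_sq (f : E (n + 1) → ℂ) :
    halfNorm Γ f ^ 2 = l2Norm (surf Γ) f ^ 2 + (gagliardo Γ f).toReal :=
  Real.sq_sqrt (by positivity)

theorem gagliardo_add_lintegral {f : E (n + 1) → ℂ} (hf : MemLp f 2 (surf Γ))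
    (hg : gagliardo Γ f < ⊤) :
    gagliardo Γ f + ∫⁻ y, ‖f y‖ₑ ^ 2 ∂surf Γ = ENNReal.ofReal (halfNorm Γ f ^ 2) := by
  rw [halfNorm_sq, lintegral_eq_l2Norm_sq hf, ENNReal.ofReal_add (by positivity) (by positivity),
    ENNReal.ofReal_toReal hg.ne, add_comm]

/-- `L²` bounds on bounded sets for the single layer potential and its gradient. -/
theorem exists_pot_l2_le (hc : IsCompact Γ) (h : IsLocallyC11Graph Γ) (R : ℝ)
    {k : E (n + 1) → ℝ} (hk : Measurable k)
    (hkb : ∀ D : ℝ, ∃ C, 0 ≤ C ∧ ∀ x, ‖x‖ ≤ D → |k x| ≤ C * ‖x‖ ^ (-n : ℝ)) :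
    ∃ C : ℝ, 0 ≤ C ∧ ∀ f : E (n + 1) → ℂ, MemLp f 2 (surf Γ) →
      MemLp (pot Γ k f) 2 (volume.restrict (Metric.ball 0 R)) ∧
      l2Norm (volume.restrict (Metric.ball 0 R)) (pot Γ k f) ≤ C * l2Norm (surf Γ) f := by
  have : IsFiniteMeasure (surf Γ) := ⟨surf_lt_top hc h⟩
  obtain ⟨C, hC⟩ := exists_lintegral_pot_le hc h R hkb
  refine ⟨Real.sqrt C, Real.sqrt_nonneg _, fun f hf => ?_⟩
  refine memLp_two_of_lintegral_le (stronglyMeasurable_pot hk hf.1).aestronglyMeasurable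
    (mul_nonneg (Real.sqrt_nonneg _) l2Norm_nonneg) ?_
  rw [mul_pow, Real.sq_sqrt C.coe_nonneg, ENNReal.ofReal_mul C.coe_nonneg, ← lintegral_eq_l2Norm_sq hf,
    ENNReal.ofReal_coe_nnreal]
  refine le_trans (lintegral_mono fun x => ?_) (hC f hf.1)
  gcongr
  refine (enorm_integral_le_lintegral_enorm _).trans (le_of_eq (lintegral_congr fun y => ?_))
  rw [enorm_mul, ← ofReal_norm, ← ofReal_norm (k _), Complex.norm_real]

theorem fundamentalSolution_bound (D : ℝ) : ∃ C, 0 ≤ C ∧ ∀ x : E (n + 1), ‖x‖ ≤ D →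
    |fundamentalSolution x| ≤ C * ‖x‖ ^ (-n : ℝ) := by
  obtain ⟨C, hC, h⟩ := abs_fundamentalSolution_le (d := n + 1) (by omega) D
  refine ⟨C * |D| ^ (1 / 2 : ℝ), by positivity, fun x hx => (h x hx).trans ?_⟩
  have e : (-((n + 1 : ℕ) - 3 / 2) : ℝ) = 1 / 2 + -n := by push_cast; ring
  rw [e, mul_assoc]
  gcongr
  rcases eq_or_ne x 0 with rfl | hx0
  · rw [norm_zero, Real.zero_rpow]
    · positivity
    -- The exponent `1/2 - n` is never zero for integer `n`, so the power of `0` vanishes.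
    · intro h0
      have : (2 * n : ℝ) = 1 := by linarith
      norm_cast at this
      omega
  · rw [Real.rpow_add (norm_pos_iff.2 hx0)]
    gcongr
    exact hx.trans (le_abs_self D)

theorem gradG_bound (a : E (n + 1)) (D : ℝ) : ∃ C, 0 ≤ C ∧ ∀ x : E (n + 1), ‖x‖ ≤ D →
    |gradG a x| ≤ C * ‖x‖ ^ (-n : ℝ) := by
  have hω := sphereArea_pos (d := n + 1) (by omega)
  refine ⟨(sphereArea (n + 1))⁻¹ * ‖a‖, by positivity, fun x _ =>
    (abs_gradG_le (by omega) a x).trans (le_of_eq ?_)⟩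
  push_cast
  ring_nf

/-- The potential estimate for both sides at once: `Ω` and bounded parts of the exterior are open
subsets of a ball minus `Γ`. Only the Hessian uses the Gagliardo seminorm. -/
theorem exists_isH2On_pot (hc : IsCompact Γ) (h : IsLocallyC11Graph Γ) (R : ℝ) :
    ∃ C : ℝ, 0 ≤ C ∧ ∀ f : E (n + 1) → ℂ, MemLp f 2 (surf Γ) → gagliardo Γ f < ⊤ →
      IsH2On (Γᶜ ∩ Metric.ball 0 R) (pot Γ fundamentalSolution f)
        (fun i => pot Γ (gradG (coordVec i)) f)
        (fun i j => pot Γ (hessG (coordVec i) (coordVec j)) f) (C * halfNorm Γ f) := by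
  have : IsFiniteMeasure (surf Γ) := ⟨surf_lt_top hc h⟩
  obtain ⟨C₀, hC₀, h₀⟩ := exists_pot_l2_le hc h R measurable_fundamentalSolution
    fundamentalSolution_bound
  choose C₁ hC₁ h₁ using fun i => exists_pot_l2_le hc h R (measurable_gradG (coordVec i))
    (gradG_bound _)
  choose C₂ h₂ using fun i j => exists_lintegral_hess_le hc h R (coordVec i) (coordVec j)
  set C := C₀ + ∑ i, C₁ i + ∑ i, ∑ j, Real.sqrt (C₂ i j) with hC
  have hs : ∀ i j, 0 ≤ Real.sqrt (C₂ i j) := fun i j => Real.sqrt_nonneg _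
  have s1 : 0 ≤ ∑ i, C₁ i := Finset.sum_nonneg fun i _ => hC₁ i
  have s2 : 0 ≤ ∑ i, ∑ j, Real.sqrt (C₂ i j) :=
    Finset.sum_nonneg fun i _ => Finset.sum_nonneg fun j _ => hs i j
  have c0 : C₀ ≤ C := by linarith
  have c1 : ∀ i, C₁ i ≤ C := fun i => by
    have := Finset.single_le_sum (f := C₁) (fun i _ => hC₁ i) (Finset.mem_univ i)
    linarith
  have c2 : ∀ i j, Real.sqrt (C₂ i j) ≤ C := fun i j => by
    have h1 := Finset.single_le_sum (f := fun j => Real.sqrt (C₂ i j)) (fun j _ => hs i j)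
      (Finset.mem_univ j)
    have h2 := Finset.single_le_sum (f := fun i => ∑ j, Real.sqrt (C₂ i j))
      (fun i _ => Finset.sum_nonneg fun j _ => hs i j) (Finset.mem_univ i)
    linarith
  refine ⟨C, by linarith, fun f hf hg => ?_⟩
  have hfi : Integrable f (surf Γ) := hf.integrable one_le_two
  have hN : 0 ≤ halfNorm Γ f := Real.sqrt_nonneg _
  have hle : l2Norm (surf Γ) f ≤ halfNorm Γ f := by
    rw [halfNorm]
    exact Real.le_sqrt_of_sq_le (le_add_of_nonneg_right ENNReal.toReal_nonneg)
  have hH : ∀ i j, MemLp (pot Γ (hessG (coordVec i) (coordVec j)) f) 2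
      (volume.restrict (Metric.ball 0 R)) ∧ l2Norm (volume.restrict (Metric.ball 0 R))
        (pot Γ (hessG (coordVec i) (coordVec j)) f) ≤ Real.sqrt (C₂ i j) * halfNorm Γ f := by
    intro i j
    refine memLp_two_of_lintegral_le
      (stronglyMeasurable_pot (measurable_hessG _ _) hf.1).aestronglyMeasurable
      (mul_nonneg (hs i j) hN) ?_
    rw [mul_pow, Real.sq_sqrt (C₂ i j).coe_nonneg, ENNReal.ofReal_mul (C₂ i j).coe_nonneg,
      ← gagliardo_add_lintegral hf hg, ENNReal.ofReal_coe_nnreal]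
    exact h₂ i j f hfi
  have hmono : volume.restrict (Γᶜ ∩ Metric.ball 0 R) ≤
    (volume : Measure (E (n + 1))).restrict (Metric.ball 0 R) :=
    Measure.restrict_mono inter_subset_right le_rfl
  have tr : ∀ {u : E (n + 1) → ℂ} {M : ℝ}, (MemLp u 2 (volume.restrict (Metric.ball 0 R)) ∧
      l2Norm (volume.restrict (Metric.ball 0 R)) u ≤ M) → M ≤ C * halfNorm Γ f →
      MemLp u 2 (volume.restrict (Γᶜ ∩ Metric.ball 0 R)) ∧
      l2Norm (volume.restrict (Γᶜ ∩ Metric.ball 0 R)) u ≤ C * halfNorm Γ f := fun hu hM =>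
    ⟨hu.1.mono_measure hmono, (ENNReal.toReal_mono hu.1.eLpNorm_ne_top
      (eLpNorm_mono_measure _ hmono)).trans (hu.2.trans hM)⟩
  have t0 := tr (h₀ f hf) (mul_le_mul c0 hle l2Norm_nonneg (by linarith))
  have t1 := fun i => tr (h₁ i f hf) (mul_le_mul (c1 i) hle l2Norm_nonneg (by linarith))
  have t2 := fun i j => tr (hH i j) (mul_le_mul_of_nonneg_right (c2 i j) hN)
  exact ⟨fun i => (hasWeakPartial_pot hc h hfi i).mono (subset_univ _),
    fun i j => (hasWeakPartial_pot_gradG hc h hfi i j).mono inter_subset_left, t0.1,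
    fun i => (t1 i).1, fun i j => (t2 i j).1, t0.2, fun i => (t1 i).2, fun i j => (t2 i j).2⟩

theorem integrable_kernel_mul (hc : IsCompact Γ) {f : E (n + 1) → ℂ}
    (hf : Integrable f (surf Γ)) {x : E (n + 1)} (hx : x ∉ Γ) :
    Integrable (fun y => (fundamentalSolution (x - y) : ℂ) * f y) (surf Γ) := by
  obtain ⟨M, hM⟩ := hc.exists_bound_of_continuousOn
    (f := fun y => fundamentalSolution (x - y)) fun y hy => ContinuousAt.continuousWithinAt <|
      (hasFDerivAt_fundamentalSolution (by omega)
        (sub_ne_zero.2 fun he => hx (by rw [he]; exact hy))).continuousAt.comp (f := fun y => x - y) (by fun_prop)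
  have hm : Measurable fun y => (fundamentalSolution (x - y) : ℂ) := Complex.measurable_ofReal.comp
    (measurable_fundamentalSolution.comp (measurable_const.sub measurable_id))
  refine hf.bdd_mul (c := M) hm.aestronglyMeasurable
    ((ae_restrict_mem hc.isClosed.measurableSet).mono fun y hy => ?_)
  rw [Complex.norm_real]
  exact hM y hy

end

section

variable {n : ℕ} {Γ : Set (E (n + 1))}

/-! ### The trace estimate for smooth functions -/

/-- The weighted energy along slanted segments issued from `a` in the direction `h`. -/
def slantEnergy (χ : GraphChart Γ) (D : E (n + 1) → ℝ≥0∞) (a h : E n) : ℝ≥0∞ :=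
  ENNReal.ofReal (‖h‖ ^ (-(n + 1 / 2) : ℝ)) * ∫⁻ t in Ioc 0 ‖h‖,
    ENNReal.ofReal (t ^ (1 / 2 : ℝ)) * D (χ.Φ (a + (t / 2) • (‖h‖⁻¹ • h)) + t • χ.ν) ^ 2

theorem slantEnergy_eq (χ : GraphChart Γ) (D : E (n + 1) → ℝ≥0∞) (a h : E n) :
    slantEnergy χ D a h = ENNReal.ofReal (‖h‖ ^ (-(n + 1 / 2) : ℝ)) * ∫⁻ t,
      {p : E n × ℝ | 0 < p.2 ∧ p.2 ≤ ‖p.1‖}.indicator 1 (h, t) * (ENNReal.ofReal (t ^ (1 / 2 : ℝ)) *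
        D (χ.Φ (a + (t / 2) • (‖h‖⁻¹ • h)) + t • χ.ν) ^ 2) := by
  rw [slantEnergy, ← lintegral_indicator measurableSet_Ioc]
  congr 2 with t
  by_cases ht : 0 < t ∧ t ≤ ‖h‖
  · rw [indicator_of_mem (show t ∈ Ioc 0 ‖h‖ from ht),
      indicator_of_mem (show (h, t) ∈ {p : E n × ℝ | 0 < p.2 ∧ p.2 ≤ ‖p.1‖} from ht), Pi.one_apply,
      one_mul]
  · rw [indicator_of_notMem (show t ∉ Ioc 0 ‖h‖ from ht),
      indicator_of_notMem (show (h, t) ∉ {p : E n × ℝ | 0 < p.2 ∧ p.2 ≤ ‖p.1‖} from ht), zero_mul]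

theorem measurableSet_slant : MeasurableSet {p : E n × ℝ | 0 < p.2 ∧ p.2 ≤ ‖p.1‖} :=
  (measurableSet_lt measurable_const measurable_snd).inter
    (measurableSet_le measurable_snd measurable_fst.norm)

theorem measurable_slantEnergy (χ : GraphChart Γ) {D : E (n + 1) → ℝ≥0∞} (hD : Measurable D) :
    Measurable fun p : E n × E n => slantEnergy χ D p.1 p.2 := by
  have hΦ := χ.continuous_Φ.measurable
  simp only [slantEnergy_eq]
  refine Measurable.mul (by fun_prop) ?_
  refine Measurable.lintegral_prod_right' (f := fun q : (E n × E n) × ℝ =>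
    {p : E n × ℝ | 0 < p.2 ∧ p.2 ≤ ‖p.1‖}.indicator 1 (q.1.2, q.2) *
      (ENNReal.ofReal (q.2 ^ (1 / 2 : ℝ)) *
        D (χ.Φ (q.1.1 + (q.2 / 2) • (‖q.1.2‖⁻¹ • q.1.2)) + q.2 • χ.ν) ^ 2)) ?_
  have h1 : Measurable fun q : (E n × E n) × ℝ =>
      ({p : E n × ℝ | 0 < p.2 ∧ p.2 ≤ ‖p.1‖}.indicator (1 : E n × ℝ → ℝ≥0∞)) (q.1.2, q.2) :=
    (measurable_one.indicator measurableSet_slant).comp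
      ((measurable_snd.comp measurable_fst).prodMk measurable_snd)
  have h2 : Measurable fun q : (E n × E n) × ℝ =>
      χ.Φ (q.1.1 + (q.2 / 2) • (‖q.1.2‖⁻¹ • q.1.2)) + q.2 • χ.ν :=
    (hΦ.comp (by fun_prop)).add (by fun_prop)
  exact h1.mul ((by fun_prop : Measurable fun q : (E n × E n) × ℝ =>
    ENNReal.ofReal (q.2 ^ (1 / 2 : ℝ))).mul ((hD.comp h2).pow_const 2))

/-- On the region `t ≤ ‖h‖` the quantities `‖h‖` and `t + ‖h‖` are comparable. The resulting `t ^
(-1/2)` cancels the weight `t ^ (1/2)` of `slantEnergy`. -/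
theorem exists_lintegral_tail_le (n : ℕ) : ∃ C : ℝ≥0, ∀ t : ℝ, 0 < t →
    ∫⁻ h : E n, {p : E n × ℝ | 0 < p.2 ∧ p.2 ≤ ‖p.1‖}.indicator 1 (h, t) *
      ENNReal.ofReal (‖h‖ ^ (-(n + 1 / 2) : ℝ)) ≤ C * ENNReal.ofReal (t ^ (-(1 / 2) : ℝ)) := by
  set Ω := (volume (Metric.ball (0 : E n) 1)).toNNReal
  set B : ℝ := (n + 1 / 2 : ℝ) / ((n + 1 / 2 : ℝ) - n) with hB
  have hB0 : 0 ≤ B := by rw [hB, add_sub_cancel_left]; positivity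
  refine ⟨((2 : ℝ) ^ (n + 1 / 2 : ℝ)).toNNReal * (Ω * B.toNNReal), fun t ht => ?_⟩
  calc _ ≤ ∫⁻ h : E n, ENNReal.ofReal ((2 : ℝ) ^ (n + 1 / 2 : ℝ)) *
        ENNReal.ofReal ((t + ‖h‖) ^ (-(n + 1 / 2) : ℝ)) := by
        refine lintegral_mono fun h => ?_
        by_cases hh : 0 < t ∧ t ≤ ‖h‖
        · rw [indicator_of_mem (show (h, t) ∈ {p : E n × ℝ | 0 < p.2 ∧ p.2 ≤ ‖p.1‖} from hh),
            Pi.one_apply, one_mul, ← ENNReal.ofReal_mul (by positivity)]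
          refine ENNReal.ofReal_le_ofReal ?_
          have h0 : 0 < ‖h‖ := hh.1.trans_le hh.2
          rw [Real.rpow_neg h0.le, Real.rpow_neg (by positivity), ← div_eq_mul_inv,
            le_div_iff₀ (by positivity), inv_mul_le_iff₀ (by positivity),
            ← Real.mul_rpow h0.le (by positivity)]
          gcongr
          linarith [hh.2]
        · rw [indicator_of_notMem (show (h, t) ∉ {p : E n × ℝ | 0 < p.2 ∧ p.2 ≤ ‖p.1‖} from hh),
            zero_mul]
          exact zero_le
    _ ≤ ENNReal.ofReal ((2 : ℝ) ^ (n + 1 / 2 : ℝ)) * (Ω * ENNReal.ofReal (B *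
        t ^ (n - (n + 1 / 2) : ℝ))) := by
        rw [lintegral_const_mul' _ _ ENNReal.ofReal_ne_top]
        gcongr
        exact lintegral_shift_rpow_le (by fun_prop) (fun _ => norm_nonneg _)
          (fun s hs => by simpa using volume_norm_sub_lt (0 : E n) s hs) (by linarith) ht
    _ = _ := by
        rw [ENNReal.ofReal_mul hB0, sub_add_cancel_left]
        push_cast
        simp only [ENNReal.ofReal]
        ring

/-- Fubini for the slanted energy. -/
theorem exists_lintegral_slantEnergy_le (n : ℕ) : ∃ C : ℝ≥0, ∀ (Γ : Set (E (n + 1)))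
    (χ : GraphChart Γ) (D : E (n + 1) → ℝ≥0∞), Measurable D →
    ∫⁻ a, ∫⁻ h, slantEnergy χ D a h ≤ C * ∫⁻ x, D x ^ 2 := by
  obtain ⟨C, hC⟩ := exists_lintegral_tail_le n
  refine ⟨C, fun Γ χ D hD => ?_⟩
  have hΦ := χ.continuous_Φ.measurable
  set P : ℝ → ℝ≥0∞ := fun t => ∫⁻ a, D (χ.Φ a + t • χ.ν) ^ 2 with hP
  have hPm : Measurable P := Measurable.lintegral_prod_right'
    (f := fun q : ℝ × E n => D (χ.Φ q.2 + q.1 • χ.ν) ^ 2) ((hD.comp ((hΦ.comp measurable_snd).add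
      (by fun_prop))).pow_const 2)
  have hind : Measurable ({p : E n × ℝ | 0 < p.2 ∧ p.2 ≤ ‖p.1‖}.indicator
      (1 : E n × ℝ → ℝ≥0∞)) := measurable_one.indicator measurableSet_slant
  -- For fixed `h` and `t`, the base of the point on the slanted segment is a translate of `a`; the
  -- integral in `a` is therefore the energy `P t` of a full horizontal slice.
  have inner : ∀ h : E n, ∫⁻ a, slantEnergy χ D a h =
      ∫⁻ t, ENNReal.ofReal (‖h‖ ^ (-(n + 1 / 2) : ℝ)) *
        ({p : E n × ℝ | 0 < p.2 ∧ p.2 ≤ ‖p.1‖}.indicator 1 (h, t) *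
          (ENNReal.ofReal (t ^ (1 / 2 : ℝ)) * P t)) := by
    intro h
    have hih : Measurable fun t => ({p : E n × ℝ | 0 < p.2 ∧ p.2 ≤ ‖p.1‖}.indicator
      (1 : E n × ℝ → ℝ≥0∞)) (h, t) := hind.comp (measurable_const.prodMk measurable_id)
    simp only [slantEnergy_eq]
    rw [lintegral_const_mul' _ _ ENNReal.ofReal_ne_top, lintegral_const_mul' _ _ ENNReal.ofReal_ne_top]
    congr 1
    rw [lintegral_lintegral_swap]
    · congr 1 with t
      have hm : Measurable fun a => D (χ.Φ (a + (t / 2) • (‖h‖⁻¹ • h)) + t • χ.ν) ^ 2 :=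
        (hD.comp ((hΦ.comp (by fun_prop)).add_const _)).pow_const 2
      rw [lintegral_const_mul _ (by fun_prop), lintegral_const_mul _ hm]
      congr 2
      exact lintegral_add_right_eq_self (fun a => D (χ.Φ a + t • χ.ν) ^ 2) _
    · refine Measurable.aemeasurable ((hih.comp measurable_snd).mul
        ((by fun_prop : Measurable fun q : E n × ℝ => ENNReal.ofReal (q.2 ^ (1 / 2 : ℝ))).mul
          ((hD.comp (Measurable.add (hΦ.comp ?_) ?_)).pow_const 2)))
      all_goals fun_prop
  calc _ = ∫⁻ h, ∫⁻ a, slantEnergy χ D a h :=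
        lintegral_lintegral_swap (measurable_slantEnergy χ hD).aemeasurable
    _ = ∫⁻ t, ∫⁻ h : E n, ENNReal.ofReal (‖h‖ ^ (-(n + 1 / 2) : ℝ)) *
        ({p : E n × ℝ | 0 < p.2 ∧ p.2 ≤ ‖p.1‖}.indicator 1 (h, t) *
          (ENNReal.ofReal (t ^ (1 / 2 : ℝ)) * P t)) := by
        simp only [inner]
        refine lintegral_lintegral_swap (Measurable.aemeasurable ?_)
        exact (by fun_prop : Measurable fun q : E n × ℝ =>
          ENNReal.ofReal (‖q.1‖ ^ (-(n + 1 / 2) : ℝ))).mul (hind.mul (by fun_prop))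
    _ ≤ ∫⁻ t, C * P t := by
        refine lintegral_mono fun t => ?_
        rcases le_or_gt t 0 with ht | ht
        · have : ∀ h : E n, (h, t) ∉ {p : E n × ℝ | 0 < p.2 ∧ p.2 ≤ ‖p.1‖} :=
            fun h hh => absurd hh.1 ht.not_gt
          simp [indicator_of_notMem (this _)]
        · have hih : Measurable fun h => ({p : E n × ℝ | 0 < p.2 ∧ p.2 ≤ ‖p.1‖}.indicator
            (1 : E n × ℝ → ℝ≥0∞)) (h, t) := hind.comp (measurable_id.prodMk measurable_const)
          have e : ∀ h : E n, ENNReal.ofReal (‖h‖ ^ (-(n + 1 / 2) : ℝ)) *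
              ({p : E n × ℝ | 0 < p.2 ∧ p.2 ≤ ‖p.1‖}.indicator 1 (h, t) *
                (ENNReal.ofReal (t ^ (1 / 2 : ℝ)) * P t)) =
              ({p : E n × ℝ | 0 < p.2 ∧ p.2 ≤ ‖p.1‖}.indicator 1 (h, t) *
                ENNReal.ofReal (‖h‖ ^ (-(n + 1 / 2) : ℝ))) *
                (ENNReal.ofReal (t ^ (1 / 2 : ℝ)) * P t) := fun h => by ring
          simp only [e]
          rw [lintegral_mul_const _ (by fun_prop)]
          refine (mul_le_mul_left (hC t ht) _).trans (le_of_eq ?_)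
          rw [mul_assoc, ← mul_assoc (ENNReal.ofReal _), ← ENNReal.ofReal_mul (by positivity),
            ← Real.rpow_add ht]
          simp
    _ = C * ∫⁻ t, P t := lintegral_const_mul' _ _ ENNReal.coe_ne_top
    _ = _ := by
        rw [χ.lintegral_eq (hD.pow_const 2) χ.F, hP, lintegral_lintegral_swap]
        · rfl
        · refine Measurable.aemeasurable ((hD.comp (Measurable.add (hΦ.comp ?_) ?_)).pow_const 2)
          all_goals fun_prop

/-- The oscillation along a slanted segment. -/
theorem enorm_sub_slant_sq_le (χ : GraphChart Γ) {φ : E (n + 1) → ℂ} (hφ : ContDiff ℝ 1 φ)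
    {a b : E n} (ha : a ∈ Metric.ball χ.c χ.ρ) (hb : b ∈ Metric.ball χ.c χ.ρ) (hab : a ≠ b) :
    ‖φ (χ.Φ ((1 / 2 : ℝ) • (a + b)) + ‖b - a‖ • χ.ν) - φ (χ.Φ a)‖ₑ ^ 2 ≤
      (1 + χ.L) ^ 2 * (ENNReal.ofReal (2 * ‖b - a‖ ^ (1 / 2 : ℝ)) *
        ∫⁻ t in Ioc 0 ‖b - a‖, ENNReal.ofReal (t ^ (1 / 2 : ℝ)) *
          ‖fderiv ℝ φ (χ.Φ (a + (t / 2) • (‖b - a‖⁻¹ • (b - a))) + t • χ.ν)‖ₑ ^ 2) := by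
  set T := ‖b - a‖ with hT
  have hT0 : 0 < T := norm_pos_iff.2 (sub_ne_zero.2 hab.symm)
  set e : E n := T⁻¹ • (b - a) with he
  have he1 : ‖e‖ = 1 := by rw [he, norm_smul, norm_inv, Real.norm_of_nonneg hT0.le]; field_simp; rfl
  -- The path covers half of the way from `a` to `b` in the base while rising to height `T = ‖b -
  -- a‖`. The path starting at `b` ends at the same apex.
  set γ : ℝ → E (n + 1) := fun t => χ.Φ (a + (t / 2) • e) + t • χ.ν with hγ
  have hγ0 : γ 0 = χ.Φ a := by simp [hγ]
  have hγT : γ T = χ.Φ ((1 / 2 : ℝ) • (a + b)) + T • χ.ν := by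
    have : a + (T / 2) • e = (1 / 2 : ℝ) • (a + b) := by
      rw [he, smul_smul, show T / 2 * T⁻¹ = 1 / 2 by field_simp, smul_add, smul_sub]
      module
    rw [hγ]; simp only [this]
  have hmem : ∀ t ∈ Icc 0 T, a + (t / 2) • e ∈ Metric.ball χ.c (3 * χ.ρ) := by
    intro t ht
    refine χ.ball_one_subset ?_
    have h1 := (convex_ball χ.c χ.ρ).add_smul_sub_mem ha hb
      (t := t / 2 * T⁻¹) ⟨by have := ht.1; positivity, by
        rw [← div_eq_mul_inv, div_le_one hT0]; linarith [ht.2]⟩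
    rwa [he, smul_smul]
  have hγd : ∀ t, HasDerivAt γ (fderiv ℝ χ.Φ (a + (t / 2) • e) ((1 / 2 : ℝ) • e) + χ.ν) t := by
    intro t
    have h1 : HasDerivAt (fun t : ℝ => a + (t / 2) • e) ((1 / 2 : ℝ) • e) t :=
      (((hasDerivAt_id t).div_const 2).smul_const e).const_add a
    have h2 := (χ.hasFDerivAt_Φ (a + (t / 2) • e)).differentiableAt.hasFDerivAt.comp_hasDerivAt t h1
    have h3 : HasDerivAt (fun t : ℝ => t • χ.ν) χ.ν t := by
      simpa using (hasDerivAt_id t).smul_const χ.ν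
    exact h2.add h3
  have hγC : ContDiff ℝ 1 γ := (χ.contDiff_Φ.comp (by fun_prop)).add (by fun_prop)
  have hbd : ∀ t ∈ Icc 0 T, ‖deriv (φ ∘ γ) t‖ₑ ≤ (1 + χ.L) * ‖fderiv ℝ φ (γ t)‖ₑ := by
    intro t ht
    rw [((hφ.differentiable one_ne_zero (γ t)).hasFDerivAt.comp_hasDerivAt t (hγd t)).deriv,
      mul_comm]
    have h1 : ‖fderiv ℝ χ.Φ (a + (t / 2) • e)‖ ≤ χ.L :=
      norm_fderiv_le_of_lipschitzOn ℝ (Metric.isOpen_ball.mem_nhds (hmem t ht)) χ.lip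
    have h2 : ‖fderiv ℝ χ.Φ (a + (t / 2) • e) ((1 / 2 : ℝ) • e) + χ.ν‖ ≤ 1 + χ.L := by
      refine (norm_add_le _ _).trans ?_
      rw [χ.norm_ν, add_comm]
      gcongr
      refine (ContinuousLinearMap.le_opNorm _ _).trans ?_
      rw [norm_smul, he1]
      have := χ.L.coe_nonneg
      norm_num
      linarith
    have h3 := (ContinuousLinearMap.le_opNorm (fderiv ℝ φ (γ t)) _).trans
      (mul_le_mul_of_nonneg_left h2 (norm_nonneg _))
    have h4 := ENNReal.ofReal_le_ofReal h3
    rw [ofReal_norm, ENNReal.ofReal_mul (norm_nonneg _), ofReal_norm,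
      ENNReal.ofReal_add zero_le_one χ.L.coe_nonneg, ENNReal.ofReal_one,
      ENNReal.ofReal_coe_nnreal] at h4
    exact h4
  have h1 : ‖φ (γ T) - φ (γ 0)‖ₑ ≤ (1 + χ.L) * ∫⁻ t in Ioc 0 T, ‖fderiv ℝ φ (γ t)‖ₑ := by
    have := enorm_sub_le_lintegral_deriv_of_contDiffOn_Icc (f := φ ∘ γ)
      (hφ.comp hγC).contDiffOn hT0.le
    refine this.trans ?_
    rw [← lintegral_const_mul' _ _ (by finiteness), restrict_Ioc_eq_restrict_Icc]
    exact setLIntegral_mono' measurableSet_Icc hbd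
  have hDm : Measurable fun t => ‖fderiv ℝ φ (γ t)‖ₑ :=
    ((hφ.continuous_fderiv one_ne_zero).comp hγC.continuous).enorm.measurable
  -- Cauchy-Schwarz with `1 = t ^ (-1/4) t ^ (1/4)`. Without the weight the final kernel would be
  -- `‖h‖ ^ (-n)`, whose tail is not integrable on `E n` when `n ≥ 1`.
  have h2 : (∫⁻ t in Ioc 0 T, ‖fderiv ℝ φ (γ t)‖ₑ) ^ 2 ≤ ENNReal.ofReal (2 * T ^ (1 / 2 : ℝ)) *
      ∫⁻ t in Ioc 0 T, ENNReal.ofReal (t ^ (1 / 2 : ℝ)) * ‖fderiv ℝ φ (γ t)‖ₑ ^ 2 := by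
    have h := lintegral_mul_sq_le (μ := volume.restrict (Ioc 0 T))
      (u := fun t => ENNReal.ofReal (t ^ (-(1 / 4) : ℝ)))
      (v := fun t => ENNReal.ofReal (t ^ (1 / 4 : ℝ)) * ‖fderiv ℝ φ (γ t)‖ₑ)
      (by fun_prop) (by fun_prop)
    have e1 : ∫⁻ t in Ioc 0 T, ENNReal.ofReal (t ^ (-(1 / 4) : ℝ)) *
        (ENNReal.ofReal (t ^ (1 / 4 : ℝ)) * ‖fderiv ℝ φ (γ t)‖ₑ) =
        ∫⁻ t in Ioc 0 T, ‖fderiv ℝ φ (γ t)‖ₑ := by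
      refine setLIntegral_congr_fun measurableSet_Ioc fun t ht => ?_
      rw [← mul_assoc, ← ENNReal.ofReal_mul (Real.rpow_nonneg ht.1.le _), ← Real.rpow_add ht.1]
      simp
    have e2 : ∫⁻ t in Ioc 0 T, ENNReal.ofReal (t ^ (-(1 / 4) : ℝ)) ^ 2 =
        ENNReal.ofReal (2 * T ^ (1 / 2 : ℝ)) := by
      rw [show 2 * T ^ (1 / 2 : ℝ) = T ^ (1 / 2 : ℝ) / (1 / 2) by ring,
        ← lintegral_Ioc_rpow (by norm_num) hT0]
      refine setLIntegral_congr_fun measurableSet_Ioc fun t ht => ?_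
      rw [← ENNReal.ofReal_pow (Real.rpow_nonneg ht.1.le _), ← Real.rpow_mul_natCast ht.1.le]
      norm_num
    have e3 : ∫⁻ t in Ioc 0 T, (ENNReal.ofReal (t ^ (1 / 4 : ℝ)) * ‖fderiv ℝ φ (γ t)‖ₑ) ^ 2 =
        ∫⁻ t in Ioc 0 T, ENNReal.ofReal (t ^ (1 / 2 : ℝ)) * ‖fderiv ℝ φ (γ t)‖ₑ ^ 2 := by
      refine setLIntegral_congr_fun measurableSet_Ioc fun t ht => ?_
      rw [mul_pow, ← ENNReal.ofReal_pow (Real.rpow_nonneg ht.1.le _),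
        ← Real.rpow_mul_natCast ht.1.le]
      norm_num
    rwa [e1, e2, e3] at h
  rw [hγ0, hγT] at h1
  calc _ ≤ ((1 + χ.L) * ∫⁻ t in Ioc 0 T, ‖fderiv ℝ φ (γ t)‖ₑ) ^ 2 := by gcongr
    _ ≤ _ := by rw [mul_pow]; gcongr

/-- The increment is split at the common apex of the two slanted paths, and the distance on the
surface is at least the distance of the parameters. The factor `T ^ (1/2)` from Cauchy-Schwarz turns
`T ^ (-(n + 1))` into `T ^ (-(n + 1/2))`. -/
theorem gagliardo_integrand_le (χ : GraphChart Γ) {φ : E (n + 1) → ℂ} (hφ : ContDiff ℝ 1 φ)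
    {a b : E n} (ha : a ∈ Metric.ball χ.c χ.ρ) (hb : b ∈ Metric.ball χ.c χ.ρ) :
    ENNReal.ofReal (‖φ (χ.Φ a) - φ (χ.Φ b)‖ ^ 2 / ‖χ.Φ a - χ.Φ b‖ ^ (n + 1)) ≤
      8 * (1 + χ.L) ^ 2 * (slantEnergy χ (fun x => ‖fderiv ℝ φ x‖ₑ) a (b - a) +
        slantEnergy χ (fun x => ‖fderiv ℝ φ x‖ₑ) b (a - b)) := by
  rcases eq_or_ne a b with rfl | hab
  · simp
  have h1 := enorm_sub_slant_sq_le χ hφ ha hb hab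
  have h2 := enorm_sub_slant_sq_le χ hφ hb ha hab.symm
  rw [add_comm b a, norm_sub_rev a b] at h2
  set m := φ (χ.Φ ((1 / 2 : ℝ) • (a + b)) + ‖b - a‖ • χ.ν) with hm
  set T := ‖b - a‖ with hT
  have hT0 : 0 < T := norm_pos_iff.2 (sub_ne_zero.2 hab.symm)
  have h3 : ‖φ (χ.Φ a) - φ (χ.Φ b)‖ₑ ^ 2 ≤ 4 * (‖m - φ (χ.Φ a)‖ₑ ^ 2 + ‖m - φ (χ.Φ b)‖ₑ ^ 2) := by
    refine le_trans ?_ (add_sq_le_four_mul _ _)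
    gcongr
    calc ‖φ (χ.Φ a) - φ (χ.Φ b)‖ₑ = ‖(m - φ (χ.Φ b)) - (m - φ (χ.Φ a))‖ₑ := by congr 1; ring
      _ ≤ _ := (enorm_sub_le).trans (by rw [add_comm])
  have h4 : ENNReal.ofReal (‖φ (χ.Φ a) - φ (χ.Φ b)‖ ^ 2 / ‖χ.Φ a - χ.Φ b‖ ^ (n + 1)) ≤
      ENNReal.ofReal (T ^ (-(n + 1 : ℕ) : ℝ)) * ‖φ (χ.Φ a) - φ (χ.Φ b)‖ₑ ^ 2 := by
    rw [← ofReal_norm, ← ENNReal.ofReal_pow (norm_nonneg _), ← ENNReal.ofReal_mul (by positivity)]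
    refine ENNReal.ofReal_le_ofReal ?_
    rw [Real.rpow_neg hT0.le, Real.rpow_natCast, div_eq_inv_mul]
    gcongr
    rw [hT, norm_sub_rev]
    exact χ.norm_sub_le_graph χ.F a b
  have h5 : ENNReal.ofReal (T ^ (-(n + 1 : ℕ) : ℝ)) * ENNReal.ofReal (2 * T ^ (1 / 2 : ℝ)) =
      2 * ENNReal.ofReal (T ^ (-(n + 1 / 2) : ℝ)) := by
    rw [← ENNReal.ofReal_ofNat 2, ← ENNReal.ofReal_mul (by positivity),
      ← ENNReal.ofReal_mul (by norm_num), mul_left_comm, ← Real.rpow_add hT0]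
    congr 3
    push_cast; ring
  rw [slantEnergy, slantEnergy, norm_sub_rev a b, ← hT]
  refine h4.trans ((mul_le_mul_right (h3.trans (mul_le_mul_right (add_le_add h1 h2) _)) _).trans
    (le_of_eq ?_))
  generalize (∫⁻ t in Ioc 0 T, ENNReal.ofReal (t ^ (1 / 2 : ℝ)) *
    ‖fderiv ℝ φ (χ.Φ (a + (t / 2) • (T⁻¹ • (b - a))) + t • χ.ν)‖ₑ ^ 2) = I
  generalize (∫⁻ t in Ioc 0 T, ENNReal.ofReal (t ^ (1 / 2 : ℝ)) *
    ‖fderiv ℝ φ (χ.Φ (b + (t / 2) • (T⁻¹ • (a - b))) + t • χ.ν)‖ₑ ^ 2) = J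
  calc _ = 4 * (1 + (χ.L : ℝ≥0∞)) ^ 2 * ((ENNReal.ofReal (T ^ (-(n + 1 : ℕ) : ℝ)) *
        ENNReal.ofReal (2 * T ^ (1 / 2 : ℝ))) * I + (ENNReal.ofReal (T ^ (-(n + 1 : ℕ) : ℝ)) *
        ENNReal.ofReal (2 * T ^ (1 / 2 : ℝ))) * J) := by ring
    _ = _ := by rw [h5]; ring

end

/-! ### From slanted energies to the trace estimate -/

section

variable {n : ℕ} {Γ : Set (E (n + 1))}

theorem lintegral_add_slant {S : E n → E n → ℝ≥0∞}
    (hSm : Measurable fun p : E n × E n => S p.1 p.2) :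
    ∫⁻ a, ∫⁻ b, (S a (b - a) + S b (a - b)) = 2 * ∫⁻ a, ∫⁻ h, S a h := by
  have hSm1 : Measurable fun p : E n × E n => S p.1 (p.2 - p.1) :=
    hSm.comp (by fun_prop : Measurable fun p : E n × E n => (p.1, p.2 - p.1))
  have hSm2 : Measurable fun p : E n × E n => S p.2 (p.1 - p.2) :=
    hSm.comp (by fun_prop : Measurable fun p : E n × E n => (p.2, p.1 - p.2))
  have e1 : ∀ a, ∫⁻ b, S a (b - a) = ∫⁻ h, S a h := fun a => lintegral_sub_right_eq_self (S a) a
  have e2 : ∫⁻ a, ∫⁻ b, S b (a - b) = ∫⁻ a, ∫⁻ h, S a h := by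
    rw [lintegral_lintegral_swap hSm2.aemeasurable]
    simp only [e1]
  have e3 : ∀ a, ∫⁻ b, (S a (b - a) + S b (a - b)) =
      (∫⁻ b, S a (b - a)) + ∫⁻ b, S b (a - b) := fun a =>
    lintegral_add_left (hSm1.comp (by fun_prop : Measurable fun b : E n => (a, b))) _
  simp only [e3]
  rw [lintegral_add_left (Measurable.lintegral_prod_right' (f := fun p : E n × E n =>
    S p.1 (p.2 - p.1)) hSm1), e2]
  simp only [e1]
  rw [two_mul]

theorem setLIntegral_cyl_gagliardo_le (χ : GraphChart Γ) {φ : E (n + 1) → ℂ}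
    (hφ : ContDiff ℝ 1 φ) :
    ∫⁻ x in χ.cyl, (∫⁻ y in χ.cyl, ENNReal.ofReal (‖φ x - φ y‖ ^ 2 / ‖x - y‖ ^ (n + 1)) ∂surf Γ)
      ∂surf Γ ≤ (χ.L : ℝ≥0∞) ^ n * (χ.L : ℝ≥0∞) ^ n * (16 * (1 + χ.L) ^ 2) *
        ∫⁻ a, ∫⁻ h, slantEnergy χ (fun x => ‖fderiv ℝ φ x‖ₑ) a h := by
  have hSm := measurable_slantEnergy χ (hφ.continuous_fderiv one_ne_zero).enorm.measurable
  have key := fun a ha b hb => gagliardo_integrand_le χ hφ (a := a) (b := b) ha hb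
  have h2 := lintegral_add_slant hSm
  generalize slantEnergy χ (fun x => ‖fderiv ℝ φ x‖ₑ) = S at key h2 ⊢
  have hl : (χ.L : ℝ≥0∞) ^ n ≠ ⊤ := by finiteness
  have hc8 : (8 * (1 + χ.L) ^ 2 : ℝ≥0∞) ≠ ⊤ := by finiteness
  have i1 : ∀ a ∈ Metric.ball χ.c χ.ρ, (∫⁻ y in χ.cyl,
      ENNReal.ofReal (‖φ (χ.Φ a) - φ y‖ ^ 2 / ‖χ.Φ a - y‖ ^ (n + 1)) ∂surf Γ) ≤
      (χ.L : ℝ≥0∞) ^ n * (8 * (1 + χ.L) ^ 2 * ∫⁻ b, (S a (b - a) + S b (a - b))) := by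
    intro a ha
    refine (χ.setLIntegral_cyl_le _).trans (mul_le_mul_right ?_ _)
    rw [← lintegral_const_mul' _ _ hc8]
    exact (setLIntegral_mono' measurableSet_ball fun b hb =>
      key a ha b hb).trans (setLIntegral_le_lintegral _ _)
  refine (χ.setLIntegral_cyl_le _).trans ?_
  refine (mul_le_mul_right ((setLIntegral_mono' measurableSet_ball i1).trans
    (setLIntegral_le_lintegral _ _)) _).trans ?_
  rw [lintegral_const_mul' _ _ hl, lintegral_const_mul' _ _ hc8, h2]
  exact le_of_eq (by ring)

theorem lintegral_sum_cyl [IsFiniteMeasure (surf Γ)] (s : Finset (GraphChart Γ))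
    {K : E (n + 1) → E (n + 1) → ℝ≥0∞}
    (hKm : Measurable fun p : E (n + 1) × E (n + 1) => K p.1 p.2) :
    (Measurable fun p : E (n + 1) × E (n + 1) => ∑ χ ∈ s,
      χ.cyl.indicator (fun x => χ.cyl.indicator (fun y => K x y) p.2) p.1) ∧
    ∫⁻ x, (∫⁻ y, (∑ χ ∈ s, χ.cyl.indicator (fun x => χ.cyl.indicator (fun y => K x y) y) x)
      ∂surf Γ) ∂surf Γ = ∑ χ ∈ s, ∫⁻ x in χ.cyl, (∫⁻ y in χ.cyl, K x y ∂surf Γ) ∂surf Γ := by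
  have im : ∀ χ : GraphChart Γ, Measurable fun p : E (n + 1) × E (n + 1) =>
      χ.cyl.indicator (fun x => χ.cyl.indicator (fun y => K x y) p.2) p.1 := by
    intro χ
    have : (fun p : E (n + 1) × E (n + 1) =>
      χ.cyl.indicator (fun x => χ.cyl.indicator (fun y => K x y) p.2) p.1) =
        (χ.cyl ×ˢ χ.cyl).indicator fun p => K p.1 p.2 := by
      ext p
      by_cases h1 : p.1 ∈ χ.cyl <;> by_cases h2 : p.2 ∈ χ.cyl <;>
        simp [indicator, h1, h2]
    rw [this]
    exact hKm.indicator (χ.isOpen_cyl.measurableSet.prod χ.isOpen_cyl.measurableSet)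
  have im' : ∀ (χ : GraphChart Γ) (x : E (n + 1)), Measurable fun y =>
      χ.cyl.indicator (fun x => χ.cyl.indicator (fun y => K x y) y) x := by
    intro χ x
    have hx : Measurable (K x) := hKm.of_uncurry_left
    by_cases h : x ∈ χ.cyl
    · simp only [indicator_of_mem h]
      exact hx.indicator χ.isOpen_cyl.measurableSet
    · simp only [indicator_of_notMem h]
      exact measurable_const
  refine ⟨Finset.measurable_fun_sum _ fun χ _ => im χ, ?_⟩
  have e1 : ∀ x, ∫⁻ y, (∑ χ ∈ s,
        χ.cyl.indicator (fun x => χ.cyl.indicator (fun y => K x y) y) x) ∂surf Γ =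
      ∑ χ ∈ s, χ.cyl.indicator (fun x => ∫⁻ y in χ.cyl, K x y ∂surf Γ) x := by
    intro x
    rw [lintegral_finsetSum s (f := fun χ y =>
      χ.cyl.indicator (fun x => χ.cyl.indicator (fun y => K x y) y) x) fun χ _ => im' χ x]
    refine Finset.sum_congr rfl fun χ _ => ?_
    by_cases hx : x ∈ χ.cyl
    · simp only [indicator_of_mem hx]
      exact lintegral_indicator χ.isOpen_cyl.measurableSet _
    · simp only [indicator_of_notMem hx, lintegral_zero]
  have e2 : ∀ χ : GraphChart Γ, Measurable fun x => ∫⁻ y in χ.cyl, K x y ∂surf Γ := fun χ =>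
    Measurable.lintegral_prod_right' (f := fun p : E (n + 1) × E (n + 1) => K p.1 p.2) hKm
  simp only [e1]
  rw [lintegral_finsetSum _ fun χ _ => (e2 χ).indicator χ.isOpen_cyl.measurableSet]
  exact Finset.sum_congr rfl fun χ _ => lintegral_indicator χ.isOpen_cyl.measurableSet _

/-- By a Lebesgue number `δ` of the covering, two surface points closer than `δ` lie in a common
cylinder, where the slanted paths apply. For the other pairs the kernel is at most `δ ^ (-(n + 1))`
and the `L²` norm on the surface suffices. -/
theorem exists_gagliardo_le (hc : IsCompact Γ) (h : IsLocallyC11Graph Γ) :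
    ∃ C : ℝ≥0, ∀ φ : E (n + 1) → ℂ, ContDiff ℝ 1 φ →
      gagliardo Γ φ ≤ C * ((∫⁻ x, ‖φ x‖ₑ ^ 2 ∂surf Γ) + ∫⁻ x, ‖fderiv ℝ φ x‖ₑ ^ 2) := by
  have : IsFiniteMeasure (surf Γ) := ⟨surf_lt_top hc h⟩
  obtain ⟨s, hs⟩ := exists_finite_cover hc h
  obtain ⟨C, hC⟩ := exists_lintegral_slantEnergy_le n
  obtain ⟨δ, hδ, hleb⟩ := lebesgue_number_lemma_of_metric (c := fun χ : s => χ.1.cyl) hc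
    (fun χ => χ.1.isOpen_cyl) (fun x hx => by
      obtain ⟨χ, hχ, hx⟩ := mem_iUnion₂.1 (hs hx)
      exact mem_iUnion.2 ⟨⟨χ, hχ⟩, hx⟩)
  set M : ℝ≥0 := ∑ χ ∈ s, χ.L ^ n * χ.L ^ n * (16 * (1 + χ.L) ^ 2) * C with hM
  set N : ℝ≥0 := ((δ ^ (n + 1))⁻¹).toNNReal * 4 * (2 * (surf Γ univ).toNNReal) with hN
  refine ⟨M + N, fun φ hφ => ?_⟩
  set K : E (n + 1) → E (n + 1) → ℝ≥0∞ := fun x y =>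
    ENNReal.ofReal (‖φ x - φ y‖ ^ 2 / ‖x - y‖ ^ (n + 1)) with hK
  have hφm : Measurable φ := hφ.continuous.measurable
  have hKm : Measurable fun p : E (n + 1) × E (n + 1) => K p.1 p.2 := by fun_prop
  have hgm : Measurable fun x => ‖φ x‖ₑ ^ 2 := by fun_prop
  set I := ∫⁻ x, ‖φ x‖ₑ ^ 2 ∂surf Γ with hI
  set J := ∫⁻ x, ‖fderiv ℝ φ x‖ₑ ^ 2 with hJ
  set c : ℝ≥0∞ := ENNReal.ofReal (δ ^ (n + 1))⁻¹ * 4 with hcdef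
  have hΓm : MeasurableSet Γ := hc.isClosed.measurableSet
  have mem : ∀ᵐ x ∂surf Γ, x ∈ Γ := ae_restrict_mem hΓm
  have pt : ∀ x ∈ Γ, ∀ y ∈ Γ, K x y ≤ (∑ χ ∈ s, χ.cyl.indicator
      (fun x => χ.cyl.indicator (fun y => K x y) y) x) + c * (‖φ x‖ₑ ^ 2 + ‖φ y‖ₑ ^ 2) := by
    intro x hx y hy
    rcases lt_or_ge (dist y x) δ with hd | hd
    · obtain ⟨χ, hχ⟩ := hleb x hx
      refine le_add_right (le_trans ?_ (Finset.single_le_sum (f := fun χ : GraphChart Γ =>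
        χ.cyl.indicator (fun x => χ.cyl.indicator (fun y => K x y) y) x)
        (fun _ _ => zero_le) χ.2))
      rw [indicator_of_mem (hχ (Metric.mem_ball_self hδ)), indicator_of_mem (hχ hd)]
    · refine le_add_left ?_
      rw [hcdef, mul_assoc]
      refine le_trans ?_ (mul_le_mul_right (add_sq_le_four_mul ‖φ x‖ₑ ‖φ y‖ₑ) _)
      refine le_trans ?_ (mul_le_mul_right (ENNReal.pow_le_pow_left (enorm_sub_le (a := φ x))) _)
      rw [hK, ← ofReal_norm, ← ENNReal.ofReal_pow (norm_nonneg _),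
        ← ENNReal.ofReal_mul (by positivity)]
      refine ENNReal.ofReal_le_ofReal ?_
      rw [div_eq_inv_mul]
      rw [dist_comm, dist_eq_norm] at hd
      gcongr
  set T : E (n + 1) → E (n + 1) → ℝ≥0∞ := fun x y =>
    ∑ χ ∈ s, χ.cyl.indicator (fun x => χ.cyl.indicator (fun y => K x y) y) x with hT
  have hTm : Measurable fun p : E (n + 1) × E (n + 1) => T p.1 p.2 :=
    (lintegral_sum_cyl s hKm).1
  have h1 : gagliardo Γ φ ≤ ∫⁻ x, (∫⁻ y, (T x y + c * (‖φ x‖ₑ ^ 2 + ‖φ y‖ₑ ^ 2)) ∂surf Γ)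
        ∂surf Γ := by
    refine lintegral_mono_ae ?_
    filter_upwards [mem] with x hx
    refine lintegral_mono_ae ?_
    filter_upwards [mem] with y hy
    exact pt x hx y hy
  have h2 : ∀ x, ∫⁻ y, (T x y + c * (‖φ x‖ₑ ^ 2 + ‖φ y‖ₑ ^ 2)) ∂surf Γ =
      (∫⁻ y, T x y ∂surf Γ) + c * (‖φ x‖ₑ ^ 2 * surf Γ univ + I) := by
    intro x
    rw [lintegral_add_right _ (by fun_prop), lintegral_const_mul _ (by fun_prop),
      lintegral_add_right _ hgm, lintegral_const]
  have h3 : ∫⁻ x, (∫⁻ y, T x y ∂surf Γ) ∂surf Γ ≤ M * J := by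
    rw [(lintegral_sum_cyl s hKm).2, hM]
    push_cast
    rw [Finset.sum_mul]
    refine Finset.sum_le_sum fun χ _ => ?_
    refine (setLIntegral_cyl_gagliardo_le χ hφ).trans ?_
    refine (mul_le_mul_right (hC Γ χ _
      (hφ.continuous_fderiv one_ne_zero).enorm.measurable) _).trans (le_of_eq ?_)
    rw [← mul_assoc]
  have h4 : ∫⁻ x, c * (‖φ x‖ₑ ^ 2 * surf Γ univ + I) ∂surf Γ = N * I := by
    rw [lintegral_const_mul _ (by fun_prop), lintegral_add_right _ measurable_const,
      lintegral_mul_const _ hgm, lintegral_const, hN, hcdef]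
    push_cast
    rw [ENNReal.coe_toNNReal (measure_ne_top _ _), ENNReal.ofReal]
    ring
  refine h1.trans ?_
  simp only [h2]
  rw [lintegral_add_right _ (by fun_prop), h4]
  push_cast
  calc _ ≤ M * J + N * I := add_le_add h3 le_rfl
    _ ≤ (M + N) * J + (M + N) * I :=
      add_le_add (mul_le_mul_left le_self_add _) (mul_le_mul_left le_add_self _)
    _ = _ := by ring

/-- The boundary value is compared with the values on a vertical segment of length one, averaged
over the segment. The segment may leave the cylinder, which is harmless as the right-hand side is
integrated over the whole space. -/
theorem setLIntegral_cyl_enorm_sq_le (χ : GraphChart Γ) {φ : E (n + 1) → ℂ}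
    (hφ : ContDiff ℝ 1 φ) :
    ∫⁻ x in χ.cyl, ‖φ x‖ₑ ^ 2 ∂surf Γ ≤ (χ.L : ℝ≥0∞) ^ n * (4 *
      ((∫⁻ x, ‖φ x‖ₑ ^ 2) + ∫⁻ x, ‖fderiv ℝ φ x‖ₑ ^ 2)) := by
  have hΦ := χ.continuous_Φ
  have hD : Continuous (fderiv ℝ φ) := hφ.continuous_fderiv one_ne_zero
  have hφc := hφ.continuous
  have pt : ∀ a, ‖φ (χ.Φ a)‖ₑ ^ 2 ≤ 4 * ((∫⁻ t in Ioc (0 : ℝ) 1, ‖φ (χ.Φ a + t • χ.ν)‖ₑ ^ 2) +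
      ∫⁻ t in Ioc (0 : ℝ) 1, ‖fderiv ℝ φ (χ.Φ a + t • χ.ν)‖ₑ ^ 2) := by
    intro a
    set γ : ℝ → E (n + 1) := fun t => χ.Φ a + t • χ.ν with hγ
    have hγC : ContDiff ℝ 1 γ := by fun_prop
    have hγd : ∀ t, HasDerivAt γ χ.ν t := fun t => by
      have := ((hasDerivAt_id t).smul_const χ.ν).const_add (χ.Φ a)
      rwa [one_smul] at this
    have hbd : ∀ t, ‖deriv (φ ∘ γ) t‖ₑ ≤ ‖fderiv ℝ φ (γ t)‖ₑ := by
      intro t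
      rw [((hφ.differentiable one_ne_zero (γ t)).hasFDerivAt.comp_hasDerivAt t (hγd t)).deriv]
      have := ENNReal.ofReal_le_ofReal ((fderiv ℝ φ (γ t)).le_opNorm χ.ν)
      rwa [χ.norm_ν, mul_one, ofReal_norm, ofReal_norm] at this
    set J := ∫⁻ t in Ioc (0 : ℝ) 1, ‖fderiv ℝ φ (γ t)‖ₑ ^ 2 with hJ
    have hJ1 : (∫⁻ t in Ioc (0 : ℝ) 1, ‖fderiv ℝ φ (γ t)‖ₑ) ^ 2 ≤ J := by
      have := lintegral_mul_sq_le (μ := volume.restrict (Ioc (0 : ℝ) 1)) (u := fun _ => 1)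
        (v := fun t => ‖fderiv ℝ φ (γ t)‖ₑ) (by fun_prop) (by fun_prop)
      simpa using this
    have hs : ∀ t ∈ Ioc (0 : ℝ) 1, ‖φ (χ.Φ a)‖ₑ ^ 2 ≤ 4 * (‖φ (γ t)‖ₑ ^ 2 + J) := by
      intro t ht
      have h1 := enorm_sub_le_lintegral_deriv_of_contDiffOn_Icc (f := φ ∘ γ)
        (hφ.comp hγC).contDiffOn ht.1.le
      have h2 : ‖φ (γ t) - φ (γ 0)‖ₑ ≤ ∫⁻ t in Ioc (0 : ℝ) 1, ‖fderiv ℝ φ (γ t)‖ₑ := by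
        refine h1.trans ((lintegral_mono hbd).trans ?_)
        rw [← restrict_Ioc_eq_restrict_Icc]
        exact lintegral_mono_set (Ioc_subset_Ioc_right ht.2)
      have h3 : φ (χ.Φ a) = φ (γ t) - (φ (γ t) - φ (γ 0)) := by simp [hγ]
      rw [h3]
      refine (ENNReal.pow_le_pow_left enorm_sub_le).trans ((add_sq_le_four_mul _ _).trans ?_)
      exact mul_le_mul_right (add_le_add le_rfl ((ENNReal.pow_le_pow_left h2).trans hJ1)) _
    have h4 := setLIntegral_mono' (μ := volume) measurableSet_Ioc hs
    rw [lintegral_const, Measure.restrict_apply_univ, Real.volume_Ioc, sub_zero, ENNReal.ofReal_one,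
      mul_one, lintegral_const_mul' _ _ (by finiteness), lintegral_add_right _ measurable_const,
      lintegral_const, Measure.restrict_apply_univ, Real.volume_Ioc, sub_zero, ENNReal.ofReal_one,
      mul_one] at h4
    exact h4
  refine (χ.setLIntegral_cyl_le _).trans (mul_le_mul_right ?_ _)
  have hm : Measurable fun a => ∫⁻ t in Ioc (0 : ℝ) 1, ‖φ (χ.Φ a + t • χ.ν)‖ₑ ^ 2 :=
    Measurable.lintegral_prod_right' (f := fun p : E n × ℝ => ‖φ (χ.Φ p.1 + p.2 • χ.ν)‖ₑ ^ 2)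
      (Continuous.measurable (by fun_prop))
  refine (setLIntegral_le_lintegral _ _).trans ((lintegral_mono pt).trans ?_)
  rw [lintegral_const_mul' _ _ (by finiteness), lintegral_add_left hm]
  refine mul_le_mul_right (add_le_add ?_ ?_) _
  · rw [χ.lintegral_eq (by fun_prop : Measurable fun x => ‖φ x‖ₑ ^ 2) χ.F]
    exact lintegral_mono fun a => setLIntegral_le_lintegral _ _
  · rw [χ.lintegral_eq (by fun_prop : Measurable fun x => ‖fderiv ℝ φ x‖ₑ ^ 2) χ.F]
    exact lintegral_mono fun a => setLIntegral_le_lintegral _ _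

theorem enorm_sq_le_sum_coord {d : ℕ} (A : E d →L[ℝ] ℂ) :
    ‖A‖ₑ ^ 2 ≤ d * ∑ i, ‖A (coordVec i)‖ₑ ^ 2 := by
  have h1 : ‖A‖ ≤ ∑ i, ‖A (coordVec i)‖ := by
    refine A.opNorm_le_bound (Finset.sum_nonneg fun _ _ => norm_nonneg _) fun x => ?_
    conv_lhs => rw [← sum_coord_smul x, map_sum]
    rw [Finset.sum_mul]
    refine (norm_sum_le _ _).trans (Finset.sum_le_sum fun i _ => ?_)
    rw [map_smul, norm_smul, mul_comm]
    gcongr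
    exact PiLp.norm_apply_le x i
  have h2 : ‖A‖ ^ 2 ≤ d * ∑ i, ‖A (coordVec i)‖ ^ 2 := by
    have := sq_sum_le_card_mul_sum_sq (s := Finset.univ) (f := fun i => ‖A (coordVec i)‖)
    rw [Finset.card_univ, Fintype.card_fin] at this
    exact (pow_le_pow_left₀ (norm_nonneg _) h1 2).trans this
  have h3 := ENNReal.ofReal_le_ofReal h2
  rw [ENNReal.ofReal_mul (Nat.cast_nonneg _), ENNReal.ofReal_sum_of_nonneg
    (fun _ _ => by positivity), ENNReal.ofReal_natCast, ENNReal.ofReal_pow (norm_nonneg _),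
    ofReal_norm] at h3
  simpa only [ENNReal.ofReal_pow (norm_nonneg _), ofReal_norm] using h3

/-- The trace estimate `H¹(ℝ^d) → H^{1/2}(Γ)` for smooth functions. -/
theorem exists_trace_estimate (hc : IsCompact Γ) (h : IsLocallyC11Graph Γ) :
    ∃ C : ℝ≥0, ∀ φ : E (n + 1) → ℂ, ContDiff ℝ 1 φ →
      (∫⁻ x, ‖φ x‖ₑ ^ 2 ∂surf Γ) + gagliardo Γ φ ≤
        C * ((∫⁻ x, ‖φ x‖ₑ ^ 2) + ∑ i, ∫⁻ x, ‖fderiv ℝ φ x (coordVec i)‖ₑ ^ 2) := by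
  obtain ⟨s, hs⟩ := exists_finite_cover hc h
  obtain ⟨C, hC⟩ := exists_gagliardo_le hc h
  set B : ℝ≥0 := ∑ χ ∈ s, χ.L ^ n * 4 with hB
  refine ⟨(B + C * (B + 1)) * (1 + (n + 1 : ℕ)), fun φ hφ => ?_⟩
  have hφc := hφ.continuous
  have hD : Continuous (fderiv ℝ φ) := hφ.continuous_fderiv one_ne_zero
  have hDi : ∀ i : Fin (n + 1), Continuous fun x => fderiv ℝ φ x (coordVec i) := fun i => by
    fun_prop
  have h1 : ∫⁻ x, ‖φ x‖ₑ ^ 2 ∂surf Γ ≤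
      B * ((∫⁻ x, ‖φ x‖ₑ ^ 2) + ∫⁻ x, ‖fderiv ℝ φ x‖ₑ ^ 2) := by
    refine (lintegral_surf_le_sum hs _).trans ?_
    rw [hB]
    push_cast
    rw [Finset.sum_mul]
    refine Finset.sum_le_sum fun χ _ => (setLIntegral_cyl_enorm_sq_le χ hφ).trans (le_of_eq ?_)
    rw [mul_assoc]
  have h2 := hC φ hφ
  have h3 : ∫⁻ x, ‖fderiv ℝ φ x‖ₑ ^ 2 ≤
      (n + 1 : ℕ) * ∑ i, ∫⁻ x, ‖fderiv ℝ φ x (coordVec i)‖ₑ ^ 2 := by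
    refine (lintegral_mono fun x => enorm_sq_le_sum_coord _).trans ?_
    rw [lintegral_const_mul' _ _ (by finiteness), lintegral_finsetSum _ fun i _ =>
      (hDi i).enorm.measurable.pow_const 2]
  push_cast
  push_cast at h3
  generalize (∫⁻ x, ‖φ x‖ₑ ^ 2) = P at *
  generalize (∫⁻ x, ‖φ x‖ₑ ^ 2 ∂surf Γ) = S at *
  generalize (∫⁻ x, ‖fderiv ℝ φ x‖ₑ ^ 2) = J at *
  generalize (∑ i, ∫⁻ x, ‖fderiv ℝ φ x (coordVec i)‖ₑ ^ 2) = T at *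
  have h4 : P + J ≤ (1 + (n + 1)) * (P + T) := by
    calc P + J ≤ P + (n + 1) * T := add_le_add le_rfl h3
      _ ≤ P + (n + 1) * T + ((n + 1) * P + T) := le_self_add
      _ = _ := by ring
  calc S + gagliardo Γ φ ≤ B * (P + J) + C * (B * (P + J) + J) :=
        add_le_add h1 (h2.trans (mul_le_mul_right (add_le_add h1 le_rfl) _))
    _ ≤ B * (P + J) + C * (B * (P + J) + (P + J)) :=
        add_le_add le_rfl (mul_le_mul_right (add_le_add le_rfl le_add_self) _)
    _ = (B + C * (B + 1)) * (P + J) := by ring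
    _ ≤ (B + C * (B + 1)) * ((1 + (n + 1)) * (P + T)) := mul_le_mul_right h4 _
    _ = _ := by ring

end

section

open scoped SchwartzMap LineDeriv BoundedContinuousFunction FourierTransform Laplacian

variable {d : ℕ}

/-- The Hilbert space `L²(ℝ^d)`. -/
abbrev L2 (d : ℕ) : Type := Lp ℂ 2 (volume : Measure (E d))

/-! ### Square integrable weak derivatives as tempered distributions -/

section Test

variable {ι : Type*} [Fintype ι] {v : ι → E d} {g : ι → E d → ℂ} {F : E d → ℂ}

theorem sum_integral_mul_of_hasCompactSupport (hg : ∀ i, MemLp (g i) 2) (hF : MemLp F 2)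
    (h : ∀ φ : E d → ℝ, ContDiff ℝ ∞ φ → HasCompactSupport φ →
      ∑ i, ∫ x, fderiv ℝ φ x (v i) • g i x = -∫ x, φ x • F x)
    {ψ : E d → ℂ} (hψ : ContDiff ℝ ∞ ψ) (hc : HasCompactSupport ψ) :
    ∑ i, ∫ x, fderiv ℝ ψ x (v i) * g i x = -∫ x, ψ x * F x := by
  have key : ∀ (a : E d → ℝ) (u : E d → ℂ), Continuous a → HasCompactSupport a → MemLp u 2 →
      Integrable fun x => a x • u x := fun a u ha hac hu =>
    (hu.locallyIntegrable (by norm_num)).integrable_smul_left_of_hasCompactSupport ha hac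
  have hre : ContDiff ℝ ∞ fun x => (ψ x).re := Complex.reCLM.contDiff.comp hψ
  have him : ContDiff ℝ ∞ fun x => (ψ x).im := Complex.imCLM.contDiff.comp hψ
  have hrec : HasCompactSupport fun x => (ψ x).re := hc.comp_left (g := Complex.re) rfl
  have himc : HasCompactSupport fun x => (ψ x).im := hc.comp_left (g := Complex.im) rfl
  have hd : ∀ x, DifferentiableAt ℝ ψ x := fun x => hψ.differentiable (by simp) x
  have dre : ∀ x w, fderiv ℝ (fun x => (ψ x).re) x w = (fderiv ℝ ψ x w).re := fun x w =>
     congrArg (· w) (Complex.reCLM.hasFDerivAt.comp x (hd x).hasFDerivAt).fderiv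
  have dim : ∀ x w, fderiv ℝ (fun x => (ψ x).im) x w = (fderiv ℝ ψ x w).im := fun x w =>
     congrArg (· w) (Complex.imCLM.hasFDerivAt.comp x (hd x).hasFDerivAt).fderiv
  have split : ∀ z w : ℂ, z * w = z.re • w + Complex.I * (z.im • w) := fun z w => by
    conv_lhs => rw [← Complex.re_add_im z]
    simp only [Complex.real_smul]
    ring
  have e1 : ∀ i, ∫ x, fderiv ℝ ψ x (v i) * g i x =
      (∫ x, fderiv ℝ (fun x => (ψ x).re) x (v i) • g i x) +
        Complex.I * ∫ x, fderiv ℝ (fun x => (ψ x).im) x (v i) • g i x := by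
    intro i
    have i1 := key _ _ (continuous_fderiv_apply hre (v i))
      (hasCompactSupport_fderiv_apply hrec (v i)) (hg i)
    have i2 := key _ _ (continuous_fderiv_apply him (v i))
      (hasCompactSupport_fderiv_apply himc (v i)) (hg i)
    rw [← integral_const_mul, ← integral_add i1 (i2.const_mul _)]
    refine integral_congr_ae (Eventually.of_forall fun x => ?_)
    simp only [dre, dim]
    exact split _ _
  have e2 : ∫ x, ψ x * F x = (∫ x, (ψ x).re • F x) + Complex.I * ∫ x, (ψ x).im • F x := by
    have i1 := key _ _ hre.continuous hrec hF
    have i2 := key _ _ him.continuous himc hF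
    rw [← integral_const_mul, ← integral_add i1 (i2.const_mul _)]
    exact integral_congr_ae (Eventually.of_forall fun x => split _ _)
  simp only [e1]
  rw [Finset.sum_add_distrib, ← Finset.mul_sum, h _ hre hrec, h _ him himc, e2]
  ring

/-- From test functions to Schwartz functions: the dilated cutoffs tend to `1`, their derivatives
are of the size of the dilation factor, and square integrability of `g` and `F` provides the
domination. -/
theorem sum_integral_mul_schwartz (hg : ∀ i, MemLp (g i) 2) (hF : MemLp F 2)
    (h : ∀ φ : E d → ℝ, ContDiff ℝ ∞ φ → HasCompactSupport φ →
      ∑ i, ∫ x, fderiv ℝ φ x (v i) • g i x = -∫ x, φ x • F x) (ψ : 𝓢(E d, ℂ)) :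
    ∑ i, ∫ x, fderiv ℝ ψ x (v i) * g i x = -∫ x, ψ x * F x := by
  obtain ⟨f, -, -⟩ : ∃ f : ContDiffBump (0 : E d), f.rIn = 1 ∧ f.rOut = 2 :=
    ⟨⟨1, 2, one_pos, one_lt_two⟩, rfl, rfl⟩
  have hf : ContDiff ℝ ∞ f := f.contDiff
  have hfc : HasCompactSupport f := f.hasCompactSupport
  obtain ⟨C, hC⟩ := (hf.continuous_fderiv (by simp)).bounded_above_of_compact_support
    (hfc.fderiv (𝕜 := ℝ))
  set a : ℕ → ℝ := fun k => ((k : ℝ) + 1)⁻¹ with ha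
  have ha0 : ∀ k, 0 < a k := fun k => by simp only [ha]; positivity
  have ha1 : ∀ k, a k ≤ 1 := fun k => inv_le_one_of_one_le₀ (by simp)
  have hat : Tendsto a atTop (𝓝 0) := tendsto_one_div_add_atTop_nhds_zero_nat.congr fun k => by
    simp [ha]
  set χ : ℕ → E d → ℝ := fun k x => f (a k • x) with hχ
  have hχs : ∀ k, ContDiff ℝ ∞ (χ k) := fun k => hf.comp (contDiff_const_smul _)
  have hχc : ∀ k, HasCompactSupport (χ k) := fun k =>
    hfc.comp_homeomorph (Homeomorph.smulOfNeZero (a k) (ha0 k).ne')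
  have hχd : ∀ k x w, fderiv ℝ (χ k) x w = a k * fderiv ℝ f (a k • x) w := by
    intro k x w
    have h1 : HasFDerivAt (χ k)
        ((fderiv ℝ f (a k • x)).comp (a k • ContinuousLinearMap.id ℝ (E d))) x :=
      HasFDerivAt.comp (g := f) (f := fun x => a k • x) x (hf.differentiable (by simp) _).hasFDerivAt
        ((ContinuousLinearMap.id ℝ (E d)).hasFDerivAt.const_smul (a k))
    rw [h1.fderiv]
    simp
  have hχb : ∀ k x, ‖(χ k x : ℂ)‖ ≤ 1 := fun k x => by
    rw [Complex.norm_real, Real.norm_of_nonneg f.nonneg]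
    exact f.le_one
  have hχt : ∀ x, Tendsto (fun k => (χ k x : ℂ)) atTop (𝓝 1) := by
    intro x
    have h1 : Tendsto (fun k => a k • x) atTop (𝓝 0) := by simpa using hat.smul_const x
    have h2 : Tendsto (fun k => f (a k • x)) atTop (𝓝 (f 0)) := (hf.continuous.tendsto 0).comp h1
    rw [f.one_of_mem_closedBall (Metric.mem_closedBall_self f.rIn_pos.le)] at h2
    exact (Complex.continuous_ofReal.tendsto 1).comp h2
  have hψd : ∀ x, DifferentiableAt ℝ ψ x := fun x => ψ.differentiableAt
  have hpd : ∀ k x w, fderiv ℝ (fun x => (χ k x : ℂ) * ψ x) x w =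
      χ k x * fderiv ℝ ψ x w + ((a k * fderiv ℝ f (a k • x) w : ℝ) : ℂ) * ψ x := by
    intro k x w
    have h1 : HasFDerivAt (fun x => (χ k x : ℂ)) (Complex.ofRealCLM.comp (fderiv ℝ (χ k) x)) x :=
      Complex.ofRealCLM.hasFDerivAt.comp x ((hχs k).differentiable (by simp) x).hasFDerivAt
    rw [show (fun x => (χ k x : ℂ) * ψ x) = (fun x => (χ k x : ℂ)) * ψ from rfl,
      (h1.mul (hψd x).hasFDerivAt).fderiv]
    simp only [add_apply, smul_apply, ContinuousLinearMap.comp_apply, Complex.ofRealCLM_apply,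
      smul_eq_mul, hχd]
    ring
  have main : ∀ k, ∑ i, ∫ x, (χ k x * fderiv ℝ ψ x (v i) +
      ((a k * fderiv ℝ f (a k • x) (v i) : ℝ) : ℂ) * ψ x) * g i x =
        -∫ x, (χ k x * ψ x) * F x := by
    intro k
    have := sum_integral_mul_of_hasCompactSupport hg hF h (ψ := fun x => (χ k x : ℂ) * ψ x)
      ((Complex.ofRealCLM.contDiff.comp (hχs k)).mul (ψ.smooth ⊤))
      (HasCompactSupport.mul_right ((hχc k).comp_left (g := ((↑) : ℝ → ℂ)) rfl))
    simpa only [hpd] using this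
  have hfm : ∀ k w, Continuous fun x => fderiv ℝ f (a k • x) w := fun k w =>
    (continuous_fderiv_apply hf w).comp (continuous_const_smul _)
  have lim1 : ∀ i, Tendsto (fun k => ∫ x, (χ k x * fderiv ℝ ψ x (v i) +
      ((a k * fderiv ℝ f (a k • x) (v i) : ℝ) : ℂ) * ψ x) * g i x) atTop
        (𝓝 (∫ x, fderiv ℝ ψ x (v i) * g i x)) := by
    intro i
    have hψ1 : MemLp (fun x => fderiv ℝ ψ x (v i)) 2 := 
      SchwartzMap.memLp (∂_{v i} ψ : 𝓢(E d, ℂ)) 2 volume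
    have hψ0 : MemLp ψ 2 := ψ.memLp 2
    refine tendsto_integral_of_dominated_convergence
      (fun x => (‖fderiv ℝ ψ x (v i)‖ + C * ‖v i‖ * ‖ψ x‖) * ‖g i x‖) (fun k => ?_) ?_
      (fun k => Eventually.of_forall fun x => ?_) (Eventually.of_forall fun x => ?_)
    · refine AEStronglyMeasurable.mul (Continuous.aestronglyMeasurable ?_) (hg i).1
      have h1 := (hχs k).continuous
      have h2 : Continuous fun x => fderiv ℝ ψ x (v i) := (∂_{v i} ψ : 𝓢(E d, ℂ)).continuous
      have h3 := ψ.continuous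
      have h4 := hfm k (v i)
      exact ((Complex.continuous_ofReal.comp h1).mul h2).add
        ((Complex.continuous_ofReal.comp (continuous_const.mul h4)).mul h3)
    · exact (hψ1.norm.add (hψ0.norm.const_mul _)).integrable_mul (hg i).norm
    · rw [norm_mul]
      gcongr
      refine (norm_add_le _ _).trans ?_
      rw [norm_mul, norm_mul]
      gcongr
      · exact mul_le_of_le_one_left (norm_nonneg _) (hχb k x)
      · rw [Complex.norm_real, Real.norm_eq_abs, abs_mul, abs_of_pos (ha0 k)]
        refine (mul_le_of_le_one_left (abs_nonneg _) (ha1 k)).trans ?_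
        refine ((fderiv ℝ f (a k • x)).le_opNorm (v i)).trans ?_
        gcongr
        exact hC _
    · have h1 : Tendsto (fun k => ((a k * fderiv ℝ f (a k • x) (v i) : ℝ) : ℂ)) atTop (𝓝 0) := by
        rw [tendsto_zero_iff_norm_tendsto_zero]
        have hb : ∀ k, ‖((a k * fderiv ℝ f (a k • x) (v i) : ℝ) : ℂ)‖ ≤ a k * (C * ‖v i‖) := by
          intro k
          rw [Complex.norm_real, Real.norm_eq_abs, abs_mul, abs_of_pos (ha0 k)]
          refine mul_le_mul_of_nonneg_left ?_ (ha0 k).le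
          refine ((fderiv ℝ f (a k • x)).le_opNorm (v i)).trans ?_
          gcongr
          exact hC _
        exact squeeze_zero (fun _ => norm_nonneg _) hb (by simpa using hat.mul_const (C * ‖v i‖))
      have := (((hχt x).mul_const (fderiv ℝ ψ x (v i))).add (h1.mul_const (ψ x))).mul_const (g i x)
      simpa using this
  have lim2 : Tendsto (fun k => ∫ x, (χ k x * ψ x) * F x) atTop (𝓝 (∫ x, ψ x * F x)) := by
    refine tendsto_integral_of_dominated_convergence (fun x => ‖ψ x‖ * ‖F x‖) (fun k => ?_) ?_
      (fun k => Eventually.of_forall fun x => ?_) (Eventually.of_forall fun x => ?_)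
    · exact ((Complex.continuous_ofReal.comp (hχs k).continuous).mul
        ψ.continuous).aestronglyMeasurable.mul hF.1
    · exact (ψ.memLp 2).norm.integrable_mul hF.norm
    · rw [norm_mul, norm_mul]
      gcongr
      exact mul_le_of_le_one_left (norm_nonneg _) (hχb k x)
    · simpa using ((hχt x).mul_const (ψ x)).mul_const (F x)
  have lim3 := tendsto_finsetSum (Finset.univ : Finset ι) fun i _ => lim1 i
  simp only [main] at lim3
  exact tendsto_nhds_unique lim3 lim2.neg

/-- With a one-point index type this transfers a single weak derivative, and with the coordinate
vectors a weak divergence; both uses occur below. -/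
theorem sum_lineDerivOp_eq (hg : ∀ i, MemLp (g i) 2) (hF : MemLp F 2)
    (h : ∀ φ : E d → ℝ, ContDiff ℝ ∞ φ → HasCompactSupport φ →
      ∑ i, ∫ x, fderiv ℝ φ x (v i) • g i x = -∫ x, φ x • F x) :
    ∑ i, ∂_{v i} (((hg i).toLp (g i) : L2 d) : 𝓢'(E d, ℂ)) =
      ((hF.toLp F : L2 d) : 𝓢'(E d, ℂ)) := by
  ext ψ
  have h1 := sum_integral_mul_schwartz hg hF h ψ
  have h2 : ∀ i, (∂_{v i} (((hg i).toLp (g i) : L2 d) :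
      𝓢'(E d, ℂ))) ψ = -∫ x, fderiv ℝ ψ x (v i) * g i x := by
    intro i
    rw [TemperedDistribution.lineDerivOp_apply_apply, Lp.toTemperedDistribution_apply,
      ← integral_neg]
    refine integral_congr_ae ?_
    filter_upwards [(hg i).coeFn_toLp] with x hx
    rw [hx, neg_apply, SchwartzMap.lineDerivOp_apply_eq_fderiv, smul_eq_mul, neg_mul]
  have h3 : ((hF.toLp F : L2 d) : 𝓢'(E d, ℂ)) ψ = ∫ x, ψ x * F x := by
    rw [Lp.toTemperedDistribution_apply]
    refine integral_congr_ae ?_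
    filter_upwards [hF.coeFn_toLp] with x hx
    rw [hx, smul_eq_mul]
  rw [sum_apply, h3, Finset.sum_congr rfl fun i _ => h2 i,
    Finset.sum_neg_distrib, h1, neg_neg]

end Test

/-! ### Bounded Fourier multipliers and second derivatives -/

/-- Plancherel: the distributional multiplier agrees on `L²` with multiplication of the Fourier
transform by a bounded function. -/
theorem exists_fourierMultiplierCLM_eq {g : E d → ℂ} (hg : g.HasTemperateGrowth) {C : ℝ}
    (hC : ∀ x, ‖g x‖ ≤ C) (w : L2 d) :
    ∃ w' : L2 d, ‖w'‖ ≤ C * ‖w‖ ∧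
      TemperedDistribution.fourierMultiplierCLM ℂ g (w : 𝓢'(E d, ℂ)) = (w' : 𝓢'(E d, ℂ)) := by
  have hgc : Continuous g := hg.1.continuous
  have hgm : MemLp g ⊤ (volume : Measure (E d)) :=
    memLp_top_of_bound hgc.aestronglyMeasurable C (Eventually.of_forall hC)
  have hC0 : 0 ≤ C := (norm_nonneg _).trans (hC 0)
  set m : Lp ℂ ⊤ (volume : Measure (E d)) := hgm.toLp g with hm
  set z : L2 d := m • (𝓕 w : L2 d) with hz
  have h1 : ‖(𝓕⁻ z : L2 d)‖ = ‖z‖ := by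
    rw [← Lp.norm_fourier_eq, FourierTransform.fourier_fourierInv_eq]
  have h2 : ‖m‖ ≤ C := by
    rw [hm, Lp.norm_toLp]
    refine ENNReal.toReal_le_of_le_ofReal hC0 ?_
    refine (eLpNorm_le_of_ae_bound (Eventually.of_forall hC)).trans ?_
    simp
  refine ⟨𝓕⁻ z, ?_, ?_⟩
  · rw [h1, ← Lp.norm_fourier_eq w]
    exact (Lp.norm_smul_le _ _).trans (mul_le_mul_of_nonneg_right h2 (norm_nonneg _))
  · rw [← Lp.fourierInv_toTemperedDistribution_eq, hz, hm, Lp.toTemperedDistribution_smul_eq hg hgm,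
      TemperedDistribution.fourierMultiplierCLM_apply, Lp.fourier_toTemperedDistribution_eq]

theorem toTemperedDistribution_smul (c : ℂ) (f : L2 d) :
    ((c • f : L2 d) : 𝓢'(E d, ℂ)) = c • (f : 𝓢'(E d, ℂ)) := by
  rw [← Lp.toTemperedDistributionCLM_apply, map_smul, Lp.toTemperedDistributionCLM_apply]

theorem toTemperedDistribution_sub (f g : L2 d) :
    ((f - g : L2 d) : 𝓢'(E d, ℂ)) = (f : 𝓢'(E d, ℂ)) - (g : 𝓢'(E d, ℂ)) := by
  rw [← Lp.toTemperedDistributionCLM_apply, map_sub, Lp.toTemperedDistributionCLM_apply,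
    Lp.toTemperedDistributionCLM_apply]

theorem eq_zero_of_toTemperedDistribution_eq_zero {f : L2 d} (h : (f : 𝓢'(E d, ℂ)) = 0) :
    f = 0 := by
  have h1 := Lp.ker_toTemperedDistributionCLM_eq_bot (E := E d) (F := ℂ) (μ := volume) (p := 2)
  rw [LinearMap.ker_eq_bot'] at h1
  exact h1 f h

/-- In the normalization of the Fourier transform used here, `Δ` has symbol `-(2π)² ‖ξ‖²`, whence
the factor `(2π)⁻²`. -/
theorem fourierMultiplierCLM_one_add_norm_sq (v : 𝓢'(E d, ℂ)) :
    TemperedDistribution.fourierMultiplierCLM ℂ (fun x : E d => ((1 + ‖x‖ ^ 2 : ℝ) : ℂ)) v =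
      v - ((2 * (Real.pi : ℂ)) ^ 2)⁻¹ • Δ v := by
  have h1 : (fun x : E d => ((1 + ‖x‖ ^ 2 : ℝ) : ℂ)) =
      (fun _ => (1 : ℂ)) + fun x : E d => Complex.ofReal (‖x‖ ^ 2) := by
    ext x
    simp
  have h2 : TemperedDistribution.fourierMultiplierCLM ℂ
      (fun x : E d => ((1 + ‖x‖ ^ 2 : ℝ) : ℂ)) v = v +
      TemperedDistribution.fourierMultiplierCLM ℂ (fun x : E d => Complex.ofReal (‖x‖ ^ 2)) v := by
    rw [h1, TemperedDistribution.fourierMultiplierCLM_apply,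
      TemperedDistribution.smulLeftCLM_add (by fun_prop) (by fun_prop), add_apply,
      FourierTransform.fourierInv_add, ← TemperedDistribution.fourierMultiplierCLM_apply,
      ← TemperedDistribution.fourierMultiplierCLM_apply,
      TemperedDistribution.fourierMultiplierCLM_const]
    simp
  rw [h2, TemperedDistribution.laplacian_eq_fourierMultiplierCLM, ← Complex.coe_smul, smul_smul]
  push_cast
  rw [mul_neg, inv_mul_cancel₀ (by simp [Real.pi_ne_zero]), neg_one_smul, sub_neg_eq_add]

/-- The second derivative is `(2πi)²` times the multiplier `ξᵢ ξⱼ / (1 + ‖ξ‖²)`, bounded by `1`,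
applied to `(1 - (2π)⁻² Δ) v`, which is in `L²` by assumption. -/
theorem exists_second_lineDerivOp (d : ℕ) : ∃ C : ℝ, 0 ≤ C ∧ ∀ v F : L2 d,
    Δ (v : 𝓢'(E d, ℂ)) = (F : 𝓢'(E d, ℂ)) → ∀ i j : Fin d,
      ∃ G : L2 d, ‖G‖ ≤ C * (‖v‖ + ‖F‖) ∧
        ∂_{coordVec j} (∂_{coordVec i} (v : 𝓢'(E d, ℂ))) = (G : 𝓢'(E d, ℂ)) := by
  refine ⟨‖(2 * (Real.pi : ℂ) * Complex.I) ^ 2‖ * (1 + ‖((2 * (Real.pi : ℂ)) ^ 2)⁻¹‖), by positivity,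
    fun v F hF i j => ?_⟩
  set c : ℂ := ((2 * (Real.pi : ℂ)) ^ 2)⁻¹ with hc
  set w : L2 d := v - c • F with hw
  have hwd : TemperedDistribution.fourierMultiplierCLM ℂ (fun x : E d => ((1 + ‖x‖ ^ 2 : ℝ) : ℂ))
      (v : 𝓢'(E d, ℂ)) = (w : 𝓢'(E d, ℂ)) := by
    rw [fourierMultiplierCLM_one_add_norm_sq, hF, hw, toTemperedDistribution_sub,
      toTemperedDistribution_smul]
  have hwn : ‖w‖ ≤ (1 + ‖c‖) * (‖v‖ + ‖F‖) := by
    refine (norm_sub_le _ _).trans ?_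
    rw [norm_smul]
    nlinarith [norm_nonneg v, norm_nonneg F, norm_nonneg c, mul_nonneg (norm_nonneg c) (norm_nonneg v)]
  set m : E d → ℂ := fun x => ((inner ℝ x (coordVec i) * inner ℝ x (coordVec j) *
    (1 + ‖x‖ ^ 2) ^ (-1 : ℝ) : ℝ) : ℂ) with hm
  have hmg : m.HasTemperateGrowth := by fun_prop
  have hmb : ∀ x, ‖m x‖ ≤ 1 := by
    intro x
    have h1 : ∀ i : Fin d, |inner ℝ x (coordVec i)| ≤ ‖x‖ := fun i => by
      simpa using abs_real_inner_le_norm x (coordVec i)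
    rw [hm, Complex.norm_real, Real.norm_eq_abs, abs_mul, abs_mul, Real.rpow_neg_one,
      abs_of_pos (by positivity : (0 : ℝ) < (1 + ‖x‖ ^ 2)⁻¹), ← div_eq_mul_inv,
      div_le_one (by positivity)]
    calc _ ≤ ‖x‖ * ‖x‖ := mul_le_mul (h1 i) (h1 j) (abs_nonneg _) (norm_nonneg _)
      _ ≤ _ := by nlinarith
  obtain ⟨w', hw', hwe⟩ := exists_fourierMultiplierCLM_eq hmg hmb w
  refine ⟨(2 * Real.pi * Complex.I) ^ 2 • w', ?_, ?_⟩
  · rw [norm_smul, mul_assoc ‖(2 * (Real.pi : ℂ) * Complex.I) ^ 2‖]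
    exact mul_le_mul_of_nonneg_left (by linarith) (norm_nonneg _)
  · rw [TemperedDistribution.lineDeriv_eq_fourierMultiplierCLM,
      TemperedDistribution.lineDeriv_eq_fourierMultiplierCLM, map_smul,
      TemperedDistribution.fourierMultiplierCLM_fourierMultiplierCLM_apply (by fun_prop)
        (by fun_prop), smul_smul, ← sq, toTemperedDistribution_smul, ← hwe, ← hwd,
      TemperedDistribution.fourierMultiplierCLM_fourierMultiplierCLM_apply (by fun_prop) hmg]
    congr 3
    ext x
    simp only [Pi.mul_apply, hm]
    rw [Real.rpow_neg_one, ← Complex.ofReal_mul, ← Complex.ofReal_mul]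
    congr 1
    field_simp

theorem lineDerivOp_toLp {i : Fin d} {u g : E d → ℂ} (hu : MemLp u 2) (hg : MemLp g 2)
    (h : HasWeakPartial univ i u g) :
    ∂_{coordVec i} ((hu.toLp u : L2 d) : 𝓢'(E d, ℂ)) = ((hg.toLp g : L2 d) : 𝓢'(E d, ℂ)) := by
  have := sum_lineDerivOp_eq (ι := Unit) (v := fun _ => coordVec i) (g := fun _ => u) (F := g)
    (fun _ => hu) hg (fun φ hφ hc => by
      simpa using h.eq_integral hφ hc (subset_univ _))
  simpa using this

theorem integral_fderiv_smul_of_lineDerivOp {i : Fin d} {u g : L2 d}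
    (h : ∂_{coordVec i} (u : 𝓢'(E d, ℂ)) = (g : 𝓢'(E d, ℂ))) {φ : E d → ℝ}
    (hφ : ContDiff ℝ ∞ φ) (hc : HasCompactSupport φ) :
    ∫ x, fderiv ℝ φ x (coordVec i) • u x = -∫ x, φ x • g x := by
  have hφ' : ContDiff ℝ ∞ fun x => (φ x : ℂ) := Complex.ofRealCLM.contDiff.comp hφ
  have hc' : HasCompactSupport fun x => (φ x : ℂ) := hc.comp_left (g := ((↑) : ℝ → ℂ)) rfl
  have h1 := congrArg (fun T : 𝓢'(E d, ℂ) => T (hc'.toSchwartzMap hφ')) h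
  simp only [TemperedDistribution.lineDerivOp_apply_apply, Lp.toTemperedDistribution_apply] at h1
  have e : ∀ x, (-∂_{coordVec i} (hc'.toSchwartzMap hφ') : 𝓢(E d, ℂ)) x =
      -((fderiv ℝ φ x (coordVec i) : ℝ) : ℂ) := by
    intro x
    rw [neg_apply, SchwartzMap.lineDerivOp_apply_eq_fderiv]
    exact congrArg (fun A : E d →L[ℝ] ℂ => -A (coordVec i))
      (Complex.ofRealCLM.hasFDerivAt.comp x (hφ.differentiable (by simp) x).hasFDerivAt).fderiv
  simp only [e] at h1
  rw [← neg_eq_iff_eq_neg, ← integral_neg]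
  simpa [neg_mul] using h1

theorem hasWeakPartial_of_lineDerivOp {i : Fin d} {u g : L2 d}
    (h : ∂_{coordVec i} (u : 𝓢'(E d, ℂ)) = (g : 𝓢'(E d, ℂ))) : HasWeakPartial univ i u g :=
  hasWeakPartial_of_integral (((Lp.memLp u).locallyIntegrable (by norm_num)).locallyIntegrableOn _)
    (((Lp.memLp g).locallyIntegrable (by norm_num)).locallyIntegrableOn _)
    fun _ h1 h2 _ => integral_fderiv_smul_of_lineDerivOp h h1 h2

end

/-! ### Elliptic regularity on the whole space -/

section

open scoped SchwartzMap LineDeriv Laplacian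

variable {d : ℕ}

theorem laplacian_eq_sum_coordVec (f : 𝓢'(E d, ℂ)) :
    Δ f = ∑ i : Fin d, ∂_{coordVec i} (∂_{coordVec i} f) := by
  have := TemperedDistribution.laplacian_eq_sum (EuclideanSpace.basisFun (Fin d) ℝ) f
  simpa using this

theorem norm_toLp_eq {u : E d → ℂ} (hu : MemLp u 2) : ‖(hu.toLp u : L2 d)‖ = l2Norm volume u :=
  Lp.norm_toLp u hu

theorem l2Norm_coe (u : L2 d) : l2Norm volume u = ‖u‖ := (Lp.norm_def u).symm

/-- Interior regularity on the whole space. -/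
theorem exists_isH2On_univ (d : ℕ) : ∃ C : ℝ, 0 ≤ C ∧ ∀ (v : E d → ℂ) (g : Fin d → E d → ℂ)
    (F : E d → ℂ), MemLp v 2 → (∀ i, MemLp (g i) 2) → MemLp F 2 →
    (∀ i, HasWeakPartial univ i v (g i)) →
    (∀ φ : E d → ℝ, ContDiff ℝ ∞ φ → HasCompactSupport φ →
      ∑ i, ∫ x, fderiv ℝ φ x (coordVec i) • g i x = -∫ x, φ x • F x) →
    ∃ G, IsH2On univ v g G
      (C * (l2Norm volume v + l2Norm volume F) + ∑ i, l2Norm volume (g i)) := by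
  obtain ⟨C, hC, hex⟩ := exists_second_lineDerivOp d
  refine ⟨1 + C, by positivity, fun v g F hv hg hF hvg hdiv => ?_⟩
  have h1 := sum_lineDerivOp_eq hg hF hdiv
  have h2 := fun i => lineDerivOp_toLp hv (hg i) (hvg i)
  have h3 : Δ ((hv.toLp v : L2 d) : 𝓢'(E d, ℂ)) = ((hF.toLp F : L2 d) : 𝓢'(E d, ℂ)) := by
    rw [laplacian_eq_sum_coordVec, ← h1]
    exact Finset.sum_congr rfl fun i _ => by rw [h2 i]
  choose G hGn hG using hex _ _ h3
  simp only [h2] at hG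
  have hs : 0 ≤ ∑ i, l2Norm volume (g i) := Finset.sum_nonneg fun _ _ => l2Norm_nonneg
  have hv0 : 0 ≤ l2Norm volume v := l2Norm_nonneg
  have hF0 : 0 ≤ l2Norm volume F := l2Norm_nonneg
  have hM : C * (l2Norm volume v + l2Norm volume F) ≤
      (1 + C) * (l2Norm volume v + l2Norm volume F) := by gcongr; linarith
  refine ⟨fun i j => G i j, hvg, fun i j => ?_, ?_, ?_, ?_, ?_, ?_, ?_⟩
  · exact (hasWeakPartial_of_lineDerivOp (hG i j)).congr
      (ae_restrict_of_ae (hg i).coeFn_toLp) .rfl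
  all_goals rw [Measure.restrict_univ]
  · exact hv
  · exact hg
  · exact fun i j => Lp.memLp _
  · nlinarith
  · intro i
    have := Finset.single_le_sum (f := fun i => l2Norm volume (g i)) (fun _ _ => l2Norm_nonneg)
      (Finset.mem_univ i)
    have h0 : 0 ≤ (1 + C) * (l2Norm volume v + l2Norm volume F) := by positivity
    linarith
  · intro i j
    have := hGn i j
    rw [norm_toLp_eq, norm_toLp_eq] at this
    rw [l2Norm_coe]
    linarith

/-! ### Density of test functions in `H¹(ℝ^d)` -/

/-- The Hilbert space containing the graph of the scaled gradient. -/
abbrev GradSpace (d : ℕ) : Type := PiLp 2 fun _ : Option (Fin d) => L2 d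

/-- The graphs `(φ, (2π)⁻¹ ∇φ)` of the test functions. -/
def testGraph (d : ℕ) : Submodule ℂ (GradSpace d) where
  carrier := {x | ∃ φ : E d → ℂ, ContDiff ℝ ∞ φ ∧ HasCompactSupport φ ∧ x none =ᵐ[volume] φ ∧
    ∀ i, x (some i) =ᵐ[volume] fun y => (2 * (Real.pi : ℂ))⁻¹ * fderiv ℝ φ y (coordVec i)}
  add_mem' := by
    rintro x y ⟨φ, hφ, hφc, hx, hx'⟩ ⟨ψ, hψ, hψc, hy, hy'⟩
    refine ⟨φ + ψ, hφ.add hψ, hφc.add hψc, ?_, fun i => ?_⟩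
    · exact (Lp.coeFn_add _ _).trans (hx.add hy)
    · refine (Lp.coeFn_add _ _).trans (((hx' i).add (hy' i)).trans (Eventually.of_forall fun z => ?_))
      simp only [Pi.add_apply]
      rw [fderiv_add (hφ.differentiable (by simp) z) (hψ.differentiable (by simp) z), add_apply,
        mul_add]
  zero_mem' := by
    refine ⟨0, contDiff_const, HasCompactSupport.zero, Lp.coeFn_zero _ _ _, fun i => ?_⟩
    refine (Lp.coeFn_zero _ _ _).trans (Eventually.of_forall fun z => ?_)
    have : fderiv ℝ (0 : E d → ℂ) z = 0 := fderiv_const_apply 0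
    simp [this]
  smul_mem' := by
    rintro c x ⟨φ, hφ, hφc, hx, hx'⟩
    refine ⟨c • φ, hφ.const_smul c, hφc.smul_left (f := fun _ => c), ?_, fun i => ?_⟩
    · exact (Lp.coeFn_smul _ _).trans (hx.const_smul c)
    · refine (Lp.coeFn_smul _ _).trans (((hx' i).const_smul c).trans
        (Eventually.of_forall fun z => ?_))
      simp only [Pi.smul_apply]
      rw [fderiv_const_smul (hφ.differentiable (by simp) z), smul_apply, smul_eq_mul, smul_eq_mul]
      ring

theorem memLp_of_test {φ : E d → ℂ} (hφ : Continuous φ) (hc : HasCompactSupport φ)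
    {μ : Measure (E d)} [IsFiniteMeasureOnCompacts μ] : MemLp φ 2 μ :=
  hφ.memLp_of_hasCompactSupport hc

/-- The graph in `GradSpace` of a function with a weak gradient. -/
def gradGraph (u : L2 d) (g : Fin d → L2 d) : GradSpace d :=
  WithLp.toLp 2 fun o => o.elim u fun i => (2 * (Real.pi : ℂ))⁻¹ • g i

/-- The relation holds on graphs of test functions and is closed, because distributional derivatives
are continuous along `L²` convergence. -/
theorem lineDerivOp_of_mem_closure {x : GradSpace d}
    (hx : x ∈ (testGraph d).topologicalClosure) (i : Fin d) :
    ∂_{coordVec i} (x none : 𝓢'(E d, ℂ)) = (2 * (Real.pi : ℂ)) • (x (some i) : 𝓢'(E d, ℂ)) := by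
  have hcl : IsClosed {x : GradSpace d | ∂_{coordVec i} (x none : 𝓢'(E d, ℂ)) =
      (2 * (Real.pi : ℂ)) • (x (some i) : 𝓢'(E d, ℂ))} := by
    have hn : ∀ o : Option (Fin d), Continuous fun x : GradSpace d => (x o : 𝓢'(E d, ℂ)) := fun o =>
      (Lp.toTemperedDistributionCLM (E := E d) ℂ volume 2).continuous.comp (PiLp.continuous_apply 2 _ o)
    exact isClosed_eq ((LineDeriv.lineDerivOpCLM ℂ 𝓢'(E d, ℂ) (coordVec i)).continuous.comp (hn none))
      ((continuous_const_smul (2 * (Real.pi : ℂ))).comp (hn (some i)))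
  refine closure_minimal ?_ hcl hx
  rintro x ⟨φ, hφ, hφc, h0, h1⟩
  have hm0 : MemLp φ 2 := memLp_of_test hφ.continuous hφc
  have hm1 : MemLp (fun y => fderiv ℝ φ y (coordVec i)) 2 :=
    memLp_of_test (continuous_fderiv_apply hφ _) (hasCompactSupport_fderiv_apply hφc _)
  have h2 : HasWeakPartial univ i φ fun y => fderiv ℝ φ y (coordVec i) :=
    hasWeakPartial_of_hasFDerivAt isOpen_univ (Du := fderiv ℝ φ)
      (fun y _ => (hφ.differentiable (by simp) y).hasFDerivAt)
      (continuous_fderiv_apply hφ _).continuousOn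
  have h3 := lineDerivOp_toLp hm0 hm1 h2
  have e0 : hm0.toLp φ = x none := Lp.ext (hm0.coeFn_toLp.trans h0.symm)
  have e1 : hm1.toLp _ = (2 * (Real.pi : ℂ)) • x (some i) := by
    refine Lp.ext (hm1.coeFn_toLp.trans ?_)
    filter_upwards [h1 i, Lp.coeFn_smul (2 * (Real.pi : ℂ)) (x (some i))] with y hy hy'
    rw [hy', Pi.smul_apply, hy, smul_eq_mul, mul_inv_cancel_left₀ (by simp [Real.pi_ne_zero])]
  rw [e0, e1, toTemperedDistribution_smul] at h3
  exact h3

/-- Orthogonality to all test graphs says that the divergence of the scaled gradient part of `q` is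
its function part, that is `(1 - (2π)⁻² Δ) q = 0`. The symbol of this operator is `1 + ‖ξ‖²`,
inverted by a Bessel potential; the factor `(2π)⁻¹` in the graph was put there for this match. -/
theorem eq_zero_of_orthogonal {q : GradSpace d}
    (hq : ∀ i, ∂_{coordVec i} (q none : 𝓢'(E d, ℂ)) =
      (2 * (Real.pi : ℂ)) • (q (some i) : 𝓢'(E d, ℂ)))
    (ho : ∀ x ∈ testGraph d, inner ℂ x q = 0) : q = 0 := by
  set c : ℂ := (2 * (Real.pi : ℂ))⁻¹ with hc
  have hc0 : (2 * (Real.pi : ℂ)) ≠ 0 := by simp [Real.pi_ne_zero]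
  have hcc : conj c = c := by
    rw [hc, map_inv₀, map_mul, Complex.conj_ofReal, Complex.conj_ofNat]
  have h1 : ∀ φ : E d → ℝ, ContDiff ℝ ∞ φ → HasCompactSupport φ →
      ∑ i, ∫ x, fderiv ℝ φ x (coordVec i) • (c • q (some i) : L2 d) x = -∫ x, φ x • q none x := by
    intro φ hφ hφc
    have hψ : ContDiff ℝ ∞ fun x => (φ x : ℂ) := Complex.ofRealCLM.contDiff.comp hφ
    have hψc : HasCompactSupport fun x => (φ x : ℂ) := hφc.comp_left (g := ((↑) : ℝ → ℂ)) rfl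
    have hd : ∀ x i, fderiv ℝ (fun x => (φ x : ℂ)) x (coordVec i) =
        ((fderiv ℝ φ x (coordVec i) : ℝ) : ℂ) := fun x i =>
      congrArg (fun A : E d →L[ℝ] ℂ => A (coordVec i))
        (Complex.ofRealCLM.hasFDerivAt.comp x (hφ.differentiable (by simp) x).hasFDerivAt).fderiv
    have m0 : MemLp (fun x => (φ x : ℂ)) 2 (volume : Measure (E d)) :=
      memLp_of_test hψ.continuous hψc
    have m1 : ∀ i, MemLp (fun y => c * ((fderiv ℝ φ y (coordVec i) : ℝ) : ℂ)) 2
        (volume : Measure (E d)) := by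
      intro i
      have := memLp_of_test (μ := volume) (continuous_fderiv_apply hψ (coordVec i))
        (hasCompactSupport_fderiv_apply hψc (coordVec i))
      simp only [hd] at this
      exact this.const_mul c
    set x : GradSpace d := WithLp.toLp 2 fun o => o.elim (m0.toLp _) fun i => (m1 i).toLp _ with hx
    have hxm : x ∈ testGraph d := by
      refine ⟨_, hψ, hψc, m0.coeFn_toLp, fun i => ?_⟩
      simp only [hd]
      exact (m1 i).coeFn_toLp
    have h2 := ho x hxm
    rw [PiLp.inner_apply, Fintype.sum_option] at h2
    have e0 : inner ℂ (x none) (q none) = ∫ y, φ y • q none y := by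
      rw [L2.inner_def]
      refine integral_congr_ae ?_
      have h3 : x none =ᵐ[volume] fun x => (φ x : ℂ) := m0.coeFn_toLp
      filter_upwards [h3] with y hy
      rw [hy, RCLike.inner_apply, Complex.conj_ofReal, Complex.real_smul, mul_comm]
    have e1 : ∀ i, inner ℂ (x (some i)) (q (some i)) =
        ∫ y, fderiv ℝ φ y (coordVec i) • (c • q (some i) : L2 d) y := by
      intro i
      rw [L2.inner_def]
      refine integral_congr_ae ?_
      have h3 : x (some i) =ᵐ[volume] fun y => c * ((fderiv ℝ φ y (coordVec i) : ℝ) : ℂ) :=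
        (m1 i).coeFn_toLp
      filter_upwards [h3, Lp.coeFn_smul c (q (some i))] with y hy hy'
      rw [hy, hy', RCLike.inner_apply, map_mul, hcc, Complex.conj_ofReal, Complex.real_smul,
        Pi.smul_apply, smul_eq_mul]
      ring
    rw [e0, Finset.sum_congr rfl fun i _ => e1 i] at h2
    linear_combination h2
  have h2 := sum_lineDerivOp_eq (g := fun i => (c • q (some i) : L2 d)) (F := (q none : E d → ℂ))
    (fun i => Lp.memLp _) (Lp.memLp _) h1
  simp only [Lp.toLp_coeFn] at h2
  have h3 : ((2 * (Real.pi : ℂ)) ^ 2)⁻¹ • Δ (q none : 𝓢'(E d, ℂ)) = (q none : 𝓢'(E d, ℂ)) := by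
    rw [laplacian_eq_sum_coordVec, Finset.smul_sum]
    conv_rhs => rw [← h2]
    refine Finset.sum_congr rfl fun i _ => ?_
    rw [hq i, toTemperedDistribution_smul, LineDeriv.lineDerivOp_smul, LineDeriv.lineDerivOp_smul, smul_smul, hc]
    congr 1
    field_simp
  have h4 : TemperedDistribution.besselPotential (E d) ℂ 2 (q none : 𝓢'(E d, ℂ)) = 0 := by
    have := fourierMultiplierCLM_one_add_norm_sq (q none : 𝓢'(E d, ℂ))
    rw [h3, sub_self] at this
    rw [TemperedDistribution.besselPotential]
    convert this using 4 with x
    norm_num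
  have h5 : (q none : 𝓢'(E d, ℂ)) = 0 := by
    have := TemperedDistribution.besselPotential_besselPotential_apply 2 (-2)
      (q none : 𝓢'(E d, ℂ))
    rw [h4, map_zero] at this
    simpa using this.symm
  have h6 : ∀ i, (q (some i) : 𝓢'(E d, ℂ)) = 0 := by
    intro i
    have := hq i
    rw [h5, LineDeriv.lineDerivOp_zero] at this
    exact (smul_eq_zero.1 this.symm).resolve_left hc0
  ext1 o
  cases o with
  | none => exact eq_zero_of_toTemperedDistribution_eq_zero h5
  | some i => exact eq_zero_of_toTemperedDistribution_eq_zero (h6 i)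

/-- Density by duality: the component of the graph of `u` orthogonal to the closure of the test
graphs is itself a graph of a distributional gradient, hence zero by `eq_zero_of_orthogonal`. -/
theorem exists_tendsto_test {u : E d → ℂ} {g : Fin d → E d → ℂ} (hu : MemLp u 2)
    (hg : ∀ i, MemLp (g i) 2) (h : ∀ i, HasWeakPartial univ i u (g i)) :
    ∃ φ : ℕ → E d → ℂ, (∀ k, ContDiff ℝ ∞ (φ k) ∧ HasCompactSupport (φ k)) ∧
      Tendsto (fun k => l2Norm volume fun x => φ k x - u x) atTop (𝓝 0) ∧
      ∀ i, Tendsto (fun k => l2Norm volume fun x => fderiv ℝ (φ k) x (coordVec i) - g i x)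
        atTop (𝓝 0) := by
  have hc0 : (2 * (Real.pi : ℂ)) ≠ 0 := by simp [Real.pi_ne_zero]
  set x : GradSpace d := gradGraph (hu.toLp u) fun i => (hg i).toLp (g i) with hx
  have hxi : ∀ i, ∂_{coordVec i} (x none : 𝓢'(E d, ℂ)) =
      (2 * (Real.pi : ℂ)) • (x (some i) : 𝓢'(E d, ℂ)) := by
    intro i
    have e : x (some i) = (2 * (Real.pi : ℂ))⁻¹ • (hg i).toLp (g i) := rfl
    rw [e, toTemperedDistribution_smul, smul_smul, mul_inv_cancel₀ hc0, one_smul]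
    exact lineDerivOp_toLp hu (hg i) (h i)
  have hmem : x ∈ (testGraph d).topologicalClosure := by
    obtain ⟨p, hp, q, hq, hpq⟩ :=
      (testGraph d).topologicalClosure.exists_add_mem_mem_orthogonal x
    have : q = 0 := by
      refine eq_zero_of_orthogonal (fun i => ?_) fun y hy =>
        (Submodule.mem_orthogonal _ _).1 hq y (Submodule.le_topologicalClosure _ hy)
      have h1 : q = x - p := by rw [hpq]; abel
      have h2 := lineDerivOp_of_mem_closure hp i
      rw [h1]
      simp only [PiLp.sub_apply]
      rw [toTemperedDistribution_sub, toTemperedDistribution_sub, sub_eq_add_neg, LineDeriv.lineDerivOp_add, LineDeriv.lineDerivOp_neg, hxi, h2,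
        ← sub_eq_add_neg, smul_sub]
    rw [hpq, this, add_zero]
    exact hp
  obtain ⟨y, hy, hyx⟩ := mem_closure_iff_seq_limit.1 hmem
  choose φ hφ hφc h0 h1 using hy
  refine ⟨φ, fun k => ⟨hφ k, hφc k⟩, ?_, fun i => ?_⟩
  · have h2 : Tendsto (fun k => ‖y k none - x none‖) atTop (𝓝 0) :=
      tendsto_iff_norm_sub_tendsto_zero.1 (((PiLp.continuous_apply 2 _ none).tendsto x).comp hyx)
    refine h2.congr fun k => ?_
    rw [← l2Norm_coe]
    refine l2Norm_congr ?_
    filter_upwards [Lp.coeFn_sub (y k none) (x none), h0 k, hu.coeFn_toLp] with z e1 e2 e3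
    rw [e1, Pi.sub_apply, e2]
    exact congrArg _ e3
  · have h2 : Tendsto (fun k => ‖(2 * (Real.pi : ℂ)) • (y k (some i) - x (some i))‖) atTop (𝓝 0) := by
      have := tendsto_iff_norm_sub_tendsto_zero.1
        (((PiLp.continuous_apply 2 _ (some i)).tendsto x).comp hyx)
      simp only [norm_smul]
      simpa using this.const_mul ‖(2 * (Real.pi : ℂ))‖
    refine h2.congr fun k => ?_
    rw [← l2Norm_coe]
    refine l2Norm_congr ?_
    have e5 : x (some i) = (2 * (Real.pi : ℂ))⁻¹ • (hg i).toLp (g i) := rfl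
    filter_upwards [Lp.coeFn_smul (2 * (Real.pi : ℂ)) (y k (some i) - x (some i)),
      Lp.coeFn_sub (y k (some i)) (x (some i)), h1 k i, (hg i).coeFn_toLp,
      Lp.coeFn_smul (2 * (Real.pi : ℂ))⁻¹ ((hg i).toLp (g i))] with z e1 e2 e3 e4 e6
    rw [e1, Pi.smul_apply, e2, Pi.sub_apply, e3, e5, e6, Pi.smul_apply, e4, smul_eq_mul,
      smul_eq_mul, ← mul_sub, mul_inv_cancel_left₀ hc0]

end

section

variable {d : ℕ}

/-! ### First order Sobolev functions on the whole space -/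

theorem MemSobolev.memLp {u : E d → ℂ} (h : MemSobolev 1 univ u) : MemLp u 2 := by
  simpa using h.1

theorem MemSobolev.hasWeakPartial {u : E d → ℂ} (h : MemSobolev 1 univ u) (i : Fin d) :
    HasWeakPartial univ i u (weakPartial univ i u) := weakPartial_spec (h.2 i).1

theorem MemSobolev.memLp_weakPartial {u : E d → ℂ} (h : MemSobolev 1 univ u) (i : Fin d) :
    MemLp (weakPartial univ i u) 2 := by
  simpa [MemSobolev] using (h.2 i).2

theorem memSobolev_univ {u : E d → ℂ} {g : Fin d → E d → ℂ} (hu : MemLp u 2)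
    (h : ∀ i, HasWeakPartial univ i u (g i)) (hg : ∀ i, MemLp (g i) 2) : MemSobolev 1 univ u :=
  memSobolev_one isOpen_univ (by simpa using hu) h (by simpa using hg)

theorem sobolevNorm_sq_univ {u : E d → ℂ} {g : Fin d → E d → ℂ}
    (h : ∀ i, HasWeakPartial univ i u (g i)) :
    sobolevNorm 1 univ u ^ 2 = l2Norm volume u ^ 2 + ∑ i, l2Norm volume (g i) ^ 2 := by
  have h1 := sobolevNormSq_one isOpen_univ h
  rw [Measure.restrict_univ] at h1
  rw [sobolevNorm, Real.sq_sqrt, h1]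
  rw [h1]
  positivity

theorem sobolevNorm_nonneg {k : ℕ} {U : Set (E d)} {u : E d → ℂ} : 0 ≤ sobolevNorm k U u :=
  Real.sqrt_nonneg _

theorem l2Norm_le_sobolevNorm {u : E d → ℂ} {g : Fin d → E d → ℂ}
    (h : ∀ i, HasWeakPartial univ i u (g i)) : l2Norm volume u ≤ sobolevNorm 1 univ u := by
  refine (sq_le_sq₀ l2Norm_nonneg sobolevNorm_nonneg).1 ?_
  rw [sobolevNorm_sq_univ h]
  exact le_add_of_nonneg_right (Finset.sum_nonneg fun _ _ => sq_nonneg _)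

theorem l2Norm_grad_le_sobolevNorm {u : E d → ℂ} {g : Fin d → E d → ℂ}
    (h : ∀ i, HasWeakPartial univ i u (g i)) (i : Fin d) :
    l2Norm volume (g i) ≤ sobolevNorm 1 univ u := by
  refine (sq_le_sq₀ l2Norm_nonneg sobolevNorm_nonneg).1 ?_
  rw [sobolevNorm_sq_univ h]
  exact le_add_of_nonneg_of_le (sq_nonneg _)
    (Finset.single_le_sum (f := fun i => l2Norm volume (g i) ^ 2) (fun _ _ => sq_nonneg _)
      (Finset.mem_univ i))

theorem sobolevNorm_le_add {u : E d → ℂ} {g : Fin d → E d → ℂ}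
    (h : ∀ i, HasWeakPartial univ i u (g i)) :
    sobolevNorm 1 univ u ≤ l2Norm volume u + ∑ i, l2Norm volume (g i) := by
  have hs : 0 ≤ ∑ i, l2Norm volume (g i) := Finset.sum_nonneg fun _ _ => l2Norm_nonneg
  refine (sq_le_sq₀ sobolevNorm_nonneg (add_nonneg l2Norm_nonneg hs)).1 ?_
  rw [sobolevNorm_sq_univ h]
  have h1 := Finset.sum_sq_le_sq_sum_of_nonneg (s := Finset.univ) (f := fun i => l2Norm volume (g i))
    (fun _ _ => l2Norm_nonneg)
  nlinarith [l2Norm_nonneg (μ := volume) (u := u)]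

theorem l2Norm_linear_le {μ : Measure (E d)} {b c : E d → ℂ} (hb : MemLp b 2 μ) (hc : MemLp c 2 μ)
    (β γ : ℂ) : l2Norm μ (fun x => β * b x + γ * c x) ≤ ‖β‖ * l2Norm μ b + ‖γ‖ * l2Norm μ c := by
  have h1 := eLpNorm_add_le (hb.const_mul β).1 (hc.const_mul γ).1 (one_le_two : (1 : ℝ≥0∞) ≤ 2)
  have h2 := eLpNorm_const_smul β b 2 μ
  have h3 := eLpNorm_const_smul γ c 2 μ
  have e2 : eLpNorm (fun x => β * b x) 2 μ = ‖β‖ₑ * eLpNorm b 2 μ := h2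
  have e3 : eLpNorm (fun x => γ * c x) 2 μ = ‖γ‖ₑ * eLpNorm c 2 μ := h3
  rw [e2, e3] at h1
  have h4 := ENNReal.toReal_mono (ENNReal.add_ne_top.2 ⟨ENNReal.mul_ne_top enorm_ne_top
    hb.eLpNorm_ne_top, ENNReal.mul_ne_top enorm_ne_top hc.eLpNorm_ne_top⟩) h1
  rw [ENNReal.toReal_add (ENNReal.mul_ne_top enorm_ne_top hb.eLpNorm_ne_top)
    (ENNReal.mul_ne_top enorm_ne_top hc.eLpNorm_ne_top), ENNReal.toReal_mul, ENNReal.toReal_mul,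
    toReal_enorm, toReal_enorm] at h4
  exact h4

theorem HasWeakPartial.linear {U : Set (E d)} {i : Fin d} {u v g k : E d → ℂ}
    (h : HasWeakPartial U i u g) (h' : HasWeakPartial U i v k) (β γ : ℂ) :
    HasWeakPartial U i (fun x => β * u x + γ * v x) (fun x => β * g x + γ * k x) :=
  (h.const_mul β).add (h'.const_mul γ)

theorem MemSobolev.linear {b c : E d → ℂ} (hb : MemSobolev 1 univ b) (hc : MemSobolev 1 univ c)
    (β γ : ℂ) : MemSobolev 1 univ (fun x => β * b x + γ * c x) :=
  memSobolev_univ ((hb.memLp.const_mul β).add (hc.memLp.const_mul γ))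
    (fun i => (hb.hasWeakPartial i).linear (hc.hasWeakPartial i) β γ)
    (fun i => ((hb.memLp_weakPartial i).const_mul β).add ((hc.memLp_weakPartial i).const_mul γ))

/-- A triangle inequality up to the factor `1 + d`, lost in passing to the sum of the component
norms; continuity arguments do not notice it. -/
theorem sobolevNorm_linear_le {b c : E d → ℂ} (hb : MemSobolev 1 univ b)
    (hc : MemSobolev 1 univ c) (β γ : ℂ) : sobolevNorm 1 univ (fun x => β * b x + γ * c x) ≤
      (1 + d) * (‖β‖ * sobolevNorm 1 univ b + ‖γ‖ * sobolevNorm 1 univ c) := by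
  have key : ∀ {x y : E d → ℂ}, MemLp x 2 → MemLp y 2 → l2Norm volume x ≤ sobolevNorm 1 univ b →
      l2Norm volume y ≤ sobolevNorm 1 univ c → l2Norm volume (fun z => β * x z + γ * y z) ≤
        ‖β‖ * sobolevNorm 1 univ b + ‖γ‖ * sobolevNorm 1 univ c := fun hx hy h1 h2 =>
    (l2Norm_linear_le hx hy β γ).trans (by gcongr)
  refine (sobolevNorm_le_add fun i =>
    (hb.hasWeakPartial i).linear (hc.hasWeakPartial i) β γ).trans ?_
  refine (add_le_add (key hb.memLp hc.memLp (l2Norm_le_sobolevNorm hb.hasWeakPartial)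
    (l2Norm_le_sobolevNorm hc.hasWeakPartial)) (Finset.sum_le_sum fun i _ =>
      key (hb.memLp_weakPartial i) (hc.memLp_weakPartial i)
        (l2Norm_grad_le_sobolevNorm hb.hasWeakPartial i)
        (l2Norm_grad_le_sobolevNorm hc.hasWeakPartial i))).trans (le_of_eq ?_)
  rw [Finset.sum_const, Finset.card_univ, Fintype.card_fin, nsmul_eq_mul]
  ring

theorem hasWeakPartial_of_contDiff {φ : E d → ℂ} (hφ : ContDiff ℝ ∞ φ) (i : Fin d) :
    HasWeakPartial univ i φ fun y => fderiv ℝ φ y (coordVec i) :=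
  hasWeakPartial_of_hasFDerivAt isOpen_univ (Du := fderiv ℝ φ)
    (fun y _ => (hφ.differentiable (by simp) y).hasFDerivAt)
    (continuous_fderiv_apply hφ _).continuousOn

theorem memLp_fderiv_test {φ : E d → ℂ} (hφ : ContDiff ℝ ∞ φ) (hc : HasCompactSupport φ)
    (i : Fin d) : MemLp (fun y => fderiv ℝ φ y (coordVec i)) 2 :=
  memLp_of_test (continuous_fderiv_apply hφ _) (hasCompactSupport_fderiv_apply hc _)

theorem memSobolev_test {φ : E d → ℂ} (hφ : ContDiff ℝ ∞ φ) (hc : HasCompactSupport φ) :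
    MemSobolev 1 univ φ :=
  memSobolev_univ (memLp_of_test hφ.continuous hc) (hasWeakPartial_of_contDiff hφ)
    (memLp_fderiv_test hφ hc)

/-- Test functions are dense in `H¹(ℝ^d)`. -/
theorem MemSobolev.exists_tendsto_test {u : E d → ℂ} (hu : MemSobolev 1 univ u) :
    ∃ φ : ℕ → E d → ℂ, (∀ k, ContDiff ℝ ∞ (φ k) ∧ HasCompactSupport (φ k)) ∧
      Tendsto (fun k => sobolevNorm 1 univ fun x => φ k x - u x) atTop (𝓝 0) := by
  obtain ⟨φ, hφ, h0, h1⟩ :=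
    Transmission.exists_tendsto_test hu.memLp hu.memLp_weakPartial hu.hasWeakPartial
  refine ⟨φ, hφ, ?_⟩
  have h2 := h0.add (tendsto_finsetSum Finset.univ fun i _ => h1 i)
  rw [Finset.sum_const_zero, add_zero] at h2
  exact squeeze_zero (fun _ => sobolevNorm_nonneg) (fun k => sobolevNorm_le_add fun i =>
    (hasWeakPartial_of_contDiff (hφ k).1 i).sub (hu.hasWeakPartial i)) h2

/-! ### The trace -/

section Trace

variable {n : ℕ} {Ω : Set (E (n + 1))}

theorem exists_trace_test_le (hc : IsCompact (frontier Ω)) (h : IsLocallyC11Graph (frontier Ω)) :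
    ∃ C : ℝ≥0, ∀ φ : E (n + 1) → ℂ, ContDiff ℝ ∞ φ → HasCompactSupport φ →
      (∫⁻ x, ‖φ x‖ₑ ^ 2 ∂surfaceMeasure Ω) + gagliardoSq Ω φ ≤
        ENNReal.ofReal (C * sobolevNorm 1 univ φ ^ 2) := by
  obtain ⟨C, hC⟩ := exists_trace_estimate hc h
  refine ⟨C, fun φ hφ hφc => (hC φ (hφ.of_le (by simp))).trans (le_of_eq ?_)⟩
  have e : ∀ i, ∫⁻ x, ‖fderiv ℝ φ x (coordVec i)‖ₑ ^ 2 =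
      ENNReal.ofReal (l2Norm volume (fun x => fderiv ℝ φ x (coordVec i)) ^ 2) := fun i =>
    lintegral_eq_l2Norm_sq (memLp_fderiv_test hφ hφc i)
  rw [ENNReal.ofReal_mul C.coe_nonneg, ENNReal.ofReal_coe_nnreal,
    sobolevNorm_sq_univ (hasWeakPartial_of_contDiff hφ),
    ENNReal.ofReal_add (sq_nonneg _) (Finset.sum_nonneg fun _ _ => sq_nonneg _),
    ENNReal.ofReal_sum_of_nonneg fun _ _ => sq_nonneg _,
    lintegral_eq_l2Norm_sq (memLp_of_test hφ.continuous hφc)]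
  simp only [e]

end Trace

end

/-! ### Existence, uniqueness and `H^{1/2}` bound of the trace -/

section

variable {n : ℕ} {Ω : Set (E (n + 1))}

theorem exists_trace_test_norm_le (hc : IsCompact (frontier Ω))
    (h : IsLocallyC11Graph (frontier Ω)) :
    ∃ C : ℝ, 0 ≤ C ∧ ∀ φ : E (n + 1) → ℂ, ContDiff ℝ ∞ φ → HasCompactSupport φ →
      l2Norm (surfaceMeasure Ω) φ ≤ C * sobolevNorm 1 univ φ ∧
      gagliardoSq Ω φ ≤ ENNReal.ofReal ((C * sobolevNorm 1 univ φ) ^ 2) := by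
  have hfin : IsFiniteMeasure (surfaceMeasure Ω) := ⟨surf_lt_top hc h⟩
  obtain ⟨C, hC⟩ := exists_trace_test_le hc h
  have hC0 : 0 ≤ (C : ℝ) := C.coe_nonneg
  -- The squared estimate has constant `C`, and `C ≤ (C + 1)²`.
  refine ⟨C + 1, by positivity, fun φ hφ hφc => ?_⟩
  have hs : 0 ≤ sobolevNorm 1 univ φ := sobolevNorm_nonneg
  have h1 : ENNReal.ofReal (C * sobolevNorm 1 univ φ ^ 2) ≤
      ENNReal.ofReal (((C + 1) * sobolevNorm 1 univ φ) ^ 2) := by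
    refine ENNReal.ofReal_le_ofReal ?_
    rw [mul_pow]
    gcongr
    nlinarith
  have h2 := (hC φ hφ hφc).trans h1
  exact ⟨(memLp_two_of_lintegral_le hφ.continuous.aestronglyMeasurable (by positivity)
    (le_self_add.trans h2)).2, le_add_self.trans h2⟩

theorem l2Norm_sub_coe {μ : Measure (E (n + 1))} {φ : E (n + 1) → ℂ} (hφ : MemLp φ 2 μ)
    (g : Lp ℂ 2 μ) : l2Norm μ (fun x => φ x - g x) = ‖hφ.toLp φ - g‖ := by
  rw [Lp.norm_def]
  refine l2Norm_congr ?_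
  filter_upwards [Lp.coeFn_sub (hφ.toLp φ) g, hφ.coeFn_toLp] with x h1 h2
  rw [h1, Pi.sub_apply, h2]

/-- The trace estimate applied to differences makes the restrictions of an approximating sequence
Cauchy in `L²(∂Ω)`. -/
theorem exists_isTrace (hc : IsCompact (frontier Ω)) (h : IsLocallyC11Graph (frontier Ω))
    {u : E (n + 1) → ℂ} (hu : MemSobolev 1 univ u) : ∃ g, IsTrace Ω u g := by
  have hfin : IsFiniteMeasure (surfaceMeasure Ω) := ⟨surf_lt_top hc h⟩
  obtain ⟨C, hC0, hC⟩ := exists_trace_test_norm_le hc h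
  obtain ⟨φ, hφ, ht⟩ := hu.exists_tendsto_test
  have hm : ∀ k, MemLp (φ k) 2 (surfaceMeasure Ω) := fun k =>
    memLp_of_test (hφ k).1.continuous (hφ k).2
  have hs : ∀ k, MemSobolev 1 univ (φ k) := fun k => memSobolev_test (hφ k).1 (hφ k).2
  set s : ℕ → ℝ := fun k => sobolevNorm 1 univ fun x => φ k x - u x with hsdef
  have hd : ∀ k l, dist ((hm k).toLp (φ k)) ((hm l).toLp (φ l)) ≤
      C * ((1 + (n + 1 : ℕ)) * (s k + s l)) := by
    intro k l
    have h1 := (hC (fun x => φ k x - φ l x) ((hφ k).1.sub (hφ l).1) ((hφ k).2.sub (hφ l).2)).1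
    have h2 : ∀ k, MemSobolev 1 univ fun x => φ k x - u x := fun k => by
      simpa [sub_eq_add_neg] using (hs k).linear hu 1 (-1)
    have h3 := sobolevNorm_linear_le (h2 k) (h2 l) 1 (-1)
    rw [norm_neg, norm_one, one_mul, one_mul] at h3
    have e : (fun x => 1 * (φ k x - u x) + -1 * (φ l x - u x)) = fun x => φ k x - φ l x := by
      ext x; ring
    rw [e] at h3
    rw [dist_eq_norm, ← l2Norm_sub_coe]
    have e2 : l2Norm (surfaceMeasure Ω) (fun x => φ k x - (hm l).toLp (φ l) x) =
        l2Norm (surfaceMeasure Ω) fun x => φ k x - φ l x :=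
      l2Norm_congr ((hm l).coeFn_toLp.mono fun x hx => by simp only [hx])
    rw [e2]
    exact h1.trans (mul_le_mul_of_nonneg_left h3 hC0)
  have hcau : CauchySeq fun k => (hm k).toLp (φ k) := by
    refine cauchySeq_iff_tendsto_dist_atTop_0.2 (squeeze_zero (fun _ => dist_nonneg)
      (fun p => hd p.1 p.2) ?_)
    rw [← prod_atTop_atTop_eq]
    have : Tendsto (fun p : ℕ × ℕ => C * ((1 + ((n + 1 : ℕ) : ℝ)) * (s p.1 + s p.2)))
        (atTop ×ˢ atTop) (𝓝 (C * ((1 + ((n + 1 : ℕ) : ℝ)) * (0 + 0)))) :=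
      (((ht.comp tendsto_fst).add (ht.comp tendsto_snd)).const_mul _).const_mul _
    simpa only [add_zero, mul_zero] using this
  obtain ⟨g, hg⟩ := cauchySeq_tendsto_of_complete hcau
  refine ⟨g, φ, hφ, ht, ?_⟩
  simp only [fun k => l2Norm_sub_coe (hm k) g]
  exact tendsto_iff_norm_sub_tendsto_zero.1 hg

theorem IsTrace.linear (hc : IsCompact (frontier Ω)) (h : IsLocallyC11Graph (frontier Ω))
    {u v : E (n + 1) → ℂ} {f g : BdryL2 Ω} (hu : MemSobolev 1 univ u) (hv : MemSobolev 1 univ v)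
    (hf : IsTrace Ω u f) (hg : IsTrace Ω v g) (β γ : ℂ) :
    IsTrace Ω (fun x => β * u x + γ * v x) (β • f + γ • g) := by
  have hfin : IsFiniteMeasure (surfaceMeasure Ω) := ⟨surf_lt_top hc h⟩
  obtain ⟨φ, hφ, h1, h2⟩ := hf
  obtain ⟨ψ, hψ, h3, h4⟩ := hg
  refine ⟨fun k x => β * φ k x + γ * ψ k x, fun k => ⟨(contDiff_const.mul (hφ k).1).add
    (contDiff_const.mul (hψ k).1), (hφ k).2.mul_left.add (hψ k).2.mul_left⟩, ?_, ?_⟩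
  · have h5 : ∀ k, MemSobolev 1 univ fun x => φ k x - u x := fun k => by
      simpa [sub_eq_add_neg] using (memSobolev_test (hφ k).1 (hφ k).2).linear hu 1 (-1)
    have h6 : ∀ k, MemSobolev 1 univ fun x => ψ k x - v x := fun k => by
      simpa [sub_eq_add_neg] using (memSobolev_test (hψ k).1 (hψ k).2).linear hv 1 (-1)
    have h7 := ((h1.const_mul ‖β‖).add (h3.const_mul ‖γ‖)).const_mul (1 + ((n + 1 : ℕ) : ℝ))
    rw [mul_zero, mul_zero, add_zero, mul_zero] at h7
    refine squeeze_zero (fun _ => sobolevNorm_nonneg) (fun k => ?_) h7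
    refine le_trans (le_of_eq ?_) (sobolevNorm_linear_le (h5 k) (h6 k) β γ)
    congr 1
    ext x
    ring
  · have h5 : ∀ k, MemLp (fun x => φ k x - f x) 2 (surfaceMeasure Ω) := fun k =>
      (memLp_of_test (hφ k).1.continuous (hφ k).2).sub (Lp.memLp f)
    have h6 : ∀ k, MemLp (fun x => ψ k x - g x) 2 (surfaceMeasure Ω) := fun k =>
      (memLp_of_test (hψ k).1.continuous (hψ k).2).sub (Lp.memLp g)
    have h7 := (h2.const_mul ‖β‖).add (h4.const_mul ‖γ‖)
    rw [mul_zero, mul_zero, add_zero] at h7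
    refine squeeze_zero (fun _ => l2Norm_nonneg) (fun k => ?_) h7
    refine le_trans (le_of_eq (l2Norm_congr ?_)) (l2Norm_linear_le (h5 k) (h6 k) β γ)
    filter_upwards [Lp.coeFn_add (β • f) (γ • g), Lp.coeFn_smul β f, Lp.coeFn_smul γ g]
      with x e1 e2 e3
    rw [e1, Pi.add_apply, e2, e3, Pi.smul_apply, Pi.smul_apply, smul_eq_mul, smul_eq_mul]
    ring

/-- Fatou in each variable. This lower semicontinuity carries the seminorm bound to the trace, which
is known only as an `L²` limit. -/
theorem gagliardoSq_le_liminf {φ : ℕ → E (n + 1) → ℂ} {g : E (n + 1) → ℂ}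
    [IsFiniteMeasure (surfaceMeasure Ω)] (hφ : ∀ k, Measurable (φ k))
    (ht : ∀ᵐ x ∂surfaceMeasure Ω, Tendsto (fun k => φ k x) atTop (𝓝 (g x))) :
    gagliardoSq Ω g ≤ liminf (fun k => gagliardoSq Ω (φ k)) atTop := by
  have hm : ∀ k, Measurable fun p : E (n + 1) × E (n + 1) =>
      ENNReal.ofReal (‖φ k p.1 - φ k p.2‖ ^ 2 / ‖p.1 - p.2‖ ^ (n + 1)) := fun k => by
    have := hφ k
    fun_prop
  have hx : ∀ᵐ x ∂surfaceMeasure Ω,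
      ∫⁻ y, ENNReal.ofReal (‖g x - g y‖ ^ 2 / ‖x - y‖ ^ (n + 1)) ∂surfaceMeasure Ω ≤
        liminf (fun k => ∫⁻ y, ENNReal.ofReal (‖φ k x - φ k y‖ ^ 2 / ‖x - y‖ ^ (n + 1))
          ∂surfaceMeasure Ω) atTop := by
    filter_upwards [ht] with x hx
    refine le_trans (lintegral_mono_ae ?_) (lintegral_liminf_le fun k => ?_)
    swap
    · have := hφ k
      fun_prop
    filter_upwards [ht] with y hy
    refine le_of_eq (Tendsto.liminf_eq ?_).symm
    exact (ENNReal.continuous_ofReal.tendsto _).comp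
      ((((hx.sub hy).norm).pow 2).div_const _)
  exact (lintegral_mono_ae hx).trans (lintegral_liminf_le fun k =>
    Measurable.lintegral_prod_right' (hm k))

/-- The bounds pass to the limit from test functions: the norm by continuity, the seminorm along a
subsequence converging almost everywhere. Stated for every trace `g` of `u`, it also yields
uniqueness. -/
theorem exists_isTrace_le (hc : IsCompact (frontier Ω)) (h : IsLocallyC11Graph (frontier Ω)) :
    ∃ C : ℝ, 0 ≤ C ∧ ∀ u, MemSobolev 1 univ u → ∀ g, IsTrace Ω u g →
      ‖g‖ ≤ C * sobolevNorm 1 univ u ∧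
        gagliardoSq Ω g ≤ ENNReal.ofReal ((C * sobolevNorm 1 univ u) ^ 2) := by
  have hfin : IsFiniteMeasure (surfaceMeasure Ω) := ⟨surf_lt_top hc h⟩
  obtain ⟨C, hC0, hC⟩ := exists_trace_test_norm_le hc h
  refine ⟨C * (1 + (n + 1 : ℕ)), by positivity, ?_⟩
  rintro u hu g ⟨φ, hφ, h1, h2⟩
  have hm : ∀ k, MemLp (φ k) 2 (surfaceMeasure Ω) := fun k =>
    memLp_of_test (hφ k).1.continuous (hφ k).2
  set s : ℕ → ℝ := fun k => sobolevNorm 1 univ fun x => φ k x - u x with hsdef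
  have hsb : ∀ k, sobolevNorm 1 univ (φ k) ≤
      (1 + (n + 1 : ℕ)) * (s k + sobolevNorm 1 univ u) := by
    intro k
    have h5 : MemSobolev 1 univ fun x => φ k x - u x := by
      simpa [sub_eq_add_neg] using (memSobolev_test (hφ k).1 (hφ k).2).linear hu 1 (-1)
    have := sobolevNorm_linear_le h5 hu 1 1
    rw [norm_one, one_mul, one_mul] at this
    refine le_trans (le_of_eq ?_) this
    congr 1
    ext x
    ring
  set b : ℕ → ℝ := fun k => C * ((1 + (n + 1 : ℕ)) * (s k + sobolevNorm 1 univ u)) with hb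
  have hbt : Tendsto b atTop (𝓝 (C * (1 + (n + 1 : ℕ)) * sobolevNorm 1 univ u)) := by
    have := ((h1.add_const (sobolevNorm 1 univ u)).const_mul (1 + ((n + 1 : ℕ) : ℝ))).const_mul C
    rwa [zero_add, ← mul_assoc] at this
  have hs0 : ∀ k, 0 ≤ sobolevNorm 1 univ (φ k) := fun k => sobolevNorm_nonneg
  have hlp : Tendsto (fun k => (hm k).toLp (φ k)) atTop (𝓝 g) := by
    refine tendsto_iff_norm_sub_tendsto_zero.2 ?_
    simpa only [fun k => l2Norm_sub_coe (hm k) g] using h2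
  constructor
  · refine le_of_tendsto_of_tendsto' hlp.norm hbt fun k => ?_
    rw [Lp.norm_toLp]
    exact ((hC _ (hφ k).1 (hφ k).2).1).trans (mul_le_mul_of_nonneg_left (hsb k) hC0)
  · obtain ⟨ns, hns, hae⟩ := (tendstoInMeasure_of_tendsto_Lp hlp).exists_seq_tendsto_ae
    have hae' : ∀ᵐ x ∂surfaceMeasure Ω, Tendsto (fun k => φ (ns k) x) atTop (𝓝 (g x)) := by
      filter_upwards [hae, ae_all_iff.2 fun k => (hm (ns k)).coeFn_toLp] with x hx hx'
      simpa only [hx'] using hx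
    refine (gagliardoSq_le_liminf (fun k => (hφ (ns k)).1.continuous.measurable) hae').trans ?_
    have h3 : Tendsto (fun k => ENNReal.ofReal (b (ns k) ^ 2)) atTop
        (𝓝 (ENNReal.ofReal ((C * (1 + (n + 1 : ℕ)) * sobolevNorm 1 univ u) ^ 2))) :=
      (ENNReal.continuous_ofReal.tendsto _).comp ((hbt.comp hns.tendsto_atTop).pow 2)
    rw [← h3.liminf_eq]
    refine liminf_le_liminf (Eventually.of_forall fun k => ?_)
    refine ((hC _ (hφ (ns k)).1 (hφ (ns k)).2).2).trans (ENNReal.ofReal_le_ofReal ?_)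
    have := hs0 (ns k)
    refine pow_le_pow_left₀ (by positivity) ?_ 2
    exact mul_le_mul_of_nonneg_left (hsb _) hC0

/-- The difference of two traces is a trace of the zero function, and the bound forces it to vanish;
the choice in `trace` is therefore immaterial. -/
theorem IsTrace.unique (hc : IsCompact (frontier Ω)) (h : IsLocallyC11Graph (frontier Ω))
    {u : E (n + 1) → ℂ} {f g : BdryL2 Ω} (hu : MemSobolev 1 univ u)
    (hf : IsTrace Ω u f) (hg : IsTrace Ω u g) : f = g := by
  obtain ⟨C, -, hC⟩ := exists_isTrace_le hc h
  have h1 := (hC _ (hu.linear hu 1 (-1)) _ (hf.linear hc h hu hu hg 1 (-1))).1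
  have h2 : (fun x => 1 * u x + -1 * u x) = fun x : E (n + 1) => 0 * u x + 0 * u x := by
    ext x; ring
  have h3 := sobolevNorm_linear_le hu hu 0 0
  simp only [norm_zero, zero_mul, add_zero, mul_zero] at h3
  have h4 : sobolevNorm 1 univ (fun x => 1 * u x + -1 * u x) = 0 := by
    refine le_antisymm ?_ sobolevNorm_nonneg
    rw [h2]
    simpa using h3
  rw [h4, mul_zero, norm_le_zero_iff, one_smul, neg_one_smul, ← sub_eq_add_neg] at h1
  exact sub_eq_zero.1 h1

theorem isTrace_trace (hc : IsCompact (frontier Ω)) (h : IsLocallyC11Graph (frontier Ω))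
    {u : E (n + 1) → ℂ} (hu : MemSobolev 1 univ u) : IsTrace Ω u (trace Ω u) := by
  have hex := exists_isTrace hc h hu
  rw [trace, dif_pos hex]
  exact hex.choose_spec

theorem trace_test (hc : IsCompact (frontier Ω)) (h : IsLocallyC11Graph (frontier Ω))
    {φ : E (n + 1) → ℂ} (hφ : ContDiff ℝ ∞ φ) (hφc : HasCompactSupport φ) :
    trace Ω φ =ᵐ[surfaceMeasure Ω] φ := by
  have hfin : IsFiniteMeasure (surfaceMeasure Ω) := ⟨surf_lt_top hc h⟩
  have hm : MemLp φ 2 (surfaceMeasure Ω) := memLp_of_test hφ.continuous hφc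
  have hs := memSobolev_test hφ hφc
  have h1 : IsTrace Ω φ (hm.toLp φ) := by
    refine ⟨fun _ => φ, fun _ => ⟨hφ, hφc⟩, ?_, ?_⟩
    · have h3 := sobolevNorm_linear_le hs hs 0 0
      simp only [norm_zero, zero_mul, add_zero, mul_zero] at h3
      have : sobolevNorm 1 univ (fun x => φ x - φ x) = 0 := by
        simp only [sub_self]
        exact le_antisymm h3 sobolevNorm_nonneg
      simp only [this]
      exact tendsto_const_nhds
    · simp only [l2Norm_sub_coe hm, sub_self, norm_zero]
      exact tendsto_const_nhds
  rw [(isTrace_trace hc h hs).unique hc h hs h1]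
  exact hm.coeFn_toLp

/-- The trace is bounded from `H¹(ℝ^d)` to `H^{1/2}(∂Ω)`. -/
theorem exists_hHalfNorm_trace_le (hc : IsCompact (frontier Ω))
    (h : IsLocallyC11Graph (frontier Ω)) : ∃ C : ℝ, 0 ≤ C ∧ ∀ u, MemSobolev 1 univ u →
      MemHHalf Ω (trace Ω u) ∧ hHalfNorm Ω (trace Ω u) ≤ C * sobolevNorm 1 univ u := by
  obtain ⟨C, hC0, hC⟩ := exists_isTrace_le hc h
  refine ⟨2 * C, by positivity, fun u hu => ?_⟩
  obtain ⟨h1, h2⟩ := hC u hu _ (isTrace_trace hc h hu)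
  refine ⟨⟨Lp.memLp _, h2.trans_lt ENNReal.ofReal_lt_top⟩, ?_⟩
  have hs : 0 ≤ sobolevNorm 1 univ u := sobolevNorm_nonneg
  have h3 : (gagliardoSq Ω (trace Ω u)).toReal ≤ (C * sobolevNorm 1 univ u) ^ 2 :=
    ENNReal.toReal_le_of_le_ofReal (by positivity) h2
  have h4 : l2Norm (surfaceMeasure Ω) (trace Ω u) ≤ C * sobolevNorm 1 univ u := h1
  have h5 : 0 ≤ C * sobolevNorm 1 univ u := by positivity
  refine Real.sqrt_le_iff.2 ⟨by positivity, ?_⟩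
  have h6 : l2Norm (surfaceMeasure Ω) (trace Ω u) ^ 2 ≤ (C * sobolevNorm 1 univ u) ^ 2 :=
    pow_le_pow_left₀ l2Norm_nonneg h4 2
  nlinarith

end

section

variable {n : ℕ} {Ω : Set (E (n + 1))}

/-! ### Boundedness of operators on `H^{1/2}(∂Ω)` -/

/-- The weighted product measure of the Gagliardo seminorm. -/
def gagliardoMeasure (Ω : Set (E (n + 1))) : Measure (E (n + 1) × E (n + 1)) :=
  ((surfaceMeasure Ω).prod (surfaceMeasure Ω)).withDensity fun p =>
    ENNReal.ofReal (‖p.1 - p.2‖ ^ (n + 1))⁻¹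

theorem ae_gagliardoMeasure [IsFiniteMeasure (surfaceMeasure Ω)] {P : E (n + 1) → Prop}
    (h : ∀ᵐ x ∂surfaceMeasure Ω, P x) : ∀ᵐ p ∂gagliardoMeasure Ω, P p.1 ∧ P p.2 :=
  (withDensity_absolutelyContinuous _ _).ae_le
    ((Measure.quasiMeasurePreserving_fst.ae h).and (Measure.quasiMeasurePreserving_snd.ae h))

theorem lintegral_gagliardoMeasure [IsFiniteMeasure (surfaceMeasure Ω)] {f : E (n + 1) → ℂ}
    (hf : Measurable f) :
    ∫⁻ p, ‖f p.1 - f p.2‖ₑ ^ 2 ∂gagliardoMeasure Ω = gagliardoSq Ω f := by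
  rw [gagliardoMeasure, lintegral_withDensity_eq_lintegral_mul _ (by fun_prop) (by fun_prop),
    lintegral_prod _ (by fun_prop)]
  refine lintegral_congr fun x => lintegral_congr fun y => ?_
  rw [Pi.mul_apply, ← ofReal_norm, ← ENNReal.ofReal_pow (norm_nonneg _),
    ← ENNReal.ofReal_mul (by positivity), div_eq_inv_mul]

theorem memLp_gagliardoMeasure [IsFiniteMeasure (surfaceMeasure Ω)] {f : BdryL2 Ω}
    (h : gagliardoSq Ω f < ⊤) :
    MemLp (fun p : E (n + 1) × E (n + 1) => f p.1 - f p.2) 2 (gagliardoMeasure Ω) := by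
  have hf := Lp.stronglyMeasurable f
  refine ⟨((hf.comp_measurable measurable_fst).sub
    (hf.comp_measurable measurable_snd)).aestronglyMeasurable, ?_⟩
  rw [← lintegral_gagliardoMeasure hf.measurable, ← eLpNorm_two_sq] at h
  exact (ENNReal.pow_lt_top_iff.1 h).resolve_right two_ne_zero

/-- `H^{1/2}(∂Ω)` as a subspace of a product of Lebesgue spaces. -/
def halfGraph (Ω : Set (E (n + 1))) [IsFiniteMeasure (surfaceMeasure Ω)] :
    Submodule ℂ (BdryL2 Ω × Lp ℂ 2 (gagliardoMeasure Ω)) where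
  carrier := {x | x.2 =ᵐ[gagliardoMeasure Ω] fun p => x.1 p.1 - x.1 p.2}
  add_mem' := by
    intro x y hx hy
    filter_upwards [Lp.coeFn_add x.2 y.2, hx, hy, ae_gagliardoMeasure (Lp.coeFn_add x.1 y.1)]
      with p e1 e2 e3 e4
    rw [Prod.snd_add, Prod.fst_add, e1, e4.1, e4.2, Pi.add_apply, Pi.add_apply, Pi.add_apply, e2, e3]
    ring
  zero_mem' := by
    filter_upwards [Lp.coeFn_zero ℂ 2 (gagliardoMeasure Ω),
      ae_gagliardoMeasure (Lp.coeFn_zero ℂ 2 (surfaceMeasure Ω))] with p e1 e2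
    rw [Prod.snd_zero, Prod.fst_zero, e1, e2.1, e2.2]
    simp
  smul_mem' := by
    intro c x hx
    filter_upwards [Lp.coeFn_smul c x.2, hx, ae_gagliardoMeasure (Lp.coeFn_smul c x.1)]
      with p e1 e2 e3
    change (c • x.2 : Lp ℂ 2 (gagliardoMeasure Ω)) p =
      (c • x.1 : BdryL2 Ω) p.1 - (c • x.1 : BdryL2 Ω) p.2
    rw [e1, e3.1, e3.2, Pi.smul_apply, Pi.smul_apply, Pi.smul_apply,
      e2, smul_sub]

theorem mem_halfGraph [IsFiniteMeasure (surfaceMeasure Ω)]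
    {x : BdryL2 Ω × Lp ℂ 2 (gagliardoMeasure Ω)} :
    x ∈ halfGraph Ω ↔ x.2 =ᵐ[gagliardoMeasure Ω] fun p => x.1 p.1 - x.1 p.2 := Iff.rfl

theorem halfGraph_ext [IsFiniteMeasure (surfaceMeasure Ω)] {x y : halfGraph Ω}
    (h : x.1.1 = y.1.1) : x = y := by
  refine Subtype.ext (Prod.ext h (Lp.ext ?_))
  refine (mem_halfGraph.1 x.2).trans (EventuallyEq.trans ?_ (mem_halfGraph.1 y.2).symm)
  rw [h]

theorem lift_mem_halfGraph [IsFiniteMeasure (surfaceMeasure Ω)] {f : BdryL2 Ω}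
    (h : gagliardoSq Ω f < ⊤) :
    ((f, (memLp_gagliardoMeasure h).toLp _) : BdryL2 Ω × Lp ℂ 2 (gagliardoMeasure Ω)) ∈
      halfGraph Ω := (memLp_gagliardoMeasure h).coeFn_toLp

/-- Convergence in both components gives convergence almost everywhere along a common subsequence,
and the pointwise relation survives. Closedness makes `H^{1/2}(∂Ω)` complete. -/
theorem isClosed_halfGraph [IsFiniteMeasure (surfaceMeasure Ω)] :
    IsClosed (halfGraph Ω : Set (BdryL2 Ω × Lp ℂ 2 (gagliardoMeasure Ω))) := by
  refine IsSeqClosed.isClosed fun x y hx hxy => ?_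
  have h1 : Tendsto (fun k => (x k).1) atTop (𝓝 y.1) := (continuous_fst.tendsto y).comp hxy
  have h2 : Tendsto (fun k => (x k).2) atTop (𝓝 y.2) := (continuous_snd.tendsto y).comp hxy
  obtain ⟨a, ha, ha'⟩ := (tendstoInMeasure_of_tendsto_Lp h1).exists_seq_tendsto_ae
  obtain ⟨b, hb, hb'⟩ :=
    (tendstoInMeasure_of_tendsto_Lp (h2.comp ha.tendsto_atTop)).exists_seq_tendsto_ae
  change y.2 =ᵐ[gagliardoMeasure Ω] fun p => y.1 p.1 - y.1 p.2
  filter_upwards [hb', ae_gagliardoMeasure ha', ae_all_iff.2 hx] with p e1 e2 e3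
  refine tendsto_nhds_unique e1 ?_
  simp only [Function.comp_apply, e3]
  exact (e2.1.comp hb.tendsto_atTop).sub (e2.2.comp hb.tendsto_atTop)

theorem gagliardoSq_of_mem_halfGraph [IsFiniteMeasure (surfaceMeasure Ω)]
    {x : BdryL2 Ω × Lp ℂ 2 (gagliardoMeasure Ω)} (hx : x ∈ halfGraph Ω) :
    gagliardoSq Ω x.1 = ENNReal.ofReal (‖x.2‖ ^ 2) := by
  rw [← lintegral_gagliardoMeasure (Lp.stronglyMeasurable x.1).measurable, ENNReal.ofReal_pow
    (norm_nonneg _), Lp.norm_def, ENNReal.ofReal_toReal (Lp.eLpNorm_ne_top _), eLpNorm_two_sq]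
  exact lintegral_congr_ae ((mem_halfGraph.1 hx).mono fun p hp => by simp only [hp])

theorem hHalfNorm_sq_of_mem_halfGraph [IsFiniteMeasure (surfaceMeasure Ω)]
    {x : BdryL2 Ω × Lp ℂ 2 (gagliardoMeasure Ω)} (hx : x ∈ halfGraph Ω) :
    hHalfNorm Ω x.1 ^ 2 = ‖x.1‖ ^ 2 + ‖x.2‖ ^ 2 := by
  rw [hHalfNorm, Real.sq_sqrt (by positivity), gagliardoSq_of_mem_halfGraph hx,
    ENNReal.toReal_ofReal (by positivity)]
  rfl

theorem exists_halfGraph_map [IsFiniteMeasure (surfaceMeasure Ω)]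
    (V : BdryL2 Ω →L[ℂ] BdryL2 Ω)
    (hV : ∀ f : BdryL2 Ω, MemHHalf Ω f → MemHHalf Ω (V f)) :
    ∃ T : halfGraph Ω →ₗ[ℂ] halfGraph Ω, ∀ x, (T x).1.1 = V x.1.1 := by
  have hmem : ∀ x : halfGraph Ω, gagliardoSq Ω (V x.1.1) < ⊤ := fun x =>
    (hV x.1.1 ⟨Lp.memLp _, by rw [gagliardoSq_of_mem_halfGraph x.2]; exact ENNReal.ofReal_lt_top⟩).2
  have hf : ∀ x : halfGraph Ω, ∃ y : halfGraph Ω, y.1.1 = V x.1.1 := fun x =>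
    ⟨⟨_, lift_mem_halfGraph (hmem x)⟩, rfl⟩
  choose T hT using hf
  refine ⟨⟨⟨T, fun x y => halfGraph_ext ?_⟩, fun c x => halfGraph_ext ?_⟩, hT⟩
  · rw [hT]
    change V (x.1.1 + y.1.1) = (T x).1.1 + (T y).1.1
    rw [map_add, hT, hT]
  · rw [hT]
    change V (c • x.1.1) = c • (T x).1.1
    rw [map_smul, hT]

/-- The closed graph theorem: an element of `halfGraph` is determined by its first component, and
there the limit is identified by continuity of `V` on `L²(∂Ω)`. -/
theorem continuous_halfGraph_map [IsFiniteMeasure (surfaceMeasure Ω)]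
    {V : BdryL2 Ω →L[ℂ] BdryL2 Ω} {T : halfGraph Ω →ₗ[ℂ] halfGraph Ω}
    (hT : ∀ x, (T x).1.1 = V x.1.1) : Continuous T := by
  have hcomp : CompleteSpace (halfGraph Ω) := isClosed_halfGraph.completeSpace_coe
  refine T.continuous_of_seq_closed_graph fun u x y hu hy => halfGraph_ext ?_
  have h1 : Continuous fun x : halfGraph Ω => x.1.1 := continuous_fst.comp continuous_subtype_val
  have h2 : Tendsto (fun k => V (u k).1.1) atTop (𝓝 (V x.1.1)) :=
    (V.continuous.tendsto _).comp ((h1.tendsto x).comp hu)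
  have h3 : Tendsto (fun k => (T (u k)).1.1) atTop (𝓝 y.1.1) := (h1.tendsto y).comp hy
  simp only [hT] at h3
  rw [hT]
  exact tendsto_nhds_unique h3 h2

/-- An operator on `L²(∂Ω)` that preserves `H^{1/2}(∂Ω)` is bounded there. -/
theorem exists_hHalfNorm_map_le [IsFiniteMeasure (surfaceMeasure Ω)]
    (V : BdryL2 Ω →L[ℂ] BdryL2 Ω)
    (hV : ∀ f : BdryL2 Ω, MemHHalf Ω f → MemHHalf Ω (V f)) :
    ∃ C : ℝ, 0 ≤ C ∧ ∀ f : BdryL2 Ω, MemHHalf Ω f → hHalfNorm Ω (V f) ≤ C * hHalfNorm Ω f := by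
  obtain ⟨T, hTV⟩ := exists_halfGraph_map V hV
  have hT := continuous_halfGraph_map hTV
  obtain ⟨C, hC0, hC⟩ : ∃ C, 0 ≤ C ∧ ∀ x, ‖T x‖ ≤ C * ‖x‖ :=
    ⟨_, norm_nonneg _, (⟨T, hT⟩ : halfGraph Ω →L[ℂ] halfGraph Ω).le_opNorm⟩
  refine ⟨2 * C, by positivity, fun f hf => ?_⟩
  obtain ⟨x, hx⟩ : ∃ x : halfGraph Ω, x.1.1 = f := ⟨⟨_, lift_mem_halfGraph hf.2⟩, rfl⟩
  have h1 : ‖(T x).1‖ ≤ C * ‖x.1‖ := hC x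
  have e1 : hHalfNorm Ω f ^ 2 = ‖x.1.1‖ ^ 2 + ‖x.1.2‖ ^ 2 := by
    rw [← hx]
    exact hHalfNorm_sq_of_mem_halfGraph x.2
  have e2 : hHalfNorm Ω (V f) ^ 2 = ‖(T x).1.1‖ ^ 2 + ‖(T x).1.2‖ ^ 2 := by
    rw [← hx, ← hTV]
    exact hHalfNorm_sq_of_mem_halfGraph (T x).2
  have h2 : 0 ≤ hHalfNorm Ω f := Real.sqrt_nonneg _
  have h3 : 0 ≤ hHalfNorm Ω (V f) := Real.sqrt_nonneg _
  have h4 : ‖x.1‖ ≤ hHalfNorm Ω f := by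
    rw [Prod.norm_def]
    refine max_le ?_ ?_
    · exact (sq_le_sq₀ (norm_nonneg _) h2).1 (by rw [e1]; nlinarith [norm_nonneg x.1.2])
    · exact (sq_le_sq₀ (norm_nonneg _) h2).1 (by rw [e1]; nlinarith [norm_nonneg x.1.1])
  have h5 : ‖(T x).1.1‖ ≤ C * hHalfNorm Ω f :=
    (norm_fst_le _).trans (h1.trans (by gcongr))
  have h6 : ‖(T x).1.2‖ ≤ C * hHalfNorm Ω f :=
    (norm_snd_le _).trans (h1.trans (by gcongr))
  refine (sq_le_sq₀ h3 (by positivity)).1 ?_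
  rw [e2]
  have h7 := pow_le_pow_left₀ (norm_nonneg _) h5 2
  have h8 := pow_le_pow_left₀ (norm_nonneg _) h6 2
  nlinarith

end

section

variable {d : ℕ}

/-! ### Multiplication by smooth functions -/

theorem fderiv_mul_coord {φ χ : E d → ℝ} (hφ : ContDiff ℝ ∞ φ) (hχ : ContDiff ℝ ∞ χ) (i : Fin d)
    (x : E d) : fderiv ℝ (fun y => φ y * χ y) x (coordVec i) =
      φ x * fderiv ℝ χ x (coordVec i) + χ x * fderiv ℝ φ x (coordVec i) := by
  rw [fderiv_fun_mul (hφ.differentiable (by simp) x) (hχ.differentiable (by simp) x)]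
  rfl

theorem HasWeakPartial.smul {U : Set (E d)} (hU : IsOpen U) {i : Fin d} {u g : E d → ℂ}
    (h : HasWeakPartial U i u g) {χ : E d → ℝ} (hχ : ContDiff ℝ ∞ χ) :
    HasWeakPartial U i (fun x => χ x • u x)
      (fun x => χ x • g x + fderiv ℝ χ x (coordVec i) • u x) := by
  have hχ' := continuous_fderiv_apply hχ (coordVec i)
  have l1 : LocallyIntegrableOn (fun x => χ x • u x) U :=
    h.1.continuousOn_smul hU.isLocallyClosed hχ.continuous.continuousOn
  have l2 : LocallyIntegrableOn (fun x => χ x • g x) U :=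
    h.2.1.continuousOn_smul hU.isLocallyClosed hχ.continuous.continuousOn
  have l3 : LocallyIntegrableOn (fun x => fderiv ℝ χ x (coordVec i) • u x) U :=
    h.1.continuousOn_smul hU.isLocallyClosed hχ'.continuousOn
  refine hasWeakPartial_of_integral l1 (l2.add l3) fun φ h1 h2 h3 => ?_
  have hs := (tsupport_fderiv_apply_subset' (φ := φ) (coordVec i)).trans h3
  have k1 := integrable_smul_of_locallyIntegrableOn l1 (continuous_fderiv_apply h1 (coordVec i))
    (hasCompactSupport_fderiv_apply h2 _) hs
  have k2 := integrable_smul_of_locallyIntegrableOn l2 h1.continuous h2 h3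
  have k3 := integrable_smul_of_locallyIntegrableOn l3 h1.continuous h2 h3
  have key := h.eq_integral (φ := fun x => φ x * χ x) (h1.mul hχ) h2.mul_right
    ((closure_mono (Function.support_mul_subset_left _ _)).trans h3)
  have e1 : ∀ x, fderiv ℝ (fun x => φ x * χ x) x (coordVec i) • u x =
      φ x • fderiv ℝ χ x (coordVec i) • u x + fderiv ℝ φ x (coordVec i) • χ x • u x := fun x => by
    rw [fderiv_mul_coord h1 hχ, add_smul, mul_smul, mul_comm (χ x), mul_smul]
  simp only [e1, mul_smul] at key
  rw [integral_add k3 k1] at key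
  simp only [smul_add]
  rw [integral_add k2 k3, neg_add, ← key]
  ring

/-- `u` has `L²` norm at most `M`. -/
def L2Le (μ : Measure (E d)) (u : E d → ℂ) (M : ℝ) : Prop := MemLp u 2 μ ∧ l2Norm μ u ≤ M

theorem L2Le.add {μ : Measure (E d)} {u v : E d → ℂ} {M N : ℝ} (hu : L2Le μ u M)
    (hv : L2Le μ v N) : L2Le μ (fun x => u x + v x) (M + N) := by
  refine ⟨hu.1.add hv.1, ?_⟩
  have := l2Norm_linear_le hu.1 hv.1 1 1
  simp only [one_mul, norm_one] at this
  exact this.trans (add_le_add hu.2 hv.2)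

theorem L2Le.const_mul {μ : Measure (E d)} {u : E d → ℂ} {M : ℝ} (hu : L2Le μ u M) (c : ℂ) :
    L2Le μ (fun x => c * u x) (‖c‖ * M) := by
  refine ⟨hu.1.const_mul c, ?_⟩
  have := l2Norm_linear_le hu.1 hu.1 c 0
  simp only [zero_mul, norm_zero, add_zero] at this
  exact this.trans (mul_le_mul_of_nonneg_left hu.2 (norm_nonneg _))

theorem L2Le.sub {μ : Measure (E d)} {u v : E d → ℂ} {M N : ℝ} (hu : L2Le μ u M)
    (hv : L2Le μ v N) : L2Le μ (fun x => u x - v x) (M + N) := by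
  have := hu.add (hv.const_mul (-1))
  simpa only [neg_one_mul, ← sub_eq_add_neg, norm_neg, norm_one, one_mul] using this

theorem L2Le.sum {μ : Measure (E d)} {ι : Type*} (s : Finset ι) {u : ι → E d → ℂ} {M : ι → ℝ}
    (hu : ∀ i, L2Le μ (u i) (M i)) : L2Le μ (fun x => ∑ i ∈ s, u i x) (∑ i ∈ s, M i) := by
  classical
  induction s using Finset.induction_on with
  | empty => exact ⟨by simp, by simp [l2Norm]⟩
  | insert i s hi ih =>
    simp only [Finset.sum_insert hi]
    exact (hu i).add ih

/-- Since `χ` vanishes off `B`, a bound for `u` on the bounded part `U ∩ B` becomes a bound for `χ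
u` on all of `U`. -/
theorem L2Le.cutoff {U B : Set (E d)} (hB : MeasurableSet B) {u : E d → ℂ} {M b : ℝ}
    (hu : L2Le (volume.restrict (U ∩ B)) u M) (hb : 0 ≤ b) {χ : E d → ℝ} (hχ : Continuous χ)
    (hχb : ∀ x, ‖χ x‖ ≤ b) (hχs : tsupport χ ⊆ B) :
    L2Le (volume.restrict U) (fun x => χ x • u x) (b * M) := by
  have e : (fun x => χ x • u x) = B.indicator fun x => χ x • u x := by
    refine (indicator_eq_self.2 fun x hx => hχs (subset_tsupport χ ?_)).symm
    exact fun h0 => hx (by simp [h0])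
  have hr : (volume.restrict U).restrict B = volume.restrict (U ∩ B) := by
    rw [Measure.restrict_restrict hB, inter_comm]
  have hm : AEStronglyMeasurable (fun x => χ x • u x) (volume.restrict (U ∩ B)) :=
    hχ.aestronglyMeasurable.smul hu.1.1
  have hle : ∀ᵐ x ∂(volume.restrict (U ∩ B)), ‖χ x • u x‖ ≤ b * ‖u x‖ := .of_forall fun x => by
    rw [norm_smul]; exact mul_le_mul_of_nonneg_right (hχb x) (norm_nonneg _)
  have h1 : MemLp (fun x => χ x • u x) 2 (volume.restrict (U ∩ B)) := hu.1.of_le_mul hm hle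
  have h2 := eLpNorm_le_mul_eLpNorm_of_ae_le_mul hle 2
  refine ⟨?_, ?_⟩
  · rw [e, memLp_indicator_iff_restrict hB, hr]
    exact h1
  · rw [e, l2Norm, eLpNorm_indicator_eq_eLpNorm_restrict hB, hr]
    refine (ENNReal.toReal_mono (ENNReal.mul_ne_top ENNReal.ofReal_ne_top hu.1.eLpNorm_ne_top)
      h2).trans ?_
    rw [ENNReal.toReal_mul, ENNReal.toReal_ofReal hb]
    exact mul_le_mul_of_nonneg_left hu.2 hb

theorem IsH2On.add {U : Set (E d)} {u v : E d → ℂ} {g k : Fin d → E d → ℂ}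
    {G K : Fin d → Fin d → E d → ℂ} {M N : ℝ} (h : IsH2On U u g G M) (h' : IsH2On U v k K N) :
    IsH2On U (fun x => u x + v x) (fun i x => g i x + k i x) (fun i j x => G i j x + K i j x)
      (M + N) := by
  have h0 := L2Le.add ⟨h.memLp, h.le⟩ ⟨h'.memLp, h'.le⟩
  have h1 := fun i => L2Le.add ⟨h.memLp_grad i, h.le_grad i⟩ ⟨h'.memLp_grad i, h'.le_grad i⟩
  have h2 := fun i j => L2Le.add ⟨h.memLp_hess i j, h.le_hess i j⟩
    ⟨h'.memLp_hess i j, h'.le_hess i j⟩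
  exact ⟨fun i => (h.grad i).add (h'.grad i), fun i j => (h.hess i j).add (h'.hess i j),
    h0.1, fun i => (h1 i).1, fun i j => (h2 i j).1, h0.2, fun i => (h1 i).2, fun i j => (h2 i j).2⟩

/-- A bound for a compactly supported smooth function and its derivatives of order at most two. -/
theorem exists_bound_derivatives {χ : E d → ℝ} (hχ : ContDiff ℝ ∞ χ) (hc : HasCompactSupport χ) :
    ∃ b : ℝ, 0 ≤ b ∧ (∀ x, ‖χ x‖ ≤ b) ∧ (∀ i x, ‖fderiv ℝ χ x (coordVec i)‖ ≤ b) ∧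
      ∀ i j x, ‖fderiv ℝ (fun y => fderiv ℝ χ y (coordVec i)) x (coordVec j)‖ ≤ b := by
  obtain ⟨b₀, h₀⟩ := hχ.continuous.bounded_above_of_compact_support hc
  choose b₁ h₁ using fun i => (continuous_fderiv_apply hχ
    (coordVec i)).bounded_above_of_compact_support (hasCompactSupport_fderiv_apply hc _)
  choose b₂ h₂ using fun i j => (continuous_fderiv_apply (contDiff_fderiv_apply hχ (coordVec i))
    (coordVec j)).bounded_above_of_compact_support
      (hasCompactSupport_fderiv_apply (hasCompactSupport_fderiv_apply hc _) _)
  have n₀ : 0 ≤ b₀ := (norm_nonneg _).trans (h₀ 0)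
  have n₁ : ∀ i, 0 ≤ b₁ i := fun i => (norm_nonneg _).trans (h₁ i 0)
  have n₂ : ∀ i j, 0 ≤ b₂ i j := fun i j => (norm_nonneg _).trans (h₂ i j 0)
  have s₁ : 0 ≤ ∑ i, b₁ i := Finset.sum_nonneg fun i _ => n₁ i
  have s₂ : 0 ≤ ∑ i, ∑ j, b₂ i j := Finset.sum_nonneg fun i _ => Finset.sum_nonneg fun j _ => n₂ i j
  refine ⟨b₀ + ∑ i, b₁ i + ∑ i, ∑ j, b₂ i j, by positivity, fun x => ?_, fun i x => ?_,
    fun i j x => ?_⟩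
  · linarith [h₀ x]
  · have := Finset.single_le_sum (fun i _ => n₁ i) (Finset.mem_univ i)
    linarith [h₁ i x]
  · have t1 := Finset.single_le_sum (fun j _ => n₂ i j) (Finset.mem_univ j)
    have t2 := Finset.single_le_sum (f := fun i => ∑ j, b₂ i j)
      (fun i _ => Finset.sum_nonneg fun j _ => n₂ i j) (Finset.mem_univ i)
    linarith [h₂ i j x]

/-- The Leibniz rule; the constant `4` counts the terms of the Hessian. The weak derivatives are
asked on all of `U` separately, because `h` provides them only on `U ∩ B`. -/
theorem IsH2On.cutoff {U B : Set (E d)} (hU : IsOpen U) (hB : MeasurableSet B) {u : E d → ℂ}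
    {g : Fin d → E d → ℂ} {G : Fin d → Fin d → E d → ℂ} {M b : ℝ} (h : IsH2On (U ∩ B) u g G M)
    (hu : ∀ i, HasWeakPartial U i u (g i)) (hg : ∀ i j, HasWeakPartial U j (g i) (G i j))
    {χ : E d → ℝ} (hχ : ContDiff ℝ ∞ χ) (hs : tsupport χ ⊆ B) (hb : 0 ≤ b)
    (h₀ : ∀ x, ‖χ x‖ ≤ b) (h₁ : ∀ i x, ‖fderiv ℝ χ x (coordVec i)‖ ≤ b)
    (h₂ : ∀ i j x, ‖fderiv ℝ (fun y => fderiv ℝ χ y (coordVec i)) x (coordVec j)‖ ≤ b) :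
    IsH2On U (fun x => χ x • u x) (fun i x => χ x • g i x + fderiv ℝ χ x (coordVec i) • u x)
      (fun i j x => (χ x • G i j x + fderiv ℝ χ x (coordVec j) • g i x) +
        (fderiv ℝ χ x (coordVec i) • g j x +
          fderiv ℝ (fun y => fderiv ℝ χ y (coordVec i)) x (coordVec j) • u x)) (4 * (b * M)) := by
  have hM : 0 ≤ M := l2Norm_nonneg.trans h.le
  have hbM : 0 ≤ b * M := mul_nonneg hb hM
  have c1 := fun i => continuous_fderiv_apply hχ (coordVec i)
  have c2 := fun i => continuous_fderiv_apply (contDiff_fderiv_apply hχ (coordVec i))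
  have s1 : ∀ i, tsupport (fun x => fderiv ℝ χ x (coordVec i)) ⊆ B := fun i =>
    (tsupport_fderiv_apply_subset' _).trans hs
  have l0 := L2Le.cutoff hB ⟨h.memLp, h.le⟩ hb hχ.continuous h₀ hs
  have l1 := fun i => (L2Le.cutoff hB ⟨h.memLp_grad i, h.le_grad i⟩ hb hχ.continuous h₀ hs).add
    (L2Le.cutoff hB ⟨h.memLp, h.le⟩ hb (c1 i) (h₁ i) (s1 i))
  have l2 := fun i j => ((L2Le.cutoff hB ⟨h.memLp_hess i j, h.le_hess i j⟩ hb hχ.continuous h₀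
    hs).add (L2Le.cutoff hB ⟨h.memLp_grad i, h.le_grad i⟩ hb (c1 j) (h₁ j) (s1 j))).add
    ((L2Le.cutoff hB ⟨h.memLp_grad j, h.le_grad j⟩ hb (c1 i) (h₁ i) (s1 i)).add
      (L2Le.cutoff hB ⟨h.memLp, h.le⟩ hb (c2 i (coordVec j)) (h₂ i j)
        ((tsupport_fderiv_apply_subset' _).trans (s1 i))))
  exact ⟨fun i => (hu i).smul hU hχ, fun i j => ((hg i j).smul hU hχ).add
      ((hu j).smul hU (contDiff_fderiv_apply hχ (coordVec i))),
    l0.1, fun i => (l1 i).1, fun i j => (l2 i j).1, l0.2.trans (by linarith),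
    fun i => (l1 i).2.trans (by linarith), fun i j => (l2 i j).2.trans (by linarith)⟩

theorem IsH2On.mono_right {U : Set (E d)} {u : E d → ℂ} {g : Fin d → E d → ℂ}
    {G : Fin d → Fin d → E d → ℂ} {M N : ℝ} (h : IsH2On U u g G M) (hMN : M ≤ N) :
    IsH2On U u g G N :=
  ⟨h.grad, h.hess, h.memLp, h.memLp_grad, h.memLp_hess, h.le.trans hMN,
    fun i => (h.le_grad i).trans hMN, fun i j => (h.le_hess i j).trans hMN⟩

theorem L2Le.integrable_smul {u : E d → ℂ} {M : ℝ} (hu : L2Le volume u M) {φ : E d → ℝ}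
    (hφ : Continuous φ) (hc : HasCompactSupport φ) : Integrable fun x => φ x • u x :=
  integrable_smul_of_locallyIntegrableOn (U := univ)
    ((hu.1.locallyIntegrable one_le_two).locallyIntegrableOn univ) hφ hc (subset_univ _)

end

section

variable {n : ℕ} {Γ : Set (E (n + 1))}

/-! ### Regularity of weak solutions of the transmission problem -/

/-- The weak form of `Δ (pot f) = f σ`. -/
theorem sum_integral_fderiv_pot (hc : IsCompact Γ) (h : IsLocallyC11Graph Γ)
    {f : E (n + 1) → ℂ} (hf : Integrable f (surf Γ)) {φ : E (n + 1) → ℝ} (hφ : ContDiff ℝ ∞ φ)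
    (hφc : HasCompactSupport φ) :
    ∑ i, ∫ x, fderiv ℝ φ x (coordVec i) • pot Γ (gradG (coordVec i)) f x =
      -∫ y, φ y • f y ∂(surf Γ) := by
  have : IsFiniteMeasure (surf Γ) := ⟨surf_lt_top hc h⟩
  have e : ∀ i, ∫ x, fderiv ℝ φ x (coordVec i) • pot Γ (gradG (coordVec i)) f x =
      -∫ x, fderiv ℝ (fun z => fderiv ℝ φ z (coordVec i)) x (coordVec i) •
        pot Γ fundamentalSolution f x := fun i => by
    rw [(hasWeakPartial_pot hc h hf i).eq_integral (contDiff_fderiv_apply hφ (coordVec i))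
      (hasCompactSupport_fderiv_apply hφc _) (subset_univ _), neg_neg]
  have hint : ∀ i, Integrable fun x => fderiv ℝ (fun z => fderiv ℝ φ z (coordVec i)) x (coordVec i) •
      pot Γ fundamentalSolution f x := fun i =>
    integrable_smul_of_locallyIntegrableOn (hasWeakPartial_pot hc h hf i).1
      (continuous_fderiv_apply (contDiff_fderiv_apply hφ _) _)
      (hasCompactSupport_fderiv_apply (hasCompactSupport_fderiv_apply hφc _) _) (subset_univ _)
  simp only [e]
  rw [Finset.sum_neg_distrib, ← integral_finsetSum _ fun i _ => hint i]
  congr 1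
  have hlap : ∀ x, ∑ i, fderiv ℝ (fun z => fderiv ℝ φ z (coordVec i)) x (coordVec i) •
      pot Γ fundamentalSolution f x = lap φ x • pot Γ fundamentalSolution f x := fun x => by
    rw [lap, Finset.sum_smul]
  simp only [hlap]
  have hlc : Continuous (lap φ) := continuous_finsetSum _ fun i _ =>
    continuous_fderiv_apply (contDiff_fderiv_apply hφ _) _
  have hls : HasCompactSupport (lap φ) := by
    refine HasCompactSupport.intro hφc fun x hx => ?_
    refine Finset.sum_eq_zero fun i _ => ?_
    have := (tsupport_fderiv_apply_subset' (φ := fun z => fderiv ℝ φ z (coordVec i))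
      (coordVec i)).trans (tsupport_fderiv_apply_subset' (φ := φ) (coordVec i))
    exact image_eq_zero_of_notMem_tsupport
      (f := fun x => fderiv ℝ (fun z => fderiv ℝ φ z (coordVec i)) x (coordVec i))
      fun hx' => hx (this hx')
  obtain ⟨C, hCt, hC⟩ := exists_lintegral_translate_le
    (locallyIntegrable_fundamentalSolution (d := n + 1) (by omega)) hc hls
  -- With both derivatives on `φ`, Fubini reduces the claim to `ΔG(· - y) = δ_y` for each `y` in
  -- `Γ`.
  have key := integral_smul_integral_mul (σ := surf Γ) (ψ := lap φ) (f := f)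
    (k := fun x y => (fundamentalSolution (x - y) : ℂ))
    (integrable_prod_kernel hc.isClosed.measurableSet measurable_fundamentalSolution hf hCt hC)
    hlc hls
  refine Eq.trans key (integral_congr_ae (.of_forall fun y => ?_))
  have h1 : ∫ x, lap φ x • (fundamentalSolution (x - y) : ℂ) = (φ y : ℂ) := by
    rw [← integral_lap_mul_fundamentalSolution_sub (by omega) hφ hφc y, ← integral_complex_ofReal]
    simp
  simp only [h1]
  exact (Complex.real_smul).symm

/-- A smooth cutoff function which is `1` on a given ball. -/
theorem exists_cutoff {d : ℕ} (R : ℝ) : ∃ χ : E d → ℝ, ∃ R' : ℝ, ContDiff ℝ ∞ χ ∧ HasCompactSupport χ ∧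
    tsupport χ ⊆ Metric.ball 0 R' ∧ ∀ x, ‖x‖ ≤ R → χ x = 1 := by
  let χ : ContDiffBump (0 : E d) := ⟨|R| + 1, |R| + 2, by positivity, by linarith⟩
  refine ⟨χ, |R| + 3, χ.contDiff, χ.hasCompactSupport, ?_, fun x hx => ?_⟩
  · rw [χ.tsupport_eq]
    exact Metric.closedBall_subset_ball (by change |R| + 2 < _; linarith)
  · refine χ.one_of_mem_closedBall (mem_closedBall_zero_iff.2 ?_)
    change ‖x‖ ≤ |R| + 1
    linarith [le_abs_self R]

/-- For a cutoff function `χ` equal to `1` near `Γ`, the weak form of the equation satisfied by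
the cutoff potential. -/
theorem sum_integral_fderiv_cutoff_pot (hc : IsCompact Γ) (h : IsLocallyC11Graph Γ)
    {f : E (n + 1) → ℂ} (hf : Integrable f (surf Γ)) {φ χ : E (n + 1) → ℝ} (hφ : ContDiff ℝ ∞ φ)
    (hφc : HasCompactSupport φ) (hχ : ContDiff ℝ ∞ χ) (hχ1 : ∀ y ∈ Γ, χ y = 1) :
    ∑ i, ∫ x, fderiv ℝ φ x (coordVec i) • (χ x • pot Γ (gradG (coordVec i)) f x +
        fderiv ℝ χ x (coordVec i) • pot Γ fundamentalSolution f x) =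
      -(∫ y, φ y • f y ∂(surf Γ)) - ∑ i, ∫ x, φ x •
        (fderiv ℝ χ x (coordVec i) • pot Γ (gradG (coordVec i)) f x +
        (fderiv ℝ χ x (coordVec i) • pot Γ (gradG (coordVec i)) f x +
        fderiv ℝ (fun z => fderiv ℝ χ z (coordVec i)) x (coordVec i) •
          pot Γ fundamentalSolution f x)) := by
  -- The equation of the potential is tested with `φ χ`; as `χ = 1` on `Γ`, the surface term is
  -- unchanged, and the commutator terms contain only derivatives of `χ`.
  have key := sum_integral_fderiv_pot hc h hf (hφ.mul hχ) (hφc.mul_right (f' := χ))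
  have hb : ∫ y, (φ y * χ y) • f y ∂(surf Γ) = ∫ y, φ y • f y ∂(surf Γ) := by
    refine setIntegral_congr_fun hc.isClosed.measurableSet fun y hy => ?_
    simp only [hχ1 y hy, mul_one]
  rw [hb] at key
  rw [← key, ← Finset.sum_sub_distrib]
  refine Finset.sum_congr rfl fun i _ => ?_
  have hw := hasWeakPartial_pot hc h hf i
  have hD := contDiff_fderiv_apply hχ (coordVec i)
  have hs := hw.smul isOpen_univ hD
  have e2 := hs.eq_integral hφ hφc (subset_univ _)
  have hcφ := continuous_fderiv_apply hφ (coordVec i)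
  have hsφ := hasCompactSupport_fderiv_apply hφc (coordVec i)
  have l1 : LocallyIntegrableOn (fun x => χ x • pot Γ (gradG (coordVec i)) f x) univ :=
    hw.2.1.continuousOn_smul isOpen_univ.isLocallyClosed hχ.continuous.continuousOn
  have l2 : LocallyIntegrableOn
      (fun x => fderiv ℝ χ x (coordVec i) • pot Γ (gradG (coordVec i)) f x) univ :=
    hw.2.1.continuousOn_smul isOpen_univ.isLocallyClosed hD.continuous.continuousOn
  have i1 := integrable_smul_of_locallyIntegrableOn l1 hcφ hsφ (subset_univ _)
  have i2 := integrable_smul_of_locallyIntegrableOn hs.1 hcφ hsφ (subset_univ _)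
  have i3 := integrable_smul_of_locallyIntegrableOn l2 hφ.continuous hφc (subset_univ _)
  have i4 := integrable_smul_of_locallyIntegrableOn hs.2.1 hφ.continuous hφc (subset_univ _)
  have e1 : ∀ x, fderiv ℝ (fun x => φ x * χ x) x (coordVec i) • pot Γ (gradG (coordVec i)) f x =
      φ x • fderiv ℝ χ x (coordVec i) • pot Γ (gradG (coordVec i)) f x +
        fderiv ℝ φ x (coordVec i) • χ x • pot Γ (gradG (coordVec i)) f x := fun x => by
    rw [fderiv_mul_coord hφ hχ, add_smul, mul_smul, mul_comm (χ x), mul_smul]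
  have e3 : ∫ x, fderiv ℝ (fun x => φ x * χ x) x (coordVec i) • pot Γ (gradG (coordVec i)) f x =
      (∫ x, φ x • fderiv ℝ χ x (coordVec i) • pot Γ (gradG (coordVec i)) f x) +
        ∫ x, fderiv ℝ φ x (coordVec i) • χ x • pot Γ (gradG (coordVec i)) f x := by
    simp only [e1]
    exact integral_add i3 i1
  have e4 : ∫ x, fderiv ℝ φ x (coordVec i) • (χ x • pot Γ (gradG (coordVec i)) f x +
        fderiv ℝ χ x (coordVec i) • pot Γ fundamentalSolution f x) =
      (∫ x, fderiv ℝ φ x (coordVec i) • χ x • pot Γ (gradG (coordVec i)) f x) +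
      ∫ x, fderiv ℝ φ x (coordVec i) • fderiv ℝ χ x (coordVec i) •
        pot Γ fundamentalSolution f x := by
    simp only [smul_add]
    exact integral_add i1 i2
  have e5 : ∫ x, φ x •
        (fderiv ℝ χ x (coordVec i) • pot Γ (gradG (coordVec i)) f x +
        (fderiv ℝ χ x (coordVec i) • pot Γ (gradG (coordVec i)) f x +
        fderiv ℝ (fun z => fderiv ℝ χ z (coordVec i)) x (coordVec i) •
          pot Γ fundamentalSolution f x)) =
      (∫ x, φ x • fderiv ℝ χ x (coordVec i) • pot Γ (gradG (coordVec i)) f x) +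
      ∫ x, φ x • (fderiv ℝ χ x (coordVec i) • pot Γ (gradG (coordVec i)) f x +
        fderiv ℝ (fun z => fderiv ℝ χ z (coordVec i)) x (coordVec i) •
          pot Γ fundamentalSolution f x) := by
    rw [← integral_add i3 i4]
    simp only [smul_add]
  change _ = (∫ x, fderiv ℝ (fun x => φ x * χ x) x (coordVec i) • pot Γ (gradG (coordVec i)) f x) - _
  rw [e3, e4, e5, e2]
  ring

/-- A weak solution of `-Δu + f σ = k` is in `H²` on both sides of `Γ`. -/
theorem exists_isH2On_of_weak_solution (hc : IsCompact Γ) (h : IsLocallyC11Graph Γ) :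
    ∃ C : ℝ, 0 ≤ C ∧ ∀ u k f : E (n + 1) → ℂ, MemSobolev 1 univ u → MemLp k 2 →
      MemLp f 2 (surf Γ) → gagliardo Γ f < ⊤ →
      (∀ φ : E (n + 1) → ℝ, ContDiff ℝ ∞ φ → HasCompactSupport φ →
        (∑ i, ∫ x, fderiv ℝ φ x (coordVec i) • weakPartial univ i u x) +
          ∫ y, φ y • f y ∂(surf Γ) = ∫ x, φ x • k x) →
      ∃ g G, IsH2On Γᶜ u g G
        (C * (sobolevNorm 1 univ u + l2Norm volume k + halfNorm Γ f)) := by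
  have : IsFiniteMeasure (surf Γ) := ⟨surf_lt_top hc h⟩
  obtain ⟨R, hR⟩ := hc.isBounded.exists_norm_le
  obtain ⟨χ, R', hχ, hχc, hχs, hχ1⟩ := exists_cutoff (d := n + 1) R
  obtain ⟨b, hb, hb0, hb1, hb2⟩ := exists_bound_derivatives hχ hχc
  obtain ⟨C₁, hC₁, h1⟩ := exists_isH2On_pot hc h R'
  obtain ⟨C₂, hC₂, h2⟩ := exists_isH2On_univ (n + 1)
  refine ⟨C₂ * (2 + (4 + 3 * (n + 1)) * (b * C₁)) + (n + 1) * (1 + 4 * (b * C₁)) + 4 * (b * C₁),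
    by positivity, fun u k f hu hk hf hfg heq => ?_⟩
  have hfi : Integrable f (surf Γ) := hf.integrable one_le_two
  have hS := h1 f hf hfg
  have hM : 0 ≤ C₁ * halfNorm Γ f := l2Norm_nonneg.trans hS.le
  have hW := hS.cutoff hc.isClosed.isOpen_compl measurableSet_ball
    (fun i => (hasWeakPartial_pot hc h hfi i).mono (subset_univ _))
    (fun i j => hasWeakPartial_pot_gradG hc h hfi i j) hχ hχs hb hb0 hb1 hb2
  -- As `Γ` is a null set, the `L²` bounds off `Γ` are bounds on the whole space.
  have hvol : volume.restrict Γᶜ = (volume : Measure (E (n + 1))) :=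
    Measure.restrict_eq_self_of_ae_mem (by
      rw [ae_iff]
      simpa using volume_surface_eq_zero hc h)
  have hB : ∀ {g : E (n + 1) → ℂ} {ψ : E (n + 1) → ℝ},
      L2Le (volume.restrict (Γᶜ ∩ Metric.ball 0 R')) g (C₁ * halfNorm Γ f) →
      Continuous ψ → (∀ x, ‖ψ x‖ ≤ b) → tsupport ψ ⊆ tsupport χ →
      L2Le volume (fun x => ψ x • g x) (b * (C₁ * halfNorm Γ f)) := fun hg hψ hψb hψs => by
    have := L2Le.cutoff measurableSet_ball hg hb hψ hψb (hψs.trans hχs)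
    rwa [hvol] at this
  have c1 := fun i => continuous_fderiv_apply hχ (coordVec i)
  have s1 : ∀ i, tsupport (fun x => fderiv ℝ χ x (coordVec i)) ⊆ tsupport χ := fun i =>
    tsupport_fderiv_apply_subset' _
  have b1 := fun i => hB ⟨hS.memLp_grad i, hS.le_grad i⟩ (c1 i) (hb1 i) (s1 i)
  have b2 := fun i => hB ⟨hS.memLp, hS.le⟩
    (continuous_fderiv_apply (contDiff_fderiv_apply hχ (coordVec i)) (coordVec i)) (hb2 i i)
    ((tsupport_fderiv_apply_subset' _).trans (s1 i))
  have hT := L2Le.sum Finset.univ fun i => (b1 i).add ((b1 i).add (b2 i))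
  have hk' : L2Le volume k (l2Norm volume k) := ⟨hk, le_rfl⟩
  have hF := (hk'.add hT).const_mul (-1)
  have hw0 : L2Le volume (fun x => χ x • pot Γ fundamentalSolution f x)
      (4 * (b * (C₁ * halfNorm Γ f))) := by
    have := hW.memLp; have t := hW.le
    rw [hvol] at this t
    exact ⟨this, t⟩
  have hw1 : ∀ i, L2Le volume (fun x => χ x • pot Γ (gradG (coordVec i)) f x +
      fderiv ℝ χ x (coordVec i) • pot Γ fundamentalSolution f x)
      (4 * (b * (C₁ * halfNorm Γ f))) := fun i => by
    have := hW.memLp_grad i; have t := hW.le_grad i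
    rw [hvol] at this t
    exact ⟨this, t⟩
  have hv0 := L2Le.sub ⟨hu.memLp, l2Norm_le_sobolevNorm hu.hasWeakPartial⟩ hw0
  have hv1 := fun i => L2Le.sub ⟨hu.memLp_weakPartial i,
    l2Norm_grad_le_sobolevNorm hu.hasWeakPartial i⟩ (hw1 i)
  -- The surface terms of `u` and of the cutoff potential cancel: the difference `v` satisfies `Δ v
  -- = -(k + commutator terms)` across `Γ`, with right-hand side in `L²`.
  have hweak : ∀ φ : E (n + 1) → ℝ, ContDiff ℝ ∞ φ → HasCompactSupport φ →
      ∑ i, ∫ x, fderiv ℝ φ x (coordVec i) • (weakPartial univ i u x -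
        (χ x • pot Γ (gradG (coordVec i)) f x +
          fderiv ℝ χ x (coordVec i) • pot Γ fundamentalSolution f x)) =
      -∫ x, φ x • (-1 * (k x + ∑ i, (fderiv ℝ χ x (coordVec i) • pot Γ (gradG (coordVec i)) f x +
        (fderiv ℝ χ x (coordVec i) • pot Γ (gradG (coordVec i)) f x +
          fderiv ℝ (fun z => fderiv ℝ χ z (coordVec i)) x (coordVec i) •
            pot Γ fundamentalSolution f x)))) := fun φ hφ hφc => by
    have key := sum_integral_fderiv_cutoff_pot hc h hfi hφ hφc hχ
      fun y hy => hχ1 y (hR y hy)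
    have e := heq φ hφ hφc
    have hcφ := fun i => continuous_fderiv_apply hφ (coordVec i)
    have hsφ := fun i => hasCompactSupport_fderiv_apply hφc (coordVec i)
    have e1 : ∀ i, ∫ x, fderiv ℝ φ x (coordVec i) • (weakPartial univ i u x -
        (χ x • pot Γ (gradG (coordVec i)) f x +
          fderiv ℝ χ x (coordVec i) • pot Γ fundamentalSolution f x)) =
        (∫ x, fderiv ℝ φ x (coordVec i) • weakPartial univ i u x) -
        ∫ x, fderiv ℝ φ x (coordVec i) • (χ x • pot Γ (gradG (coordVec i)) f x +
          fderiv ℝ χ x (coordVec i) • pot Γ fundamentalSolution f x) := fun i => by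
      rw [← integral_sub (L2Le.integrable_smul ⟨hu.memLp_weakPartial i, le_rfl⟩ (hcφ i) (hsφ i))
        ((hw1 i).integrable_smul (hcφ i) (hsφ i))]
      simp only [smul_sub]
    have e2 := integral_add (hk'.integrable_smul hφ.continuous hφc)
      (hT.integrable_smul hφ.continuous hφc)
    have e3 := integral_finsetSum Finset.univ fun i _ =>
      ((b1 i).add ((b1 i).add (b2 i))).integrable_smul hφ.continuous hφc
    simp only [← Finset.smul_sum] at e3
    simp only [e1, Finset.sum_sub_distrib, neg_one_mul, smul_neg, integral_neg, neg_neg]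
    simp only [smul_add _ (k _)]
    rw [e2, e3, key, ← e]
    ring
  obtain ⟨G, hG⟩ := h2 _ _ _ hv0.1 (fun i => (hv1 i).1) hF.1
    (fun i => (hu.hasWeakPartial i).sub ((hasWeakPartial_pot hc h hfi i).smul isOpen_univ hχ))
    hweak
  have hsum := (hG.mono (subset_univ Γᶜ)).add hW
  -- Off `Γ`, `u` is the globally `H²` function `v` plus the cutoff potential.
  simp only [sub_add_cancel] at hsum
  refine ⟨_, _, hsum.mono_right ?_⟩
  have t1 := hv0.2
  have t2 := hF.2
  have t3 := Finset.sum_le_sum fun i (_ : i ∈ Finset.univ) => (hv1 i).2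
  simp only [Finset.sum_const, Finset.card_univ, Fintype.card_fin, nsmul_eq_mul, norm_neg, norm_one,
    one_mul] at t2 t3
  have t4 := mul_le_mul_of_nonneg_left (add_le_add t1 t2) hC₂
  refine (add_le_add (add_le_add t4 t3) le_rfl).trans ?_
  have p1 : 0 ≤ sobolevNorm 1 univ u := sobolevNorm_nonneg
  have p2 : 0 ≤ l2Norm volume k := l2Norm_nonneg
  have p3 : 0 ≤ halfNorm Γ f := Real.sqrt_nonneg _
  push_cast
  have q1 : 0 ≤ C₂ * sobolevNorm 1 univ u := by positivity
  -- The constant was chosen so that the difference of the two sides expands into products of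
  -- nonnegative quantities.
  rw [← sub_nonneg]
  ring_nf
  positivity

end

section

variable {d : ℕ}

/-! ### Test functions and the Riesz representation of form functionals -/

/-- The space of complex test functions. -/
def testFun (d : ℕ) : Submodule ℂ (E d → ℂ) where
  carrier := {φ | ContDiff ℝ ∞ φ ∧ HasCompactSupport φ}
  add_mem' h h' := ⟨h.1.add h'.1, h.2.add h'.2⟩
  zero_mem' := ⟨contDiff_const, HasCompactSupport.zero⟩
  smul_mem' c _ h := ⟨contDiff_const.smul h.1, h.2.smul_left (f := fun _ => c)⟩

theorem memLp_testFun (φ : testFun d) {μ : Measure (E d)} [IsFiniteMeasureOnCompacts μ] :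
    MemLp (φ : E d → ℂ) 2 μ := memLp_of_test φ.2.1.continuous φ.2.2

/-- The inclusion of test functions in `L²(ℝ^d)`. -/
def testToL2 (d : ℕ) : testFun d →ₗ[ℂ] L2 d where
  toFun φ := (memLp_testFun φ).toLp φ
  map_add' _ _ := rfl
  map_smul' _ _ := rfl

theorem testToL2_apply (φ : testFun d) : testToL2 d φ = (memLp_testFun φ).toLp φ := rfl

theorem testToL2_coe (φ : testFun d) : testToL2 d φ =ᵐ[volume] (φ : E d → ℂ) :=
  (memLp_testFun φ).coeFn_toLp

theorem denseRange_testToL2 (d : ℕ) : DenseRange (testToL2 d) := by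
  refine (Lp.dense_hasCompactSupport_contDiff (E := E d) (F := ℂ) (μ := volume) (p := 2)
    (by simp)).mono ?_
  rintro f ⟨g, hfg, hgc, hg⟩
  refine ⟨⟨g, hg, hgc⟩, Lp.ext ?_⟩
  exact (testToL2_coe _).trans hfg.symm

/-- Extension by density followed by the Riesz representation. -/
theorem exists_inner_eq_of_le {W H : Type*} [AddCommGroup W] [Module ℂ W] [NormedAddCommGroup H]
    [InnerProductSpace ℂ H] [CompleteSpace H] {e : W →ₗ[ℂ] H} (he : DenseRange e) (ℓ : W →ₗ[ℂ] ℂ)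
    {C : ℝ} (h : ∀ φ, ‖ℓ φ‖ ≤ C * ‖e φ‖) : ∃ k : H, ∀ φ, ℓ φ = inner ℂ k (e φ) :=
  ⟨(InnerProductSpace.toDual ℂ H).symm (ℓ.extendOfNorm e), fun φ => by
    rw [InnerProductSpace.toDual_symm_apply, LinearMap.extendOfNorm_eq he ⟨C, h⟩]⟩

/-- The representing function is conjugated to make the pairing bilinear. Accordingly, the form,
conjugate linear in its second argument, is tested on conjugates of test functions below. -/
theorem exists_integral_eq_of_le (ℓ : testFun d →ₗ[ℂ] ℂ) {C : ℝ}
    (h : ∀ φ : testFun d, ‖ℓ φ‖ ≤ C * l2Norm volume (φ : E d → ℂ)) :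
    ∃ k : E d → ℂ, MemLp k 2 ∧ ∀ φ, ℓ φ = ∫ x, (φ : E d → ℂ) x * k x := by
  have hn : ∀ φ : testFun d, ‖ℓ φ‖ ≤ C * ‖testToL2 d φ‖ := fun φ => by
    rw [testToL2_apply, norm_toLp_eq (memLp_testFun φ)]
    exact h φ
  obtain ⟨k, hk⟩ := exists_inner_eq_of_le (denseRange_testToL2 d) ℓ hn
  have hks : MemLp (fun x => conj (k x)) 2 := (Lp.memLp k).star
  refine ⟨fun x => conj (k x), hks, fun φ => ?_⟩
  rw [hk, L2.inner_def]
  have hx := testToL2_coe φ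
  refine integral_congr_ae (hx.mono fun x hx => ?_)
  change inner ℂ (k x) (testToL2 d φ x) = _
  rw [hx]
  exact RCLike.inner_apply _ _

theorem fderiv_conj_apply {φ : E d → ℂ} (hφ : ContDiff ℝ ∞ φ) (x v : E d) :
    fderiv ℝ (fun y => conj (φ y)) x v = conj (fderiv ℝ φ x v) := by
  have h := (Complex.conjCLE.toContinuousLinearMap.hasFDerivAt (x := φ x)).comp x
    (hφ.differentiable (by simp) x).hasFDerivAt
  exact congrArg (· v) h.fderiv

theorem fderiv_ofReal_apply {φ : E d → ℝ} (hφ : ContDiff ℝ ∞ φ) (x v : E d) :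
    fderiv ℝ (fun y => (φ y : ℂ)) x v = (fderiv ℝ φ x v : ℂ) := by
  have h := (Complex.ofRealCLM.hasFDerivAt (x := φ x)).comp x
    (hφ.differentiable (by simp) x).hasFDerivAt
  exact congrArg (· v) h.fderiv

/-- The functional `φ ↦ ∑ᵢ ∫ ∂ᵢφ aᵢ + ∫ φ g dσ` on test functions. -/
theorem exists_testFun_functional {σ : Measure (E d)} [IsFiniteMeasureOnCompacts σ]
    {a : Fin d → E d → ℂ} {g : E d → ℂ} (ha : ∀ i, MemLp (a i) 2) (hg : MemLp g 2 σ) :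
    ∃ ℓ : testFun d →ₗ[ℂ] ℂ, ∀ φ : testFun d, ℓ φ =
      (∑ i, ∫ x, fderiv ℝ (φ : E d → ℂ) x (coordVec i) * a i x) +
        ∫ x, (φ : E d → ℂ) x * g x ∂σ := by
  have i1 : ∀ (φ : testFun d) i, Integrable
      fun x => fderiv ℝ (φ : E d → ℂ) x (coordVec i) * a i x := fun φ i =>
    (memLp_fderiv_test φ.2.1 φ.2.2 i).integrable_mul (ha i)
  have i2 : ∀ φ : testFun d, Integrable (fun x => (φ : E d → ℂ) x * g x) σ := fun φ =>
    (memLp_testFun φ).integrable_mul hg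
  refine ⟨⟨⟨fun φ => (∑ i, ∫ x, fderiv ℝ (φ : E d → ℂ) x (coordVec i) * a i x) +
        ∫ x, (φ : E d → ℂ) x * g x ∂σ, fun φ ψ => ?_⟩, fun c φ => ?_⟩, fun φ => rfl⟩
  · have e1 : ∀ i, ∫ x, fderiv ℝ ((φ + ψ : testFun d) : E d → ℂ) x (coordVec i) * a i x =
        (∫ x, fderiv ℝ (φ : E d → ℂ) x (coordVec i) * a i x) +
        ∫ x, fderiv ℝ (ψ : E d → ℂ) x (coordVec i) * a i x := fun i => by
      rw [← integral_add (i1 φ i) (i1 ψ i)]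
      refine integral_congr_ae (.of_forall fun x => ?_)
      simp only [Submodule.coe_add]
      rw [fderiv_add (φ.2.1.differentiable (by simp) x) (ψ.2.1.differentiable (by simp) x),
        add_apply, add_mul]
    have e2 : ∫ x, ((φ + ψ : testFun d) : E d → ℂ) x * g x ∂σ =
        (∫ x, (φ : E d → ℂ) x * g x ∂σ) + ∫ x, (ψ : E d → ℂ) x * g x ∂σ := by
      rw [← integral_add (i2 φ) (i2 ψ)]
      simp only [Submodule.coe_add, Pi.add_apply, add_mul]
    simp only [e1, e2, Finset.sum_add_distrib]
    ring
  · have e1 : ∀ i, ∫ x, fderiv ℝ ((c • φ : testFun d) : E d → ℂ) x (coordVec i) * a i x =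
        c * ∫ x, fderiv ℝ (φ : E d → ℂ) x (coordVec i) * a i x := fun i => by
      rw [← integral_const_mul]
      refine integral_congr_ae (.of_forall fun x => ?_)
      simp only [Submodule.coe_smul]
      rw [fderiv_const_smul (φ.2.1.differentiable (by simp) x), smul_apply, smul_eq_mul, mul_assoc]
    have e2 : ∫ x, ((c • φ : testFun d) : E d → ℂ) x * g x ∂σ =
        c * ∫ x, (φ : E d → ℂ) x * g x ∂σ := by
      rw [← integral_const_mul]
      simp only [Submodule.coe_smul, Pi.smul_apply, smul_eq_mul, mul_assoc]
    simp only [e1, e2, ← Finset.mul_sum, RingHom.id_apply, smul_eq_mul]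
    ring

/-! ### Regularity of the domain of the operator determined by the form -/

section Form

variable {n : ℕ} {Ω : Set (E (n + 1))}

/-- The form `Q` on conjugates of test functions. -/
theorem formQ_conj_test (hc : IsCompact (frontier Ω)) (h : IsLocallyC11Graph (frontier Ω))
    (V : BdryL2 Ω →L[ℂ] BdryL2 Ω) (u : E (n + 1) → ℂ) {φ : E (n + 1) → ℂ} (hφ : ContDiff ℝ ∞ φ)
    (hφc : HasCompactSupport φ) :
    formQ Ω V u (fun x => conj (φ x)) =
      (∑ i, ∫ x, fderiv ℝ φ x (coordVec i) * weakPartial univ i u x) +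
        ∫ x, φ x * V (trace Ω u) x ∂(surfaceMeasure Ω) := by
  have hψ : ContDiff ℝ ∞ fun x => conj (φ x) := Complex.conjCLE.contDiff.comp hφ
  have hψc : HasCompactSupport fun x => conj (φ x) := hφc.comp_left (map_zero _)
  unfold formQ
  congr 1
  · refine Finset.sum_congr rfl fun i _ => integral_congr_ae ?_
    have := (hasWeakPartial_of_contDiff hψ i).weakPartial_ae_eq isOpen_univ
    rw [Measure.restrict_univ] at this
    filter_upwards [this] with x hx
    rw [hx, fderiv_conj_apply hφ, Complex.conj_conj, mul_comm]
  · rw [L2.inner_def]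
    refine integral_congr_ae ?_
    filter_upwards [trace_test hc h hψ hψc] with x hx
    rw [hx, RCLike.inner_apply, Complex.conj_conj, mul_comm]

/-- Elements of the form domain have an image in `L²`, tested on test functions. -/
theorem exists_of_mem_formDomain (hc : IsCompact (frontier Ω))
    (h : IsLocallyC11Graph (frontier Ω)) {V : BdryL2 Ω →L[ℂ] BdryL2 Ω} {u : E (n + 1) → ℂ}
    (hu : u ∈ formDomain Ω V) : ∃ k, MemLp k 2 ∧ ∀ φ : E (n + 1) → ℂ, ContDiff ℝ ∞ φ →
      HasCompactSupport φ → formQ Ω V u (fun x => conj (φ x)) = ∫ x, φ x * k x := by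
  have : IsFiniteMeasure (surfaceMeasure Ω) := ⟨surf_lt_top hc h⟩
  obtain ⟨hu1, C, hC⟩ := hu
  obtain ⟨ℓ, hℓ⟩ := exists_testFun_functional hu1.memLp_weakPartial (Lp.memLp (V (trace Ω u)))
  obtain ⟨k, hk, hkℓ⟩ := exists_integral_eq_of_le ℓ (C := C) fun φ : testFun (n + 1) => by
    rw [hℓ, ← formQ_conj_test hc h V u φ.2.1 φ.2.2]
    have hψ : ContDiff ℝ ∞ fun x => conj ((φ : E (n + 1) → ℂ) x) :=
      Complex.conjCLE.contDiff.comp φ.2.1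
    have hψc : HasCompactSupport fun x => conj ((φ : E (n + 1) → ℂ) x) :=
      φ.2.2.comp_left (map_zero _)
    refine (hC _ (memSobolev_test hψ hψc)).trans (le_of_eq ?_)
    have e : eLpNorm (fun x => conj ((φ : E (n + 1) → ℂ) x)) 2 volume = eLpNorm (φ : E (n + 1) → ℂ) 2 volume :=
      eLpNorm_congr_norm_ae (.of_forall fun x => RCLike.norm_conj _)
    rw [l2Norm, e, l2Norm]
  exact ⟨k, hk, fun φ hφ hφc => by
    rw [formQ_conj_test hc h V u hφ hφc, ← hkℓ ⟨φ, hφ, hφc⟩, hℓ]⟩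

/-- The weak equation satisfied by `u` on both sides of the boundary. -/
theorem weak_solution_of_formQ (hc : IsCompact (frontier Ω)) (h : IsLocallyC11Graph (frontier Ω))
    {V : BdryL2 Ω →L[ℂ] BdryL2 Ω} {u k : E (n + 1) → ℂ}
    (hk : ∀ φ : E (n + 1) → ℂ, ContDiff ℝ ∞ φ →
      HasCompactSupport φ → formQ Ω V u (fun x => conj (φ x)) = ∫ x, φ x * k x)
    {φ : E (n + 1) → ℝ} (hφ : ContDiff ℝ ∞ φ) (hφc : HasCompactSupport φ) :
    (∑ i, ∫ x, fderiv ℝ φ x (coordVec i) • weakPartial univ i u x) +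
      ∫ y, φ y • V (trace Ω u) y ∂(surfaceMeasure Ω) = ∫ x, φ x • k x := by
  have hψ : ContDiff ℝ ∞ fun x => (φ x : ℂ) := Complex.ofRealCLM.contDiff.comp hφ
  have hψc : HasCompactSupport fun x => (φ x : ℂ) := hφc.comp_left Complex.ofReal_zero
  have e := hk _ hψ hψc
  rw [formQ_conj_test hc h V u hψ hψc] at e
  simp only [fderiv_ofReal_apply hφ] at e
  simpa only [Complex.real_smul] using e

/-- Elements of the form domain are in `H²` off the boundary. -/
theorem exists_isH2On_formDomain (hc : IsCompact (frontier Ω))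
    (h : IsLocallyC11Graph (frontier Ω)) (V : BdryL2 Ω →L[ℂ] BdryL2 Ω)
    (hV : ∀ f : BdryL2 Ω, MemHHalf Ω f → MemHHalf Ω (V f)) :
    ∃ C : ℝ, 0 ≤ C ∧ ∀ u k : E (n + 1) → ℂ, MemSobolev 1 univ u → MemLp k 2 →
      (∀ φ : E (n + 1) → ℂ, ContDiff ℝ ∞ φ → HasCompactSupport φ →
        formQ Ω V u (fun x => conj (φ x)) = ∫ x, φ x * k x) →
      ∃ g G, IsH2On (frontier Ω)ᶜ u g G (C * (sobolevNorm 1 univ u + l2Norm volume k)) := by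
  have : IsFiniteMeasure (surfaceMeasure Ω) := ⟨surf_lt_top hc h⟩
  obtain ⟨C₁, hC₁, h1⟩ := exists_isH2On_of_weak_solution hc h
  obtain ⟨C₂, hC₂, h2⟩ := exists_hHalfNorm_trace_le hc h
  obtain ⟨C₃, hC₃, h3⟩ := exists_hHalfNorm_map_le V hV
  refine ⟨C₁ * (1 + C₃ * C₂), by positivity, fun u k hu hk hQ => ?_⟩
  obtain ⟨ht, htn⟩ := h2 u hu
  have hVt := hV _ ht
  obtain ⟨g, G, hG⟩ := h1 u k (V (trace Ω u)) hu hk hVt.1 hVt.2 fun φ hφ hφc =>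
    weak_solution_of_formQ hc h hQ hφ hφc
  refine ⟨g, G, hG.mono_right ?_⟩
  have hle : halfNorm (frontier Ω) (V (trace Ω u)) ≤ C₃ * (C₂ * sobolevNorm 1 univ u) :=
    (h3 _ ht).trans (mul_le_mul_of_nonneg_left htn hC₃)
  have hk0 : 0 ≤ l2Norm volume k := l2Norm_nonneg
  have hp : 0 ≤ C₃ * C₂ * l2Norm volume k := by positivity
  calc C₁ * (sobolevNorm 1 univ u + l2Norm volume k + halfNorm (frontier Ω) (V (trace Ω u)))
      ≤ C₁ * ((1 + C₃ * C₂) * (sobolevNorm 1 univ u + l2Norm volume k)) := by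
        refine mul_le_mul_of_nonneg_left ?_ hC₁
        linarith
    _ = _ := by ring

end Form

end

end Transmission

end

/-! ### Conclusion: the two sides of the boundary -/

theorem mainTheorem8 (d : ℕ) (hd : 1 ≤ d) (Ω : Set (Transmission.E d)) (hΩ : IsOpen Ω)
    (hΩb : Bornology.IsBounded Ω) (hΓ : Transmission.IsLocallyC11Graph (frontier Ω)) :
    -- the potential is given by an absolutely convergent integral off the boundary
    (∀ f, Transmission.MemHHalf Ω f → ∀ x ∉ frontier Ω,
      Integrable (fun y => (Transmission.greenKernel x y : ℂ) * f y)
        (Transmission.surfaceMeasure Ω)) ∧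
    -- it is continuous from `H^{1/2}(∂Ω)` to `H²(Ω)`
    (∃ C : ℝ, ∀ f, Transmission.MemHHalf Ω f →
      Transmission.MemSobolev 2 Ω (Transmission.singleLayer Ω f) ∧
      Transmission.sobolevNorm 2 Ω (Transmission.singleLayer Ω f) ≤
        C * Transmission.hHalfNorm Ω f) ∧
    -- and to `H²_loc(ℝ^d ∖ closure Ω)`, with regularity up to the boundary
    (∀ R : ℝ, ∃ C : ℝ, ∀ f, Transmission.MemHHalf Ω f →
      Transmission.MemSobolev 2 ((closure Ω)ᶜ ∩ Metric.ball 0 R)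
        (Transmission.singleLayer Ω f) ∧
      Transmission.sobolevNorm 2 ((closure Ω)ᶜ ∩ Metric.ball 0 R)
        (Transmission.singleLayer Ω f) ≤ C * Transmission.hHalfNorm Ω f) ∧
    -- the domain of `-Δ + V ⊗ δ_{∂Ω}` is continuously included in `ℰ_2`
    (∀ V : Transmission.BdryL2 Ω →L[ℂ] Transmission.BdryL2 Ω, IsSelfAdjoint V →
      (∀ f : Transmission.BdryL2 Ω, Transmission.MemHHalf Ω f → Transmission.MemHHalf Ω (V f)) →
      Transmission.formDomain Ω V ⊆ Transmission.spaceE 2 Ω ∧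
      ∃ C : ℝ, ∀ u ∈ Transmission.formDomain Ω V, ∀ h, Transmission.IsDeltaLaplacian Ω V u h →
        Transmission.normE 2 Ω u ≤
          C * (Transmission.sobolevNorm 1 univ u + Transmission.l2Norm volume h)) := by
  obtain ⟨n, rfl⟩ : ∃ n, d = n + 1 := ⟨d - 1, by omega⟩
  have hc : IsCompact (frontier Ω) := Metric.isCompact_of_isClosed_isBounded isClosed_frontier
    (hΩb.closure.subset frontier_subset_closure)
  have : IsFiniteMeasure (Transmission.surfaceMeasure Ω) := ⟨Transmission.surf_lt_top hc hΓ⟩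
  have hin : Ω ⊆ (frontier Ω)ᶜ := fun x hx hx' => by
    rw [hΩ.frontier_eq] at hx'
    exact hx'.2 hx
  have hout : (closure Ω)ᶜ ⊆ (frontier Ω)ᶜ := compl_subset_compl.2 frontier_subset_closure
  have hco : IsOpen (closure Ω)ᶜ := isClosed_closure.isOpen_compl
  refine ⟨fun f hf x hx => Transmission.integrable_kernel_mul hc (hf.1.integrable one_le_two) hx,
    ?_, fun R => ?_, fun V _ hV => ?_⟩
  · obtain ⟨R, hR⟩ := hΩb.subset_ball 0
    obtain ⟨C, -, hC⟩ := Transmission.exists_isH2On_pot hc hΓ R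
    refine ⟨(1 + (n + 1 : ℕ) + (n + 1 : ℕ) ^ 2) * C, fun f hf => ?_⟩
    have h2 := (hC f hf.1 hf.2).mono (subset_inter hin hR)
    refine ⟨h2.memSobolev hΩ, (h2.sobolevNorm_le hΩ).trans (le_of_eq ?_)⟩
    exact (mul_assoc _ _ _).symm
  · obtain ⟨C, -, hC⟩ := Transmission.exists_isH2On_pot hc hΓ R
    refine ⟨(1 + (n + 1 : ℕ) + (n + 1 : ℕ) ^ 2) * C, fun f hf => ?_⟩
    have ho := hco.inter (Metric.isOpen_ball (x := (0 : Transmission.E (n + 1))) (ε := R))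
    have h2 := (hC f hf.1 hf.2).mono (inter_subset_inter_left _ hout)
    refine ⟨h2.memSobolev ho, (h2.sobolevNorm_le ho).trans (le_of_eq ?_)⟩
    exact (mul_assoc _ _ _).symm
  · obtain ⟨C, hC0, hC⟩ := Transmission.exists_isH2On_formDomain hc hΓ V hV
    -- The `1` accounts for the `H¹` norm of `u`, the factor `2` for the two sides of the boundary.
    refine ⟨fun u hu => ?_, 1 + 2 * ((1 + (n + 1 : ℕ) + (n + 1 : ℕ) ^ 2) * C), fun u hu h hh => ?_⟩
    · obtain ⟨k, hk, hQ⟩ := Transmission.exists_of_mem_formDomain hc hΓ hu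
      obtain ⟨g, G, hG⟩ := hC u k hu.1 hk hQ
      exact ⟨hu.1, (hG.mono hin).memSobolev hΩ, (hG.mono hout).memSobolev hco⟩
    -- The given `h` plays the role of `k` directly, so the bound involves its norm and not that of
    -- a separately chosen representative.
    · obtain ⟨g, G, hG⟩ := hC u h hu.1 hh.1 fun φ hφ hφc => by
        have hψ : Transmission.MemSobolev 1 univ fun x => conj (φ x) :=
          Transmission.memSobolev_test (Complex.conjCLE.contDiff.comp hφ)
            (hφc.comp_left (map_zero _))
        rw [hh.2 _ hψ]
        simp only [Complex.conj_conj, mul_comm]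
      have h1 := (hG.mono hin).sobolevNorm_le hΩ
      have h2 := (hG.mono hout).sobolevNorm_le hco
      have h3 : 0 ≤ Transmission.l2Norm volume h := Transmission.l2Norm_nonneg
      rw [← mul_assoc] at h1 h2
      unfold Transmission.normE
      linarith
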